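/- Let $n\ge 3$ and let $\mathbb H^n=\{(x_0,x')\in\mathbb R\times\mathbb R^n : x_0^2-|x'|^2=1,\ x_0>0\}$ be hyperbolic space with its Riemannian metric, volume $d\Omega$, Laplace--Beltrami operator $\Delta_{\mathbb H^n}$ and distance $d(\Omega,\Omega')$, where $\cosh d(\Omega,\Omega')=x_0y_0-x'\cdot y'$ for $\Omega=(x_0,x')$, $\Omega'=(y_0,y')$. Then there is a constant $C$, depending only on $n$, such that the following holds for every $\sigma>0$, every compact interval $I\subset\mathbb R$ and every (not necessarily radial) solution $u$ on $I$ of the defocusing nonlinear Schrödinger equation $$ i\partial_t u+\Delta_{\mathbb H^n}u=|u|^{2\sigma}u . $$ Here a solution on $I$ is a function $u\in C(I;H^1(\mathbb H^n))$ with $|u|^{2\sigma}u\in L^1(I;L^2(\mathbb H^n))$ (so that Duhamel's formula makes sense in $L^2$) which satisfies the equation in the sense of distributions (equivalently, satisfies Duhamel's formula). * If $n=3$, then $$\int_I\int_{\mathbb H^3}|u(t,\Omega)|^4\,d\Omega\,dt\le C\,\|u\|_{L^\infty(I;H^1)}^4 .$$ * If $n>3$, then $$\int_I\int_{\mathbb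 H^n}\int_{\mathbb H^n}\frac{\cosh d(\Omega,\Omega')}{\sinh^3 d(\Omega,\Omega')}\,|u(t,\Omega')|^2\,|u(t,\Omega)|^2\,d\Omega\,d\Omega'\,dt\le C\,\|u\|_{L^\infty(I;H^1)}^4 .$$ -/

import Mathlib

open MeasureTheory Filter Topology
open scoped ENNReal NNReal

noncomputable section

namespace HypNLS

/-- `ℝⁿ` with its Euclidean structure. -/
abbrev E (n : ℕ) : Type := EuclideanSpace ℝ (Fin n)

/-- The Minkowski form `⟨x', y'⟩ - x₀ y₀` on `ℝ^{n+1} = ℝ × ℝⁿ`. -/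
def mink {n : ℕ} (p q : ℝ × E n) : ℝ := inner ℝ p.2 q.2 - p.1 * q.1

/-- Hyperbolic space `ℍⁿ`: the upper sheet of the hyperboloid `x₀² - |x'|² = 1`, that is, the set
of the points `(cosh r, (sinh r) ω)` with `r ≥ 0` and `ω` in the unit sphere. -/
def hyperboloid (n : ℕ) : Set (ℝ × E n) := {p | mink p p = -1 ∧ 0 < p.1}

/-- The hyperboloid as a graph over `ℝⁿ`. -/
def graphMap {n : ℕ} (x : E n) : ℝ × E n := (√(1 + ‖x‖ ^ 2), x)

lemma graphMap_mem {n : ℕ} (x : E n) : graphMap x ∈ hyperboloid n := by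
  have h : (0 : ℝ) < 1 + ‖x‖ ^ 2 := by positivity
  refine ⟨?_, Real.sqrt_pos.2 h⟩
  have h2 := Real.mul_self_sqrt h.le
  simp only [mink, graphMap, real_inner_self_eq_norm_sq]
  linarith

/-- The global chart of `ℍⁿ` (its inverse is `(x₀, x') ↦ x'`). -/
def chart {n : ℕ} (x : E n) : hyperboloid n := ⟨graphMap x, graphMap_mem x⟩

/-- Partial derivative of `f` in the direction of the `i`-th basis vector of `ℝⁿ`. -/
def pderiv {n : ℕ} {F : Type*} [NormedAddCommGroup F] [NormedSpace ℝ F]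
    (i : Fin n) (f : E n → F) (x : E n) : F :=
  fderiv ℝ f x (EuclideanSpace.single i 1)

/-- The hyperbolic metric `g_{ij}` in the global chart: the metric that the Minkowski form
induces on the hyperboloid. -/
def metric {n : ℕ} (x : E n) : Matrix (Fin n) (Fin n) ℝ :=
  Matrix.of fun i j => mink (pderiv i graphMap x) (pderiv j graphMap x)

/-- The Riemannian volume density `√(det g)` in the global chart. -/
def volDensity {n : ℕ} (x : E n) : ℝ := √((metric x).det)

/-- The Riemannian volume `dΩ` of `ℍⁿ`. -/
def vol (n : ℕ) : Measure (hyperboloid n) :=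
  ((volume : Measure (E n)).withDensity fun x => ENNReal.ofReal (volDensity x)).map chart

/-- The hyperbolic distance, `cosh d(Ω, Ω') = x₀ y₀ - ⟨x', y'⟩`. -/
def hdist {n : ℕ} (p q : hyperboloid n) : ℝ := Real.arcosh (-mink (p : ℝ × E n) q)

/-- The Laplace-Beltrami operator `(det g)^{-1/2} ∂ᵢ ((det g)^{1/2} g^{ij} ∂ⱼ φ)` of `ℍⁿ`. -/
def laplacian {n : ℕ} (φ : hyperboloid n → ℝ) (p : hyperboloid n) : ℝ :=
  (volDensity (p : ℝ × E n).2)⁻¹ *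
    ∑ i, pderiv i (fun x => volDensity x *
      ∑ j, (metric x)⁻¹ i j * pderiv j (fun y => φ (chart y)) x) (p : ℝ × E n).2

/-- Real test functions on `ℍⁿ`: smooth with compact support. -/
def IsTest {n : ℕ} (φ : hyperboloid n → ℝ) : Prop :=
  ContDiff ℝ (⊤ : ℕ∞) (fun x => φ (chart x)) ∧ HasCompactSupport (fun x => φ (chart x))

/-- `G` is the weak differential of `f`: `Gᵢ` is the distributional `i`-th partial derivative
of `f` in the global chart. -/
def IsWeakDiff {n : ℕ} (f : hyperboloid n → ℂ) (G : hyperboloid n → Fin n → ℂ) : Prop :=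
  LocallyIntegrable (fun x => f (chart x)) ∧
  ∀ i, LocallyIntegrable (fun x => G (chart x) i) ∧
    ∀ φ : E n → ℝ, ContDiff ℝ (⊤ : ℕ∞) φ → HasCompactSupport φ →
      ∫ x, pderiv i φ x • f (chart x) = -∫ x, φ x • G (chart x) i

/-- `|ξ|²_g = Re ∑ g^{ij} ξᵢ conj(ξⱼ)` for a complex covector `ξ` at the point `p`. -/
def covecNormSq {n : ℕ} (p : hyperboloid n) (ξ : Fin n → ℂ) : ℝ :=
  (∑ i, ∑ j, ((metric (p : ℝ × E n).2)⁻¹ i j : ℂ) * ξ i * star (ξ j)).re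

/-- The norm `‖f‖_{H¹(ℍⁿ)} = (‖f‖²_{L²} + ‖∇f‖²_{L²})^{1/2}`. The weak differential is unique
almost everywhere, so the infimum only selects it, and it is `∞` if there is none. -/
def H1norm {n : ℕ} (f : hyperboloid n → ℂ) : ℝ≥0∞ :=
  ⨅ (G : hyperboloid n → Fin n → ℂ) (_ : IsWeakDiff f G),
    (∫⁻ p, (‖f p‖ₑ ^ 2 + ENNReal.ofReal (covecNormSq p (G p))) ∂(vol n)) ^ (1 / 2 : ℝ)

/-- `f ∈ H¹(ℍⁿ)`. -/
def MemH1 {n : ℕ} (f : hyperboloid n → ℂ) : Prop :=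
  AEStronglyMeasurable f (vol n) ∧ H1norm f < ⊤

/-- `u ∈ C(I; H¹(ℍⁿ))`. -/
def ContH1 {n : ℕ} (I : Set ℝ) (u : ℝ → hyperboloid n → ℂ) : Prop :=
  (∀ t ∈ I, MemH1 (u t)) ∧
  ∀ t ∈ I, Tendsto (fun s => H1norm (u s - u t)) (𝓝[I] t) (𝓝 0)

/-- The norm of `L^∞(I; H¹(ℍⁿ))`. -/
def LinftyH1norm {n : ℕ} (I : Set ℝ) (u : ℝ → hyperboloid n → ℂ) : ℝ≥0∞ :=
  essSup (fun t => H1norm (u t)) (volume.restrict I)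

/-- The nonlinearity `|f|^{2σ} f`. -/
def nonlin {n : ℕ} (σ : ℝ) (f : hyperboloid n → ℂ) (p : hyperboloid n) : ℂ :=
  ((‖f p‖ ^ (2 * σ) : ℝ) : ℂ) * f p

/-- `u` is a solution on `[a, b]` of `i ∂ₜ u + Δ u = |u|^{2σ} u` on `ℍⁿ` in the energy space:
`u ∈ C([a, b]; H¹)`, the Duhamel integrand satisfies `|u|^{2σ} u ∈ L¹([a, b]; L²)`, and the
equation holds in the sense of distributions, integrated in time. -/
structure IsSolution {n : ℕ} (σ a b : ℝ) (u : ℝ → hyperboloid n → ℂ) : Prop where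
  cont : ContH1 (Set.Icc a b) u
  nonlin_integrable : ∫⁻ t in Set.Icc a b, eLpNorm (nonlin σ (u t)) 2 (vol n) < ⊤
  eqn : ∀ φ : hyperboloid n → ℝ, IsTest φ → ∀ s ∈ Set.Icc a b, ∀ t ∈ Set.Icc a b,
    Complex.I * ((∫ p, φ p • u t p ∂(vol n)) - ∫ p, φ p • u s p ∂(vol n))
      + ∫ τ in s..t, ∫ p, laplacian φ p • u τ p ∂(vol n)
      = ∫ τ in s..t, ∫ p, φ p • nonlin σ (u τ) p ∂(vol n)

end HypNLS

end

/-!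
The proof is the interaction Morawetz argument. If `u` solves the equation on `ℍⁿ`, then
`v = u ⊗ u` solves a Schrödinger equation on the product `ℍⁿ × ℍⁿ`, and one differentiates the
virial functional `2 Im ∫ v̄ ⟨∇a, ∇v⟩` in time, where the weight `a` is the distance `d(Ω, Ω')`.
The functional is bounded by `‖u‖_{H¹}⁴` because `|∇a|² ≤ 2`. Its derivative consists of
three terms: the Hessian of `a` in the direction of `∇v`, which is nonnegative because the distance
is a convex function on `ℍⁿ × ℍⁿ` (`hess_wt_nonneg`, which rests on the inequality
`distance_convex`); the contribution of the nonlinearity, which is nonnegative because the equation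
is defocusing and the Laplacian of the distance is nonnegative (`forcing_nonlin_nonneg`); and the
integral of `-Δ²a |v|²`. So `∫∫∫ -Δ²a |v|²` is bounded by `‖u‖_{H¹}⁴`. For `n > 3` the
function `-Δ²a` is a positive multiple of `cosh d / sinh³ d`, and for `n = 3` it is a positive
multiple of the delta function on the diagonal.

The distance is not smooth on the diagonal, so it is replaced by `a = log (S + √(S² - 1 + δ))` with
`S = cosh d` (`wt δ`); its bilaplacian is computed explicitly in `lap_lap_wt` and has a sign for
`n ≥ 3` and `δ ≤ 1` (`bilapKer_nonneg`). The bound does not depend on `δ` (`morawetz_regularized`),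
and `δ → 0` by Fatou's lemma. For `n = 3` the kernel `-Δ²a` dominates a constant times an
approximate identity at scale `√δ` (`exists_mol_le`), which gives the `L⁴` bound
(`exists_lintegral_pow_four_le`).

A solution is only in `H¹`, so the virial identity is applied to the approximations `moll j u`,
obtained by averaging against a radial kernel and cutting off. Radial kernels commute with the
Laplacian, so the approximations solve the equation up to an error that vanishes in `L²`
(`eqn_moll`, `l2Lim_src`); their derivatives converge in `L²` to the weak derivatives
(`l2Lim_D_moll`). In the limit the sign of the nonlinear term can be read off for the
exact nonlinearity, which is itself approximated by Lipschitz ones (`regNl`). No bound for `|u|^{2σ}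
    u`
beyond its integrability in time with values in `L²` enters the final constant.

All computations take place in the global chart `x ↦ (√(1 + |x|²), x)`, in which the volume is
`dx / √(1 + |x|²)` and the inverse metric is `1 + x ⊗ x`. The latter is the sum of the squares of
the coordinate fields and of the Euler field, and the gradient, the Laplacian and the Hessian are
expressed through these `n + 1` fields (`Frame`, `hframe`), which avoids Christoffel symbols.
-/

noncomputable section
open scoped ContDiff
set_option linter.unusedSectionVars false

namespace HypNLS

/-! ### Calculus along a frame of vector fields -/

section Along

variable {W : Type*} [NormedAddCommGroup W] [NormedSpace ℝ W]
  {F : Type*} [NormedAddCommGroup F] [NormedSpace ℝ F]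

/-- The derivative of `f` along the vector field `Z`. -/
def along (Z : W → W) (f : W → F) (w : W) : F := fderiv ℝ f w (Z w)

lemma ContDiff.along {m k : WithTop ℕ∞} {Z : W → W} {f : W → F} (hZ : ContDiff ℝ m Z)
    (hf : ContDiff ℝ k f) (hmk : m + 1 ≤ k) : ContDiff ℝ m (along Z f) :=
  (hf.fderiv_right hmk).clm_apply hZ

lemma contDiff_along {Z : W → W} {f : W → F} (hZ : ContDiff ℝ ∞ Z)
    (hf : ContDiff ℝ ∞ f) : ContDiff ℝ ∞ (along Z f) :=
  ContDiff.along hZ hf (by simp)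

lemma HasCompactSupport.along {f : W → F} (hf : HasCompactSupport f) (Z : W → W) :
    HasCompactSupport (along Z f) := by
  refine hf.mono' fun w hw => ?_
  by_contra h
  apply hw
  have : fderiv ℝ f w = 0 := by
    by_contra h2
    exact h (support_fderiv_subset ℝ h2)
  simp [HypNLS.along, this]

lemma along_smul {Z : W → W} {g : W → ℝ} {f : W → F} {w : W} (hg : DifferentiableAt ℝ g w)
    (hf : DifferentiableAt ℝ f w) :
    along Z (fun x => g x • f x) w = g w • along Z f w + along Z g w • f w := by
  simp only [along]
  rw [fderiv_fun_smul hg hf]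
  simp

lemma along_mul {Z : W → W} {f g : W → ℝ} {w : W} (hf : DifferentiableAt ℝ f w)
    (hg : DifferentiableAt ℝ g w) :
    along Z (fun x => f x * g x) w = f w * along Z g w + g w * along Z f w := by
  simp only [along]
  rw [fderiv_fun_mul hf hg]
  simp

lemma along_add {Z : W → W} {f g : W → F} {w : W} (hf : DifferentiableAt ℝ f w)
    (hg : DifferentiableAt ℝ g w) :
    along Z (fun x => f x + g x) w = along Z f w + along Z g w := by
  simp only [along]
  rw [fderiv_fun_add hf hg]
  simp

lemma along_sub {Z : W → W} {f g : W → F} {w : W} (hf : DifferentiableAt ℝ f w)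
    (hg : DifferentiableAt ℝ g w) :
    along Z (fun x => f x - g x) w = along Z f w - along Z g w := by
  simp only [along]
  rw [fderiv_fun_sub hf hg]
  simp

lemma along_sum {κ : Type*} (s : Finset κ) {Z : W → W} {f : κ → W → F} {w : W}
    (hf : ∀ i ∈ s, DifferentiableAt ℝ (f i) w) :
    along Z (fun x => ∑ i ∈ s, f i x) w = ∑ i ∈ s, along Z (f i) w := by
  simp only [along]
  rw [fderiv_fun_sum hf]
  simp

lemma along_comp {Z : W → W} {φ : ℝ → ℝ} {f : W → ℝ} {w : W} {φ' : ℝ}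
    (hφ : HasDerivAt φ φ' (f w)) (hf : DifferentiableAt ℝ f w) :
    along Z (fun x => φ (f x)) w = φ' * along Z f w := by
  have := (hφ.comp_hasFDerivAt w hf.hasFDerivAt).fderiv
  simp only [along]
  rw [show (fun x => φ (f x)) = φ ∘ f from rfl, this]
  simp

lemma along_clm {G : Type*} [NormedAddCommGroup G] [NormedSpace ℝ G] (A : F →L[ℝ] G)
    {Z : W → W} {f : W → F} {w : W} (hf : DifferentiableAt ℝ f w) :
    along Z (fun x => A (f x)) w = A (along Z f w) := by
  have := (A.hasFDerivAt.comp w hf.hasFDerivAt).fderiv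
  simp only [along]
  rw [show (fun x => A (f x)) = A ∘ f from rfl, this]
  simp

end Along

/-- A finite family of smooth vector fields `Z i` with a measure `vol` and the weighted divergences
`div i` of the fields: `∫ (Z i f + div i * f) = 0` for compactly supported `f`. It encodes the
metric for which `∑ i, Z i ⊗ Z i` is the inverse metric, and its Laplacian. -/
structure Frame (W : Type*) [NormedAddCommGroup W] [NormedSpace ℝ W] [MeasurableSpace W]
    (ι : Type*) where
  /-- the vector fields -/
  Z : ι → W → W
  /-- the divergences of the fields with respect to `vol` -/
  div : ι → W → ℝ
  /-- the volume -/
  vol : Measure W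
  smooth_Z : ∀ i, ContDiff ℝ ∞ (Z i)
  smooth_div : ∀ i, ContDiff ℝ ∞ (div i)
  finite : IsFiniteMeasureOnCompacts vol
  integral_along : ∀ i (f : W → ℝ), ContDiff ℝ 1 f → HasCompactSupport f →
    ∫ w, (along (Z i) f w + div i w * f w) ∂vol = 0

namespace Frame

variable {W : Type*} [NormedAddCommGroup W] [NormedSpace ℝ W] [MeasurableSpace W]
  {ι : Type*} (X : Frame W ι)
  {F : Type*} [NormedAddCommGroup F] [NormedSpace ℝ F]

/-- The derivative along the `i`-th field of the frame. -/
def D (i : ι) (f : W → F) : W → F := along (X.Z i) f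

lemma smooth_D (i : ι) {f : W → F} (hf : ContDiff ℝ ∞ f) : ContDiff ℝ ∞ (X.D i f) :=
  contDiff_along (X.smooth_Z i) hf

lemma contDiff_one_D (i : ι) {f : W → F} (hf : ContDiff ℝ ∞ f) : ContDiff ℝ 1 (X.D i f) :=
  (X.smooth_D i hf).of_le (by simp)

lemma continuous_D (i : ι) {f : W → F} (hf : ContDiff ℝ 1 f) : Continuous (X.D i f) :=
  (hf.continuous_fderiv one_ne_zero).clm_apply (X.smooth_Z i).continuous

variable [Fintype ι]

/-- The pairing `⟨∇a, ∇f⟩` of gradients (the carré du champ). -/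
def grad (a : W → ℝ) (f : W → F) (w : W) : F := ∑ i, X.D i a w • X.D i f w

/-- The Laplacian of the frame. -/
def lap (f : W → F) (w : W) : F := ∑ i, (X.D i (X.D i f) w + X.div i w • X.D i f w)

/-- The Hessian of `a` applied twice to the gradient of `p`, by the formula
`Hess a (∇p, ∇p) = ⟨∇p, ∇⟨∇a, ∇p⟩⟩ - ⟨∇a, ∇|∇p|²⟩ / 2`. -/
def hess (a p : W → ℝ) (w : W) : ℝ :=
  X.grad p (X.grad a p) w - X.grad a (X.grad p p) w / 2

variable {X}

lemma smooth_grad {a : W → ℝ} {f : W → F} (ha : ContDiff ℝ ∞ a) (hf : ContDiff ℝ ∞ f) :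
    ContDiff ℝ ∞ (X.grad a f) :=
  ContDiff.sum fun i _ => (X.smooth_D i ha).smul (X.smooth_D i hf)

lemma smooth_lap {f : W → F} (hf : ContDiff ℝ ∞ f) : ContDiff ℝ ∞ (X.lap f) :=
  ContDiff.sum fun i _ => (X.smooth_D i (X.smooth_D i hf)).add
    ((X.smooth_div i).smul (X.smooth_D i hf))

lemma hasCompactSupport_grad {a : W → ℝ} {f : W → F} (hf : HasCompactSupport f) :
    HasCompactSupport (X.grad a f) := by
  refine hf.mono' fun w hw => ?_
  by_contra h
  apply hw
  refine Finset.sum_eq_zero fun i _ => ?_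
  have : X.D i f w = 0 := by
    have h1 : w ∉ tsupport f := h
    have : fderiv ℝ f w = 0 := by
      by_contra h2
      exact h1 (support_fderiv_subset ℝ h2)
    simp [D, along, this]
  simp [this]

lemma hasCompactSupport_lap {f : W → F} (hf : HasCompactSupport f) :
    HasCompactSupport (X.lap f) := by
  have key : ∀ (g : W → F), Function.support g ⊆ tsupport f → ∀ i,
      Function.support (X.D i g) ⊆ tsupport f := by
    intro g hg i w hw
    by_contra h
    apply hw
    have h1 : w ∉ tsupport g := fun h' => h ((closure_minimal hg (isClosed_tsupport f)) h')
    have : fderiv ℝ g w = 0 := by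
      by_contra h2
      exact h1 (support_fderiv_subset ℝ h2)
    simp [D, along, this]
  refine hf.mono' fun w hw => ?_
  by_contra h
  apply hw
  refine Finset.sum_eq_zero fun i _ => ?_
  have h1 := key f (subset_tsupport f) i
  have h2 := key _ h1 i
  rw [Function.notMem_support.1 fun h' => h (h1 h'), Function.notMem_support.1 fun h' => h (h2 h')]
  simp

lemma grad_comm (a b : W → ℝ) (w : W) : X.grad a b w = X.grad b a w := by
  simp only [grad, smul_eq_mul, mul_comm]

lemma grad_mul_right (a : W → ℝ) {f g : W → ℝ} {w : W} (hf : DifferentiableAt ℝ f w)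
    (hg : DifferentiableAt ℝ g w) :
    X.grad a (fun x => f x * g x) w = f w * X.grad a g w + g w * X.grad a f w := by
  simp only [grad, D, smul_eq_mul, Finset.mul_sum, ← Finset.sum_add_distrib]
  refine Finset.sum_congr rfl fun i _ => ?_
  rw [along_mul hf hg]; ring

lemma grad_comp_left {φ : ℝ → ℝ} {φ' : ℝ} {s : W → ℝ} (f : W → F) {w : W}
    (hφ : HasDerivAt φ φ' (s w)) (hs : DifferentiableAt ℝ s w) :
    X.grad (fun x => φ (s x)) f w = φ' • X.grad s f w := by
  simp only [grad, D, Finset.smul_sum, smul_smul]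
  refine Finset.sum_congr rfl fun i _ => ?_
  rw [along_comp hφ hs]

/-- Chain rule for the Laplacian. -/
lemma lap_comp {φ φ₁ : ℝ → ℝ} {φ₂ : ℝ} {s : W → ℝ} {w : W} (hs : ContDiff ℝ ∞ s)
    (hφ : ∀ x, HasDerivAt φ (φ₁ (s x)) (s x)) (hφ₁ : HasDerivAt φ₁ φ₂ (s w)) :
    X.lap (fun x => φ (s x)) w = φ₁ (s w) * X.lap s w + φ₂ * X.grad s s w := by
  have hd : ∀ x, DifferentiableAt ℝ s x := fun x => hs.differentiable (by simp) x
  have h1 : ∀ i, X.D i (fun x => φ (s x)) = fun x => φ₁ (s x) * X.D i s x := fun i =>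
    funext fun x => along_comp (hφ x) (hd x)
  have hd2 : DifferentiableAt ℝ (fun x => φ₁ (s x)) w :=
    (hφ₁.differentiableAt).comp w (hd w)
  simp only [lap, grad, h1, smul_eq_mul, Finset.mul_sum, ← Finset.sum_add_distrib]
  refine Finset.sum_congr rfl fun i _ => ?_
  have h2 : X.D i (fun x => φ₁ (s x) * X.D i s x) w
      = φ₁ (s w) * X.D i (X.D i s) w + X.D i s w * (φ₂ * X.D i s w) := by
    have := along_mul (Z := X.Z i) hd2 ((X.smooth_D i hs).differentiable (by simp) w)
    rw [D, this, along_comp hφ₁ (hd w)]; rfl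
  rw [h2]; ring

lemma lap_smul {g : W → ℝ} {f : W → F} (hg : ContDiff ℝ ∞ g) (hf : ContDiff ℝ ∞ f) (w : W) :
    X.lap (fun x => g x • f x) w
      = g w • X.lap f w + (2 : ℝ) • X.grad g f w + X.lap g w • f w := by
  have dg : ∀ x, DifferentiableAt ℝ g x := fun x => hg.differentiable (by simp) x
  have df : ∀ x, DifferentiableAt ℝ f x := fun x => hf.differentiable (by simp) x
  have h1 : ∀ i, X.D i (fun x => g x • f x) = fun x => g x • X.D i f x + X.D i g x • f x :=
    fun i => funext fun x => along_smul (dg x) (df x)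
  simp only [lap, grad, h1, Finset.smul_sum, Finset.sum_smul, ← Finset.sum_add_distrib]
  refine Finset.sum_congr rfl fun i _ => ?_
  have dg' := (X.smooth_D i hg).differentiable (by simp) w
  have df' := (X.smooth_D i hf).differentiable (by simp) w
  have h2 : X.D i (fun x => g x • X.D i f x + X.D i g x • f x) w
      = g w • X.D i (X.D i f) w + X.D i g w • X.D i f w
        + (X.D i g w • X.D i f w + X.D i (X.D i g) w • f w) := by
    rw [D, along_add (f := fun x => g x • X.D i f x) (g := fun x => X.D i g x • f x)
      ((dg w).smul df') (dg'.smul (df w)), along_smul (dg w) df', along_smul dg' (df w)]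
    rfl
  rw [h2]
  simp only [smul_eq_mul]
  module

lemma lap_mul {f g : W → ℝ} (hf : ContDiff ℝ ∞ f) (hg : ContDiff ℝ ∞ g) (w : W) :
    X.lap (fun x => f x * g x) w = f w * X.lap g w + 2 * X.grad f g w + X.lap f w * g w :=
  lap_smul hf hg w

/-- Chain rule for the Hessian. -/
lemma hess_comp {φ φ₁ : ℝ → ℝ} {φ₂ : ℝ} {s p : W → ℝ} {w : W} (hs : ContDiff ℝ ∞ s)
    (hp : ContDiff ℝ ∞ p)
    (hφ : ∀ x, HasDerivAt φ (φ₁ (s x)) (s x)) (hφ₁ : HasDerivAt φ₁ φ₂ (s w)) :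
    X.hess (fun x => φ (s x)) p w = φ₁ (s w) * X.hess s p w + φ₂ * X.grad s p w ^ 2 := by
  have hd : ∀ x, DifferentiableAt ℝ s x := fun x => hs.differentiable (by simp) x
  have h1 : X.grad (fun x => φ (s x)) p = fun x => φ₁ (s x) * X.grad s p x :=
    funext fun x => grad_comp_left p (hφ x) (hd x)
  have hd2 : DifferentiableAt ℝ (fun x => φ₁ (s x)) w :=
    (hφ₁.differentiableAt).comp w (hd w)
  simp only [hess]
  rw [grad_comp_left (X.grad p p) (hφ w) (hd w), h1,
    grad_mul_right p hd2 ((smooth_grad hs hp).differentiable (by simp) w), grad_comm p,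
    grad_comm p (fun x => φ₁ (s x)), grad_comp_left p hφ₁ (hd w)]
  simp only [smul_eq_mul]
  ring

/-- The Hessian in terms of the second derivatives of `a` and the commutators of the frame. -/
lemma hess_eq_sum {a p : W → ℝ} (ha : ContDiff ℝ ∞ a) (hp : ContDiff ℝ ∞ p) (w : W) :
    X.hess a p w = ∑ i, ∑ j, X.D i p w * (X.D i (X.D j a) w * X.D j p w
      + X.D j a w * (X.D i (X.D j p) w - X.D j (X.D i p) w)) := by
  have da : ∀ i, DifferentiableAt ℝ (X.D i a) w := fun i =>
    (X.smooth_D i ha).differentiable (by simp) w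
  have dp : ∀ i, DifferentiableAt ℝ (X.D i p) w := fun i =>
    (X.smooth_D i hp).differentiable (by simp) w
  have h1 : ∀ i, X.D i (X.grad a p) w
      = ∑ j, (X.D j a w * X.D i (X.D j p) w + X.D j p w * X.D i (X.D j a) w) := by
    intro i
    have := along_sum (Z := X.Z i) (w := w) Finset.univ (f := fun j x => X.D j a x * X.D j p x)
      fun j _ => (da j).mul (dp j)
    refine this.trans (Finset.sum_congr rfl fun j _ => ?_)
    exact along_mul (da j) (dp j)
  have h2 : ∀ i, X.D i (X.grad p p) w = ∑ j, 2 * (X.D j p w * X.D i (X.D j p) w) := by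
    intro i
    have := along_sum (Z := X.Z i) (w := w) Finset.univ (f := fun j x => X.D j p x * X.D j p x)
      fun j _ => (dp j).mul (dp j)
    refine this.trans (Finset.sum_congr rfl fun j _ => ?_)
    rw [along_mul (dp j) (dp j)]
    simp only [D]
    ring
  have e1 : X.grad p (X.grad a p) w = ∑ i, ∑ j, X.D i p w *
      (X.D j a w * X.D i (X.D j p) w + X.D j p w * X.D i (X.D j a) w) := by
    rw [grad]
    exact Finset.sum_congr rfl fun i _ => by rw [← Finset.mul_sum, ← h1 i, smul_eq_mul]
  have e2 : X.grad a (X.grad p p) w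
      = ∑ i, ∑ j, 2 * (X.D j a w * (X.D i p w * X.D j (X.D i p) w)) := by
    rw [Finset.sum_comm]
    rw [grad]
    refine Finset.sum_congr rfl fun i _ => ?_
    rw [h2 i, smul_eq_mul, Finset.mul_sum]
    exact Finset.sum_congr rfl fun j _ => by ring
  rw [hess, e1, e2, Finset.sum_div, ← Finset.sum_sub_distrib]
  refine Finset.sum_congr rfl fun i _ => ?_
  rw [Finset.sum_div, ← Finset.sum_sub_distrib]
  exact Finset.sum_congr rfl fun j _ => by ring

/-! ### Integration by parts and the virial identity -/

variable [BorelSpace W]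

lemma integrable_of_compact {f : W → F} (hf : Continuous f)
    (hc : HasCompactSupport f) : Integrable f X.vol := by
  have := X.finite
  exact hf.integrable_of_hasCompactSupport hc

/-- Green's formula. -/
lemma integral_mul_lap {f g : W → ℝ} (hf : ContDiff ℝ 1 f) (hc : HasCompactSupport f)
    (hg : ContDiff ℝ ∞ g) :
    ∫ w, f w * X.lap g w ∂X.vol = -∫ w, X.grad f g w ∂X.vol := by
  have hprod : ∀ i, ContDiff ℝ 1 (fun w => f w * X.D i g w) := fun i =>
    hf.mul (X.contDiff_one_D i hg)
  have hcs : ∀ i, HasCompactSupport (fun w => f w * X.D i g w) := fun i => hc.mul_right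
  have h0 : ∀ w, f w * X.lap g w + X.grad f g w
      = ∑ i, (along (X.Z i) (fun w => f w * X.D i g w) w + X.div i w * (f w * X.D i g w)) := by
    intro w
    simp only [lap, grad, smul_eq_mul, Finset.mul_sum, ← Finset.sum_add_distrib]
    refine Finset.sum_congr rfl fun i _ => ?_
    rw [along_mul (hf.differentiable (by simp) w)
      ((X.smooth_D i hg).differentiable (by simp) w)]
    simp only [D]
    ring
  have i1 : Integrable (fun w => f w * X.lap g w) X.vol :=
    integrable_of_compact (hf.continuous.mul (smooth_lap hg).continuous) hc.mul_right
  have hgc : Continuous (X.grad f g) := continuous_finsetSum _ fun i _ =>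
    (X.continuous_D i hf).smul (X.smooth_D i hg).continuous
  have i2 : Integrable (X.grad f g) X.vol := by
    refine integrable_of_compact hgc ?_
    have : X.grad f g = X.grad g f := funext fun w => grad_comm _ _ _
    rw [this]; exact hasCompactSupport_grad hc
  have h1 : ∫ w, (f w * X.lap g w + X.grad f g w) ∂X.vol = 0 := by
    simp_rw [h0]
    rw [integral_finsetSum]
    · exact Finset.sum_eq_zero fun i _ => X.integral_along i _ (hprod i) (hcs i)
    · intro i _
      refine integrable_of_compact ?_ ?_
      · exact (X.continuous_D i (hprod i)).add
          ((X.smooth_div i).continuous.mul (hprod i).continuous)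
      · exact (HasCompactSupport.along (hcs i) _).add (hcs i).mul_left
  rw [integral_add i1 i2] at h1
  linarith

/-- The Rellich identity: the commutator of the Laplacian with `2⟨∇a, ∇·⟩ + Δa`. -/
lemma rellich {a p : W → ℝ} (ha : ContDiff ℝ ∞ a) (hp : ContDiff ℝ ∞ p)
    (hc : HasCompactSupport p) :
    -2 * ∫ w, X.lap p w * (2 * X.grad a p w + X.lap a w * p w) ∂X.vol
      = 4 * ∫ w, X.hess a p w ∂X.vol - ∫ w, X.lap (X.lap a) w * p w ^ 2 ∂X.vol := by
  have sa := smooth_lap (X := X) ha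
  have sp := smooth_lap (X := X) hp
  have sap := smooth_grad (X := X) ha hp
  have spp := smooth_grad (X := X) hp hp
  have cap := hasCompactSupport_grad (X := X) (a := a) hc
  have cpp := hasCompactSupport_grad (X := X) (a := p) hc
  have e1 := integral_mul_lap (X := X) (sap.of_le (by simp)) cap hp
  have e2 := integral_mul_lap (X := X) (spp.of_le (by simp)) cpp ha
  have e3 := integral_mul_lap (X := X) (f := fun w => X.lap a w * p w)
    ((sa.mul hp).of_le (by simp)) hc.mul_left hp
  have e4 := integral_mul_lap (X := X) (f := fun w => p w * p w)
    ((hp.mul hp).of_le (by simp)) hc.mul_left sa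
  have d3 : ∀ w, X.grad (fun w => X.lap a w * p w) p w
      = X.lap a w * X.grad p p w + X.grad (fun w => p w * p w) (X.lap a) w / 2 := by
    intro w
    have dp := hp.differentiable (by simp) w
    rw [grad_comm, grad_mul_right p (sa.differentiable (by simp) w) dp,
      grad_comm (fun w => p w * p w), grad_mul_right (X.lap a) dp dp, grad_comm p (X.lap a)]
    ring
  have h1 : Integrable (fun w => X.grad p (X.grad a p) w) X.vol :=
    integrable_of_compact (smooth_grad hp sap).continuous (hasCompactSupport_grad cap)
  have h2 : Integrable (fun w => X.grad a (X.grad p p) w) X.vol :=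
    integrable_of_compact (smooth_grad ha spp).continuous (hasCompactSupport_grad cpp)
  have h3 : Integrable (fun w => X.lap a w * X.grad p p w) X.vol :=
    integrable_of_compact (sa.mul spp).continuous cpp.mul_left
  have h4 : Integrable (fun w => X.grad (fun w => p w * p w) (X.lap a) w) X.vol := by
    have : X.grad (fun w => p w * p w) (X.lap a) = X.grad (X.lap a) (fun w => p w * p w) :=
      funext fun w => grad_comm _ _ _
    rw [this]
    exact integrable_of_compact (smooth_grad sa (hp.mul hp)).continuous
      (hasCompactSupport_grad hc.mul_left)
  have h5 : Integrable (fun w => X.grad a p w * X.lap p w) X.vol :=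
    integrable_of_compact (sap.mul sp).continuous cap.mul_right
  have h6 : Integrable (fun w => X.lap a w * p w * X.lap p w) X.vol :=
    integrable_of_compact ((sa.mul hp).mul sp).continuous (hc.mul_left).mul_right
  simp only [d3] at e3
  rw [integral_add h3 (h4.div_const 2), integral_div] at e3
  have l1 : ∫ w, X.lap p w * (2 * X.grad a p w + X.lap a w * p w) ∂X.vol
      = 2 * ∫ w, X.grad a p w * X.lap p w ∂X.vol + ∫ w, X.lap a w * p w * X.lap p w ∂X.vol := by
    rw [← integral_const_mul, ← integral_add (h5.const_mul 2) h6]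
    exact integral_congr_ae (.of_forall fun w => by ring)
  have l2 : ∫ w, X.hess a p w ∂X.vol = ∫ w, X.grad p (X.grad a p) w ∂X.vol
      - (∫ w, X.grad a (X.grad p p) w ∂X.vol) / 2 := by
    rw [← integral_div, ← integral_sub h1 (h2.div_const 2)]; rfl
  have c1 : ∫ w, X.grad (X.grad a p) p w ∂X.vol = ∫ w, X.grad p (X.grad a p) w ∂X.vol :=
    integral_congr_ae (.of_forall fun w => grad_comm _ _ _)
  have c2 : ∫ w, X.grad (X.grad p p) a w ∂X.vol = ∫ w, X.grad a (X.grad p p) w ∂X.vol :=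
    integral_congr_ae (.of_forall fun w => grad_comm _ _ _)
  have c3 : ∫ w, X.grad p p w * X.lap a w ∂X.vol = ∫ w, X.lap a w * X.grad p p w ∂X.vol :=
    integral_congr_ae (.of_forall fun w => mul_comm _ _)
  have c4 : ∫ w, p w * p w * X.lap (X.lap a) w ∂X.vol
      = ∫ w, X.lap (X.lap a) w * p w ^ 2 ∂X.vol :=
    integral_congr_ae (.of_forall fun w => by ring)
  rw [l1, l2]
  linarith

/-- The adjoint of `⟨∇a, ∇·⟩` is `-(⟨∇a, ∇·⟩ + Δa)`; that is, the operator `2⟨∇a, ∇·⟩ + Δa` is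
antisymmetric. -/
lemma integral_mul_grad_antisymm {a p s : W → ℝ} (ha : ContDiff ℝ ∞ a) (hp : ContDiff ℝ ∞ p)
    (hs : ContDiff ℝ ∞ s) (hc : HasCompactSupport p) :
    ∫ w, p w * X.grad a s w ∂X.vol
      = -∫ w, s w * (X.grad a p w + X.lap a w * p w) ∂X.vol := by
  have e := integral_mul_lap (X := X) (f := fun w => p w * s w)
    ((hp.mul hs).of_le (by simp)) hc.mul_right ha
  have d : ∀ w, X.grad (fun w => p w * s w) a w = p w * X.grad a s w + s w * X.grad a p w := by
    intro w
    rw [grad_comm, grad_mul_right a (hp.differentiable (by simp) w)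
      (hs.differentiable (by simp) w)]
  have h1 : Integrable (fun w => p w * X.grad a s w) X.vol :=
    integrable_of_compact (hp.mul (smooth_grad ha hs)).continuous hc.mul_right
  have h2 : Integrable (fun w => s w * X.grad a p w) X.vol :=
    integrable_of_compact (hs.mul (smooth_grad ha hp)).continuous
      (hasCompactSupport_grad hc).mul_left
  have h3 : Integrable (fun w => p w * s w * X.lap a w) X.vol :=
    integrable_of_compact ((hp.mul hs).mul (smooth_lap ha)).continuous hc.mul_right.mul_right
  simp only [d] at e
  rw [integral_add h1 h2] at e
  have : ∫ w, s w * (X.grad a p w + X.lap a w * p w) ∂X.vol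
      = ∫ w, s w * X.grad a p w ∂X.vol + ∫ w, p w * s w * X.lap a w ∂X.vol := by
    rw [← integral_add h2 h3]
    exact integral_congr_ae (.of_forall fun w => by ring)
  linarith

/-- The virial identity at a fixed time, in real form: `p + i q` evolves with time derivative
`-(Δq - g) + i (Δp - f)`, the Schrödinger equation with source `f + i g`. -/
lemma virial {a p q f g : W → ℝ} (ha : ContDiff ℝ ∞ a) (hp : ContDiff ℝ ∞ p)
    (hq : ContDiff ℝ ∞ q) (hf : ContDiff ℝ ∞ f) (hg : ContDiff ℝ ∞ g)
    (cp : HasCompactSupport p) (cq : HasCompactSupport q) (cf : HasCompactSupport f)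
    (cg : HasCompactSupport g) {r s : W → ℝ} (hr : ∀ w, r w = -(X.lap q w - g w))
    (hs : ∀ w, s w = X.lap p w - f w) :
    2 * ∫ w, (r w * X.grad a q w + p w * X.grad a s w - s w * X.grad a p w
        - q w * X.grad a r w) ∂X.vol
      = 4 * ∫ w, (X.hess a p w + X.hess a q w) ∂X.vol
        - ∫ w, X.lap (X.lap a) w * (p w ^ 2 + q w ^ 2) ∂X.vol
        + 2 * ∫ w, (f w * (2 * X.grad a p w + X.lap a w * p w)
            + g w * (2 * X.grad a q w + X.lap a w * q w)) ∂X.vol := by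
  obtain rfl : r = fun w => -(X.lap q w - g w) := funext hr
  obtain rfl : s = fun w => X.lap p w - f w := funext hs
  clear hr hs
  set r : W → ℝ := fun w => -(X.lap q w - g w) with hrdef
  set s : W → ℝ := fun w => X.lap p w - f w with hsdef
  have sr : ContDiff ℝ ∞ r := ((smooth_lap hq).sub hg).neg
  have ss : ContDiff ℝ ∞ s := (smooth_lap hp).sub hf
  have cr : HasCompactSupport r := ((hasCompactSupport_lap cq).sub cg).neg
  have cs : HasCompactSupport s := (hasCompactSupport_lap cp).sub cf
  have sa := smooth_lap (X := X) ha
  have saa := smooth_lap (X := X) sa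
  have A1 := integral_mul_grad_antisymm (X := X) ha hp ss cp
  have A2 := integral_mul_grad_antisymm (X := X) ha hq sr cq
  have R1 := rellich (X := X) ha hp cp
  have R2 := rellich (X := X) ha hq cq
  have sGp := smooth_grad (X := X) ha hp
  have sGq := smooth_grad (X := X) ha hq
  have sGr := smooth_grad (X := X) ha sr
  have sGs := smooth_grad (X := X) ha ss
  have I1 : Integrable (fun w => r w * X.grad a q w) X.vol :=
    integrable_of_compact (sr.mul sGq).continuous cr.mul_right
  have I2 : Integrable (fun w => p w * X.grad a s w) X.vol :=
    integrable_of_compact (hp.mul sGs).continuous cp.mul_right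
  have I3 : Integrable (fun w => s w * X.grad a p w) X.vol :=
    integrable_of_compact (ss.mul sGp).continuous cs.mul_right
  have I4 : Integrable (fun w => q w * X.grad a r w) X.vol :=
    integrable_of_compact (hq.mul sGr).continuous cq.mul_right
  have J1 : Integrable (fun w => s w * (X.grad a p w + X.lap a w * p w)) X.vol :=
    integrable_of_compact (ss.mul (sGp.add (sa.mul hp))).continuous cs.mul_right
  have J2 : Integrable (fun w => r w * (X.grad a q w + X.lap a w * q w)) X.vol :=
    integrable_of_compact (sr.mul (sGq.add (sa.mul hq))).continuous cr.mul_right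
  have P1 : Integrable (fun w => X.lap p w * (2 * X.grad a p w + X.lap a w * p w)) X.vol :=
    integrable_of_compact ((smooth_lap hp).mul
      ((contDiff_const.mul sGp).add (sa.mul hp))).continuous (hasCompactSupport_lap cp).mul_right
  have P2 : Integrable (fun w => X.lap q w * (2 * X.grad a q w + X.lap a w * q w)) X.vol :=
    integrable_of_compact ((smooth_lap hq).mul
      ((contDiff_const.mul sGq).add (sa.mul hq))).continuous (hasCompactSupport_lap cq).mul_right
  have F1 : Integrable (fun w => f w * (2 * X.grad a p w + X.lap a w * p w)) X.vol :=
    integrable_of_compact (hf.mul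
      ((contDiff_const.mul sGp).add (sa.mul hp))).continuous cf.mul_right
  have F2 : Integrable (fun w => g w * (2 * X.grad a q w + X.lap a w * q w)) X.vol :=
    integrable_of_compact (hg.mul
      ((contDiff_const.mul sGq).add (sa.mul hq))).continuous cg.mul_right
  have hH : ∀ {u : W → ℝ}, ContDiff ℝ ∞ u → HasCompactSupport u →
      Integrable (X.hess a u) X.vol := by
    intro u hu cu
    have t1 : Integrable (X.grad u (X.grad a u)) X.vol :=
      integrable_of_compact (smooth_grad hu (smooth_grad ha hu)).continuous
        (hasCompactSupport_grad (hasCompactSupport_grad cu))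
    have t2 : Integrable (X.grad a (X.grad u u)) X.vol :=
      integrable_of_compact (smooth_grad ha (smooth_grad hu hu)).continuous
        (hasCompactSupport_grad (hasCompactSupport_grad cu))
    exact t1.sub (t2.div_const 2)
  have B1 : Integrable (fun w => X.lap (X.lap a) w * p w ^ 2) X.vol :=
    integrable_of_compact (saa.mul (hp.pow 2)).continuous
      (by simp only [pow_two]; exact (cp.mul_right (f' := p)).mul_left (f := X.lap (X.lap a)))
  have B2 : Integrable (fun w => X.lap (X.lap a) w * q w ^ 2) X.vol :=
    integrable_of_compact (saa.mul (hq.pow 2)).continuous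
      (by simp only [pow_two]; exact (cq.mul_right (f' := q)).mul_left (f := X.lap (X.lap a)))
  have L1 : ∫ w, (r w * X.grad a q w + p w * X.grad a s w - s w * X.grad a p w
        - q w * X.grad a r w) ∂X.vol
      = ∫ w, r w * X.grad a q w ∂X.vol + ∫ w, p w * X.grad a s w ∂X.vol
        - ∫ w, s w * X.grad a p w ∂X.vol - ∫ w, q w * X.grad a r w ∂X.vol := by
    have I12 : Integrable (fun w => r w * X.grad a q w + p w * X.grad a s w) X.vol := I1.add I2
    have I123 : Integrable (fun w => r w * X.grad a q w + p w * X.grad a s w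
      - s w * X.grad a p w) X.vol := I12.sub I3
    rw [integral_sub I123 I4, integral_sub I12 I3, integral_add I1 I2]
  have L2 : ∫ w, (X.hess a p w + X.hess a q w) ∂X.vol
      = ∫ w, X.hess a p w ∂X.vol + ∫ w, X.hess a q w ∂X.vol := integral_add (hH hp cp) (hH hq cq)
  have L3 : ∫ w, X.lap (X.lap a) w * (p w ^ 2 + q w ^ 2) ∂X.vol
      = ∫ w, X.lap (X.lap a) w * p w ^ 2 ∂X.vol + ∫ w, X.lap (X.lap a) w * q w ^ 2 ∂X.vol := by
    rw [← integral_add B1 B2]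
    exact integral_congr_ae (.of_forall fun w => by ring)
  -- the left-hand side after moving all the derivatives off `r` and `s`
  have L4 : ∫ w, r w * X.grad a q w ∂X.vol + ∫ w, r w * (X.grad a q w + X.lap a w * q w) ∂X.vol
      - (∫ w, s w * X.grad a p w ∂X.vol + ∫ w, s w * (X.grad a p w + X.lap a w * p w) ∂X.vol)
      = -(∫ w, X.lap q w * (2 * X.grad a q w + X.lap a w * q w) ∂X.vol)
        - ∫ w, X.lap p w * (2 * X.grad a p w + X.lap a w * p w) ∂X.vol
        + ∫ w, (f w * (2 * X.grad a p w + X.lap a w * p w)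
            + g w * (2 * X.grad a q w + X.lap a w * q w)) ∂X.vol := by
    rw [integral_add F1 F2, ← integral_add' I1 J2, ← integral_add' I3 J1,
      ← integral_sub' (I1.add J2) (I3.add J1), ← integral_neg', ← integral_sub' P2.neg P1,
      ← integral_add' F1 F2, ← integral_add' (P2.neg.sub P1) (F1.add F2)]
    refine integral_congr_ae (.of_forall fun w => ?_)
    simp only [hrdef, hsdef, Pi.add_apply, Pi.sub_apply, Pi.neg_apply]
    ring
  rw [L1, L2, L3]
  linarith

end Frame

/-! ### Products of frames -/

namespace Frame

section Prod

variable {W W' : Type*} [NormedAddCommGroup W] [NormedSpace ℝ W] [MeasurableSpace W]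
  [NormedAddCommGroup W'] [NormedSpace ℝ W'] [MeasurableSpace W'] [BorelSpace W] [BorelSpace W']
  [SecondCountableTopology W] [SecondCountableTopology W']
  {ι κ : Type*} {F : Type*} [NormedAddCommGroup F] [NormedSpace ℝ F]

lemma fderiv_left {f : W × W' → F} {w : W × W'} (hf : DifferentiableAt ℝ f w) (v : W) :
    fderiv ℝ f w (v, 0) = fderiv ℝ (fun x => f (x, w.2)) w.1 v := by
  have h := (HasFDerivAt.comp w.1 (g := f) (f := fun x => (x, w.2)) hf.hasFDerivAt
    (hasFDerivAt_prodMk_left w.1 w.2)).fderiv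
  have h' : fderiv ℝ (fun x => f (x, w.2)) w.1 = _ := h
  rw [h']; simp

lemma fderiv_right {f : W × W' → F} {w : W × W'} (hf : DifferentiableAt ℝ f w) (v : W') :
    fderiv ℝ f w (0, v) = fderiv ℝ (fun y => f (w.1, y)) w.2 v := by
  have h := (HasFDerivAt.comp w.2 (g := f) (f := fun y => (w.1, y)) hf.hasFDerivAt
    (hasFDerivAt_prodMk_right w.1 w.2)).fderiv
  have h' : fderiv ℝ (fun y => f (w.1, y)) w.2 = _ := h
  rw [h']; simp

lemma hasCompactSupport_slice_left {G : Type*} [Zero G] {f : W × W' → G}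
    (hf : HasCompactSupport f) (y : W') : HasCompactSupport fun x => f (x, y) := by
  refine HasCompactSupport.intro (hf.isCompact.image continuous_fst) fun x hx => ?_
  by_contra h
  exact hx ⟨(x, y), subset_tsupport f h, rfl⟩

lemma hasCompactSupport_slice_right {G : Type*} [Zero G] {f : W × W' → G}
    (hf : HasCompactSupport f) (x : W) : HasCompactSupport fun y => f (x, y) := by
  refine HasCompactSupport.intro (hf.isCompact.image continuous_snd) fun y hy => ?_
  by_contra h
  exact hy ⟨(x, y), subset_tsupport f h, rfl⟩

/-- The product of two frames: the fields of both factors, acting on the product manifold. -/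
def prod (X : Frame W ι) (Y : Frame W' κ) [SFinite X.vol] [SFinite Y.vol] :
    Frame (W × W') (ι ⊕ κ) where
  Z := Sum.elim (fun i w => (X.Z i w.1, 0)) (fun j w => (0, Y.Z j w.2))
  div := Sum.elim (fun i w => X.div i w.1) (fun j w => Y.div j w.2)
  vol := X.vol.prod Y.vol
  smooth_Z := by
    rintro (i | j)
    · exact ((X.smooth_Z i).comp contDiff_fst).prodMk contDiff_const
    · exact contDiff_const.prodMk ((Y.smooth_Z j).comp contDiff_snd)
  smooth_div := by
    rintro (i | j)
    · exact (X.smooth_div i).comp contDiff_fst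
    · exact (Y.smooth_div j).comp contDiff_snd
  finite := by
    have := X.finite
    have := Y.finite
    infer_instance
  integral_along := by
    have := X.finite
    have := Y.finite
    rintro (i | j) f hf hc
    · have hd := hf.differentiable one_ne_zero
      have hi : Integrable (fun w : W × W' => along (fun w : W × W' => (X.Z i w.1, (0 : W'))) f w
          + X.div i w.1 * f w) (X.vol.prod Y.vol) := by
        refine Continuous.integrable_of_hasCompactSupport ?_
          ((HasCompactSupport.along hc _).add hc.mul_left)
        exact ((hf.continuous_fderiv one_ne_zero).clm_apply
          (((X.smooth_Z i).continuous.comp continuous_fst).prodMk continuous_const)).add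
          (((X.smooth_div i).continuous.comp continuous_fst).mul hf.continuous)
      simp only [Sum.elim_inl]
      rw [integral_prod_symm _ hi]
      refine (integral_congr_ae (.of_forall fun y => ?_)).trans (integral_zero _ _)
      have := X.integral_along i (fun x => f (x, y)) (hf.comp (contDiff_prodMk_left y))
        (hasCompactSupport_slice_left hc y)
      rw [← this]
      refine integral_congr_ae (.of_forall fun x => ?_)
      simp only [along]
      rw [fderiv_left (hd (x, y))]
    · have hd := hf.differentiable one_ne_zero
      have hi : Integrable (fun w : W × W' => along (fun w : W × W' => ((0 : W), Y.Z j w.2)) f w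
          + Y.div j w.2 * f w) (X.vol.prod Y.vol) := by
        refine Continuous.integrable_of_hasCompactSupport ?_
          ((HasCompactSupport.along hc _).add hc.mul_left)
        exact ((hf.continuous_fderiv one_ne_zero).clm_apply
          (continuous_const.prodMk ((Y.smooth_Z j).continuous.comp continuous_snd))).add
          (((Y.smooth_div j).continuous.comp continuous_snd).mul hf.continuous)
      simp only [Sum.elim_inr]
      rw [integral_prod _ hi]
      refine (integral_congr_ae (.of_forall fun x => ?_)).trans (integral_zero _ _)
      have := Y.integral_along j (fun y => f (x, y)) (hf.comp (contDiff_prodMk_right x))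
        (hasCompactSupport_slice_right hc x)
      rw [← this]
      refine integral_congr_ae (.of_forall fun y => ?_)
      simp only [along]
      rw [fderiv_right (hd (x, y))]

variable (X : Frame W ι) (Y : Frame W' κ) [SFinite X.vol] [SFinite Y.vol]

lemma prod_D_inl (i : ι) {f : W × W' → F} {w : W × W'} (hf : DifferentiableAt ℝ f w) :
    (X.prod Y).D (.inl i) f w = X.D i (fun x => f (x, w.2)) w.1 :=
  fderiv_left hf _

lemma prod_D_inr (j : κ) {f : W × W' → F} {w : W × W'} (hf : DifferentiableAt ℝ f w) :
    (X.prod Y).D (.inr j) f w = Y.D j (fun y => f (w.1, y)) w.2 :=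
  fderiv_right hf _

variable [Fintype ι] [Fintype κ]

lemma prod_grad {a : W × W' → ℝ} {f : W × W' → F} {w : W × W'}
    (ha : DifferentiableAt ℝ a w) (hf : DifferentiableAt ℝ f w) :
    (X.prod Y).grad a f w = X.grad (fun x => a (x, w.2)) (fun x => f (x, w.2)) w.1
      + Y.grad (fun y => a (w.1, y)) (fun y => f (w.1, y)) w.2 := by
  simp only [grad, Fintype.sum_sum_type]
  congr 1
  · exact Finset.sum_congr rfl fun i _ => by rw [prod_D_inl X Y i ha, prod_D_inl X Y i hf]
  · exact Finset.sum_congr rfl fun i _ => by rw [prod_D_inr X Y i ha, prod_D_inr X Y i hf]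

lemma prod_lap {f : W × W' → F} (hf : ContDiff ℝ ∞ f) (w : W × W') :
    (X.prod Y).lap f w = X.lap (fun x => f (x, w.2)) w.1 + Y.lap (fun y => f (w.1, y)) w.2 := by
  have hd : ∀ w, DifferentiableAt ℝ f w := fun w => hf.differentiable (by simp) w
  simp only [lap, Fintype.sum_sum_type]
  congr 1
  · refine Finset.sum_congr rfl fun i _ => ?_
    rw [prod_D_inl X Y i (((X.prod Y).smooth_D (.inl i) hf).differentiable (by simp) w),
      prod_D_inl X Y i (hd w)]
    congr 2
    funext x
    exact prod_D_inl X Y i (hd (x, w.2))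
  · refine Finset.sum_congr rfl fun i _ => ?_
    rw [prod_D_inr X Y i (((X.prod Y).smooth_D (.inr i) hf).differentiable (by simp) w),
      prod_D_inr X Y i (hd w)]
    congr 2
    funext y
    exact prod_D_inr X Y i (hd (w.1, y))

/-- The Hessian on a product: the Hessians of the two slices and the mixed second derivatives. -/
lemma prod_hess {a p : W × W' → ℝ} (ha : ContDiff ℝ ∞ a) (hp : ContDiff ℝ ∞ p) (w : W × W') :
    (X.prod Y).hess a p w = X.hess (fun x => a (x, w.2)) (fun x => p (x, w.2)) w.1
      + Y.hess (fun y => a (w.1, y)) (fun y => p (w.1, y)) w.2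
      + 2 * ∑ i, ∑ j, (X.prod Y).D (.inl i) p w
        * ((X.prod Y).D (.inl i) ((X.prod Y).D (.inr j) a) w * (X.prod Y).D (.inr j) p w) := by
  set P := X.prod Y with hP
  have sD : ∀ (k) {f : W × W' → ℝ}, ContDiff ℝ ∞ f → ∀ w, DifferentiableAt ℝ (P.D k f) w :=
    fun k f hf w => (P.smooth_D k hf).differentiable (by simp) w
  have da : ∀ w, DifferentiableAt ℝ a w := fun w => ha.differentiable (by simp) w
  have dp : ∀ w, DifferentiableAt ℝ p w := fun w => hp.differentiable (by simp) w
  have ll : ∀ {f : W × W' → ℝ}, ContDiff ℝ ∞ f → ∀ i i', P.D (.inl i) (P.D (.inl i') f) w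
      = X.D i (X.D i' fun x => f (x, w.2)) w.1 := by
    intro f hf i i'
    rw [hP, prod_D_inl X Y i (sD _ hf w)]
    congr 1
    exact funext fun x => prod_D_inl X Y i' (hf.differentiable (by simp) (x, w.2))
  have rr : ∀ {f : W × W' → ℝ}, ContDiff ℝ ∞ f → ∀ i i', P.D (.inr i) (P.D (.inr i') f) w
      = Y.D i (Y.D i' fun y => f (w.1, y)) w.2 := by
    intro f hf i i'
    rw [hP, prod_D_inr X Y i (sD _ hf w)]
    congr 1
    exact funext fun y => prod_D_inr X Y i' (hf.differentiable (by simp) (w.1, y))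
  -- fields of different factors commute
  have comm : ∀ {f : W × W' → ℝ}, ContDiff ℝ ∞ f → ∀ i j, P.D (.inl i) (P.D (.inr j) f) w
      = P.D (.inr j) (P.D (.inl i) f) w := by
    intro f hf i j
    have h2 : DifferentiableAt ℝ (fderiv ℝ f) w :=
      (hf.fderiv_right (m := ∞) (by simp)).differentiable (by simp) w
    have key : ∀ (V U : W × W' → W × W'), ContDiff ℝ ∞ U →
        along V (along U f) w = fderiv ℝ (fderiv ℝ f) w (V w) (U w)
          + fderiv ℝ f w (fderiv ℝ U w (V w)) := by
      intro V U hU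
      have := fderiv_clm_apply h2 (hU.differentiable (by simp) w)
      simp only [along]
      rw [show along U f = fun y => fderiv ℝ f y (U y) from rfl, this]
      simp [add_comm]
    have z1 : fderiv ℝ (P.Z (.inr j)) w (P.Z (.inl i) w) = 0 := by
      have := fderiv_left (f := P.Z (.inr j)) ((P.smooth_Z (.inr j)).differentiable (by simp) w)
        (X.Z i w.1)
      refine this.trans ?_
      simp [hP, prod]
    have z2 : fderiv ℝ (P.Z (.inl i)) w (P.Z (.inr j) w) = 0 := by
      have := fderiv_right (f := P.Z (.inl i)) ((P.smooth_Z (.inl i)).differentiable (by simp) w)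
        (Y.Z j w.2)
      refine this.trans ?_
      simp [hP, prod]
    have hs : IsSymmSndFDerivAt ℝ f w := by
      refine (hf.contDiffAt (x := w)).isSymmSndFDerivAt ?_
      simp only [minSmoothness_of_isRCLikeNormedField]
      exact WithTop.coe_le_coe.2 (le_top : (2 : ℕ∞) ≤ ⊤)
    simp only [D]
    rw [key _ _ (P.smooth_Z _), key _ _ (P.smooth_Z _), z1, z2, hs.eq]
  have al : ContDiff ℝ ∞ fun x => a (x, w.2) := ha.comp (contDiff_prodMk_left w.2)
  have pl : ContDiff ℝ ∞ fun x => p (x, w.2) := hp.comp (contDiff_prodMk_left w.2)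
  have ar : ContDiff ℝ ∞ fun y => a (w.1, y) := ha.comp (contDiff_prodMk_right w.1)
  have pr : ContDiff ℝ ∞ fun y => p (w.1, y) := hp.comp (contDiff_prodMk_right w.1)
  rw [hess_eq_sum ha hp, hess_eq_sum al pl, hess_eq_sum ar pr]
  simp only [Fintype.sum_sum_type, Finset.sum_add_distrib, two_mul]
  have c0 : ∀ i j, P.D (.inl i) (P.D (.inr j) p) w - P.D (.inr j) (P.D (.inl i) p) w = 0 :=
    fun i j => sub_eq_zero.2 (comm hp i j)
  have c0' : ∀ i j, P.D (.inr j) (P.D (.inl i) p) w - P.D (.inl i) (P.D (.inr j) p) w = 0 :=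
    fun i j => sub_eq_zero.2 (comm hp i j).symm
  simp only [c0, c0', ll ha, rr ha, ll hp, rr hp, mul_zero, add_zero]
  have e1 : ∀ i, P.D (.inl i) p w = X.D i (fun x => p (x, w.2)) w.1 := fun i =>
    prod_D_inl X Y i (dp w)
  have e2 : ∀ i, P.D (.inr i) p w = Y.D i (fun y => p (w.1, y)) w.2 := fun i =>
    prod_D_inr X Y i (dp w)
  have e3 : ∀ i, P.D (.inl i) a w = X.D i (fun x => a (x, w.2)) w.1 := fun i =>
    prod_D_inl X Y i (da w)
  have e4 : ∀ i, P.D (.inr i) a w = Y.D i (fun y => a (w.1, y)) w.2 := fun i =>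
    prod_D_inr X Y i (da w)
  have sw : ∑ j, ∑ i, P.D (.inr j) p w * (P.D (.inr j) (P.D (.inl i) a) w * P.D (.inl i) p w)
      = ∑ i, ∑ j, P.D (.inl i) p w * (P.D (.inl i) (P.D (.inr j) a) w * P.D (.inr j) p w) := by
    rw [Finset.sum_comm]
    refine Finset.sum_congr rfl fun i _ => Finset.sum_congr rfl fun j _ => ?_
    rw [comm ha]; ring
  rw [sw]
  simp only [e1, e2, e3, e4]
  ring

end Prod

end Frame

/-! ### Hyperbolic space in the graph chart -/

section Chart

variable {n : ℕ}

/-- The height `x₀ = √(1 + |x|²)` of the point of the hyperboloid over `x`. -/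
def ht (x : E n) : ℝ := √(1 + ‖x‖ ^ 2)

lemma ht_sq (x : E n) : ht x ^ 2 = 1 + ‖x‖ ^ 2 := Real.sq_sqrt (by positivity)

lemma one_le_ht (x : E n) : 1 ≤ ht x := Real.one_le_sqrt.2 (by nlinarith [sq_nonneg ‖x‖])

lemma ht_pos (x : E n) : 0 < ht x := lt_of_lt_of_le one_pos (one_le_ht x)

lemma ht_ne (x : E n) : ht x ≠ 0 := (ht_pos x).ne'

lemma norm_lt_ht (x : E n) : ‖x‖ < ht x := by
  refine lt_of_pow_lt_pow_left₀ 2 (ht_pos x).le ?_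
  rw [ht_sq]; linarith

lemma smooth_ht : ContDiff ℝ ∞ (ht : E n → ℝ) :=
  (contDiff_const.add (contDiff_norm_sq ℝ)).sqrt fun x => by positivity

lemma continuous_ht : Continuous (ht : E n → ℝ) := smooth_ht.continuous

lemma hasFDerivAt_ht (x : E n) : HasFDerivAt ht ((ht x)⁻¹ • innerSL ℝ x) x := by
  have h1 : HasFDerivAt (fun x : E n => 1 + ‖x‖ ^ 2) (2 • innerSL ℝ x) x :=
    (hasStrictFDerivAt_norm_sq x).hasFDerivAt.const_add 1
  have h2 := h1.sqrt (by positivity)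
  have e : (1 / (2 * √(1 + ‖x‖ ^ 2))) • 2 • innerSL ℝ x = (ht x)⁻¹ • innerSL ℝ x := by
    ext v
    simp [ht]
    ring
  rw [e] at h2
  exact h2

lemma fderiv_ht (x v : E n) : fderiv ℝ ht x v = inner ℝ x v / ht x := by
  rw [(hasFDerivAt_ht x).fderiv]
  simp
  ring

lemma inner_single (x : E n) (i : Fin n) : inner ℝ x (EuclideanSpace.single i (1 : ℝ)) = x i := by
  simp [EuclideanSpace.inner_single_right]

lemma sum_smul_single (x : E n) : ∑ i, x i • EuclideanSpace.single i (1 : ℝ) = x := by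
  have := (EuclideanSpace.basisFun (Fin n) ℝ).sum_repr x
  simpa using this

lemma inner_eq_sum (x y : E n) : inner ℝ x y = ∑ i, x i * y i := by
  simp [PiLp.inner_apply, mul_comm]

lemma norm_sq_eq_sum (x : E n) : ‖x‖ ^ 2 = ∑ i, x i ^ 2 := EuclideanSpace.real_norm_sq_eq x

/-- The Euler field splits along the coordinate directions. -/
lemma fderiv_self_eq_sum {F : Type*} [NormedAddCommGroup F] [NormedSpace ℝ F] (f : E n → F)
    (x v : E n) : fderiv ℝ f x v = ∑ i, v i • fderiv ℝ f x (EuclideanSpace.single i 1) := by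
  conv_lhs => rw [← sum_smul_single v]
  rw [map_sum]
  simp

/-- The hyperbolic volume in the chart. -/
def hvol (n : ℕ) : Measure (E n) := volume.withDensity fun x => ENNReal.ofReal (ht x)⁻¹

lemma integral_hvol {F : Type*} [NormedAddCommGroup F] [NormedSpace ℝ F] (f : E n → F) :
    ∫ x, f x ∂hvol n = ∫ x, (ht x)⁻¹ • f x := by
  rw [hvol, integral_withDensity_eq_integral_toReal_smul]
  · refine integral_congr_ae (.of_forall fun x => ?_)
    simp only
    rw [ENNReal.toReal_ofReal (inv_nonneg.2 (ht_pos x).le)]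
  · exact (continuous_ht.measurable.inv).ennreal_ofReal
  · exact .of_forall fun x => ENNReal.ofReal_lt_top

lemma hvol_le (s : Set (E n)) : hvol n s ≤ volume s := by
  have : hvol n ≤ volume := by
    calc hvol n ≤ volume.withDensity 1 :=
          withDensity_mono (.of_forall fun x => by
            simp only [Pi.one_apply]
            exact ENNReal.ofReal_le_one.2 (inv_le_one_of_one_le₀ (one_le_ht x)))
      _ = volume := withDensity_one
  exact this s

instance : IsFiniteMeasureOnCompacts (hvol n) :=
  ⟨fun _ hK => lt_of_le_of_lt (hvol_le _) hK.measure_lt_top⟩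

instance : IsLocallyFiniteMeasure (hvol n) := inferInstance

instance : SigmaFinite (hvol n) := inferInstance

lemma absolutelyContinuous_hvol : (volume : Measure (E n)) ≪ hvol n := by
  refine withDensity_absolutelyContinuous'
    (continuous_ht.measurable.inv.ennreal_ofReal.aemeasurable)
    (.of_forall fun x => ?_)
  simp [ht_pos x]

lemma hvol_absolutelyContinuous : hvol n ≪ (volume : Measure (E n)) :=
  withDensity_absolutelyContinuous _ _

lemma integral_fderiv_eq_zero {F : Type*} [NormedAddCommGroup F] [NormedSpace ℝ F]
    {f : E n → F} (hf : ContDiff ℝ 1 f) (hc : HasCompactSupport f) (v : E n) :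
    ∫ x, fderiv ℝ f x v = 0 := by
  have hd : Continuous fun x => fderiv ℝ f x v :=
    (hf.continuous_fderiv one_ne_zero).clm_apply continuous_const
  have hdc : HasCompactSupport fun x => fderiv ℝ f x v := hc.fderiv_apply ℝ v
  have := integral_smul_fderiv_eq_neg_fderiv_smul_of_integrable (μ := (volume : Measure (E n)))
    (f := fun _ : E n => (1 : ℝ)) (g := f) (v := v) (by simp)
    (by simpa using hd.integrable_of_hasCompactSupport hdc)
    (by simpa using hf.continuous.integrable_of_hasCompactSupport hc)
    (by simp) (fun x _ => hf.differentiable one_ne_zero x)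
  simpa using this

/-- The frame of hyperbolic space in the chart: the coordinate fields and the Euler field. The
inverse metric is `δ + x ⊗ x`. -/
def hframe (n : ℕ) : Frame (E n) (Option (Fin n)) where
  Z i := match i with
    | none => fun x => x
    | some i => fun _ => EuclideanSpace.single i 1
  div i := match i with
    | none => fun x => n - ‖x‖ ^ 2 / ht x ^ 2
    | some i => fun x => -(x i / ht x ^ 2)
  vol := hvol n
  smooth_Z := by
    rintro (_ | i)
    · exact contDiff_id
    · exact contDiff_const
  smooth_div := by
    rintro (_ | i)
    · exact contDiff_const.sub ((contDiff_norm_sq ℝ).div (smooth_ht.pow 2)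
        fun x => pow_ne_zero 2 (ht_ne x))
    · exact ((EuclideanSpace.proj (𝕜 := ℝ) i).contDiff.div (smooth_ht.pow 2)
        fun x => pow_ne_zero 2 (ht_ne x)).neg
  finite := inferInstance
  integral_along := by
    intro i f hf hc
    have hg : ContDiff ℝ 1 fun x => (ht x)⁻¹ * f x :=
      ((smooth_ht.inv ht_ne).of_le (by simp)).mul hf
    have hgc : HasCompactSupport fun x => (ht x)⁻¹ * f x := hc.mul_left
    have dg : ∀ x v, fderiv ℝ (fun x => (ht x)⁻¹ * f x) x v
        = (ht x)⁻¹ * fderiv ℝ f x v - f x * (inner ℝ x v / ht x ^ 3) := by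
      intro x v
      have h1 : HasFDerivAt (fun x => (ht x)⁻¹) (-((ht x)^2)⁻¹ • ((ht x)⁻¹ • innerSL ℝ x)) x :=
        (hasDerivAt_inv (ht_ne x)).comp_hasFDerivAt x (hasFDerivAt_ht x)
      have := (h1.mul (hf.differentiable one_ne_zero x).hasFDerivAt).fderiv
      rw [show (fun x => (ht x)⁻¹ * f x) = (fun x => (ht x)⁻¹) * f from rfl, this]
      simp
      field_simp
      ring
    rw [integral_hvol]
    rcases i with _ | i
    · have hi : ∀ i ∈ (Finset.univ : Finset (Fin n)), Integrable fun x : E n =>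
          fderiv ℝ (fun x => ((ht x)⁻¹ * f x) * x i) x (EuclideanSpace.single i 1) := by
        intro i _
        have h1 : ContDiff ℝ 1 fun x : E n => ((ht x)⁻¹ * f x) * x i :=
          hg.mul (EuclideanSpace.proj (𝕜 := ℝ) i).contDiff
        have h2 : HasCompactSupport fun x : E n => ((ht x)⁻¹ * f x) * x i := hgc.mul_right
        exact ((h1.continuous_fderiv one_ne_zero).clm_apply
          continuous_const).integrable_of_hasCompactSupport (h2.fderiv_apply ℝ _)
      have h0 : ∑ i, ∫ x : E n, fderiv ℝ (fun x => ((ht x)⁻¹ * f x) * x i) x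
          (EuclideanSpace.single i 1) = 0 :=
        Finset.sum_eq_zero fun i _ => integral_fderiv_eq_zero
          (hg.mul (EuclideanSpace.proj (𝕜 := ℝ) i).contDiff) hgc.mul_right _
      rw [← integral_finsetSum _ hi] at h0
      rw [← h0]
      refine integral_congr_ae (.of_forall fun x => ?_)
      have e1 : ∀ i, fderiv ℝ (fun x : E n => ((ht x)⁻¹ * f x) * x i) x
          (EuclideanSpace.single i 1) = (ht x)⁻¹ * f x
          + x i * fderiv ℝ (fun x => (ht x)⁻¹ * f x) x (EuclideanSpace.single i 1) := by
        intro i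
        have := ((hg.differentiable one_ne_zero x).hasFDerivAt.mul
          (EuclideanSpace.proj (𝕜 := ℝ) i).hasFDerivAt).fderiv
        rw [show (fun x : E n => ((ht x)⁻¹ * f x) * x i)
          = (fun x => (ht x)⁻¹ * f x) * (EuclideanSpace.proj (𝕜 := ℝ) i) from rfl, this]
        simp
      simp only [e1, Finset.sum_add_distrib]
      have e2 := fderiv_self_eq_sum (fun x => (ht x)⁻¹ * f x) x x
      simp only [smul_eq_mul] at e2 ⊢
      rw [← e2, dg, real_inner_self_eq_norm_sq]
      simp only [along, Finset.sum_const, Finset.card_univ, Fintype.card_fin, nsmul_eq_mul]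
      have := ht_ne x
      field_simp
      ring
    · rw [← integral_fderiv_eq_zero hg hgc (EuclideanSpace.single i 1)]
      refine integral_congr_ae (.of_forall fun x => ?_)
      simp only [dg, along, inner_single, smul_eq_mul]
      have := ht_ne x
      field_simp
      ring

variable {F : Type*} [NormedAddCommGroup F] [NormedSpace ℝ F]

lemma D_some (i : Fin n) (f : E n → F) (x : E n) :
    (hframe n).D (some i) f x = fderiv ℝ f x (EuclideanSpace.single i 1) := rfl

lemma D_none (f : E n → F) (x : E n) : (hframe n).D none f x = fderiv ℝ f x x := rfl

lemma D_none_eq_sum (f : E n → F) (x : E n) :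
    (hframe n).D none f x = ∑ i, x i • (hframe n).D (some i) f x :=
  fderiv_self_eq_sum f x x

instance : SFinite (hframe n).vol := inferInstanceAs (SFinite (hvol n))

/-- `Δ f = ∑ ∂ᵢ∂ᵢ f + (x·∂)² f + (n - 1) x·∂ f`. -/
lemma hframe_lap (f : E n → F) (x : E n) :
    (hframe n).lap f x = ∑ i, (hframe n).D (some i) ((hframe n).D (some i) f) x
      + (hframe n).D none ((hframe n).D none f) x + ((n : ℝ) - 1) • (hframe n).D none f x := by
  have e : ∑ i, (hframe n).div (some i) x • (hframe n).D (some i) f x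
      = -(1 / ht x ^ 2) • (hframe n).D none f x := by
    rw [D_none_eq_sum, Finset.smul_sum]
    refine Finset.sum_congr rfl fun i _ => ?_
    rw [smul_smul]
    congr 1
    simp only [hframe]
    ring
  have e2 : (hframe n).div none x = n - ‖x‖ ^ 2 / ht x ^ 2 := rfl
  simp only [Frame.lap, Fintype.sum_option, Finset.sum_add_distrib]
  rw [e, e2, show ((n : ℝ) - 1) = (n - ‖x‖ ^ 2 / ht x ^ 2) + -(1 / ht x ^ 2) by
    have := ht_sq x
    have := ht_ne x
    field_simp
    linarith, add_smul]
  abel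

/-! ### The ambient coordinates and the function `cosh d` -/

/-- The hyperbolic cosine of the distance: `cosh d = x₀ y₀ - ⟨x, y⟩`. -/
def coshd (x y : E n) : ℝ := ht x * ht y - inner ℝ x y

lemma coshd_comm (x y : E n) : coshd x y = coshd y x := by
  rw [coshd, coshd, real_inner_comm, mul_comm]

lemma coshd_sub_one (x y : E n) :
    2 * (ht x / ht y) * (coshd x y - 1)
      = ‖x - (ht x / ht y) • y‖ ^ 2 + (ht x / ht y - 1) ^ 2 := by
  rw [norm_sub_sq_real, norm_smul, inner_smul_right, mul_pow, Real.norm_eq_abs, sq_abs, coshd]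
  have h1 := ht_sq x
  have h2 := ht_sq y
  have e1 : ‖x‖ ^ 2 = ht x ^ 2 - 1 := by linarith
  have e2 : ‖y‖ ^ 2 = ht y ^ 2 - 1 := by linarith
  rw [e1, e2]
  have := ht_ne y
  field_simp
  ring

lemma one_le_coshd (x y : E n) : 1 ≤ coshd x y := by
  have h := coshd_sub_one x y
  have h1 : 0 < 2 * (ht x / ht y) := by have := ht_pos x; have := ht_pos y; positivity
  have h2 : 0 ≤ 2 * (ht x / ht y) * (coshd x y - 1) := by rw [h]; positivity
  nlinarith [nonneg_of_mul_nonneg_right h2 h1]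

lemma norm_sub_sq_le (x y : E n) : ‖x - y‖ ^ 2 ≤ 2 * ht x * ht y * (coshd x y - 1) := by
  have h1 := ht_sq x
  have h2 := ht_sq y
  have h3 := one_le_coshd x y
  have : ‖x - y‖ ^ 2 = 2 * (coshd x y - 1) + (ht x - ht y) ^ 2 := by
    rw [norm_sub_sq_real, coshd]; nlinarith
  have h4 : (ht x - ht y) ^ 2 ≤ 2 * (ht x * ht y - 1) * (coshd x y - 1) := by
    -- `(x₀ - y₀)² ≤ 2 (x₀ y₀ - 1)(S - 1)` follows from Cauchy-Schwarz for `(x, y)`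
    have hc := abs_real_inner_le_norm x y
    have hx : ht x * ht y - coshd x y = inner ℝ x y := by rw [coshd]; ring
    have hsq : (ht x * ht y - coshd x y) ^ 2 ≤ (ht x ^ 2 - 1) * (ht y ^ 2 - 1) := by
      rw [hx, h1, h2, ← sq_abs]
      calc |inner ℝ x y| ^ 2 ≤ (‖x‖ * ‖y‖) ^ 2 := by gcongr
        _ = _ := by ring
    nlinarith [sq_nonneg (coshd x y - 1)]
  rw [this]
  nlinarith

lemma eq_of_coshd_eq_one {x y : E n} (h : coshd x y = 1) : x = y := by
  have h1 := norm_sub_sq_le x y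
  rw [h, sub_self, mul_zero] at h1
  have : ‖x - y‖ = 0 := by
    have := norm_nonneg (x - y)
    nlinarith
  exact sub_eq_zero.1 (norm_eq_zero.1 this)

lemma coshd_self (x : E n) : coshd x x = 1 := by
  rw [coshd, real_inner_self_eq_norm_sq]; nlinarith [ht_sq x]

lemma ht_le (x y : E n) : ht y ≤ 2 * coshd x y * ht x := by
  have h1 := real_inner_le_norm x y
  have h2 := norm_lt_ht x
  have h3 := norm_lt_ht y
  have h4 := ht_sq x
  have hx := one_le_ht x
  have hy := ht_pos y
  have h5 : ht y * (ht x - ‖x‖) ≤ coshd x y := by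
    rw [coshd]
    nlinarith [norm_nonneg x]
  have h6 : (ht x - ‖x‖) * (ht x + ‖x‖) = 1 := by ring_nf; linarith
  have h7 : 1 ≤ (ht x - ‖x‖) * (2 * ht x) := by nlinarith
  nlinarith

lemma smooth_coshd : ContDiff ℝ ∞ fun w : E n × E n => coshd w.1 w.2 :=
  ((smooth_ht.comp contDiff_fst).mul (smooth_ht.comp contDiff_snd)).sub
    (contDiff_fst.inner ℝ contDiff_snd)

lemma smooth_coshd_left (y : E n) : ContDiff ℝ ∞ fun x => coshd x y :=
  (smooth_ht.mul contDiff_const).sub (contDiff_id.inner ℝ contDiff_const)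

lemma fderiv_coshd (x y v : E n) :
    fderiv ℝ (fun x => coshd x y) x v = inner ℝ x v / ht x * ht y - inner ℝ v y := by
  have h1 := (hasFDerivAt_ht x).mul_const (ht y)
  have h2 : HasFDerivAt (fun x => inner ℝ x y) (innerSL ℝ y) x := by
    have := (innerSL ℝ y).hasFDerivAt (x := x)
    refine this.congr_of_eventuallyEq (.of_forall fun z => ?_)
    simp [real_inner_comm]
  have := (h1.sub h2).fderiv
  rw [show (fun x => coshd x y) = (fun x => ht x * ht y) - fun x => inner ℝ x y from rfl, this]
  simp [real_inner_comm]
  ring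

lemma D_some_coshd (i : Fin n) (x y : E n) :
    (hframe n).D (some i) (fun x => coshd x y) x = x i / ht x * ht y - y i := by
  rw [D_some, fderiv_coshd, inner_single, real_inner_comm, inner_single]

lemma D_none_coshd (x y : E n) :
    (hframe n).D none (fun x => coshd x y) x = ‖x‖ ^ 2 / ht x * ht y - inner ℝ x y := by
  rw [D_none, fderiv_coshd, real_inner_self_eq_norm_sq]

/-- The Killing identity: the boosts `x₀ ∂ᵢ` of the two variables annihilate `cosh d`. -/
lemma boost_coshd (i : Fin n) (x y : E n) :
    ht x * (hframe n).D (some i) (fun x => coshd x y) x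
      = -(ht y * (hframe n).D (some i) (fun y => coshd x y) y) := by
  have e : (fun y => coshd x y) = fun y => coshd y x := funext fun y => coshd_comm x y
  rw [e, D_some_coshd, D_some_coshd]
  have := ht_ne x
  have := ht_ne y
  field_simp
  ring

lemma D_D_coshd (x y : E n) :
    (∀ i j, (hframe n).D (some i) ((hframe n).D (some j) fun x => coshd x y) x
      = ((if i = j then 1 else 0) / ht x - x i * x j / ht x ^ 3) * ht y) ∧
    (∀ j, (hframe n).D none ((hframe n).D (some j) fun x => coshd x y) x
      = x j / ht x ^ 3 * ht y) ∧
    (∀ i, (hframe n).D (some i) ((hframe n).D none fun x => coshd x y) x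
      = (2 * x i / ht x - ‖x‖ ^ 2 * x i / ht x ^ 3) * ht y - y i) ∧
    (hframe n).D none ((hframe n).D none fun x => coshd x y) x
      = (2 * ‖x‖ ^ 2 / ht x - ‖x‖ ^ 4 / ht x ^ 3) * ht y - inner ℝ x y := by
  have hinv : HasFDerivAt (fun x : E n => (ht x)⁻¹)
      (-((ht x)^2)⁻¹ • ((ht x)⁻¹ • innerSL ℝ x)) x :=
    (hasDerivAt_inv (ht_ne x)).comp_hasFDerivAt x (hasFDerivAt_ht x)
  have dS : ∀ j v, fderiv ℝ ((hframe n).D (some j) fun x => coshd x y) x v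
      = (v j / ht x - inner ℝ x v * x j / ht x ^ 3) * ht y := by
    intro j v
    have e : ((hframe n).D (some j) fun x => coshd x y)
        = fun x => (EuclideanSpace.proj (𝕜 := ℝ) j x * (ht x)⁻¹) * ht y - y j := by
      funext z; rw [D_some_coshd]; simp [div_eq_mul_inv]
    have := (((((EuclideanSpace.proj (𝕜 := ℝ) j).hasFDerivAt (x := x)).mul hinv).mul_const
      (ht y)).sub_const (y j)).fderiv
    rw [e]
    refine (congrArg (fun A => A v) this).trans ?_
    simp
    have := ht_ne x
    field_simp
    ring
  have dN : ∀ v, fderiv ℝ ((hframe n).D none fun x => coshd x y) x v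
      = (2 * inner ℝ x v / ht x - ‖x‖ ^ 2 * inner ℝ x v / ht x ^ 3) * ht y - inner ℝ y v := by
    intro v
    have e : ((hframe n).D none fun x => coshd x y)
        = fun x => (‖x‖ ^ 2 * (ht x)⁻¹) * ht y - innerSL ℝ y x := by
      funext z; rw [D_none_coshd]; simp [div_eq_mul_inv, real_inner_comm]
    have := ((((hasStrictFDerivAt_norm_sq x).hasFDerivAt.mul hinv).mul_const
      (ht y)).sub ((innerSL ℝ y).hasFDerivAt (x := x))).fderiv
    rw [e]
    refine (congrArg (fun A => A v) this).trans ?_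
    simp
    have := ht_ne x
    field_simp
    ring
  refine ⟨fun i j => ?_, fun j => ?_, fun i => ?_, ?_⟩
  · rw [D_some, dS, inner_single]
    simp [eq_comm]
  · rw [D_none, dS, real_inner_self_eq_norm_sq]
    have h := ht_sq x
    have := ht_ne x
    field_simp
    rw [h]
    ring
  · rw [D_some, dN, inner_single, inner_single]
  · rw [D_none, dN, real_inner_self_eq_norm_sq, real_inner_comm]
    ring

lemma grad_coshd (x y : E n) :
    (hframe n).grad (fun x => coshd x y) (fun x => coshd x y) x = coshd x y ^ 2 - 1 := by
  simp only [Frame.grad, Fintype.sum_option, D_some_coshd, D_none_coshd, smul_eq_mul]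
  have e : ∑ i, (x i / ht x * ht y - y i) * (x i / ht x * ht y - y i)
      = ‖x‖ ^ 2 * (ht y / ht x) ^ 2 - 2 * inner ℝ x y * (ht y / ht x) + ‖y‖ ^ 2 := by
    rw [norm_sq_eq_sum, norm_sq_eq_sum, inner_eq_sum, Finset.sum_mul, Finset.mul_sum,
      Finset.sum_mul, ← Finset.sum_sub_distrib, ← Finset.sum_add_distrib]
    exact Finset.sum_congr rfl fun i _ => by ring
  rw [e, coshd]
  have h1 : ‖x‖ ^ 2 = ht x ^ 2 - 1 := by linarith [ht_sq x]
  have h2 : ‖y‖ ^ 2 = ht y ^ 2 - 1 := by linarith [ht_sq y]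
  rw [h1, h2]
  have := ht_ne x
  field_simp
  ring

lemma lap_coshd (x y : E n) :
    (hframe n).lap (fun x => coshd x y) x = n * coshd x y := by
  obtain ⟨h1, h2, h3, h4⟩ := D_D_coshd x y
  rw [hframe_lap, h4, D_none_coshd]
  simp only [h1, if_true, smul_eq_mul]
  have e : ∑ i, (1 / ht x - x i * x i / ht x ^ 3) * ht y
      = (n / ht x - ‖x‖ ^ 2 / ht x ^ 3) * ht y := by
    rw [← Finset.sum_mul, Finset.sum_sub_distrib, ← Finset.sum_div, ← Finset.sum_div,
      norm_sq_eq_sum]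
    simp [pow_two]
  rw [e, coshd]
  have h1 : ‖x‖ ^ 2 = ht x ^ 2 - 1 := by linarith [ht_sq x]
  have h1' : ‖x‖ ^ 4 = (ht x ^ 2 - 1) ^ 2 := by rw [← h1]; ring
  rw [h1, h1']
  have := ht_ne x
  field_simp
  ring

/-- `cosh d` has Hessian `cosh d` times the metric in each variable. -/
lemma hess_coshd {p : E n → ℝ} (hp : ContDiff ℝ ∞ p) (x y : E n) :
    (hframe n).hess (fun x => coshd x y) p x = coshd x y * (hframe n).grad p p x := by
  obtain ⟨h1, h2, h3, h4⟩ := D_D_coshd x y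
  -- the Euler field scales the coordinate fields
  have c1 : ∀ i, (hframe n).D (some i) ((hframe n).D none p) x
      - (hframe n).D none ((hframe n).D (some i) p) x = (hframe n).D (some i) p x := by
    intro i
    have hd : DifferentiableAt ℝ (fderiv ℝ p) x :=
      (hp.fderiv_right (m := ∞) (by simp)).differentiable (by simp) x
    have a1 := fderiv_clm_apply hd (differentiableAt_id (x := x))
    have a2 := fderiv_clm_apply hd (differentiableAt_const (EuclideanSpace.single i (1 : ℝ)))
    have hs : IsSymmSndFDerivAt ℝ p x := by
      refine (hp.contDiffAt (x := x)).isSymmSndFDerivAt ?_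
      simp only [minSmoothness_of_isRCLikeNormedField]
      exact WithTop.coe_le_coe.2 (le_top : (2 : ℕ∞) ≤ ⊤)
    rw [D_some, D_none, D_some]
    rw [show (hframe n).D none p = fun z => fderiv ℝ p z (id z) from rfl, a1,
      show (hframe n).D (some i) p = fun z => fderiv ℝ p z (EuclideanSpace.single i (1 : ℝ))
        from rfl, a2]
    simp [hs.eq x (EuclideanSpace.single i (1 : ℝ))]
  have c2 : ∀ i, (hframe n).D none ((hframe n).D (some i) p) x
      - (hframe n).D (some i) ((hframe n).D none p) x = -(hframe n).D (some i) p x :=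
    fun i => by rw [← c1 i]; ring
  have c3 : ∀ i j, (hframe n).D (some i) ((hframe n).D (some j) p) x
      - (hframe n).D (some j) ((hframe n).D (some i) p) x = 0 := by
    intro i j
    have hd : DifferentiableAt ℝ (fderiv ℝ p) x :=
      (hp.fderiv_right (m := ∞) (by simp)).differentiable (by simp) x
    have a2 := fun i => fderiv_clm_apply hd
      (differentiableAt_const (EuclideanSpace.single i (1 : ℝ)))
    have hs : IsSymmSndFDerivAt ℝ p x := by
      refine (hp.contDiffAt (x := x)).isSymmSndFDerivAt ?_
      simp only [minSmoothness_of_isRCLikeNormedField]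
      exact WithTop.coe_le_coe.2 (le_top : (2 : ℕ∞) ≤ ⊤)
    have a3 : ∀ i, (hframe n).D (some i) p
      = fun z => fderiv ℝ p z (EuclideanSpace.single i (1 : ℝ)) := fun i => rfl
    rw [D_some, D_some, a3, a3, a2, a2]
    simp [hs.eq (EuclideanSpace.single j (1 : ℝ)) (EuclideanSpace.single i (1 : ℝ))]
  rw [Frame.hess_eq_sum (smooth_coshd_left y) hp]
  simp only [Frame.grad, Fintype.sum_option, smul_eq_mul, c1, c2, c3, h1, h2, h3, h4,
    D_some_coshd, D_none_coshd, sub_self, mul_zero, add_zero]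
  set e := (hframe n).D none p x with he
  set c : Fin n → ℝ := fun i => (hframe n).D (some i) p x with hc
  have hc' : ∀ i, (hframe n).D (some i) p x = c i := fun i => rfl
  have hsum : e = ∑ i, x i * c i := D_none_eq_sum p x
  simp only [hc']
  set Q := ∑ i, c i * c i with hQ
  have s1 : ∑ j, e * (x j / ht x ^ 3 * ht y * c j + (x j / ht x * ht y - y j) * -c j)
      = e * (e / ht x ^ 3 * ht y - e / ht x * ht y + ∑ j, y j * c j) := by
    rw [← Finset.mul_sum]
    congr 1
    conv_rhs => rw [hsum]
    rw [Finset.sum_div, Finset.sum_mul, Finset.sum_div, Finset.sum_mul,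
      ← Finset.sum_sub_distrib, ← Finset.sum_add_distrib]
    exact Finset.sum_congr rfl fun i _ => by ring
  have s2 : ∑ i, c i * (((2 * x i / ht x - ‖x‖ ^ 2 * x i / ht x ^ 3) * ht y - y i) * e
        + (‖x‖ ^ 2 / ht x * ht y - inner ℝ x y) * c i)
      = (2 / ht x - ‖x‖ ^ 2 / ht x ^ 3) * ht y * e * e - (∑ j, y j * c j) * e
        + (‖x‖ ^ 2 / ht x * ht y - inner ℝ x y) * Q := by
    have t : (2 / ht x - ‖x‖ ^ 2 / ht x ^ 3) * ht y * e * e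
        = ∑ i, (2 / ht x - ‖x‖ ^ 2 / ht x ^ 3) * ht y * e * (x i * c i) := by
      rw [← Finset.mul_sum, ← hsum]
    rw [t, hQ, Finset.sum_mul, Finset.mul_sum, ← Finset.sum_sub_distrib,
      ← Finset.sum_add_distrib]
    exact Finset.sum_congr rfl fun i _ => by ring
  have s3 : ∑ i, ∑ j, c i * (((if i = j then 1 else 0) / ht x - x i * x j / ht x ^ 3) * ht y
      * c j) = Q / ht x * ht y - e * e / ht x ^ 3 * ht y := by
    have t1 : ∀ i, ∑ j, c i * (((if i = j then 1 else 0) / ht x - x i * x j / ht x ^ 3) * ht y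
        * c j) = c i * c i / ht x * ht y - x i * c i * e / ht x ^ 3 * ht y := by
      intro i
      have t2 : ∀ j, c i * (((if i = j then 1 else 0) / ht x - x i * x j / ht x ^ 3) * ht y * c j)
          = (if i = j then c i / ht x * ht y * c j else 0)
            - x i * c i / ht x ^ 3 * ht y * (x j * c j) := by
        intro j
        split_ifs <;> ring
      simp only [t2]
      rw [Finset.sum_sub_distrib, ← Finset.mul_sum, ← hsum]
      simp
      ring
    simp only [t1]
    rw [Finset.sum_sub_distrib, ← Finset.sum_mul, ← Finset.sum_div, ← Finset.sum_mul,
      ← Finset.sum_div, ← Finset.sum_mul, ← hsum]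
  rw [s1, Finset.sum_add_distrib]
  have s23 : ∑ i, c i * (((2 * x i / ht x - ‖x‖ ^ 2 * x i / ht x ^ 3) * ht y - y i) * e
        + (‖x‖ ^ 2 / ht x * ht y - inner ℝ x y) * c i) = _ := s2
  rw [s23, s3, coshd]
  have h1 : ‖x‖ ^ 2 = ht x ^ 2 - 1 := by linarith [ht_sq x]
  have h1' : ‖x‖ ^ 4 = (ht x ^ 2 - 1) ^ 2 := by rw [← h1]; ring
  rw [h1, h1']
  have := ht_ne x
  field_simp
  ring

end Chart

/-! ### The regularized distance -/

section Radial

/-- `(s² - 1 + δ)^{-1/2}`, the derivative of the regularized distance in the variable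
`s = cosh d`. -/
def invRoot (δ s : ℝ) : ℝ := (√(s ^ 2 - 1 + δ))⁻¹

variable {δ s : ℝ}

lemma radicand_pos (hδ : 0 < δ) (hs : 1 ≤ s) : 0 < s ^ 2 - 1 + δ := by nlinarith

lemma invRoot_pos (hδ : 0 < δ) (hs : 1 ≤ s) : 0 < invRoot δ s :=
  inv_pos.2 (Real.sqrt_pos.2 (radicand_pos hδ hs))

lemma invRoot_sq (hδ : 0 < δ) (hs : 1 ≤ s) : invRoot δ s ^ 2 * (s ^ 2 - 1 + δ) = 1 := by
  have h := radicand_pos hδ hs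
  rw [invRoot, inv_pow, Real.sq_sqrt h.le, inv_mul_cancel₀ h.ne']

lemma hasDerivAt_invRoot (hδ : 0 < δ) (hs : 1 ≤ s) :
    HasDerivAt (invRoot δ) (-(s * invRoot δ s ^ 3)) s := by
  have h := radicand_pos hδ hs
  have h1 : HasDerivAt (fun s : ℝ => s ^ 2 - 1 + δ) (2 * s) s := by
    simpa using ((hasDerivAt_pow 2 s).sub_const 1).add_const δ
  have h2 := (h1.sqrt h.ne').fun_inv (Real.sqrt_pos.2 h).ne'
  convert! h2 using 1
  simp only [invRoot]
  have := (Real.sqrt_pos.2 h).ne'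
  field_simp

/-- The regularized distance `log (s + √(s² - 1 + δ))` in the variable `s = cosh d`; for `δ = 0`
it is `arcosh s`. -/
def regDist (δ s : ℝ) : ℝ := Real.log (s + √(s ^ 2 - 1 + δ))

lemma hasDerivAt_regDist (hδ : 0 < δ) (hs : 1 ≤ s) :
    HasDerivAt (regDist δ) (invRoot δ s) s := by
  have h := radicand_pos hδ hs
  have h0 := Real.sqrt_pos.2 h
  have h1 : HasDerivAt (fun s : ℝ => s ^ 2 - 1 + δ) (2 * s) s := by
    simpa using ((hasDerivAt_pow 2 s).sub_const 1).add_const δ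
  have h3 : HasDerivAt (fun s : ℝ => s + √(s ^ 2 - 1 + δ))
      (1 + 2 * s / (2 * √(s ^ 2 - 1 + δ))) s := (hasDerivAt_id s).add (h1.sqrt h.ne')
  have h2 := h3.log (by positivity)
  have e : (1 + 2 * s / (2 * √(s ^ 2 - 1 + δ))) / (s + √(s ^ 2 - 1 + δ))
      = invRoot δ s := by
    simp only [invRoot]
    field_simp
    ring
  rw [e] at h2
  exact h2

/-- The Laplacian of the regularized distance, in the variable `s = cosh d`. -/
def lapReg (n : ℕ) (δ s : ℝ) : ℝ := ((n : ℝ) - 1) * s * invRoot δ s + δ * s * invRoot δ s ^ 3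

/-- The derivative of `lapReg`. -/
def lapReg' (n : ℕ) (δ s : ℝ) : ℝ := ((n : ℝ) - 1) * (invRoot δ s - s ^ 2 * invRoot δ s ^ 3)
    + δ * (invRoot δ s ^ 3 - 3 * s ^ 2 * invRoot δ s ^ 5)

/-- The kernel `-Δ²` of the regularized distance, in the variable `s = cosh d`. -/
def bilapKer (n : ℕ) (δ s : ℝ) : ℝ :=
  s * (invRoot δ s ^ 3 * (((n : ℝ) - 1) * (n - 3) * (1 - δ) + δ * (2 * n - 6))
    + invRoot δ s ^ 5 * (δ * ((1 - δ) * (6 * n - 18) + 6 * δ))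
    + invRoot δ s ^ 7 * (15 * δ ^ 2 * (1 - δ)))

lemma hasDerivAt_lapReg (n : ℕ) (hδ : 0 < δ) (hs : 1 ≤ s) :
    HasDerivAt (lapReg n δ) (lapReg' n δ s) s := by
  have h := hasDerivAt_invRoot hδ hs
  have h1 := ((hasDerivAt_id s).const_mul ((n : ℝ) - 1)).mul h
  have h2 := ((hasDerivAt_id s).const_mul δ).mul (h.pow 3)
  convert! h1.add h2 using 1
  simp only [lapReg', id]
  norm_num
  ring

lemma hasDerivAt_lapReg' (n : ℕ) (hδ : 0 < δ) (hs : 1 ≤ s) :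
    HasDerivAt (lapReg' n δ)
      (((n : ℝ) - 1) * (-(3 * s * invRoot δ s ^ 3) + 3 * s ^ 3 * invRoot δ s ^ 5)
        + δ * (-(9 * s * invRoot δ s ^ 5) + 15 * s ^ 3 * invRoot δ s ^ 7)) s := by
  have h := hasDerivAt_invRoot hδ hs
  have h1 := (h.sub ((hasDerivAt_pow 2 s).mul (h.pow 3))).const_mul ((n : ℝ) - 1)
  have h2 := ((h.pow 3).sub (((hasDerivAt_pow 2 s).const_mul 3).mul (h.pow 5))).const_mul δ
  convert! h1.add h2 using 1
  norm_num
  ring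

lemma lapReg_eq (n : ℕ) (hδ : 0 < δ) (hs : 1 ≤ s) :
    n * s * invRoot δ s + (s ^ 2 - 1) * -(s * invRoot δ s ^ 3) = lapReg n δ s := by
  have h := invRoot_sq hδ hs
  rw [lapReg]
  linear_combination (-s * invRoot δ s) * h

/-- The radial Laplacian `(s² - 1) ∂ₛ² + n s ∂ₛ` applied to `lapReg`. -/
lemma bilapKer_eq (n : ℕ) (hδ : 0 < δ) (hs : 1 ≤ s) :
    n * s * lapReg' n δ s + (s ^ 2 - 1) *
      (((n : ℝ) - 1) * (-(3 * s * invRoot δ s ^ 3) + 3 * s ^ 3 * invRoot δ s ^ 5)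
        + δ * (-(9 * s * invRoot δ s ^ 5) + 15 * s ^ 3 * invRoot δ s ^ 7))
      = -bilapKer n δ s := by
  have h := invRoot_sq hδ hs
  have hp := invRoot_pos hδ hs
  simp only [lapReg', bilapKer]
  set r := invRoot δ s
  have e : δ = (r ^ 2)⁻¹ - s ^ 2 + 1 := by
    have : r ^ 2 ≠ 0 := by positivity
    field_simp
    linarith
  rw [e]
  field_simp
  ring

lemma lapReg_nonneg {n : ℕ} (hn : 1 ≤ n) (hδ : 0 < δ) (hs : 1 ≤ s) : 0 ≤ lapReg n δ s := by
  have h := invRoot_pos hδ hs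
  have : (1 : ℝ) ≤ n := by exact_mod_cast hn
  have h1 : 0 ≤ (n : ℝ) - 1 := by linarith
  rw [lapReg]
  positivity

/-- The distance has a nonnegative `-Δ²` from dimension three on, and so does its regularization. -/
lemma bilapKer_nonneg {n : ℕ} (hn : 3 ≤ n) (hδ : 0 < δ) (hδ1 : δ ≤ 1) (hs : 1 ≤ s) :
    0 ≤ bilapKer n δ s := by
  have h := invRoot_pos hδ hs
  have h3 : (3 : ℝ) ≤ n := by exact_mod_cast hn
  have h1 : 0 ≤ (n : ℝ) - 1 := by linarith
  have h2 : 0 ≤ (n : ℝ) - 3 := by linarith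
  have h4 : 0 ≤ 2 * (n : ℝ) - 6 := by linarith
  have h5 : 0 ≤ 6 * (n : ℝ) - 18 := by linarith
  have h6 : 0 ≤ 1 - δ := by linarith
  rw [bilapKer]
  positivity

/-- On `s ≥ 1` both `s (s² - 1 + δ)^{-1/2}` and `(s² - 1 + δ)^{-1/2}` are bounded. -/
lemma invRoot_bounds (hδ : 0 < δ) (hs : 1 ≤ s) :
    s * invRoot δ s ≤ 1 + δ⁻¹ ∧ invRoot δ s ≤ 1 + δ⁻¹ := by
  have h := invRoot_sq hδ hs
  have hp := invRoot_pos hδ hs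
  have hi : 0 < δ⁻¹ := inv_pos.2 hδ
  have hm : δ * δ⁻¹ = 1 := mul_inv_cancel₀ hδ.ne'
  have key : s * invRoot δ s ≤ 1 + δ⁻¹ := by
    refine le_of_sq_le_sq ?_ (by positivity) |> fun h => h
    have h1 : invRoot δ s ^ 2 ≤ δ⁻¹ := by
      have : invRoot δ s ^ 2 * δ ≤ 1 := by
        rw [← h]; gcongr; nlinarith
      calc invRoot δ s ^ 2 = invRoot δ s ^ 2 * δ * δ⁻¹ := by rw [mul_assoc, hm, mul_one]
        _ ≤ 1 * δ⁻¹ := by gcongr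
        _ = δ⁻¹ := one_mul _
    nlinarith [mul_pos hδ (pow_pos hp 2)]
  exact ⟨key, le_trans (by nlinarith) key⟩

lemma lapReg_le {n : ℕ} (hn : 1 ≤ n) (hδ : 0 < δ) (hs : 1 ≤ s) :
    lapReg n δ s ≤ n * (1 + δ⁻¹) ^ 3 * (1 + δ) := by
  obtain ⟨h1, h2⟩ := invRoot_bounds hδ hs
  have h := invRoot_pos hδ hs
  have hn' : (1 : ℝ) ≤ n := by exact_mod_cast hn
  have hi : 0 < δ⁻¹ := inv_pos.2 hδ
  have hM : (1 : ℝ) ≤ 1 + δ⁻¹ := by linarith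
  set M := 1 + δ⁻¹
  have e : lapReg n δ s = ((n : ℝ) - 1) * (s * invRoot δ s)
      + δ * ((s * invRoot δ s) * invRoot δ s ^ 2) := by rw [lapReg]; ring
  have hM3 : M ≤ M ^ 3 := by
    nlinarith [sq_nonneg M, mul_nonneg (by linarith : 0 ≤ M) (by nlinarith : 0 ≤ M ^ 2 - 1)]
  rw [e]
  have b1 : ((n : ℝ) - 1) * (s * invRoot δ s) ≤ n * M ^ 3 := by
    have : 0 ≤ s * invRoot δ s := by positivity
    nlinarith
  have b2 : (s * invRoot δ s) * invRoot δ s ^ 2 ≤ n * M ^ 3 := by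
    calc (s * invRoot δ s) * invRoot δ s ^ 2 ≤ M * M ^ 2 := by gcongr
      _ = 1 * M ^ 3 := by ring
      _ ≤ n * M ^ 3 := by gcongr
  nlinarith

lemma bilapKer_le {n : ℕ} (hn : 3 ≤ n) (hδ : 0 < δ) (hδ1 : δ ≤ 1) (hs : 1 ≤ s) :
    bilapKer n δ s ≤ (1 + δ⁻¹) ^ 7 * ((n - 1) * (n - 3) + 2 * n + 6 * n + 6 + 15) := by
  obtain ⟨h1, h2⟩ := invRoot_bounds hδ hs
  have h := invRoot_pos hδ hs
  have hn' : (3 : ℝ) ≤ n := by exact_mod_cast hn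
  have hi : 0 < δ⁻¹ := inv_pos.2 hδ
  have hM : (1 : ℝ) ≤ 1 + δ⁻¹ := by linarith
  set M := 1 + δ⁻¹
  have hd : 0 ≤ 1 - δ := by linarith
  have a1 : 0 ≤ (n : ℝ) - 1 := by linarith
  have a3 : 0 ≤ (n : ℝ) - 3 := by linarith
  have a6 : 0 ≤ 6 * (n : ℝ) - 18 := by linarith
  have k : ∀ m : ℕ, m ≤ 6 → s * invRoot δ s ^ (m + 1) ≤ M ^ 7 := by
    intro m hm
    calc s * invRoot δ s ^ (m + 1) = (s * invRoot δ s) * invRoot δ s ^ m := by ring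
      _ ≤ M * M ^ m := by gcongr
      _ = M ^ (m + 1) := by ring
      _ ≤ M ^ 7 := pow_le_pow_right₀ hM (by omega)
  have c1 : ((n : ℝ) - 1) * (n - 3) * (1 - δ) + δ * (2 * n - 6) ≤ (n - 1) * (n - 3) + 2 * n := by
    have : ((n : ℝ) - 1) * (n - 3) * (1 - δ) ≤ (n - 1) * (n - 3) * 1 := by gcongr; linarith
    nlinarith
  have c2 : δ * ((1 - δ) * (6 * n - 18) + 6 * δ) ≤ 6 * n + 6 := by
    have : (1 - δ) * (6 * (n : ℝ) - 18) ≤ 1 * (6 * n - 18) := by gcongr; linarith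
    have h3 : (1 - δ) * (6 * (n : ℝ) - 18) + 6 * δ ≤ 6 * n + 6 := by linarith
    have h4 : 0 ≤ (1 - δ) * (6 * (n : ℝ) - 18) + 6 * δ := by positivity
    calc δ * ((1 - δ) * (6 * n - 18) + 6 * δ) ≤ 1 * ((1 - δ) * (6 * n - 18) + 6 * δ) := by gcongr
      _ ≤ _ := by linarith
  have c3 : 15 * δ ^ 2 * (1 - δ) ≤ 15 := by
    have : δ ^ 2 ≤ 1 := by nlinarith
    have := mul_le_mul this (by linarith : 1 - δ ≤ 1) hd zero_le_one
    linarith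
  have p1 : 0 ≤ ((n : ℝ) - 1) * (n - 3) * (1 - δ) + δ * (2 * n - 6) := by
    have : 0 ≤ 2 * (n : ℝ) - 6 := by linarith
    positivity
  have p2 : 0 ≤ δ * ((1 - δ) * (6 * n - 18) + 6 * δ) := by positivity
  have p3 : 0 ≤ 15 * δ ^ 2 * (1 - δ) := by positivity
  have hM7 : 0 ≤ M ^ 7 := by positivity
  calc bilapKer n δ s = (s * invRoot δ s ^ (2 + 1)) * (((n : ℝ) - 1) * (n - 3) * (1 - δ)
        + δ * (2 * n - 6)) + (s * invRoot δ s ^ (4 + 1)) * (δ * ((1 - δ) * (6 * n - 18) + 6 * δ))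
        + (s * invRoot δ s ^ (6 + 1)) * (15 * δ ^ 2 * (1 - δ)) := by rw [bilapKer]; ring
    _ ≤ M ^ 7 * ((n - 1) * (n - 3) + 2 * n) + M ^ 7 * (6 * n + 6) + M ^ 7 * 15 := by
        gcongr
        · exact k 2 (by norm_num)
        · exact k 4 (by norm_num)
        · exact k 6 (by norm_num)
    _ = _ := by ring

end Radial

section Weight

variable {n : ℕ}

/-- The frame of the product `ℍⁿ × ℍⁿ`. -/
abbrev hframe2 (n : ℕ) : Frame (E n × E n) (Option (Fin n) ⊕ Option (Fin n)) :=
  (hframe n).prod (hframe n)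

/-- A tangent vector of the hyperboloid is spacelike. -/
lemma sq_le_norm_sq_of_tangent {x v : E n} {v₀ : ℝ} (h : inner ℝ v x = v₀ * ht x) :
    v₀ ^ 2 ≤ ‖v‖ ^ 2 := by
  have h1 := abs_real_inner_le_norm v x
  rw [h, abs_mul, abs_of_pos (ht_pos x)] at h1
  have h2 := norm_lt_ht x
  have h3 : |v₀| ≤ ‖v‖ := by
    by_contra hc
    push Not at hc
    have : ‖v‖ * ‖x‖ < |v₀| * ht x := by
      calc ‖v‖ * ‖x‖ ≤ ‖v‖ * ht x := by gcongr
        _ < |v₀| * ht x := by gcongr; exact ht_pos x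
    linarith
  rw [← sq_abs]
  gcongr

set_option maxHeartbeats 1000000 in
/-- The Hessian of the distance on `ℍⁿ × ℍⁿ` is nonnegative, in polynomial form: `(ξ₀, ξ)` and
`(η₀, η)` are tangent to the hyperboloid at the points over `x` and `y`. -/
lemma distance_convex {x y ξ η : E n} {ξ₀ η₀ : ℝ} (hξ : inner ℝ ξ x = ξ₀ * ht x)
    (hη : inner ℝ η y = η₀ * ht y) :
    0 ≤ coshd x y * (‖ξ‖ ^ 2 - ξ₀ ^ 2) + coshd x y * (‖η‖ ^ 2 - η₀ ^ 2)
        - 2 * (inner ℝ ξ η - ξ₀ * η₀) ∧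
    coshd x y * ((inner ℝ ξ y - ξ₀ * ht y) + (inner ℝ η x - η₀ * ht x)) ^ 2
      ≤ (coshd x y ^ 2 - 1) * (coshd x y * (‖ξ‖ ^ 2 - ξ₀ ^ 2)
        + coshd x y * (‖η‖ ^ 2 - η₀ ^ 2) - 2 * (inner ℝ ξ η - ξ₀ * η₀)) := by
  rcases (one_le_coshd x y).eq_or_lt with h1 | h1
  · obtain rfl := eq_of_coshd_eq_one h1.symm
    rw [← h1, hξ, hη]
    have := sq_le_norm_sq_of_tangent (x := x) (v := ξ - η) (v₀ := ξ₀ - η₀)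
      (by rw [inner_sub_left, hξ, hη]; ring)
    rw [norm_sub_sq_real] at this
    constructor
    · nlinarith
    · simp
  set S := coshd x y with hS
  set α := inner ℝ ξ y - ξ₀ * ht y with hα
  set β := inner ℝ η x - η₀ * ht x with hβ
  set d := S ^ 2 - 1 with hd
  have dpos : 0 < d := by nlinarith
  have hxy : inner ℝ x y = ht x * ht y - S := by rw [hS, coshd]; ring
  have hx : ‖x‖ ^ 2 = ht x ^ 2 - 1 := by linarith [ht_sq x]
  have hy : ‖y‖ ^ 2 = ht y ^ 2 - 1 := by linarith [ht_sq y]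
  have hξy : inner ℝ ξ y = α + ξ₀ * ht y := by rw [hα]; ring
  have hηx : inner ℝ η x = β + η₀ * ht x := by rw [hβ]; ring
  -- the components of the two vectors orthogonal to the geodesic from `x` to `y`
  set P := d • ξ + α • (S • x - y) with hP
  set P₀ := d * ξ₀ + α * (S * ht x - ht y) with hP₀
  set R := d • η + β • (S • y - x) with hR
  set R₀ := d * η₀ + β * (S * ht y - ht x) with hR₀
  have xx : inner ℝ x x = ht x ^ 2 - 1 := by rw [real_inner_self_eq_norm_sq, hx]
  have yy : inner ℝ y y = ht y ^ 2 - 1 := by rw [real_inner_self_eq_norm_sq, hy]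
  have yx : inner ℝ y x = ht x * ht y - S := by rw [real_inner_comm, hxy]
  have Px : inner ℝ P x = P₀ * ht x := by
    rw [hP, hP₀]
    simp only [inner_add_left, inner_sub_left, real_inner_smul_left]
    rw [hξ, yx, xx]; ring
  have Ry : inner ℝ R y = R₀ * ht y := by
    rw [hR, hR₀]
    simp only [inner_add_left, inner_sub_left, real_inner_smul_left]
    rw [hη, hxy, yy]; ring
  have Rx : inner ℝ R x = R₀ * ht x := by
    rw [hR, hR₀]
    simp only [inner_add_left, inner_sub_left, real_inner_smul_left]
    rw [hηx, yx, xx, hd]; ring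
  have nP : ‖P‖ ^ 2 - P₀ ^ 2 = d ^ 2 * (‖ξ‖ ^ 2 - ξ₀ ^ 2) - d * α ^ 2 := by
    rw [← real_inner_self_eq_norm_sq, hP, hP₀]
    simp only [inner_add_left, inner_sub_left, real_inner_smul_left, inner_add_right,
      inner_sub_right, real_inner_smul_right]
    rw [real_inner_comm ξ x, real_inner_comm ξ y, hξ, hξy, yx, hxy, xx, yy,
      real_inner_self_eq_norm_sq, hd]
    ring
  have nR : ‖R‖ ^ 2 - R₀ ^ 2 = d ^ 2 * (‖η‖ ^ 2 - η₀ ^ 2) - d * β ^ 2 := by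
    rw [← real_inner_self_eq_norm_sq, hR, hR₀]
    simp only [inner_add_left, inner_sub_left, real_inner_smul_left, inner_add_right,
      inner_sub_right, real_inner_smul_right]
    rw [real_inner_comm η x, real_inner_comm η y, hη, hηx, yx, hxy, xx, yy,
      real_inner_self_eq_norm_sq, hd]
    ring
  have nPR : inner ℝ P R - P₀ * R₀ = d ^ 2 * (inner ℝ ξ η - ξ₀ * η₀) + d * S * α * β := by
    rw [hP, hP₀, hR, hR₀]
    simp only [inner_add_left, inner_sub_left, real_inner_smul_left, inner_add_right,
      inner_sub_right, real_inner_smul_right]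
    rw [real_inner_comm η x, real_inner_comm η y, hξ, hξy, hη, hηx, yx, hxy, xx, yy, hd]
    ring
  have i1 := sq_le_norm_sq_of_tangent Px
  have i2 := sq_le_norm_sq_of_tangent Ry
  have i3 := sq_le_norm_sq_of_tangent (x := x) (v := P - R) (v₀ := P₀ - R₀)
    (by rw [inner_sub_left, Px, Rx]; ring)
  rw [norm_sub_sq_real] at i3
  set T := S * (‖ξ‖ ^ 2 - ξ₀ ^ 2) + S * (‖η‖ ^ 2 - η₀ ^ 2) - 2 * (inner ℝ ξ η - ξ₀ * η₀) with hT
  have key : 0 ≤ d * (d * T - S * (α + β) ^ 2) := by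
    have e : d * (d * T - S * (α + β) ^ 2)
        = S * (‖P‖ ^ 2 - P₀ ^ 2) + S * (‖R‖ ^ 2 - R₀ ^ 2) - 2 * (inner ℝ P R - P₀ * R₀) := by
      rw [nP, nR, nPR, hT]; ring
    rw [e]
    have t1 := mul_nonneg (sub_nonneg.2 h1.le)
      (add_nonneg (sub_nonneg.2 i1) (sub_nonneg.2 i2))
    linear_combination t1 + i3
  have key2 : S * (α + β) ^ 2 ≤ d * T := by
    have := nonneg_of_mul_nonneg_right key dpos
    linarith
  have key3 : 0 ≤ d * T := le_trans (by positivity) key2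
  exact ⟨nonneg_of_mul_nonneg_right key3 dpos, key2⟩

lemma grad_coshd_right (x y : E n) (p : E n → ℝ) : (hframe n).grad (fun y => coshd x y) p y
    = (hframe n).grad (fun y => coshd y x) p y :=
  congrArg (fun f => (hframe n).grad f p y) (funext fun y => coshd_comm x y)

lemma grad2_coshd (w : E n × E n) :
    (hframe2 n).grad (fun w => coshd w.1 w.2) (fun w => coshd w.1 w.2) w
      = 2 * (coshd w.1 w.2 ^ 2 - 1) := by
  have hd := smooth_coshd.differentiable (n := ∞) (by simp) w
  rw [Frame.prod_grad _ _ hd hd]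
  simp only
  rw [grad_coshd, grad_coshd_right, Frame.grad_comm, grad_coshd_right, grad_coshd,
    coshd_comm w.2 w.1]
  ring

lemma lap2_coshd (w : E n × E n) :
    (hframe2 n).lap (fun w => coshd w.1 w.2) w = 2 * (n * coshd w.1 w.2) := by
  rw [Frame.prod_lap _ _ smooth_coshd]
  have e : (hframe n).lap (fun y => coshd w.1 y) w.2 = (hframe n).lap (fun y => coshd y w.1) w.2 :=
    congrArg (fun f => (hframe n).lap f w.2) (funext fun y => coshd_comm _ _)
  simp only
  rw [e, lap_coshd, lap_coshd, coshd_comm w.2 w.1]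
  ring

/-- The gradient vector at `x` in Euclidean coordinates. -/
lemma grad_data {p : E n → ℝ} (x : E n) : ∃ ξ : E n,
    inner ℝ ξ x = ((hframe n).D none p x * ht x) * ht x ∧
    ‖ξ‖ ^ 2 - ((hframe n).D none p x * ht x) ^ 2 = (hframe n).grad p p x ∧
    (∀ y, (hframe n).grad (fun x => coshd x y) p x
      = (hframe n).D none p x * ht x * ht y - inner ℝ ξ y) ∧
    ∀ i, ξ i = (hframe n).D (some i) p x + (hframe n).D none p x * x i := by
  set e := (hframe n).D none p x with he
  set c : E n := WithLp.toLp 2 fun i => (hframe n).D (some i) p x with hc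
  have hci : ∀ i, (hframe n).D (some i) p x = c i := fun i => rfl
  have hec : e = inner ℝ c x := by
    rw [inner_eq_sum, he, D_none_eq_sum]
    exact Finset.sum_congr rfl fun i _ => by rw [hci, smul_eq_mul, mul_comm]
  have hx := ht_sq x
  refine ⟨c + e • x, ?_, ?_, fun y => ?_, fun i => by simp [hci]⟩
  · rw [inner_add_left, real_inner_smul_left, ← hec, real_inner_self_eq_norm_sq]
    linear_combination (-e) * hx
  · rw [norm_add_sq_real, norm_smul, inner_smul_right, ← hec, mul_pow, Real.norm_eq_abs, sq_abs,
      mul_pow, hx]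
    simp only [Frame.grad, Fintype.sum_option, smul_eq_mul, ← he, hci]
    rw [norm_sq_eq_sum c]
    simp only [← pow_two]
    ring
  · simp only [Frame.grad, Fintype.sum_option, D_some_coshd, D_none_coshd, smul_eq_mul, ← he, hci]
    have s : ∑ i, (x i / ht x * ht y - y i) * c i = inner ℝ c x / ht x * ht y - inner ℝ c y := by
      rw [inner_eq_sum, inner_eq_sum, Finset.sum_div, Finset.sum_mul, ← Finset.sum_sub_distrib]
      exact Finset.sum_congr rfl fun i _ => by ring
    rw [s, inner_add_left, real_inner_smul_left, ← hec]
    have : ‖x‖ ^ 2 = ht x ^ 2 - 1 := by linarith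
    rw [this]
    have := ht_ne x
    field_simp
    ring

/-- `cosh d` is convex on `ℍⁿ × ℍⁿ`, with the quantitative bound `S |∇S · ∇p|² ≤ (S² - 1) Hess S`
that passes to convexity of the distance itself. -/
lemma hess2_coshd {p : E n × E n → ℝ} (hp : ContDiff ℝ ∞ p) (w : E n × E n) :
    0 ≤ (hframe2 n).hess (fun w => coshd w.1 w.2) p w ∧
    coshd w.1 w.2 * (hframe2 n).grad (fun w => coshd w.1 w.2) p w ^ 2
      ≤ (coshd w.1 w.2 ^ 2 - 1) * (hframe2 n).hess (fun w => coshd w.1 w.2) p w := by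
  obtain ⟨x, y⟩ := w
  have hd := smooth_coshd.differentiable (n := ∞) (by simp) (x, y)
  have dp := hp.differentiable (by simp) (x, y)
  have pl : ContDiff ℝ ∞ fun x => p (x, y) := hp.comp (contDiff_prodMk_left y)
  have pr : ContDiff ℝ ∞ fun y => p (x, y) := hp.comp (contDiff_prodMk_right x)
  obtain ⟨ξ, a1, a2, a3, a4⟩ := grad_data (p := fun x => p (x, y)) x
  obtain ⟨η, b1, b2, b3, b4⟩ := grad_data (p := fun y => p (x, y)) y
  have esym : (fun y => coshd x y) = fun y => coshd y x := funext fun y => coshd_comm _ _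
  have eg : (hframe2 n).grad (fun w => coshd w.1 w.2) p (x, y)
      = -((inner ℝ ξ y - (hframe n).D none (fun x => p (x, y)) x * ht x * ht y)
        + (inner ℝ η x - (hframe n).D none (fun y => p (x, y)) y * ht y * ht x)) := by
    rw [Frame.prod_grad _ _ hd dp]
    simp only [esym]
    rw [a3, b3]; ring
  have ec : ∑ i, ∑ j, (hframe2 n).D (.inl i) p (x, y)
        * ((hframe2 n).D (.inl i) ((hframe2 n).D (.inr j) fun w => coshd w.1 w.2) (x, y)
          * (hframe2 n).D (.inr j) p (x, y))
      = -(inner ℝ ξ η - ((hframe n).D none (fun x => p (x, y)) x * ht x)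
        * ((hframe n).D none (fun y => p (x, y)) y * ht y)) := by
    have m1 : ∀ j, (hframe2 n).D (.inr (some j)) (fun w => coshd w.1 w.2)
        = fun w => (w.2 j / ht w.2) * ht w.1 - EuclideanSpace.proj (𝕜 := ℝ) j w.1 := by
      intro j; funext w
      rw [Frame.prod_D_inr _ _ _ (smooth_coshd.differentiable (n := ∞) (by simp) w)]
      have : (fun y => coshd w.1 y) = fun y => coshd y w.1 := funext fun y => coshd_comm _ _
      simp only [this]
      rw [D_some_coshd]; rfl
    have m2 : (hframe2 n).D (.inr none) (fun w => coshd w.1 w.2)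
        = fun w => (‖w.2‖ ^ 2 / ht w.2) * ht w.1 - inner ℝ w.2 w.1 := by
      funext w
      rw [Frame.prod_D_inr _ _ _ (smooth_coshd.differentiable (n := ∞) (by simp) w)]
      have : (fun y => coshd w.1 y) = fun y => coshd y w.1 := funext fun y => coshd_comm _ _
      simp only [this]
      rw [D_none_coshd]
    have s1 : ∀ j, DifferentiableAt ℝ ((hframe2 n).D (.inr j) fun w => coshd w.1 w.2) (x, y) :=
      fun j => ((hframe2 n).smooth_D _ smooth_coshd).differentiable (by simp) _
    have f1 : ∀ j v, fderiv ℝ (fun z : E n => (y j / ht y) * ht z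
        - EuclideanSpace.proj (𝕜 := ℝ) j z) x v = (y j / ht y) * (inner ℝ x v / ht x) - v j := by
      intro j v
      rw [fderiv_fun_sub ((hasFDerivAt_ht x).differentiableAt.const_mul _)
        (EuclideanSpace.proj (𝕜 := ℝ) j).differentiableAt,
        fderiv_const_mul (hasFDerivAt_ht x).differentiableAt]
      simp only [ContinuousLinearMap.fderiv, sub_apply,
        smul_apply, fderiv_ht, smul_eq_mul]
      rfl
    have f2 : ∀ v, fderiv ℝ (fun z : E n => (‖y‖ ^ 2 / ht y) * ht z
        - inner ℝ y z) x v = (‖y‖ ^ 2 / ht y) * (inner ℝ x v / ht x) - inner ℝ y v := by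
      intro v
      have hi : HasFDerivAt (fun z : E n => inner ℝ y z) (innerSL ℝ y) x :=
        (innerSL ℝ y).hasFDerivAt
      rw [fderiv_fun_sub ((hasFDerivAt_ht x).differentiableAt.const_mul _)
        hi.differentiableAt,
        fderiv_const_mul (hasFDerivAt_ht x).differentiableAt, hi.fderiv]
      simp only [sub_apply,
        smul_apply, fderiv_ht, smul_eq_mul]
      rfl
    have n11 : ∀ i j, (hframe2 n).D (.inl (some i)) ((hframe2 n).D (.inr (some j))
        fun w => coshd w.1 w.2) (x, y)
        = y j / ht y * (x i / ht x) - (if i = j then 1 else 0) := by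
      intro i j
      rw [Frame.prod_D_inl _ _ _ (s1 _), D_some]
      simp only [m1]
      rw [f1, inner_single]
      simp [eq_comm]
    have n12 : ∀ i, (hframe2 n).D (.inl (some i)) ((hframe2 n).D (.inr none)
        fun w => coshd w.1 w.2) (x, y) = ‖y‖ ^ 2 / ht y * (x i / ht x) - y i := by
      intro i
      rw [Frame.prod_D_inl _ _ _ (s1 _), D_some]
      simp only [m2]
      rw [f2, inner_single, inner_single]
    have n21 : ∀ j, (hframe2 n).D (.inl none) ((hframe2 n).D (.inr (some j))
        fun w => coshd w.1 w.2) (x, y) = y j / ht y * (‖x‖ ^ 2 / ht x) - x j := by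
      intro j
      rw [Frame.prod_D_inl _ _ _ (s1 _), D_none]
      simp only [m1]
      rw [f1, real_inner_self_eq_norm_sq]
    have n22 : (hframe2 n).D (.inl none) ((hframe2 n).D (.inr none)
        fun w => coshd w.1 w.2) (x, y) = ‖y‖ ^ 2 / ht y * (‖x‖ ^ 2 / ht x) - inner ℝ x y := by
      rw [Frame.prod_D_inl _ _ _ (s1 _), D_none]
      simp only [m2]
      rw [f2, real_inner_self_eq_norm_sq, real_inner_comm]
    have pl' : ∀ i, (hframe2 n).D (.inl i) p (x, y) = (hframe n).D i (fun x => p (x, y)) x :=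
      fun i => Frame.prod_D_inl _ _ i dp
    have pr' : ∀ i, (hframe2 n).D (.inr i) p (x, y) = (hframe n).D i (fun y => p (x, y)) y :=
      fun i => Frame.prod_D_inr _ _ i dp
    simp only [pl', pr', Fintype.sum_option, n11, n12, n21, n22]
    have he := D_none_eq_sum (fun x => p (x, y)) x
    have hg := D_none_eq_sum (fun y => p (x, y)) y
    set e := (hframe n).D none (fun x => p (x, y)) x
    set g := (hframe n).D none (fun y => p (x, y)) y
    set c : Fin n → ℝ := fun i => (hframe n).D (some i) (fun x => p (x, y)) x with hc
    set d : Fin n → ℝ := fun i => (hframe n).D (some i) (fun y => p (x, y)) y with hd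
    have hc' : ∀ i, (hframe n).D (some i) (fun x => p (x, y)) x = c i := fun i => rfl
    have hd' : ∀ i, (hframe n).D (some i) (fun y => p (x, y)) y = d i := fun i => rfl
    simp only [hc', hd', smul_eq_mul] at he hg a4 b4 ⊢
    have hin : inner ℝ ξ η = ∑ i, c i * d i + g * ∑ i, c i * y i + e * ∑ i, x i * d i
        + e * g * inner ℝ x y := by
      rw [inner_eq_sum, inner_eq_sum, Finset.mul_sum, Finset.mul_sum, Finset.mul_sum,
        ← Finset.sum_add_distrib, ← Finset.sum_add_distrib, ← Finset.sum_add_distrib]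
      exact Finset.sum_congr rfl fun i _ => by rw [a4, b4]; ring
    have t1 : ∑ j, e * ((y j / ht y * (‖x‖ ^ 2 / ht x) - x j) * d j)
        = e * (g / ht y * (‖x‖ ^ 2 / ht x) - ∑ j, x j * d j) := by
      rw [hg, ← Finset.mul_sum, Finset.sum_div, Finset.sum_mul, ← Finset.sum_sub_distrib]
      congr 1
      exact Finset.sum_congr rfl fun i _ => by ring
    have t2 : ∑ i, c i * ((‖y‖ ^ 2 / ht y * (x i / ht x) - y i) * g)
        = (‖y‖ ^ 2 / ht y * (e / ht x) - ∑ i, c i * y i) * g := by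
      rw [he, Finset.sum_div, Finset.mul_sum, ← Finset.sum_sub_distrib, Finset.sum_mul]
      exact Finset.sum_congr rfl fun i _ => by ring
    have t3 : ∑ i, ∑ j, c i * ((y j / ht y * (x i / ht x) - (if i = j then 1 else 0)) * d j)
        = e / ht x * (g / ht y) - ∑ i, c i * d i := by
      have : ∀ i, ∑ j, c i * ((y j / ht y * (x i / ht x) - (if i = j then 1 else 0)) * d j)
          = x i * c i / ht x * (g / ht y) - c i * d i := by
        intro i
        have t4 : ∀ j, c i * ((y j / ht y * (x i / ht x) - (if i = j then 1 else 0)) * d j)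
            = x i * c i / ht x * (y j * d j / ht y) - (if i = j then c i * d j else 0) := by
          intro j; split_ifs <;> ring
        simp only [t4]
        rw [Finset.sum_sub_distrib, ← Finset.mul_sum, ← Finset.sum_div, ← hg]
        simp
      simp only [this]
      rw [Finset.sum_sub_distrib, ← Finset.sum_mul, ← Finset.sum_div, ← he]
    rw [Finset.sum_add_distrib, t1, t2, t3, hin]
    have h1 : ‖x‖ ^ 2 = ht x ^ 2 - 1 := by linarith [ht_sq x]
    have h2 : ‖y‖ ^ 2 = ht y ^ 2 - 1 := by linarith [ht_sq y]
    rw [h1, h2]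
    have := ht_ne x
    have := ht_ne y
    field_simp
    ring
  have eh : (hframe2 n).hess (fun w => coshd w.1 w.2) p (x, y)
      = coshd x y * (‖ξ‖ ^ 2 - ((hframe n).D none (fun x => p (x, y)) x * ht x) ^ 2)
        + coshd x y * (‖η‖ ^ 2 - ((hframe n).D none (fun y => p (x, y)) y * ht y) ^ 2)
        - 2 * (inner ℝ ξ η - ((hframe n).D none (fun x => p (x, y)) x * ht x)
          * ((hframe n).D none (fun y => p (x, y)) y * ht y)) := by
    rw [Frame.prod_hess _ _ smooth_coshd hp, ec]
    simp only [esym]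
    rw [hess_coshd pl, hess_coshd pr, a2, b2, coshd_comm y x]
    ring
  rw [eg, eh]
  have := distance_convex a1 b1
  refine ⟨this.1, ?_⟩
  rw [neg_sq]
  exact this.2

/-- The regularized distance on `ℍⁿ × ℍⁿ`. -/
def wt (δ : ℝ) (w : E n × E n) : ℝ := regDist δ (coshd w.1 w.2)

variable {δ : ℝ}

lemma smooth_wt (hδ : 0 < δ) : ContDiff ℝ ∞ (wt δ : E n × E n → ℝ) := by
  have h1 : ∀ w : E n × E n, coshd w.1 w.2 ^ 2 - 1 + δ ≠ 0 := fun w =>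
    (radicand_pos hδ (one_le_coshd _ _)).ne'
  refine (smooth_coshd.add ((((smooth_coshd.pow 2).sub contDiff_const).add
    contDiff_const).sqrt h1)).log fun w => ?_
  have := one_le_coshd w.1 w.2
  have : 0 ≤ √(coshd w.1 w.2 ^ 2 - 1 + δ) := Real.sqrt_nonneg _
  positivity

/-- The regularized distance is convex on `ℍⁿ × ℍⁿ`. -/
lemma hess_wt_nonneg (hδ : 0 < δ) {p : E n × E n → ℝ} (hp : ContDiff ℝ ∞ p) (w : E n × E n) :
    0 ≤ (hframe2 n).hess (wt δ) p w := by
  have h := Frame.hess_comp (X := hframe2 n) (φ := regDist δ) (φ₁ := invRoot δ) (w := w)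
    smooth_coshd hp (fun w => hasDerivAt_regDist hδ (one_le_coshd w.1 w.2))
    (hasDerivAt_invRoot hδ (one_le_coshd w.1 w.2))
  rw [show (wt δ : E n × E n → ℝ) = fun w => regDist δ (coshd w.1 w.2) from rfl, h]
  obtain ⟨h1, h2⟩ := hess2_coshd hp w
  have hs := one_le_coshd w.1 w.2
  have hq := invRoot_sq hδ hs
  have hp := invRoot_pos hδ hs
  set r := invRoot δ (coshd w.1 w.2)
  set H := (hframe2 n).hess (fun w => coshd w.1 w.2) p w
  have e : r * H + -(coshd w.1 w.2 * r ^ 3) * (hframe2 n).grad (fun w => coshd w.1 w.2) p w ^ 2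
      = r ^ 3 * ((coshd w.1 w.2 ^ 2 - 1) * H
        - coshd w.1 w.2 * (hframe2 n).grad (fun w => coshd w.1 w.2) p w ^ 2) + r ^ 3 * δ * H := by
    linear_combination (-r * H) * hq
  rw [e]
  have : 0 ≤ (coshd w.1 w.2 ^ 2 - 1) * H
        - coshd w.1 w.2 * (hframe2 n).grad (fun w => coshd w.1 w.2) p w ^ 2 := by linarith
  positivity

lemma grad_wt_le (hδ : 0 < δ) (w : E n × E n) : (hframe2 n).grad (wt δ) (wt δ) w ≤ 2 := by
  have hs := one_le_coshd w.1 w.2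
  have hd := hasDerivAt_regDist hδ hs
  have hq := invRoot_sq hδ hs
  have dS := smooth_coshd.differentiable (n := ∞) (by simp) w
  have : (hframe2 n).grad (wt δ) (wt δ) w = invRoot δ (coshd w.1 w.2) ^ 2
      * (2 * (coshd w.1 w.2 ^ 2 - 1)) := by
    rw [show (wt δ : E n × E n → ℝ) = fun w => regDist δ (coshd w.1 w.2) from rfl,
      Frame.grad_comp_left (s := fun w : E n × E n => coshd w.1 w.2) _ hd dS, Frame.grad_comm,
      Frame.grad_comp_left (s := fun w : E n × E n => coshd w.1 w.2) _ hd dS, grad2_coshd]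
    simp only [smul_eq_mul]; ring
  rw [this]
  nlinarith [sq_nonneg (invRoot δ (coshd w.1 w.2))]

lemma lap_wt (hδ : 0 < δ) (w : E n × E n) :
    (hframe2 n).lap (wt δ) w = 2 * lapReg n δ (coshd w.1 w.2) := by
  have h := Frame.lap_comp (X := hframe2 n) (φ := regDist δ) (φ₁ := invRoot δ) (w := w)
    smooth_coshd (fun w => hasDerivAt_regDist hδ (one_le_coshd w.1 w.2))
    (hasDerivAt_invRoot hδ (one_le_coshd w.1 w.2))
  rw [show (wt δ : E n × E n → ℝ) = fun w => regDist δ (coshd w.1 w.2) from rfl, h, grad2_coshd,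
    lap2_coshd, ← lapReg_eq n hδ (one_le_coshd w.1 w.2)]
  ring

/-- On the product the Laplacian of a function of `cosh d` is twice the one in a single variable,
whence the factor `4`. -/
lemma lap_lap_wt (hδ : 0 < δ) (w : E n × E n) :
    (hframe2 n).lap ((hframe2 n).lap (wt δ)) w = -(4 * bilapKer n δ (coshd w.1 w.2)) := by
  have e : (hframe2 n).lap (wt δ) = fun w => 2 * lapReg n δ (coshd w.1 w.2) :=
    funext fun w => lap_wt hδ w
  have h := Frame.lap_comp (X := hframe2 n) (φ := fun s => 2 * lapReg n δ s)
    (φ₁ := fun s => 2 * lapReg' n δ s) (w := w)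
    smooth_coshd (fun w => (hasDerivAt_lapReg n hδ (one_le_coshd w.1 w.2)).const_mul 2)
    ((hasDerivAt_lapReg' n hδ (one_le_coshd w.1 w.2)).const_mul 2)
  rw [e, h, grad2_coshd, lap2_coshd]
  have := bilapKer_eq n hδ (one_le_coshd w.1 w.2)
  linear_combination 4 * this

/-- The Laplacian of the regularized distance in the first variable alone. -/
lemma lap_wt_left (hδ : 0 < δ) (x y : E n) :
    (hframe n).lap (fun x => wt δ (x, y)) x = lapReg n δ (coshd x y) := by
  have h := Frame.lap_comp (X := hframe n) (φ := regDist δ) (φ₁ := invRoot δ) (w := x)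
    (smooth_coshd_left y) (fun x => hasDerivAt_regDist hδ (one_le_coshd x y))
    (hasDerivAt_invRoot hδ (one_le_coshd x y))
  rw [show (fun x => wt δ (x, y)) = fun x => regDist δ (coshd x y) from rfl, h, grad_coshd,
    lap_coshd, ← lapReg_eq n hδ (one_le_coshd x y)]
  ring

end Weight

/-! ### Convergence in `L²` and tensor products -/

section L2

variable {α β : Type*} [MeasurableSpace α] [MeasurableSpace β] {μ : Measure α} {ν : Measure β}

/-- Convergence in `L²(μ)` of a sequence of functions. -/
def L2Tendsto (μ : Measure α) (f : ℕ → α → ℂ) (g : α → ℂ) : Prop :=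
  (∀ j, MemLp (f j) 2 μ) ∧ MemLp g 2 μ ∧ Tendsto (fun j => eLpNorm (f j - g) 2 μ) atTop (𝓝 0)

namespace L2Tendsto

variable {f f' : ℕ → α → ℂ} {g g' : α → ℂ}

lemma add (h : L2Tendsto μ f g) (h' : L2Tendsto μ f' g') :
    L2Tendsto μ (fun j x => f j x + f' j x) (fun x => g x + g' x) := by
  refine ⟨fun j => (h.1 j).add (h'.1 j), h.2.1.add h'.2.1, ?_⟩
  have hs := h.2.2.add h'.2.2
  rw [add_zero] at hs
  refine tendsto_of_tendsto_of_tendsto_of_le_of_le tendsto_const_nhds hs (fun _ => zero_le) ?_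
  intro j
  have e : ((fun x => f j x + f' j x) - fun x => g x + g' x) = (f j - g) + (f' j - g') := by
    funext x; simp only [Pi.sub_apply, Pi.add_apply]; ring
  simp only [e]
  exact eLpNorm_add_le ((h.1 j).sub h.2.1).1 ((h'.1 j).sub h'.2.1).1 (by norm_num)

lemma zero : L2Tendsto μ (fun _ _ => 0) (fun _ => 0) := by
  refine ⟨fun j => MemLp.zero, MemLp.zero, ?_⟩
  simp

lemma sum {κ : Type*} (s : Finset κ) {f : κ → ℕ → α → ℂ} {g : κ → α → ℂ}
    (h : ∀ i ∈ s, L2Tendsto μ (f i) (g i)) :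
    L2Tendsto μ (fun j x => ∑ i ∈ s, f i j x) (fun x => ∑ i ∈ s, g i x) := by
  classical
  induction s using Finset.induction_on with
  | empty => simpa using zero
  | insert i s hi ih =>
    simp only [Finset.sum_insert hi]
    exact (h i (Finset.mem_insert_self i s)).add (ih fun k hk => h k (Finset.mem_insert_of_mem hk))

lemma _root_.HypNLS.memLp_bdd_mul {b : α → ℝ} {C : ℝ} (hb : AEStronglyMeasurable b μ)
    (hC : ∀ x, |b x| ≤ C) {f : α → ℂ} (hf : MemLp f 2 μ) : MemLp (fun x => (b x : ℂ) * f x) 2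
        μ := by
  refine MemLp.of_le_mul (c := C) hf
    ((Complex.continuous_ofReal.comp_aestronglyMeasurable hb).mul hf.1)
    (.of_forall fun x => ?_)
  rw [norm_mul, Complex.norm_real]
  exact mul_le_mul_of_nonneg_right (hC x) (norm_nonneg _)

lemma _root_.HypNLS.eLpNorm_bdd_mul_le {b : α → ℝ} {C : ℝ}
    (hC : ∀ x, |b x| ≤ C) (f : α → ℂ) :
    eLpNorm (fun x => (b x : ℂ) * f x) 2 μ ≤ ENNReal.ofReal C * eLpNorm f 2 μ := by
  refine eLpNorm_le_mul_eLpNorm_of_ae_le_mul (.of_forall fun x => ?_) 2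
  rw [norm_mul, Complex.norm_real]
  exact mul_le_mul_of_nonneg_right (hC x) (norm_nonneg _)

lemma bdd_mul {b : α → ℝ} {C : ℝ} (hb : AEStronglyMeasurable b μ) (hC : ∀ x, |b x| ≤ C)
    (h : L2Tendsto μ f g) : L2Tendsto μ (fun j x => (b x : ℂ) * f j x)
        (fun x => (b x : ℂ) * g x) := by
  refine ⟨fun j => memLp_bdd_mul hb hC (h.1 j), memLp_bdd_mul hb hC h.2.1, ?_⟩
  have hs := ENNReal.Tendsto.const_mul (a := ENNReal.ofReal C) h.2.2 (.inr ENNReal.ofReal_ne_top)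
  rw [mul_zero] at hs
  refine tendsto_of_tendsto_of_tendsto_of_le_of_le tendsto_const_nhds hs (fun _ => zero_le) ?_
  intro j
  have e : ((fun x => (b x : ℂ) * f j x) - fun x => (b x : ℂ) * g x)
      = fun x => (b x : ℂ) * (f j - g) x := by
    funext x; simp only [Pi.sub_apply]; ring
  simp only [e]
  exact eLpNorm_bdd_mul_le hC _

lemma tendsto_eLpNorm (h : L2Tendsto μ f g) :
    Tendsto (fun j => eLpNorm (f j) 2 μ) atTop (𝓝 (eLpNorm g 2 μ)) := by
  have h1 : Tendsto (fun j => (h.1 j).toLp (f j)) atTop (𝓝 (h.2.1.toLp g)) :=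
    (Lp.tendsto_Lp_iff_tendsto_eLpNorm'' f h.1 g h.2.1).2 h.2.2
  have h2 := (continuous_enorm.tendsto _).comp h1
  simpa [Function.comp_def, Lp.enorm_def, eLpNorm_congr_ae (MemLp.coeFn_toLp _)] using h2

/-- The `L²` pairing `∫ conj f g` is continuous. -/
lemma tendsto_pairing (h : L2Tendsto μ f g) (h' : L2Tendsto μ f' g') :
    Tendsto (fun j => ∫ x, starRingEnd ℂ (f j x) * f' j x ∂μ) atTop
      (𝓝 (∫ x, starRingEnd ℂ (g x) * g' x ∂μ)) := by
  have h1 : Tendsto (fun j => (h.1 j).toLp (f j)) atTop (𝓝 (h.2.1.toLp g)) :=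
    (Lp.tendsto_Lp_iff_tendsto_eLpNorm'' f h.1 g h.2.1).2 h.2.2
  have h2 : Tendsto (fun j => (h'.1 j).toLp (f' j)) atTop (𝓝 (h'.2.1.toLp g')) :=
    (Lp.tendsto_Lp_iff_tendsto_eLpNorm'' f' h'.1 g' h'.2.1).2 h'.2.2
  have key : ∀ {p q : α → ℂ} (hp : MemLp p 2 μ) (hq : MemLp q 2 μ),
      inner ℂ (hp.toLp p) (hq.toLp q) = ∫ x, starRingEnd ℂ (p x) * q x ∂μ := by
    intro p q hp hq
    rw [L2.inner_def]
    refine integral_congr_ae ?_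
    filter_upwards [hp.coeFn_toLp, hq.coeFn_toLp] with x h1 h2
    rw [h1, h2]
    simp [mul_comm]
  have h3 := h1.inner (𝕜 := ℂ) h2
  simp only [key] at h3
  exact h3

end L2Tendsto

/-- The `L²` pairing is bounded by the product of the norms. -/
lemma norm_pairing_le {f g : α → ℂ} (hf : MemLp f 2 μ) (hg : MemLp g 2 μ) :
    ‖∫ x, starRingEnd ℂ (f x) * g x ∂μ‖ ≤ (eLpNorm f 2 μ).toReal * (eLpNorm g 2 μ).toReal := by
  have key : inner ℂ (hf.toLp f) (hg.toLp g) = ∫ x, starRingEnd ℂ (f x) * g x ∂μ := by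
    rw [L2.inner_def]
    refine integral_congr_ae ?_
    filter_upwards [hf.coeFn_toLp, hg.coeFn_toLp] with x h1 h2
    rw [h1, h2]
    simp [mul_comm]
  rw [← key]
  refine (norm_inner_le_norm _ _).trans ?_
  rw [Lp.norm_toLp, Lp.norm_toLp]

lemma integrable_pairing {f g : α → ℂ} (hf : MemLp f 2 μ) (hg : MemLp g 2 μ) :
    Integrable (fun x => starRingEnd ℂ (f x) * g x) μ :=
  MemLp.integrable_mul (p := 2) (q := 2) hf.star hg

/-- The tensor product of two functions. -/
def tens (f : α → ℂ) (g : β → ℂ) (w : α × β) : ℂ := f w.1 * g w.2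

variable [SFinite μ] [SFinite ν]

lemma eLpNorm_tens {f : α → ℂ} {g : β → ℂ} (hf : AEStronglyMeasurable f μ)
    (hg : AEStronglyMeasurable g ν) :
    eLpNorm (tens f g) 2 (μ.prod ν) = eLpNorm f 2 μ * eLpNorm g 2 ν := by
  have h2 : (2 : ℝ≥0∞) ≠ 0 := by norm_num
  have h3 : (2 : ℝ≥0∞) ≠ ⊤ := by norm_num
  rw [eLpNorm_eq_lintegral_rpow_enorm_toReal h2 h3, eLpNorm_eq_lintegral_rpow_enorm_toReal h2 h3,
    eLpNorm_eq_lintegral_rpow_enorm_toReal h2 h3,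
    ← ENNReal.mul_rpow_of_nonneg _ _ (by norm_num),
    ← lintegral_prod_mul (hf.enorm.pow_const _) (hg.enorm.pow_const _)]
  congr 1
  refine lintegral_congr fun w => ?_
  rw [tens, enorm_mul, ENNReal.mul_rpow_of_nonneg _ _ (by norm_num)]

lemma memLp_tens {f : α → ℂ} {g : β → ℂ} (hf : MemLp f 2 μ) (hg : MemLp g 2 ν) :
    MemLp (tens f g) 2 (μ.prod ν) := by
  refine ⟨(hf.1.comp_fst).mul (hg.1.comp_snd), ?_⟩
  rw [eLpNorm_tens hf.1 hg.1]
  exact ENNReal.mul_lt_top hf.2 hg.2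

lemma L2Tendsto.tens {f : ℕ → α → ℂ} {g : α → ℂ} {f' : ℕ → β → ℂ} {g' : β → ℂ}
    (h : L2Tendsto μ f g) (h' : L2Tendsto ν f' g') :
    L2Tendsto (μ.prod ν) (fun j => tens (f j) (f' j)) (tens g g') := by
  refine ⟨fun j => memLp_tens (h.1 j) (h'.1 j), memLp_tens h.2.1 h'.2.1, ?_⟩
  have t1 := ENNReal.Tendsto.mul h.2.2 (.inr h'.2.1.2.ne) h'.tendsto_eLpNorm
    (.inr ENNReal.zero_ne_top)
  have t2 := ENNReal.Tendsto.const_mul (a := eLpNorm g 2 μ) h'.2.2 (.inr h.2.1.2.ne)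
  have t3 := t1.add t2
  rw [zero_mul, mul_zero, add_zero] at t3
  refine tendsto_of_tendsto_of_tendsto_of_le_of_le tendsto_const_nhds t3 (fun _ => zero_le) ?_
  intro j
  have e : HypNLS.tens (f j) (f' j) - HypNLS.tens g g'
      = HypNLS.tens (f j - g) (f' j) + HypNLS.tens g (f' j - g') := by
    funext w; simp only [HypNLS.tens, Pi.sub_apply, Pi.add_apply]; ring
  have m1 := (h.1 j).sub h.2.1
  have m2 := (h'.1 j).sub h'.2.1
  simp only [e]
  refine (eLpNorm_add_le (memLp_tens m1 (h'.1 j)).1 (memLp_tens h.2.1 m2).1 (by norm_num)).trans ?_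
  rw [eLpNorm_tens m1.1 (h'.1 j).1, eLpNorm_tens h.2.1.1 m2.1]

end L2

/-! ### Integral operators with smooth kernels -/

lemma Frame.hasCompactSupport_D {W : Type*} [NormedAddCommGroup W] [NormedSpace ℝ W]
    [MeasurableSpace W] {ι : Type*} (X : Frame W ι) {F : Type*} [NormedAddCommGroup F]
    [NormedSpace ℝ F] (i : ι) {f : W → F} (hf : HasCompactSupport f) : HasCompactSupport
        (X.D i f) :=
  HasCompactSupport.along hf _

section Kernels

variable {n : ℕ}

/-- The integral operator with kernel `κ` on `ℍⁿ`. -/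
def kint (κ : E n × E n → ℝ) (f : E n → ℂ) (x : E n) : ℂ := ∫ y, κ (x, y) • f y ∂hvol n

lemma integrable_kint {κ : E n × E n → ℝ} (hκ : Continuous κ) {x : E n}
    (hc : HasCompactSupport fun y => κ (x, y)) {f : E n → ℂ} (hf : LocallyIntegrable f (hvol n)) :
    Integrable (fun y => κ (x, y) • f y) (hvol n) :=
  hf.integrable_smul_left_of_hasCompactSupport (by fun_prop) hc

lemma locallyIntegrable_of_memLp {f : E n → ℂ} (hf : MemLp f 2 (hvol n)) :
    LocallyIntegrable f (hvol n) := hf.locallyIntegrable (by norm_num)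

lemma kint_add_right {κ : E n × E n → ℝ} (hκ : Continuous κ) {x : E n}
    (hc : HasCompactSupport fun y => κ (x, y)) {f g : E n → ℂ} (hf : LocallyIntegrable f (hvol n))
    (hg : LocallyIntegrable g (hvol n)) :
    kint κ (fun y => f y + g y) x = kint κ f x + kint κ g x := by
  simp only [kint, smul_add]
  exact integral_add (integrable_kint hκ hc hf) (integrable_kint hκ hc hg)

lemma kint_congr_ae {κ : E n × E n → ℝ} {f g : E n → ℂ} (h : f =ᵐ[hvol n] g) :
    kint κ f = kint κ g := by
  funext x
  refine integral_congr_ae ?_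
  filter_upwards [h] with y hy
  rw [hy]

/-- A compactly supported kernel on a product vanishes off a product of balls. -/
lemma exists_ball_of_compact {κ : E n × E n → ℝ} (hc : HasCompactSupport κ) :
    ∃ R : ℝ, ∀ x y, κ (x, y) ≠ 0 → ‖x‖ ≤ R ∧ ‖y‖ ≤ R := by
  obtain ⟨R, hR⟩ := hc.isCompact.isBounded.exists_norm_le
  refine ⟨R, fun x y h => ?_⟩
  have := hR _ (subset_tsupport _ (show (x, y) ∈ Function.support κ from h))
  exact ⟨(norm_fst_le _).trans this, (norm_snd_le _).trans this⟩

lemma smooth_kint {κ : E n × E n → ℝ} (hκ : ContDiff ℝ ∞ κ) (hc : HasCompactSupport κ)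
    {f : E n → ℂ} (hf : LocallyIntegrable f (hvol n)) : ContDiff ℝ ∞ (kint κ f) := by
  obtain ⟨R, hR⟩ := exists_ball_of_compact hc
  have := contDiffOn_convolution_right_with_param_comp (μ := hvol n) (𝕜 := ℝ) (n := ⊤)
    (ContinuousLinearMap.lsmul ℝ ℝ : ℝ →L[ℝ] ℂ →L[ℝ] ℂ).flip
    (s := Set.univ) (v := fun _ : E n => (0 : E n)) contDiffOn_const (f := f)
    (g := fun x z => κ (x, -z)) (k := Metric.closedBall 0 R) isOpen_univ
    (isCompact_closedBall _ _) ?_ hf ?_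
  · rw [← contDiffOn_univ]
    convert this using 2 with x
    simp [kint, convolution]
  · intro x z _ hz
    by_contra h
    exact hz (by simpa using (hR _ _ h).2)
  · exact (hκ.comp (contDiff_fst.prodMk contDiff_snd.neg)).contDiffOn

lemma hasCompactSupport_kint {κ : E n × E n → ℝ} (hc : HasCompactSupport κ) (f : E n → ℂ) :
    HasCompactSupport (kint κ f) := by
  obtain ⟨R, hR⟩ := exists_ball_of_compact hc
  refine HasCompactSupport.intro (isCompact_closedBall (0 : E n) R) fun x hx => ?_
  have : ∀ y, κ (x, y) = 0 := fun y => by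
    by_contra h
    exact hx (by simpa using (hR _ _ h).1)
  simp [kint, this]

lemma D_kint {κ : E n × E n → ℝ} (hκ : ContDiff ℝ ∞ κ) (hc : HasCompactSupport κ)
    {f : E n → ℂ} (hf : LocallyIntegrable f (hvol n)) (i : Option (Fin n)) :
    (hframe n).D i (kint κ f) = kint ((hframe2 n).D (.inl i) κ) f := by
  obtain ⟨R, hR⟩ := exists_ball_of_compact hc
  have hκ1 : ContDiff ℝ 1 κ := hκ.of_le (by simp)
  obtain ⟨C, hC⟩ := (hc.fderiv ℝ).exists_bound_of_continuous (hκ1.continuous_fderiv one_ne_zero)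
  obtain ⟨R', hR'⟩ := (hc.fderiv ℝ).isCompact.isBounded.exists_norm_le
  have hloc : Integrable (fun y => (Metric.closedBall (0 : E n) R').indicator
      (fun y => C * ‖f y‖) y) (hvol n) := by
    rw [integrable_indicator_iff measurableSet_closedBall]
    exact ((hf.integrableOn_isCompact (isCompact_closedBall _ _)).norm.const_mul C)
  funext x
  have h0 : ∀ z y, HasFDerivAt (fun z => κ (z, y) • f y)
      (((fderiv ℝ κ (z, y)).comp (ContinuousLinearMap.inl ℝ (E n) (E n))).smulRight (f y)) z := by
    intro z y
    have h1 : HasFDerivAt (fun z => κ (z, y))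
        ((fderiv ℝ κ (z, y)).comp (ContinuousLinearMap.inl ℝ (E n) (E n))) z :=
      ((hκ1.differentiable one_ne_zero) (z, y)).hasFDerivAt.comp z (hasFDerivAt_prodMk_left z y)
    exact h1.smul_const (f y)
  have hsm : ∀ z, HasCompactSupport fun y => κ (z, y) :=
    fun z => Frame.hasCompactSupport_slice_right hc z
  have hmeas : ∀ z, AEStronglyMeasurable (fun y => ((fderiv ℝ κ (z, y)).comp
      (ContinuousLinearMap.inl ℝ (E n) (E n))).smulRight (f y)) (hvol n) := by
    intro z
    have h1 : Continuous fun y => (fderiv ℝ κ (z, y)).comp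
        (ContinuousLinearMap.inl ℝ (E n) (E n)) :=
      ((hκ1.continuous_fderiv one_ne_zero).comp (by fun_prop)).clm_comp continuous_const
    exact (ContinuousLinearMap.smulRightL ℝ (E n) ℂ).aestronglyMeasurable_comp₂
      h1.aestronglyMeasurable hf.aestronglyMeasurable
  have hbound : ∀ z y, ‖((fderiv ℝ κ (z, y)).comp
      (ContinuousLinearMap.inl ℝ (E n) (E n))).smulRight (f y)‖
      ≤ (Metric.closedBall (0 : E n) R').indicator (fun y => C * ‖f y‖) y := by
    intro z y
    rw [ContinuousLinearMap.norm_smulRight_apply]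
    by_cases h : fderiv ℝ κ (z, y) = 0
    · rw [h]
      simp only [ContinuousLinearMap.zero_comp, norm_zero, zero_mul]
      refine Set.indicator_nonneg (fun y _ => ?_) _
      exact mul_nonneg ((norm_nonneg _).trans (hC (z, y))) (norm_nonneg _)
    · have hy : ‖y‖ ≤ R' := (norm_snd_le (z, y)).trans
        (hR' _ (subset_tsupport _ (show (z, y) ∈ Function.support (fderiv ℝ κ) from h)))
      rw [Set.indicator_of_mem (by simpa using hy)]
      refine mul_le_mul_of_nonneg_right ?_ (norm_nonneg _)
      refine (ContinuousLinearMap.opNorm_comp_le _ _).trans ?_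
      calc _ ≤ ‖fderiv ℝ κ (z, y)‖ * 1 := mul_le_mul_of_nonneg_left
            (ContinuousLinearMap.norm_inl_le_one ℝ _ _) (norm_nonneg _)
        _ ≤ C := by rw [mul_one]; exact hC _
  have key := hasFDerivAt_integral_of_dominated_of_fderiv_le (μ := hvol n) (𝕜 := ℝ)
    (F := fun z y => κ (z, y) • f y)
    (F' := fun z y => ((fderiv ℝ κ (z, y)).comp (ContinuousLinearMap.inl ℝ (E n) (E n))).smulRight
      (f y)) (x₀ := x) (s := Set.univ)
    (bound := (Metric.closedBall (0 : E n) R').indicator (fun y => C * ‖f y‖))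
    univ_mem (.of_forall fun z => (integrable_kint hκ.continuous (hsm z) hf).1)
    (integrable_kint hκ.continuous (hsm x) hf) (hmeas x)
    (.of_forall fun y z _ => hbound z y) hloc (.of_forall fun y z _ => h0 z y)
  have e : HasFDerivAt (kint κ f) _ x := key
  change fderiv ℝ (kint κ f) x ((hframe n).Z i x) = _
  rw [e.fderiv, ContinuousLinearMap.integral_apply
    (Integrable.mono' hloc (hmeas x) (.of_forall (hbound x)))]
  rfl

/-- The Laplacian in the first variable. -/
def lapFst (κ : E n × E n → ℝ) (w : E n × E n) : ℝ :=
  ∑ i, ((hframe2 n).D (.inl i) ((hframe2 n).D (.inl i) κ) w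
    + (hframe n).div i w.1 * (hframe2 n).D (.inl i) κ w)

/-- The Laplacian in the second variable. -/
def lapSnd (κ : E n × E n → ℝ) (w : E n × E n) : ℝ :=
  ∑ i, ((hframe2 n).D (.inr i) ((hframe2 n).D (.inr i) κ) w
    + (hframe n).div i w.2 * (hframe2 n).D (.inr i) κ w)

section Partial

variable {κ : E n × E n → ℝ}

lemma smooth_lapFst (hκ : ContDiff ℝ ∞ κ) : ContDiff ℝ ∞ (lapFst κ) :=
  ContDiff.sum fun i _ => ((hframe2 n).smooth_D _ ((hframe2 n).smooth_D _ hκ)).add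
    ((((hframe n).smooth_div i).comp contDiff_fst).mul ((hframe2 n).smooth_D _ hκ))

lemma smooth_lapSnd (hκ : ContDiff ℝ ∞ κ) : ContDiff ℝ ∞ (lapSnd κ) :=
  ContDiff.sum fun i _ => ((hframe2 n).smooth_D _ ((hframe2 n).smooth_D _ hκ)).add
    ((((hframe n).smooth_div i).comp contDiff_snd).mul ((hframe2 n).smooth_D _ hκ))

lemma tsupport_D_subset (i : Option (Fin n) ⊕ Option (Fin n)) (κ : E n × E n → ℝ) :
    tsupport ((hframe2 n).D i κ) ⊆ tsupport κ := by
  refine closure_minimal (fun w hw => ?_) (isClosed_tsupport κ)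
  by_contra h
  refine hw ?_
  have : fderiv ℝ κ w = 0 := by
    by_contra h2
    exact h (support_fderiv_subset ℝ h2)
  simp [Frame.D, along, this]

lemma hasCompactSupport_lapFst (hc : HasCompactSupport κ) : HasCompactSupport (lapFst κ) := by
  refine HasCompactSupport.intro hc.isCompact fun w hw => Finset.sum_eq_zero fun i _ => ?_
  rw [image_eq_zero_of_notMem_tsupport fun h =>
      hw (tsupport_D_subset _ _ (tsupport_D_subset _ _ h)),
    image_eq_zero_of_notMem_tsupport fun h => hw (tsupport_D_subset _ _ h), mul_zero, add_zero]

lemma hasCompactSupport_lapSnd (hc : HasCompactSupport κ) : HasCompactSupport (lapSnd κ) := by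
  refine HasCompactSupport.intro hc.isCompact fun w hw => Finset.sum_eq_zero fun i _ => ?_
  rw [image_eq_zero_of_notMem_tsupport fun h =>
      hw (tsupport_D_subset _ _ (tsupport_D_subset _ _ h)),
    image_eq_zero_of_notMem_tsupport fun h => hw (tsupport_D_subset _ _ h), mul_zero, add_zero]

lemma D_fst_apply (hκ : ContDiff ℝ ∞ κ) (i : Option (Fin n)) (x y : E n) :
    (hframe n).D i (fun x => κ (x, y)) x = (hframe2 n).D (.inl i) κ (x, y) :=
  (Frame.prod_D_inl (hframe n) (hframe n) i (hκ.differentiable (by simp) (x, y))).symm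

lemma D_snd_apply (hκ : ContDiff ℝ ∞ κ) (i : Option (Fin n)) (x y : E n) :
    (hframe n).D i (fun y => κ (x, y)) y = (hframe2 n).D (.inr i) κ (x, y) :=
  (Frame.prod_D_inr (hframe n) (hframe n) i (hκ.differentiable (by simp) (x, y))).symm

lemma lapFst_apply (hκ : ContDiff ℝ ∞ κ) (x y : E n) :
    lapFst κ (x, y) = (hframe n).lap (fun x => κ (x, y)) x := by
  refine Finset.sum_congr rfl fun i _ => ?_
  rw [show ((hframe n).D i fun x => κ (x, y)) = fun z => (hframe2 n).D (.inl i) κ (z, y) from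
    funext fun z => D_fst_apply hκ i z y, D_fst_apply ((hframe2 n).smooth_D _ hκ)]
  rfl

lemma lapSnd_apply (hκ : ContDiff ℝ ∞ κ) (x y : E n) :
    lapSnd κ (x, y) = (hframe n).lap (fun y => κ (x, y)) y := by
  refine Finset.sum_congr rfl fun i _ => ?_
  rw [show ((hframe n).D i fun y => κ (x, y)) = fun z => (hframe2 n).D (.inr i) κ (x, z) from
    funext fun z => D_snd_apply hκ i x z, D_snd_apply ((hframe2 n).smooth_D _ hκ)]
  rfl

end Partial

lemma lap_kint {κ : E n × E n → ℝ} (hκ : ContDiff ℝ ∞ κ) (hc : HasCompactSupport κ)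
    {f : E n → ℂ} (hf : LocallyIntegrable f (hvol n)) (x : E n) :
    (hframe n).lap (kint κ f) x = kint (lapFst κ) f x := by
  set Y := hframe2 n
  have h1 : ∀ i, Integrable (fun y => Y.D (.inl i) κ (x, y) • f y) (hvol n) := fun i =>
    integrable_kint (Y.smooth_D _ hκ).continuous
      (Frame.hasCompactSupport_slice_right (Y.hasCompactSupport_D _ hc) x) hf
  have h2 : ∀ i, Integrable (fun y => Y.D (.inl i) (Y.D (.inl i) κ) (x, y) • f y) (hvol n) :=
    fun i => integrable_kint (Y.smooth_D _ (Y.smooth_D _ hκ)).continuous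
      (Frame.hasCompactSupport_slice_right (Y.hasCompactSupport_D _ (Y.hasCompactSupport_D _ hc)) x)
      hf
  have e : ∀ y, lapFst κ (x, y) • f y
      = ∑ i, (Y.D (.inl i) (Y.D (.inl i) κ) (x, y) • f y
        + (hframe n).div i x • (Y.D (.inl i) κ (x, y) • f y)) := by
    intro y
    rw [lapFst, Finset.sum_smul]
    refine Finset.sum_congr rfl fun i _ => ?_
    rw [add_smul, smul_smul]
  have e' : kint (lapFst κ) f x
      = ∑ i, (kint (Y.D (.inl i) (Y.D (.inl i) κ)) f x
        + (hframe n).div i x • kint (Y.D (.inl i) κ) f x) := by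
    simp only [kint, e]
    refine (integral_finsetSum _ fun i _ => (h2 i).add ((h1 i).smul ((hframe n).div i x))).trans ?_
    refine Finset.sum_congr rfl fun i _ => ?_
    refine (integral_add (h2 i) ((h1 i).smul ((hframe n).div i x))).trans ?_
    congr 1
    exact integral_smul ((hframe n).div i x) fun y => Y.D (.inl i) κ (x, y) • f y
  rw [e', Frame.lap]
  refine Finset.sum_congr rfl fun i _ => ?_
  rw [D_kint hκ hc hf, D_kint (Y.smooth_D _ hκ) (Y.hasCompactSupport_D _ hc) hf]

/-- Operators with compactly supported kernels are bounded from `L²` to `L^∞`. -/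
lemma exists_norm_kint_le {κ : E n × E n → ℝ} (hκ : Continuous κ) (hc : HasCompactSupport κ) :
    ∃ C : ℝ, 0 ≤ C ∧ ∀ f, MemLp f 2 (hvol n) → ∀ x,
      ‖kint κ f x‖ ≤ C * (eLpNorm f 2 (hvol n)).toReal := by
  obtain ⟨B, hB⟩ := hc.exists_bound_of_continuous hκ
  obtain ⟨R, hR⟩ := exists_ball_of_compact hc
  have hB0 : 0 ≤ B := (norm_nonneg _).trans (hB 0)
  set g : E n → ℂ := (Metric.closedBall (0 : E n) R).indicator fun _ => (B : ℂ)
  have hg : MemLp g 2 (hvol n) := memLp_indicator_const 2 measurableSet_closedBall _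
    (.inr (isCompact_closedBall _ _).measure_lt_top.ne)
  refine ⟨(eLpNorm g 2 (hvol n)).toReal, ENNReal.toReal_nonneg, fun f hf x => ?_⟩
  have hs : MemLp (fun y => ((κ (x, y) : ℝ) : ℂ)) 2 (hvol n) := by
    refine MemLp.mono hg (by fun_prop : Continuous _).aestronglyMeasurable (.of_forall fun y => ?_)
    by_cases h : κ (x, y) = 0
    · simp [h]
    · rw [show g y = B from Set.indicator_of_mem (by simpa using (hR _ _ h).2) _]
      rw [Complex.norm_real, Complex.norm_real]
      exact (hB _).trans (le_abs_self _)
  have h1 := norm_pairing_le hs hf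
  have e : kint κ f x = ∫ y, starRingEnd ℂ ((κ (x, y) : ℝ) : ℂ) * f y ∂hvol n := by
    simp [kint]
  rw [e]
  refine h1.trans (mul_le_mul_of_nonneg_right ?_ ENNReal.toReal_nonneg)
  refine ENNReal.toReal_mono hg.2.ne (eLpNorm_mono fun y => ?_)
  by_cases h : κ (x, y) = 0
  · simp [h]
  · rw [show g y = B from Set.indicator_of_mem (by simpa using (hR _ _ h).2) _]
    rw [Complex.norm_real, Complex.norm_real]
    exact (hB _).trans (le_abs_self _)

end Kernels

/-! ### Radial kernels -/

section Radial

variable {n : ℕ}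

/-- A smooth step: `1` on `(-∞, 1/2]` and `0` on `[1, ∞)`. -/
def bump (s : ℝ) : ℝ := Real.smoothTransition (2 - 2 * s)

lemma smooth_bump : ContDiff ℝ ∞ bump := by
  unfold bump
  exact Real.smoothTransition.contDiff.comp (by fun_prop)

lemma bump_nonneg (s : ℝ) : 0 ≤ bump s := Real.smoothTransition.nonneg _

lemma bump_le_one (s : ℝ) : bump s ≤ 1 := Real.smoothTransition.le_one _

lemma bump_eq_one {s : ℝ} (h : s ≤ 1 / 2) : bump s = 1 :=
  Real.smoothTransition.one_of_one_le (by linarith)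

lemma bump_eq_zero {s : ℝ} (h : 1 ≤ s) : bump s = 0 :=
  Real.smoothTransition.zero_of_nonpos (by linarith)

/-- The kernel which is the function `φ` of `cosh d(x, y)`. -/
def rad (φ : ℝ → ℝ) (w : E n × E n) : ℝ := φ (coshd w.1 w.2)

variable {φ : ℝ → ℝ}

lemma smooth_rad (hφ : ContDiff ℝ ∞ φ) : ContDiff ℝ ∞ (rad φ : E n × E n → ℝ) :=
  hφ.comp smooth_coshd

lemma rad_symm (φ : ℝ → ℝ) (x y : E n) : rad φ (x, y) = rad φ (y, x) := by
  simp only [rad, coshd_comm]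

lemma hasCompactSupport_rad (h : ∀ s, 2 ≤ s → φ s = 0) (x : E n) :
    HasCompactSupport fun y => rad φ (x, y) := by
  refine HasCompactSupport.intro (isCompact_closedBall (0 : E n) (4 * ht x)) fun y hy => ?_
  refine h _ ?_
  by_contra h2
  refine hy ?_
  have h3 := ht_le x y
  have h4 := norm_lt_ht y
  have h5 := ht_pos x
  simp only [Metric.mem_closedBall, dist_zero_right]
  simp only at h2
  nlinarith

/-- A boost acting on both variables fixes `cosh d(x, y)`. -/
lemma boost_rad (hφ : ContDiff ℝ ∞ φ) (i : Fin n) (x y : E n) :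
    (hframe2 n).D (.inl (some i)) (rad φ) (x, y)
      = -(ht y / ht x * fderiv ℝ (fun y => rad φ (x, y)) y (EuclideanSpace.single i 1)) := by
  rw [hframe2, Frame.prod_D_inl _ _ _ ((smooth_rad hφ).differentiable (by simp) (x, y)),
    ← D_some]
  have hd : HasDerivAt φ (deriv φ (coshd x y)) (coshd x y) :=
    (hφ.differentiable (by simp) _).hasDerivAt
  have h1 : (hframe n).D (some i) (fun x => φ (coshd x y)) x
      = deriv φ (coshd x y) * (hframe n).D (some i) (fun x => coshd x y) x :=
    along_comp hd ((smooth_coshd_left y).differentiable (by simp) x)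
  have h2 : (hframe n).D (some i) (fun y => φ (coshd x y)) y
      = deriv φ (coshd x y) * (hframe n).D (some i) (fun y => coshd x y) y := by
    refine along_comp hd ?_
    have := (smooth_coshd_left x).differentiable (by simp) y
    simpa only [coshd_comm] using this
  simp only [rad]
  rw [h1, h2]
  have hb := boost_coshd i x y
  have hx := ht_ne x
  field_simp
  linear_combination deriv φ (coshd x y) * hb

lemma lap_rad (hφ : ContDiff ℝ ∞ φ) (x y : E n) :
    (hframe n).lap (fun x => rad φ (x, y)) x
      = deriv φ (coshd x y) * (n * coshd x y) + deriv (deriv φ) (coshd x y)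
        * (coshd x y ^ 2 - 1) := by
  have hφ1 : ContDiff ℝ ∞ (deriv φ) := (contDiff_infty_iff_deriv.1 hφ).2
  have := (hframe n).lap_comp (w := x) (smooth_coshd_left y)
    (fun z => (hφ.differentiable (by simp) (coshd z y)).hasDerivAt)
    (hφ1.differentiable (by simp) (coshd x y)).hasDerivAt
  rw [lap_coshd, grad_coshd] at this
  exact this

/-- The Laplacian of a radial kernel does not depend on the variable it acts on. -/
lemma lap_rad_symm (hφ : ContDiff ℝ ∞ φ) (x y : E n) :
    (hframe n).lap (fun x => rad φ (x, y)) x = (hframe n).lap (fun y => rad φ (x, y)) y := by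
  rw [lap_rad hφ]
  simp only [fun y => rad_symm φ x y]
  rw [lap_rad hφ, coshd_comm]

/-- `G (some i)` are the weak partial derivatives of `u`, and `G none` is the weak derivative along
the Euler field, all in `L²(ℍⁿ)`: the weak derivatives of `u` along the frame `hframe`. -/
structure IsWeakJet (u : E n → ℂ) (G : Option (Fin n) → E n → ℂ) : Prop where
  memLp : MemLp u 2 (hvol n)
  memLp_deriv : ∀ i, MemLp (G i) 2 (hvol n)
  euler : ∀ᵐ x ∂hvol n, G none x = ∑ i, x i • G (some i) x
  weak : ∀ i, ∀ ψ : E n → ℝ, ContDiff ℝ ∞ ψ → HasCompactSupport ψ →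
    ∫ x, fderiv ℝ ψ x (EuclideanSpace.single i 1) • u x = -∫ x, ψ x • G (some i) x

/-- Derivatives pass through radial kernels. -/
lemma kint_D_some_rad (hφ : ContDiff ℝ ∞ φ) (h : ∀ s, 2 ≤ s → φ s = 0) {u : E n → ℂ}
    {G : Option (Fin n) → E n → ℂ} (hu : IsWeakJet u G) (i : Fin n) (x : E n) :
    kint ((hframe2 n).D (.inl (some i)) (rad φ)) u x
      = kint (fun w => ht w.2 / ht w.1 * rad φ w) (G (some i)) x := by
  have hw := hu.weak i (fun y => rad φ (x, y))
    ((smooth_rad hφ).comp (contDiff_prodMk_right x)) (hasCompactSupport_rad h x)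
  simp only [kint, integral_hvol, boost_rad hφ]
  have e1 : ∀ y, (ht y)⁻¹ • -(ht y / ht x * fderiv ℝ (fun y => rad φ (x, y)) y
      (EuclideanSpace.single i 1)) • u y
      = (-(ht x)⁻¹) • (fderiv ℝ (fun y => rad φ (x, y)) y (EuclideanSpace.single i 1) • u y) := by
    intro y
    have := ht_ne y
    rw [smul_smul, smul_smul]
    congr 1
    field_simp
  have e2 : ∀ y, (ht y)⁻¹ • (ht y / ht x * rad φ (x, y)) • G (some i) y
      = (ht x)⁻¹ • (rad φ (x, y) • G (some i) y) := by
    intro y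
    have := ht_ne y
    rw [smul_smul, smul_smul]
    congr 1
    field_simp
  simp only [e1, e2]
  rw [integral_smul, integral_smul, hw]
  simp

/-- The cutoff to the region `x₀ ≤ J`. -/
def cut (J : ℝ) (x : E n) : ℝ := bump (ht x / (2 * J))

lemma smooth_cut (J : ℝ) : ContDiff ℝ ∞ (cut J : E n → ℝ) :=
  smooth_bump.comp (smooth_ht.div_const _)

lemma cut_eq_one {J : ℝ} (hJ : 0 < J) {x : E n} (h : ht x ≤ J) : cut J x = 1 := by
  refine bump_eq_one ?_
  rw [div_le_iff₀ (by positivity)]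
  linarith

lemma cut_eq_zero {J : ℝ} (hJ : 0 < J) {x : E n} (h : 2 * J ≤ ht x) : cut J x = 0 := by
  refine bump_eq_zero ?_
  rwa [le_div_iff₀ (by positivity), one_mul]

/-- The kernel `rad φ` cut off in the first variable. -/
def cutRad (J : ℝ) (φ : ℝ → ℝ) (w : E n × E n) : ℝ := cut J w.1 * rad φ w

lemma smooth_cutRad (J : ℝ) (hφ : ContDiff ℝ ∞ φ) : ContDiff ℝ ∞ (cutRad J φ : E n × E n → ℝ) :=
  ((smooth_cut J).comp contDiff_fst).mul (smooth_rad hφ)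

lemma hasCompactSupport_cutRad {J : ℝ} (hJ : 0 < J) (h : ∀ s, 2 ≤ s → φ s = 0) :
    HasCompactSupport (cutRad J φ : E n × E n → ℝ) := by
  refine HasCompactSupport.intro (isCompact_closedBall (0 : E n × E n) (8 * J)) fun w hw => ?_
  by_contra h0
  have h1 := left_ne_zero_of_mul h0
  have h2 := right_ne_zero_of_mul h0
  have h3 : ht w.1 < 2 * J := by
    by_contra h3
    exact h1 (cut_eq_zero hJ (not_lt.1 h3))
  have h4 : coshd w.1 w.2 < 2 := by
    by_contra h3
    exact h2 (h _ (not_lt.1 h3))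
  refine hw ?_
  have h5 := ht_le w.1 w.2
  have h6 := norm_lt_ht w.1
  have h7 := norm_lt_ht w.2
  have h8 := ht_pos w.1
  simp only [Metric.mem_closedBall, dist_zero_right, Prod.norm_def, max_le_iff]
  constructor <;> nlinarith

lemma kint_rad_one_const (hφ : ContDiff ℝ ∞ φ) (h : ∀ s, 2 ≤ s → φ s = 0) (x : E n) :
    ∫ y, rad φ (x, y) ∂hvol n = ∫ y, rad φ (0, y) ∂hvol n := by
  set J : ℝ := ht x + 1
  have hJ : 0 < J := by have := ht_pos x; positivity
  have hJ1 : 1 < J := by have := ht_pos x; linarith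
  have hl : LocallyIntegrable (fun _ : E n => (1 : ℂ)) (hvol n) := locallyIntegrable_const _
  set g : E n → ℂ := kint (cutRad J φ) fun _ => 1
  have hg : ContDiff ℝ ∞ g :=
    smooth_kint (smooth_cutRad J hφ) (hasCompactSupport_cutRad hJ h) hl
  set s : Set (E n) := {z | ‖z‖ < √(J ^ 2 - 1)}
  have hs : s = Metric.ball 0 (√(J ^ 2 - 1)) := by ext; simp [s]
  have hmem : ∀ z, z ∈ s ↔ ht z < J := by
    intro z
    have h0 := ht_sq z
    have h1 := ht_pos z
    simp only [s, Set.mem_ofPred_eq]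
    rw [Real.lt_sqrt (norm_nonneg _)]
    constructor
    · intro h2; nlinarith
    · intro h2; nlinarith
  have hval : ∀ z, ht z ≤ J → g z = ((∫ y, rad φ (z, y) ∂hvol n : ℝ) : ℂ) := by
    intro z hz
    simp only [g, kint, cutRad, cut_eq_one hJ hz, one_mul]
    rw [← integral_complex_ofReal]
    simp
  have hder : ∀ z ∈ s, fderiv ℝ g z = 0 := by
    intro z hz
    have hopen : {z : E n | ht z < J} ∈ 𝓝 z :=
      (isOpen_lt continuous_ht continuous_const).mem_nhds ((hmem z).1 hz)
    ext v
    rw [fderiv_self_eq_sum]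
    simp only [zero_apply]
    refine Finset.sum_eq_zero fun i _ => ?_
    have e0 : (hframe n).D (some i) g z = 0 := by
      rw [D_kint (smooth_cutRad J hφ) (hasCompactSupport_cutRad hJ h) hl]
      have e1 : ∀ y, (hframe2 n).D (.inl (some i)) (cutRad J φ) (z, y)
          = (hframe2 n).D (.inl (some i)) (rad φ) (z, y) := by
        intro y
        have : cutRad J φ =ᶠ[𝓝 (z, y)] rad φ := by
          have h3 := (continuous_fst (X := E n) (Y := E n)).tendsto (z, y) hopen
          filter_upwards [h3] with w hw
          rw [cutRad, cut_eq_one hJ (le_of_lt hw), one_mul]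
        exact congrFun (congrArg DFunLike.coe this.fderiv_eq) _
      simp only [kint, e1, integral_hvol, boost_rad hφ]
      have e2 : ∀ y, (ht y)⁻¹ • -(ht y / ht z * fderiv ℝ (fun y => rad φ (z, y)) y
          (EuclideanSpace.single i 1)) • (1 : ℂ)
          = ((-(ht z)⁻¹ * fderiv ℝ (fun y => rad φ (z, y)) y (EuclideanSpace.single i 1) : ℝ) : ℂ)
          := by
        intro y
        have := ht_ne y
        rw [smul_smul, Complex.real_smul, mul_one]
        congr 1
        field_simp
      simp only [e2]
      rw [integral_complex_ofReal, integral_const_mul, integral_fderiv_eq_zero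
        (f := fun y => rad φ (z, y)) (((smooth_rad hφ).comp (contDiff_prodMk_right z)).of_le
            (by simp))
        (hasCompactSupport_rad h z)]
      simp
    rw [← D_some, e0, smul_zero]
  have hconv : Convex ℝ s := hs ▸ convex_ball _ _
  have hso : IsOpen s := hs ▸ Metric.isOpen_ball
  have hx : x ∈ s := (hmem x).2 (by simp [J])
  have h0 : (0 : E n) ∈ s := (hmem 0).2 (by simpa [ht] using hJ1)
  have hc : g x = g 0 := by
    refine hso.is_const_of_fderiv_eq_zero (𝕜 := ℝ) hconv.isPreconnected
      (hg.differentiable (by simp)).differentiableOn (fun z hz => hder z hz) hx h0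
  rw [hval x ((hmem x).1 hx).le, hval 0 ((hmem 0).1 h0).le] at hc
  exact_mod_cast hc

end Radial

/-! ### Mollification by radial kernels -/

section L2Lim

variable {α : Type*} [MeasurableSpace α] {μ : Measure α}

/-- Dominated convergence to `0` in `L²`. -/
lemma tendsto_eLpNorm_zero {G : Type*} [NormedAddCommGroup G] {h : ℕ → α → ℂ} {g : α → G}
    (hm : ∀ j, AEStronglyMeasurable (h j) μ) (hg : MemLp g 2 μ) (hb : ∀ j x, ‖h j x‖ ≤ ‖g x‖)
    (hl : ∀ x, Tendsto (fun j => h j x) atTop (𝓝 0)) :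
    Tendsto (fun j => eLpNorm (h j) 2 μ) atTop (𝓝 0) := by
  have h2 : (2 : ℝ≥0∞) ≠ 0 := by norm_num
  have h3 : (2 : ℝ≥0∞) ≠ ⊤ := by norm_num
  have hfin : ∫⁻ x, ‖g x‖ₑ ^ 2 ∂μ ≠ ⊤ := by
    have := lintegral_rpow_enorm_lt_top_of_eLpNorm_lt_top h2 h3 hg.2
    simpa using this.ne
  have key := tendsto_lintegral_of_dominated_convergence' (μ := μ)
    (F := fun j x => ‖h j x‖ₑ ^ 2) (f := fun _ => 0) (fun x => ‖g x‖ₑ ^ 2)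
    (fun j => (hm j).enorm.pow_const 2)
    (fun j => .of_forall fun x => by
      have := enorm_le_iff_norm_le.2 (hb j x)
      exact pow_le_pow_left' this 2) hfin
    (.of_forall fun x => by
      have := ((ENNReal.continuous_pow 2).tendsto _).comp
        ((continuous_enorm.tendsto _).comp (hl x))
      simpa [Function.comp_def] using this)
  simp only [lintegral_zero] at key
  have := (ENNReal.continuous_rpow_const (y := (1 / 2 : ℝ))).tendsto 0 |>.comp key
  simp only [one_div, ENNReal.zero_rpow_of_pos (by norm_num : (0 : ℝ) < 2⁻¹)] at this
  refine this.congr fun j => ?_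
  rw [eLpNorm_eq_lintegral_rpow_enorm_toReal h2 h3]
  simp

/-- Convergence in `L²(μ)` of a sequence whose norms are at most `N`. -/
def L2Lim (μ : Measure α) (f : ℕ → α → ℂ) (g : α → ℂ) (N : ℝ≥0∞) : Prop :=
  L2Tendsto μ f g ∧ ∀ j, eLpNorm (f j) 2 μ ≤ N

namespace L2Lim

variable {f f' : ℕ → α → ℂ} {g g' : α → ℂ} {N N' : ℝ≥0∞}

lemma mono (h : L2Lim μ f g N) (hN : N ≤ N') : L2Lim μ f g N' :=
  ⟨h.1, fun j => (h.2 j).trans hN⟩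

lemma add (h : L2Lim μ f g N) (h' : L2Lim μ f' g' N') :
    L2Lim μ (fun j x => f j x + f' j x) (fun x => g x + g' x) (N + N') :=
  ⟨h.1.add h'.1, fun j => (eLpNorm_add_le (h.1.1 j).1 (h'.1.1 j).1 (by norm_num)).trans
    (add_le_add (h.2 j) (h'.2 j))⟩

lemma sum {κ : Type*} (s : Finset κ) {f : κ → ℕ → α → ℂ} {g : κ → α → ℂ} {N : κ → ℝ≥0∞}
    (h : ∀ i ∈ s, L2Lim μ (f i) (g i) (N i)) :
    L2Lim μ (fun j x => ∑ i ∈ s, f i j x) (fun x => ∑ i ∈ s, g i x) (∑ i ∈ s, N i) := by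
  classical
  induction s using Finset.induction_on with
  | empty =>
    refine ⟨by simpa using L2Tendsto.zero, fun j => ?_⟩
    have : (fun _ => 0 : α → ℂ) = 0 := rfl
    simp [this]
  | insert i s hi ih =>
    simp only [Finset.sum_insert hi]
    exact (h i (Finset.mem_insert_self i s)).add (ih fun k hk => h k (Finset.mem_insert_of_mem hk))

/-- Multiplication by uniformly bounded functions that converge pointwise. -/
lemma seq_mul {b : ℕ → α → ℝ} {β : α → ℝ} {C : ℝ} (hb : ∀ j, AEStronglyMeasurable (b j) μ)
    (hC : ∀ j x, |b j x| ≤ C) (hβ : ∀ x, Tendsto (fun j => b j x) atTop (𝓝 (β x)))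
    (h : L2Lim μ f g N) :
    L2Lim μ (fun j x => (b j x : ℂ) * f j x) (fun x => (β x : ℂ) * g x) (ENNReal.ofReal C * N) := by
  have hβm : AEStronglyMeasurable β μ :=
    aestronglyMeasurable_of_tendsto_ae atTop hb (.of_forall hβ)
  have hβC : ∀ x, |β x| ≤ C := fun x =>
    le_of_tendsto (hβ x).abs (.of_forall fun j => hC j x)
  refine ⟨⟨fun j => memLp_bdd_mul (hb j) (hC j) (h.1.1 j), memLp_bdd_mul hβm hβC h.1.2.1, ?_⟩,
    fun j => (eLpNorm_bdd_mul_le (hC j) _).trans (mul_le_mul_right (h.2 j) _)⟩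
  have s1 := ENNReal.Tendsto.const_mul (a := ENNReal.ofReal C) h.1.2.2 (.inr ENNReal.ofReal_ne_top)
  have s2 : Tendsto (fun j => eLpNorm (fun x => ((b j x - β x : ℝ) : ℂ) * g x) 2 μ) atTop
      (𝓝 0) := by
    refine tendsto_eLpNorm_zero (g := fun x => ((2 * C : ℝ) : ℂ) * g x)
      (fun j => ?_) (h.1.2.1.const_mul _) (fun j x => ?_) fun x => ?_
    · exact (Complex.continuous_ofReal.comp_aestronglyMeasurable ((hb j).sub hβm)).mul h.1.2.1.1
    · rw [norm_mul, norm_mul, Complex.norm_real, Complex.norm_real]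
      refine mul_le_mul_of_nonneg_right ?_ (norm_nonneg _)
      have h1 := hC j x
      have h2 := hβC x
      rw [Real.norm_eq_abs]
      calc |b j x - β x| ≤ |b j x| + |β x| := abs_sub _ _
        _ ≤ 2 * C := by linarith
        _ ≤ _ := le_abs_self _
    · have h1 : Tendsto (fun j => b j x - β x) atTop (𝓝 0) := by
        simpa using (hβ x).sub_const (β x)
      have := ((Complex.continuous_ofReal.tendsto 0).comp h1).mul_const (g x)
      simpa using this
  have s3 := s1.add s2
  rw [mul_zero, add_zero] at s3
  refine tendsto_of_tendsto_of_tendsto_of_le_of_le tendsto_const_nhds s3 (fun _ => zero_le) ?_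
  intro j
  have e : ((fun x => (b j x : ℂ) * f j x) - fun x => (β x : ℂ) * g x)
      = (fun x => (b j x : ℂ) * (f j - g) x) + fun x => ((b j x - β x : ℝ) : ℂ) * g x := by
    funext x; simp only [Pi.sub_apply, Pi.add_apply]; push_cast; ring
  simp only [e]
  refine (eLpNorm_add_le ?_ ?_ (by norm_num)).trans (add_le_add (eLpNorm_bdd_mul_le (hC j) _)
      le_rfl)
  · exact (memLp_bdd_mul (hb j) (hC j) ((h.1.1 j).sub h.1.2.1)).1
  · exact (Complex.continuous_ofReal.comp_aestronglyMeasurable ((hb j).sub hβm)).mul h.1.2.1.1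

end L2Lim
end L2Lim

section Mollifier

variable {n : ℕ}

instance : (hvol n).IsOpenPosMeasure := absolutelyContinuous_hvol.isOpenPosMeasure

/-- The normalization of the mollifier. -/
def molMass (n : ℕ) (ε : ℝ) : ℝ := ∫ y : E n, bump ((coshd 0 y - 1) / ε) ∂hvol n

/-- The mollifier at scale `√ε`, as a function of `cosh d(x, y)`. -/
def mol (n : ℕ) (ε s : ℝ) : ℝ := (molMass n ε)⁻¹ * bump ((s - 1) / ε)

lemma smooth_mol (n : ℕ) (ε : ℝ) : ContDiff ℝ ∞ (mol n ε) :=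
  contDiff_const.mul (smooth_bump.comp (by fun_prop))

variable {ε : ℝ}

lemma mol_eq_zero (n : ℕ) (hε : 0 < ε) {s : ℝ} (h : 1 + ε ≤ s) : mol n ε s = 0 := by
  rw [mol, bump_eq_zero, mul_zero]
  rw [le_div_iff₀ hε]
  linarith

lemma mol_support (n : ℕ) (hε : 0 < ε) (hε1 : ε ≤ 1) (s : ℝ) (h : 2 ≤ s) : mol n ε s = 0 :=
  mol_eq_zero n hε (by linarith)

lemma molMass_pos (n : ℕ) (hε : 0 < ε) (hε1 : ε ≤ 1) : 0 < molMass n ε := by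
  have hs : ContDiff ℝ ∞ fun s : ℝ => bump ((s - 1) / ε) := smooth_bump.comp (by fun_prop)
  set g : E n → ℝ := fun y => rad (fun s : ℝ => bump ((s - 1) / ε)) (0, y)
  have hc : Continuous g := (smooth_rad hs).continuous.comp (by fun_prop)
  have hcs : HasCompactSupport g := hasCompactSupport_rad (fun s h => bump_eq_zero (by
    rw [le_div_iff₀ hε]
    linarith)) 0
  have h0 : g 0 ≠ 0 := by
    simp only [g, rad]
    rw [coshd_self, bump_eq_one (by simp)]
    exact one_ne_zero
  exact hc.integral_pos_of_hasCompactSupport_nonneg_nonzero hcs (fun y => bump_nonneg _) h0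

lemma mol_nonneg (hε : 0 < ε) (hε1 : ε ≤ 1) (s : ℝ) : 0 ≤ mol n ε s :=
  mul_nonneg (inv_nonneg.2 (molMass_pos n hε hε1).le) (bump_nonneg _)

lemma integral_mol (hε : 0 < ε) (hε1 : ε ≤ 1) (x : E n) :
    ∫ y, rad (mol n ε) (x, y) ∂hvol n = 1 := by
  rw [kint_rad_one_const (smooth_mol n ε) (mol_support n hε hε1)]
  simp only [rad, mol]
  rw [integral_const_mul]
  exact inv_mul_cancel₀ (molMass_pos n hε hε1).ne'

lemma lintegral_mol (hε : 0 < ε) (hε1 : ε ≤ 1) (x : E n) :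
    ∫⁻ y, ENNReal.ofReal (rad (mol n ε) (x, y)) ∂hvol n = 1 := by
  rw [← ofReal_integral_eq_lintegral_ofReal, integral_mol hε hε1, ENNReal.ofReal_one]
  · exact ((smooth_rad (smooth_mol n ε)).continuous.comp
        (by fun_prop)).integrable_of_hasCompactSupport
      (hasCompactSupport_rad (mol_support n hε hε1) x)
  · exact .of_forall fun y => mol_nonneg hε hε1 _

/-- Averaging against the mollifier contracts `L²`. -/
lemma eLpNorm_le_of_mol (hε : 0 < ε) (hε1 : ε ≤ 1) {G : Type*} [NormedAddCommGroup G]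
    {h : E n → ℂ} {g : E n → G} (hg : AEStronglyMeasurable g (hvol n))
    (hb : ∀ x, ‖h x‖ₑ ≤ ∫⁻ y, ENNReal.ofReal (rad (mol n ε) (x, y)) * ‖g y‖ₑ ∂hvol n) :
    eLpNorm h 2 (hvol n) ≤ eLpNorm g 2 (hvol n) := by
  have h2 : (2 : ℝ≥0∞) ≠ 0 := by norm_num
  have h3 : (2 : ℝ≥0∞) ≠ ⊤ := by norm_num
  rw [eLpNorm_eq_lintegral_rpow_enorm_toReal h2 h3, eLpNorm_eq_lintegral_rpow_enorm_toReal h2 h3]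
  refine ENNReal.rpow_le_rpow ?_ (by positivity)
  simp only [ENNReal.toReal_ofNat, ENNReal.rpow_ofNat]
  set k : E n × E n → ℝ≥0∞ := fun w => ENNReal.ofReal (rad (mol n ε) w)
  have hkc : Continuous k := ENNReal.continuous_ofReal.comp (smooth_rad (smooth_mol n ε)).continuous
  have hcs : ∀ x, (∫⁻ y, k (x, y) * ‖g y‖ₑ ∂hvol n) ^ 2 ≤ ∫⁻ y, k (x, y) * ‖g y‖ₑ ^ 2 ∂hvol n := by
    intro x
    have hk1 : AEMeasurable (fun y => k (x, y) ^ (1 / 2 : ℝ)) (hvol n) :=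
      ((hkc.comp (by fun_prop : Continuous fun y : E n => (x, y))).measurable.pow_const
          _).aemeasurable
    have := ENNReal.lintegral_mul_le_Lp_mul_Lq (hvol n) Real.HolderConjugate.two_two hk1
      (hk1.mul hg.enorm)
    have e1 : ∀ y, k (x, y) ^ (1 / 2 : ℝ) * (k (x, y) ^ (1 / 2 : ℝ) * ‖g y‖ₑ)
        = k (x, y) * ‖g y‖ₑ := by
      intro y
      rw [← mul_assoc, ← ENNReal.rpow_add_of_nonneg _ _ (by norm_num) (by norm_num)]
      norm_num
    have e2 : ∀ y, (k (x, y) ^ (1 / 2 : ℝ)) ^ (2 : ℝ) = k (x, y) := by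
      intro y
      rw [← ENNReal.rpow_mul]
      norm_num
    simp only [Pi.mul_apply, e1, ENNReal.mul_rpow_of_nonneg _ _ zero_le_two, e2] at this
    rw [lintegral_mol hε hε1, ENNReal.one_rpow, one_mul] at this
    calc _ ≤ ((∫⁻ y, k (x, y) * ‖g y‖ₑ ^ (2 : ℝ) ∂hvol n) ^ (1 / 2 : ℝ)) ^ 2 := by gcongr
      _ = _ := by
        rw [← ENNReal.rpow_natCast, ← ENNReal.rpow_mul]
        norm_num
  calc ∫⁻ x, ‖h x‖ₑ ^ 2 ∂hvol n ≤ ∫⁻ x, ∫⁻ y, k (x, y) * ‖g y‖ₑ ^ 2 ∂hvol n ∂hvol n :=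
        lintegral_mono fun x => (pow_le_pow_left' (hb x) 2).trans (hcs x)
    _ = ∫⁻ y, ∫⁻ x, k (x, y) * ‖g y‖ₑ ^ 2 ∂hvol n ∂hvol n := by
        refine lintegral_lintegral_swap ?_
        exact hkc.measurable.aemeasurable.mul (hg.comp_snd.enorm.pow_const 2)
    _ = ∫⁻ y, ‖g y‖ₑ ^ 2 ∂hvol n := by
        refine lintegral_congr fun y => ?_
        have hkm : Measurable fun x => k (x, y) :=
          (hkc.comp (by fun_prop : Continuous fun x : E n => (x, y))).measurable
        rw [lintegral_mul_const _ hkm]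
        have : ∀ x, k (x, y) = ENNReal.ofReal (rad (mol n ε) (y, x)) := fun x => by
          simp only [k, rad_symm _ x y]
        simp only [this]
        rw [lintegral_mol hε hε1, one_mul]

lemma aestronglyMeasurable_kint {κ : E n × E n → ℝ} (hκ : Continuous κ) {f : E n → ℂ}
    (hf : AEStronglyMeasurable f (hvol n)) : AEStronglyMeasurable (kint κ f) (hvol n) :=
  AEStronglyMeasurable.integral_prod_right' (f := fun w : E n × E n => κ w • f w.2)
    (hκ.aestronglyMeasurable.smul hf.comp_snd)

/-- An integral whose integrand is at most `c` times the mollifier times `g` has `L²` norm at most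
`c` times that of `g`. -/
lemma eLpNorm_integral_le (hε : 0 < ε) (hε1 : ε ≤ 1) {T : E n → E n → ℂ} {c : ℝ} {g : E n → ℝ}
    (hg : AEStronglyMeasurable g (hvol n)) (hg0 : ∀ y, 0 ≤ g y)
    (hc : 0 ≤ c) (hb : ∀ x, ∀ᵐ y ∂hvol n, ‖T x y‖ ≤ c * rad (mol n ε) (x, y) * g y) :
    eLpNorm (fun x => ∫ y, T x y ∂hvol n) 2 (hvol n) ≤ ENNReal.ofReal c * eLpNorm g 2 (hvol n) := by
  have e : eLpNorm (fun y => c * g y) 2 (hvol n) ≤ ENNReal.ofReal c * eLpNorm g 2 (hvol n) :=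
    eLpNorm_le_mul_eLpNorm_of_ae_le_mul (.of_forall fun y => by
      rw [norm_mul, Real.norm_of_nonneg hc]) 2
  refine (eLpNorm_le_of_mol hε hε1 (hg.const_mul c) fun x => ?_).trans e
  refine (enorm_integral_le_lintegral_enorm _).trans (lintegral_mono_ae ?_)
  filter_upwards [hb x] with y hy
  rw [← ofReal_norm, ← ofReal_norm, ← ENNReal.ofReal_mul
      (show 0 ≤ rad (mol n ε) (x, y) from mol_nonneg hε hε1 _)]
  refine ENNReal.ofReal_le_ofReal ?_
  rw [Real.norm_of_nonneg (mul_nonneg hc (hg0 y))]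
  refine hy.trans (le_of_eq (by ring))

lemma continuous_rad_mol (n : ℕ) (ε : ℝ) : Continuous (rad (mol n ε) : E n × E n → ℝ) :=
  (smooth_rad (smooth_mol n ε)).continuous

lemma eLpNorm_kint_mol_le (hε : 0 < ε) (hε1 : ε ≤ 1) {f : E n → ℂ} (hf : MemLp f 2 (hvol n)) :
    eLpNorm (kint (rad (mol n ε)) f) 2 (hvol n) ≤ eLpNorm f 2 (hvol n) := by
  have := eLpNorm_integral_le hε hε1 (T := fun x y => rad (mol n ε) (x, y) • f y) (c := 1)
    (g := fun y => ‖f y‖) hf.1.norm (fun _ => norm_nonneg _) zero_le_one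
    (fun x => .of_forall fun y => by
      rw [norm_smul, Real.norm_of_nonneg (show 0 ≤ rad (mol n ε) (x, y) from mol_nonneg hε hε1 _),
        one_mul])
  rw [ENNReal.ofReal_one, one_mul, eLpNorm_norm] at this
  exact this

lemma memLp_kint_mol (hε : 0 < ε) (hε1 : ε ≤ 1) {f : E n → ℂ} (hf : MemLp f 2 (hvol n)) :
    MemLp (kint (rad (mol n ε)) f) 2 (hvol n) :=
  ⟨aestronglyMeasurable_kint (continuous_rad_mol n ε) hf.1,
    (eLpNorm_kint_mol_le hε hε1 hf).trans_lt hf.2⟩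

/-- The scales of the mollification. -/
def scale (j : ℕ) : ℝ := 1 / ((j : ℝ) + 1)

lemma scale_pos (j : ℕ) : 0 < scale j := Nat.one_div_pos_of_nat

lemma scale_le_one (j : ℕ) : scale j ≤ 1 := by
  rw [scale, div_le_one (by positivity)]
  linarith [(Nat.cast_nonneg j : (0 : ℝ) ≤ j)]

lemma tendsto_scale : Tendsto scale atTop (𝓝 0) := tendsto_one_div_add_atTop_nhds_zero_nat

lemma coshd_lt_of_rad_mol_ne {x y : E n} (hε : 0 < ε) (h : rad (mol n ε) (x, y) ≠ 0) :
    coshd x y < 1 + ε := by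
  by_contra h2
  exact h (mol_eq_zero n hε (not_lt.1 h2))

lemma tendsto_kint_mol_of_continuous {g : E n → ℂ} (hg : Continuous g)
    (x : E n) : Tendsto (fun j => kint (rad (mol n (scale j))) g x) atTop (𝓝 (g x)) := by
  rw [Metric.tendsto_atTop]
  intro η hη
  obtain ⟨r, hr, hgr⟩ := Metric.continuousAt_iff.1 (hg.continuousAt (x := x)) (η / 2) (half_pos hη)
  have hx := ht_pos x
  have hev : ∀ᶠ j in atTop, 8 * ht x ^ 2 * scale j < r ^ 2 := by
    have := (tendsto_scale.const_mul (8 * ht x ^ 2))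
    rw [mul_zero] at this
    exact this.eventually_lt_const (by positivity)
  obtain ⟨j₀, hj₀⟩ := eventually_atTop.1 hev
  refine ⟨j₀, fun j hj => ?_⟩
  have h1 := hj₀ j hj
  have hi : Integrable (fun y => rad (mol n (scale j)) (x, y)) (hvol n) :=
    ((continuous_rad_mol n _).comp (by fun_prop)).integrable_of_hasCompactSupport
      (hasCompactSupport_rad (mol_support n (scale_pos j) (scale_le_one j)) x)
  have hl : LocallyIntegrable g (hvol n) := hg.locallyIntegrable
  have hint := integral_mol (scale_pos j) (scale_le_one j) x
  have e : kint (rad (mol n (scale j))) g x - g x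
      = ∫ y, rad (mol n (scale j)) (x, y) • (g y - g x) ∂hvol n := by
    simp only [smul_sub]
    rw [integral_sub (integrable_kint (continuous_rad_mol n _)
      (hasCompactSupport_rad (mol_support n (scale_pos j) (scale_le_one j)) x) hl)
      (hi.smul_const _), integral_smul_const, hint, one_smul]
    rfl
  rw [dist_eq_norm, e]
  calc _ ≤ ∫ y, rad (mol n (scale j)) (x, y) * (η / 2) ∂hvol n := by
        refine norm_integral_le_of_norm_le (hi.mul_const _) (.of_forall fun y => ?_)
        have h0 : 0 ≤ rad (mol n (scale j)) (x, y) := mol_nonneg (scale_pos j) (scale_le_one j) _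
        rw [norm_smul, Real.norm_of_nonneg h0]
        by_cases hz : rad (mol n (scale j)) (x, y) = 0
        · simp [hz]
        refine mul_le_mul_of_nonneg_left ?_ h0
        have h2 := coshd_lt_of_rad_mol_ne (scale_pos j) hz
        have h3 := norm_sub_sq_le x y
        have h4 := ht_le x y
        have h5 := scale_le_one j
        have h6 := one_le_coshd x y
        have h7 := ht_pos y
        have h8 : ‖x - y‖ ^ 2 < r ^ 2 := by
          have h9 : ht y ≤ 4 * ht x := by nlinarith
          have h10 : ht x * ht y ≤ 4 * ht x ^ 2 := by nlinarith
          calc _ ≤ 2 * (ht x * ht y) * (coshd x y - 1) := by linarith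
            _ ≤ 2 * (4 * ht x ^ 2) * scale j := by
              refine mul_le_mul (by linarith) (by linarith) (by linarith) (by positivity)
            _ < r ^ 2 := by linarith
        have h9 : dist y x < r := by
          rw [dist_comm, dist_eq_norm]
          exact lt_of_pow_lt_pow_left₀ 2 hr.le h8
        rw [← dist_eq_norm]
        exact (hgr h9).le
    _ < η := by
        rw [integral_mul_const, hint]
        linarith

lemma kint_mol_sub (j : ℕ) {f g : E n → ℂ} (hf : LocallyIntegrable f (hvol n))
    (hg : LocallyIntegrable g (hvol n)) :
    kint (rad (mol n (scale j))) (fun y => f y - g y)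
      = fun x => kint (rad (mol n (scale j))) f x - kint (rad (mol n (scale j))) g x := by
  funext x
  have hc := hasCompactSupport_rad (mol_support n (scale_pos j) (scale_le_one j)) x
  simp only [kint, smul_sub]
  exact integral_sub (integrable_kint (continuous_rad_mol n _) hc hf)
    (integrable_kint (continuous_rad_mol n _) hc hg)

/-- Mollifications converge in `L²`. -/
lemma l2Lim_kint_mol {f : E n → ℂ} (hf : MemLp f 2 (hvol n)) :
    L2Lim (hvol n) (fun j => kint (rad (mol n (scale j))) f) f (eLpNorm f 2 (hvol n)) := by
  refine ⟨⟨fun j => memLp_kint_mol (scale_pos j) (scale_le_one j) hf, hf, ?_⟩,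
    fun j => eLpNorm_kint_mol_le (scale_pos j) (scale_le_one j) hf⟩
  rw [ENNReal.tendsto_atTop_zero]
  intro η hη
  have hη3 : η / 3 ≠ 0 := by simpa using hη.ne'
  obtain ⟨g, hgc, hfg, hg, hgm⟩ := hf.exists_hasCompactSupport_eLpNorm_sub_le (by norm_num) hη3
  have hgl : Tendsto (fun j => eLpNorm (fun x => kint (rad (mol n (scale j))) g x - g x) 2 (hvol n))
      atTop (𝓝 0) := by
    obtain ⟨B, hB⟩ := hgc.exists_bound_of_continuous hg
    obtain ⟨R, hR⟩ := hgc.isCompact.isBounded.exists_norm_le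
    have hB0 : 0 ≤ B := (norm_nonneg _).trans (hB 0)
    set D : E n → ℝ := (Metric.closedBall (0 : E n) (4 * (1 + R))).indicator fun _ => B + B
    have hzero : ∀ j x, 4 * (1 + R) < ‖x‖ → kint (rad (mol n (scale j))) g x = 0 := by
      intro j x hx
      refine integral_eq_zero_of_ae (.of_forall fun y => ?_)
      by_cases hy : g y = 0
      · simp [hy]
      have h1 := hR y (subset_tsupport _ hy)
      have h2 : ht y ≤ 1 + R := by
        have := ht_sq y
        have h3 := ht_pos y
        nlinarith [norm_nonneg y]
      have h3 : rad (mol n (scale j)) (x, y) = 0 := by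
        by_contra h4
        have h5 := coshd_lt_of_rad_mol_ne (scale_pos j) h4
        have h6 := ht_le y x
        have h7 := norm_lt_ht x
        have h8 := scale_le_one j
        rw [coshd_comm] at h6
        nlinarith [ht_pos y]
      simp [h3]
    refine tendsto_eLpNorm_zero (g := D) (fun j => ?_) ?_ (fun j x => ?_) fun x => ?_
    · exact (aestronglyMeasurable_kint (continuous_rad_mol n _) hg.aestronglyMeasurable).sub
        hg.aestronglyMeasurable
    · exact memLp_indicator_const 2 measurableSet_closedBall _
        (.inr (isCompact_closedBall _ _).measure_lt_top.ne)
    · by_cases hx : ‖x‖ ≤ 4 * (1 + R)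
      · rw [show D x = B + B from Set.indicator_of_mem (by simpa using hx) _,
          Real.norm_of_nonneg (by linarith)]
        refine (norm_sub_le _ _).trans (add_le_add ?_ (hB x))
        have hi : Integrable (fun y => rad (mol n (scale j)) (x, y)) (hvol n) :=
          ((continuous_rad_mol n _).comp (by fun_prop)).integrable_of_hasCompactSupport
            (hasCompactSupport_rad (mol_support n (scale_pos j) (scale_le_one j)) x)
        calc _ ≤ ∫ y, rad (mol n (scale j)) (x, y) * B ∂hvol n := by
              refine norm_integral_le_of_norm_le (hi.mul_const _) (.of_forall fun y => ?_)
              have h0 : 0 ≤ rad (mol n (scale j)) (x, y) :=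
                mol_nonneg (scale_pos j) (scale_le_one j) _
              rw [norm_smul, Real.norm_of_nonneg h0]
              exact mul_le_mul_of_nonneg_left (hB y) h0
          _ = B := by rw [integral_mul_const, integral_mol (scale_pos j) (scale_le_one j), one_mul]
      · have h1 : g x = 0 := by
          by_contra h
          have := hR x (subset_tsupport _ h)
          have h2 := norm_nonneg x
          linarith
        rw [hzero j x (not_le.1 hx), h1]
        simp
    · simpa using (tendsto_kint_mol_of_continuous hg x).sub_const (g x)
  rw [ENNReal.tendsto_atTop_zero] at hgl
  obtain ⟨j₀, hj₀⟩ := hgl (η / 3) (pos_iff_ne_zero.2 hη3)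
  refine ⟨j₀, fun j hj => ?_⟩
  have hd : MemLp (fun y => f y - g y) 2 (hvol n) := hf.sub hgm
  have e : kint (rad (mol n (scale j))) f - f
      = (kint (rad (mol n (scale j))) (fun y => f y - g y)
        + fun x => kint (rad (mol n (scale j))) g x - g x) + fun y => g y - f y := by
    rw [kint_mol_sub j (locallyIntegrable_of_memLp hf) (locallyIntegrable_of_memLp hgm)]
    funext x
    simp only [Pi.sub_apply, Pi.add_apply]
    ring
  have m1 := memLp_kint_mol (scale_pos j) (scale_le_one j) hd
  have m2 : AEStronglyMeasurable (fun x => kint (rad (mol n (scale j))) g x - g x) (hvol n) :=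
    (memLp_kint_mol (scale_pos j) (scale_le_one j) hgm).1.sub hgm.1
  have e3 : eLpNorm (fun y => g y - f y) 2 (hvol n) ≤ η / 3 := by
    rw [show (fun y => g y - f y) = g - f from rfl, eLpNorm_sub_comm]
    exact hfg
  rw [e]
  calc _ ≤ eLpNorm (kint (rad (mol n (scale j))) (fun y => f y - g y)) 2 (hvol n)
        + eLpNorm (fun x => kint (rad (mol n (scale j))) g x - g x) 2 (hvol n)
        + eLpNorm (fun y => g y - f y) 2 (hvol n) := by
        refine (eLpNorm_add_le (m1.1.add m2) (hgm.sub hf).1 (by norm_num)).trans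
          (add_le_add (eLpNorm_add_le m1.1 m2 (by norm_num)) le_rfl)
    _ ≤ η / 3 + η / 3 + η / 3 :=
        add_le_add (add_le_add ((eLpNorm_kint_mol_le (scale_pos j) (scale_le_one j) hd).trans hfg)
          (hj₀ j hj)) e3
    _ = η := ENNReal.add_thirds η

end Mollifier

/-! ### Convergence of the derivatives of mollifications -/

section Cutoff

variable {n : ℕ}

/-- On the support of the mollifier the heights of the two points, and the points themselves, are
close; the difference is measured against vectors tangent to the hyperboloid. -/
lemma ratio_bounds {ε : ℝ} (hε1 : ε ≤ 1) {x y : E n} (h : coshd x y < 1 + ε) :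
    ht y / ht x ≤ 4 ∧ |ht y / ht x - 1| ≤ 3 * √ε ∧
    ∀ c : Fin n → ℂ, ‖∑ i, (x i - y i) • c i‖
      ≤ 3 * √ε * (∑ i, ‖c i‖ + ‖∑ i, y i • c i‖) := by
  have h1 := one_le_coshd x y
  have hε : 0 < ε := by linarith
  have hx := ht_pos x
  have hy := ht_pos y
  have hxy := ht_le x y
  have hyx := ht_le y x
  rw [coshd_comm y x] at hyx
  have r1 : ht y / ht x ≤ 4 := by rw [div_le_iff₀ hx]; nlinarith
  have r2 : ht x / ht y ≤ 4 := by rw [div_le_iff₀ hy]; nlinarith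
  have hs : √ε ^ 2 = ε := Real.sq_sqrt hε.le
  have hs0 := Real.sqrt_nonneg ε
  have i1 := coshd_sub_one x y
  have i2 := coshd_sub_one y x
  rw [coshd_comm y x] at i2
  have p1 : 0 < ht x / ht y := by positivity
  have p2 : 0 < ht y / ht x := by positivity
  have b1 : 2 * (ht x / ht y) * (coshd x y - 1) ≤ (3 * √ε) ^ 2 := by nlinarith
  have b2 : 2 * (ht y / ht x) * (coshd x y - 1) ≤ (3 * √ε) ^ 2 := by nlinarith
  refine ⟨r1, abs_le_of_sq_le_sq (by nlinarith [sq_nonneg ‖y - (ht y / ht x) • x‖]) (by positivity),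
      ?_⟩
  intro c
  have c1 : |ht x / ht y - 1| ≤ 3 * √ε :=
    abs_le_of_sq_le_sq (by nlinarith [sq_nonneg ‖x - (ht x / ht y) • y‖]) (by positivity)
  have c2 : ‖x - (ht x / ht y) • y‖ ≤ 3 * √ε := by
    have := abs_le_of_sq_le_sq (a := ‖x - (ht x / ht y) • y‖) (b := 3 * √ε)
      (by nlinarith [sq_nonneg (ht x / ht y - 1)]) (by positivity)
    rwa [abs_norm] at this
  have e : ∑ i, (x i - y i) • c i = ∑ i, (x - (ht x / ht y) • y) i • c i
      + (ht x / ht y - 1) • ∑ i, y i • c i := by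
    rw [Finset.smul_sum, ← Finset.sum_add_distrib]
    refine Finset.sum_congr rfl fun i _ => ?_
    rw [smul_smul, ← add_smul]
    congr 1
    simp only [PiLp.sub_apply, PiLp.smul_apply, smul_eq_mul]
    ring
  rw [e, mul_add]
  refine (norm_add_le _ _).trans (add_le_add ?_ ?_)
  · rw [Finset.mul_sum]
    refine norm_sum_le_of_le _ fun i _ => ?_
    rw [norm_smul]
    exact mul_le_mul_of_nonneg_right ((PiLp.norm_apply_le _ i).trans c2) (norm_nonneg _)
  · rw [norm_smul]
    exact mul_le_mul_of_nonneg_right c1 (norm_nonneg _)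

lemma rad_mol_nonneg (j : ℕ) (w : E n × E n) : 0 ≤ rad (mol n (scale j)) w :=
  mol_nonneg (scale_pos j) (scale_le_one j) _

lemma hasCompactSupport_rad_mol (j : ℕ) (x : E n) :
    HasCompactSupport fun y => rad (mol n (scale j)) (x, y) :=
  hasCompactSupport_rad (mol_support n (scale_pos j) (scale_le_one j)) x

lemma hasCompactSupport_D_rad_mol (j : ℕ) (i : Option (Fin n)) (x : E n) :
    HasCompactSupport fun y => (hframe2 n).D (.inl i) (rad (mol n (scale j))) (x, y) := by
  refine HasCompactSupport.intro (isCompact_closedBall (0 : E n) (4 * ht x)) fun y hy => ?_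
  have hy2 : 2 < coshd x y := by
    have h3 := ht_le x y
    have h4 := norm_lt_ht y
    have h5 := ht_pos x
    simp only [Metric.mem_closedBall, dist_zero_right, not_le] at hy
    by_contra h
    nlinarith
  have h0 : rad (mol n (scale j)) =ᶠ[𝓝 (x, y)] fun _ => (0 : ℝ) := by
    have := (isOpen_lt continuous_const (smooth_coshd (n := n)).continuous).mem_nhds
      (show (x, y) ∈ {w : E n × E n | 2 < coshd w.1 w.2} from hy2)
    filter_upwards [this] with w hw
    exact mol_support n (scale_pos j) (scale_le_one j) _ (le_of_lt hw)
  simp only [Frame.D, along, h0.fderiv_eq]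
  simp

/-- Convergence of averages against the mollifier, with a small error. -/
lemma l2Lim_of_error {f : E n → ℂ} (hf : MemLp f 2 (hvol n)) {g : E n → ℝ}
    (hg : MemLp g 2 (hvol n)) (hg0 : ∀ y, 0 ≤ g y) {T : ℕ → E n → E n → ℂ} {c : ℝ} (hc : 0 ≤ c)
    (hT : ∀ j x, Integrable (T j x) (hvol n))
    (hTm : ∀ j, AEStronglyMeasurable (fun x => ∫ y, T j x y ∂hvol n) (hvol n))
    (hb : ∀ j x, ∀ᵐ y ∂hvol n, ‖T j x y - rad (mol n (scale j)) (x, y) • f y‖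
      ≤ c * √(scale j) * rad (mol n (scale j)) (x, y) * g y) :
    L2Lim (hvol n) (fun j x => ∫ y, T j x y ∂hvol n) f
      (eLpNorm f 2 (hvol n) + ENNReal.ofReal c * eLpNorm g 2 (hvol n)) := by
  have h1 := l2Lim_kint_mol hf
  set err : ℕ → E n → ℂ := fun j x => ∫ y, (T j x y - rad (mol n (scale j)) (x, y) • f y) ∂hvol n
  have herr : ∀ j, eLpNorm (err j) 2 (hvol n)
      ≤ ENNReal.ofReal (c * √(scale j)) * eLpNorm g 2 (hvol n) := fun j =>
    eLpNorm_integral_le (scale_pos j) (scale_le_one j) hg.1 hg0 (by positivity) (hb j)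
  have e : ∀ j x, ∫ y, T j x y ∂hvol n = kint (rad (mol n (scale j))) f x + err j x := by
    intro j x
    simp only [err]
    rw [integral_sub (hT j x) (integrable_kint (continuous_rad_mol n _)
      (hasCompactSupport_rad_mol j x) (locallyIntegrable_of_memLp hf))]
    simp [kint]
  have hem : ∀ j, MemLp (err j) 2 (hvol n) := by
    intro j
    refine ⟨?_, (herr j).trans_lt (ENNReal.mul_lt_top ENNReal.ofReal_lt_top hg.2)⟩
    have : err j = fun x => (∫ y, T j x y ∂hvol n) - kint (rad (mol n (scale j))) f x := by
      funext x
      rw [e]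
      ring
    rw [this]
    exact (hTm j).sub (h1.1.1 j).1
  have h2 : L2Lim (hvol n) err (fun _ => 0) (ENNReal.ofReal c * eLpNorm g 2 (hvol n)) := by
    refine ⟨⟨hem, MemLp.zero, ?_⟩, fun j => (herr j).trans ?_⟩
    · have h3 : Tendsto (fun j => ENNReal.ofReal (c * √(scale j)) * eLpNorm g 2 (hvol n)) atTop
          (𝓝 0) := by
        have h4 : Tendsto (fun j => ENNReal.ofReal (c * √(scale j))) atTop (𝓝 0) := by
          have := ENNReal.tendsto_ofReal
            (((Real.continuous_sqrt.tendsto 0).comp tendsto_scale).const_mul c)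
          simpa using this
        simpa using ENNReal.Tendsto.mul_const h4 (.inr hg.2.ne)
      refine tendsto_of_tendsto_of_tendsto_of_le_of_le tendsto_const_nhds h3 (fun _ => zero_le)
        fun j => ?_
      rw [show (fun _ => (0 : ℂ)) = (0 : E n → ℂ) from rfl, sub_zero]
      exact herr j
    · gcongr
      calc c * √(scale j) ≤ c * 1 := mul_le_mul_of_nonneg_left
            (Real.sqrt_le_one.2 (scale_le_one j)) hc
        _ = c := mul_one c
  have := h1.add h2
  simp only [add_zero] at this
  simpa only [← e] using this

/-- Derivatives of mollifications converge to the weak derivatives. -/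
lemma l2Lim_D_mol {u : E n → ℂ} {G : Option (Fin n) → E n → ℂ} (hu : IsWeakJet u G)
    (i : Option (Fin n)) :
    L2Lim (hvol n) (fun j => kint ((hframe2 n).D (.inl i) (rad (mol n (scale j)))) u) (G i)
      (16 * ∑ i, eLpNorm (G i) 2 (hvol n)) := by
  set g : E n → ℝ := fun y => ∑ i, ‖G i y‖
  have hg : MemLp g 2 (hvol n) := memLp_finsetSum _ fun i _ => (hu.memLp_deriv i).norm
  have hg0 : ∀ y, 0 ≤ g y := fun y => Finset.sum_nonneg fun i _ => norm_nonneg _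
  have hgi : ∀ i y, ‖G i y‖ ≤ g y := fun i y =>
    Finset.single_le_sum (f := fun i => ‖G i y‖) (fun i _ => norm_nonneg _) (Finset.mem_univ i)
  have hgN : eLpNorm g 2 (hvol n) ≤ ∑ i, eLpNorm (G i) 2 (hvol n) := by
    have := eLpNorm_sum_le (s := Finset.univ) (f := fun i y => ‖G i y‖) (p := 2) (μ := hvol n)
      (fun i _ => (hu.memLp_deriv i).1.norm) (by norm_num)
    simp only [eLpNorm_norm] at this
    refine le_trans (le_of_eq ?_) this
    congr 1
    funext y
    simp [g]
  have hfin : eLpNorm (G i) 2 (hvol n) + ENNReal.ofReal 15 * eLpNorm g 2 (hvol n)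
      ≤ 16 * ∑ i, eLpNorm (G i) 2 (hvol n) := by
    calc _ ≤ ∑ i, eLpNorm (G i) 2 (hvol n) + 15 * ∑ i, eLpNorm (G i) 2 (hvol n) := by
          gcongr
          · exact Finset.single_le_sum (f := fun i => eLpNorm (G i) 2 (hvol n)) (fun _ _ => zero_le)
              (Finset.mem_univ i)
          · simp
      _ = (1 + 15) * ∑ i, eLpNorm (G i) 2 (hvol n) := by ring
      _ = _ := by norm_num
  have hl : ∀ i, LocallyIntegrable (G i) (hvol n) := fun i =>
    locallyIntegrable_of_memLp (hu.memLp_deriv i)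
  have hkc : ∀ j, Continuous fun w : E n × E n => ht w.2 / ht w.1 * rad (mol n (scale j)) w :=
    fun j => ((continuous_ht.comp continuous_snd).div (continuous_ht.comp continuous_fst)
      fun w => ht_ne _).mul (continuous_rad_mol n _)
  have hint : ∀ j x (i : Fin n), Integrable
      (fun y => (ht y / ht x * rad (mol n (scale j)) (x, y)) • G (some i) y) (hvol n) := by
    intro j x i
    exact integrable_kint (hkc j) (hasCompactSupport_rad_mol j x).mul_left (hl (some i))
  have hkm : ∀ j i, AEStronglyMeasurable
      (kint ((hframe2 n).D (.inl i) (rad (mol n (scale j)))) u) (hvol n) := fun j i =>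
    aestronglyMeasurable_kint ((hframe2 n).smooth_D _ (smooth_rad (smooth_mol n _))).continuous
      hu.memLp.1
  have hsome : ∀ j x (i : Fin n), kint ((hframe2 n).D (.inl (some i)) (rad (mol n (scale j)))) u x
      = ∫ y, (ht y / ht x * rad (mol n (scale j)) (x, y)) • G (some i) y ∂hvol n := fun j x i =>
    kint_D_some_rad (smooth_mol n _) (mol_support n (scale_pos j) (scale_le_one j)) hu i x
  refine L2Lim.mono ?_ hfin
  cases i with
  | some i =>
    have := l2Lim_of_error (hu.memLp_deriv (some i)) hg hg0 (c := 15)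
      (T := fun j x y => (ht y / ht x * rad (mol n (scale j)) (x, y)) • G (some i) y) (by norm_num)
      (fun j x => hint j x i) (fun j => by simpa only [← hsome] using hkm j (some i)) ?_
    · simpa only [← hsome] using this
    intro j x
    refine .of_forall fun y => ?_
    rw [← sub_smul, norm_smul]
    by_cases h0 : rad (mol n (scale j)) (x, y) = 0
    · simp [h0]
    have hr := ratio_bounds (scale_le_one j) (coshd_lt_of_rad_mol_ne (scale_pos j) h0)
    have hk := rad_mol_nonneg j (x, y)
    rw [show ht y / ht x * rad (mol n (scale j)) (x, y) - rad (mol n (scale j)) (x, y)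
      = (ht y / ht x - 1) * rad (mol n (scale j)) (x, y) by ring, norm_mul, Real.norm_eq_abs,
      Real.norm_of_nonneg hk]
    have hs0 := Real.sqrt_nonneg (scale j)
    refine mul_le_mul ?_ (hgi _ y) (norm_nonneg _) (by positivity)
    exact mul_le_mul_of_nonneg_right (hr.2.1.trans (by linarith)) hk
  | none =>
    set T : ℕ → E n → E n → ℂ := fun j x y => ∑ i : Fin n,
      x i • ((ht y / ht x * rad (mol n (scale j)) (x, y)) • G (some i) y)
    have hTi : ∀ j x, Integrable (T j x) (hvol n) := fun j x =>
      integrable_finsetSum _ fun i _ => (hint j x i).smul (x i)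
    have hTe : ∀ j, kint ((hframe2 n).D (.inl none) (rad (mol n (scale j)))) u
        = fun x => ∫ y, T j x y ∂hvol n := by
      intro j
      funext x
      have e0 : ∀ y, (hframe2 n).D (.inl none) (rad (mol n (scale j))) (x, y)
          = ∑ i, x i * (hframe2 n).D (.inl (some i)) (rad (mol n (scale j))) (x, y) := by
        intro y
        have hs := smooth_rad (n := n) (smooth_mol n (scale j))
        rw [← D_fst_apply hs, D_none_eq_sum]
        exact Finset.sum_congr rfl fun i _ => by rw [D_fst_apply hs, smul_eq_mul]
      have e1 : ∀ i : Fin n, Integrable (fun y =>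
          (hframe2 n).D (.inl (some i)) (rad (mol n (scale j))) (x, y) • u y) (hvol n) := fun i =>
        integrable_kint ((hframe2 n).smooth_D _ (smooth_rad (smooth_mol n _))).continuous
          (hasCompactSupport_D_rad_mol j _ x) (locallyIntegrable_of_memLp hu.memLp)
      refine Eq.trans ?_ (integral_finsetSum _ fun i _ => (hint j x i).smul (x i)).symm
      have e3 : ∀ y, (hframe2 n).D (.inl none) (rad (mol n (scale j))) (x, y) • u y
          = ∑ i, x i • ((hframe2 n).D (.inl (some i)) (rad (mol n (scale j))) (x, y) • u y) := by
        intro y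
        rw [e0, Finset.sum_smul]
        exact Finset.sum_congr rfl fun i _ => mul_smul _ _ _
      simp only [kint, e3]
      refine (integral_finsetSum _ fun i _ => (e1 i).smul (x i)).trans ?_
      refine Finset.sum_congr rfl fun i _ => ?_
      refine (integral_smul (x i) _).trans (Eq.trans ?_ (integral_smul (x i) _).symm)
      congr 1
      exact hsome j x i
    have := l2Lim_of_error (hu.memLp_deriv none) hg hg0 (c := 15) (T := T) (by norm_num)
      hTi (fun j => by simpa only [← hTe] using hkm j none) ?_
    · simpa only [hTe] using this
    intro j x
    filter_upwards [hu.euler] with y hy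
    by_cases h0 : rad (mol n (scale j)) (x, y) = 0
    · simp [h0, T]
    obtain ⟨r1, r2, r3⟩ := ratio_bounds (scale_le_one j) (coshd_lt_of_rad_mol_ne (scale_pos j) h0)
    have hk := rad_mol_nonneg j (x, y)
    set k := rad (mol n (scale j)) (x, y)
    have hρ : 0 < ht y / ht x := div_pos (ht_pos y) (ht_pos x)
    set ρ := ht y / ht x
    have eT : T j x y - k • G none y
        = k • (ρ • ∑ i, (x i - y i) • G (some i) y + (ρ - 1) • G none y) := by
      rw [hy, Finset.smul_sum, Finset.smul_sum, Finset.smul_sum, ← Finset.sum_add_distrib,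
        Finset.smul_sum]
      refine (Finset.sum_sub_distrib _ _).symm.trans (Finset.sum_congr rfl fun i _ => ?_)
      change x i • ((ρ * k) • G (some i) y) - k • y i • G (some i) y = _
      module
    have hgy : g y = ∑ i, ‖G (some i) y‖ + ‖∑ i, y i • G (some i) y‖ := by
      simp only [g, Fintype.sum_option, ← hy]
      ring
    have hs0 := Real.sqrt_nonneg (scale j)
    rw [eT, norm_smul, Real.norm_of_nonneg hk]
    have hsum : ‖ρ • ∑ i, (x i - y i) • G (some i) y + (ρ - 1) • G none y‖
        ≤ 15 * √(scale j) * g y := by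
      refine (norm_add_le _ _).trans ?_
      rw [norm_smul, norm_smul, Real.norm_of_nonneg hρ.le, Real.norm_eq_abs]
      have t1 := r3 fun i => G (some i) y
      rw [← hgy] at t1
      have t2 := hgi none y
      have t3 : ρ * ‖∑ i, (x i - y i) • G (some i) y‖ ≤ 4 * (3 * √(scale j) * g y) :=
        mul_le_mul r1 t1 (norm_nonneg _) (by norm_num)
      have t4 : |ρ - 1| * ‖G none y‖ ≤ 3 * √(scale j) * g y :=
        mul_le_mul r2 t2 (norm_nonneg _) (by positivity)
      linarith
    calc _ ≤ k * (15 * √(scale j) * g y) := mul_le_mul_of_nonneg_left hsum hk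
      _ = _ := by ring

end Cutoff

/-! ### Approximation by smooth functions with compact support -/

section Approximants

variable {n : ℕ}

lemma integral_real_smul (c : ℝ) (f : E n → ℂ) :
    ∫ y, (c • f) y ∂hvol n = c • ∫ y, f y ∂hvol n := integral_smul c f

lemma abs_cut_le (J : ℝ) (x : E n) : |cut J x| ≤ 1 := by
  rw [abs_of_nonneg (show 0 ≤ cut J x from bump_nonneg _)]
  exact bump_le_one _

lemma hasCompactSupport_deriv_bump : HasCompactSupport (deriv bump) := by
  refine HasCompactSupport.intro (isCompact_Icc (a := (1 / 2 : ℝ)) (b := 1)) fun s hs => ?_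
  rcases lt_or_ge s (1 / 2) with h | h
  · have : bump =ᶠ[𝓝 s] fun _ => (1 : ℝ) := by
      filter_upwards [gt_mem_nhds h] with t ht
      exact bump_eq_one (le_of_lt ht)
    rw [this.deriv_eq, deriv_const]
  · have h1 : 1 < s := by
      by_contra h2
      exact hs ⟨h, not_lt.1 h2⟩
    have : bump =ᶠ[𝓝 s] fun _ => (0 : ℝ) := by
      filter_upwards [lt_mem_nhds h1] with t ht
      exact bump_eq_zero (le_of_lt ht)
    rw [this.deriv_eq, deriv_const]

lemma exists_bump_bound : ∃ B : ℝ, 0 ≤ B ∧ ∀ s, |deriv bump s| ≤ B ∧ |deriv (deriv bump) s| ≤ B ∧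
    (1 < s → deriv bump s = 0 ∧ deriv (deriv bump) s = 0) := by
  have h1 : ContDiff ℝ ∞ (deriv bump) := (contDiff_infty_iff_deriv.1 smooth_bump).2
  have h2 : ContDiff ℝ ∞ (deriv (deriv bump)) := (contDiff_infty_iff_deriv.1 h1).2
  obtain ⟨B, hB⟩ := hasCompactSupport_deriv_bump.exists_bound_of_continuous h1.continuous
  obtain ⟨B', hB'⟩ := hasCompactSupport_deriv_bump.deriv.exists_bound_of_continuous h2.continuous
  refine ⟨max B B', le_max_of_le_left ((norm_nonneg _).trans (hB 0)), fun s =>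
    ⟨(hB s).trans (le_max_left _ _), (hB' s).trans (le_max_right _ _), fun hs => ?_⟩⟩
  have e : bump =ᶠ[𝓝 s] fun _ => (0 : ℝ) := by
    filter_upwards [lt_mem_nhds hs] with t ht
    exact bump_eq_zero (le_of_lt ht)
  have e' : deriv bump =ᶠ[𝓝 s] fun _ => (0 : ℝ) := by
    have := e.deriv
    simpa using this
  exact ⟨e'.self_of_nhds, by rw [e'.deriv_eq, deriv_const]⟩

lemma lap_ht (x : E n) : (hframe n).lap ht x = n * ht x ∧
    (hframe n).grad ht ht x = ht x ^ 2 - 1 := by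
  have h0 : ∀ x : E n, coshd x 0 = ht x := fun x => by simp [coshd, ht]
  have h1 := lap_coshd x 0
  have h2 := grad_coshd x 0
  simp only [h0] at h1 h2
  exact ⟨h1, h2⟩

/-- The derivatives of the cutoffs along the frame are bounded uniformly in the cutoff radius. -/
lemma exists_cut_bound (n : ℕ) : ∃ B : ℝ, 0 ≤ B ∧ ∀ J : ℝ, 1 ≤ J → ∀ x : E n,
    (∀ i, |(hframe n).D i (cut J) x| ≤ B) ∧ |(hframe n).lap (cut J) x| ≤ B ∧
    (ht x < J → (∀ i, (hframe n).D i (cut J) x = 0) ∧ (hframe n).lap (cut J) x = 0) := by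
  obtain ⟨B, hB0, hB⟩ := exists_bump_bound
  have h1 : ContDiff ℝ ∞ (deriv bump) := (contDiff_infty_iff_deriv.1 smooth_bump).2
  refine ⟨(n + 1) * B, by positivity, fun J hJ x => ?_⟩
  have hJ0 : 0 < J := by linarith
  have hx := one_le_ht x
  set φ : ℝ → ℝ := fun s => bump (s / (2 * J))
  set φ₁ : ℝ → ℝ := fun s => deriv bump (s / (2 * J)) / (2 * J)
  have d0 : ∀ s, HasDerivAt φ (φ₁ s) s := fun s => by
    have := (smooth_bump.differentiable (by simp) (s / (2 * J))).hasDerivAt.comp s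
      ((hasDerivAt_id s).div_const (2 * J))
    exact this.congr_deriv (by simp only [φ₁]; ring)
  have d1 : ∀ s, HasDerivAt φ₁ (deriv (deriv bump) (s / (2 * J)) / (2 * J) / (2 * J)) s :=
      fun s => by
    have := ((h1.differentiable (by simp) (s / (2 * J))).hasDerivAt.comp s
      ((hasDerivAt_id s).div_const (2 * J))).div_const (2 * J)
    exact this.congr_deriv (by ring)
  have eD : ∀ i, (hframe n).D i (cut J) x = φ₁ (ht x) * (hframe n).D i ht x := fun i =>
    along_comp (d0 (ht x)) (smooth_ht.differentiable (by simp) x)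
  have eL : (hframe n).lap (cut J) x = φ₁ (ht x) * (n * ht x)
      + deriv (deriv bump) (ht x / (2 * J)) / (2 * J) / (2 * J) * (ht x ^ 2 - 1) := by
    have := (hframe n).lap_comp (w := x) smooth_ht (fun z => d0 (ht z)) (d1 (ht x))
    rw [(lap_ht x).1, (lap_ht x).2] at this
    exact this
  obtain ⟨b1, b2, b3⟩ := hB (ht x / (2 * J))
  have hφ₁ : |φ₁ (ht x)| * ht x ≤ B := by
    by_cases hc : 1 < ht x / (2 * J)
    · simp only [φ₁, (b3 hc).1]
      simpa using hB0
    · have hc' : ht x ≤ 2 * J := by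
        rw [not_lt, div_le_iff₀ (by positivity), one_mul] at hc
        exact hc
      simp only [φ₁, abs_div, abs_of_pos (show (0 : ℝ) < 2 * J by positivity)]
      rw [div_mul_eq_mul_div, div_le_iff₀ (by positivity)]
      exact mul_le_mul b1 hc' (by linarith) hB0
  have hDht : ∀ i, |(hframe n).D i ht x| ≤ ht x := by
    intro i
    have h2 : (hframe n).D i ht x ^ 2 ≤ ht x ^ 2 := by
      have h3 := (lap_ht x).2
      have h4 : (hframe n).D i ht x ^ 2 ≤ (hframe n).grad ht ht x := by
        refine le_trans ?_ (Finset.single_le_sum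
          (f := fun i => (hframe n).D i ht x • (hframe n).D i ht x)
          (fun i _ => mul_self_nonneg _) (Finset.mem_univ i))
        rw [sq, smul_eq_mul]
      linarith
    exact abs_le_of_sq_le_sq h2 (by linarith)
  refine ⟨fun i => ?_, ?_, fun hlt => ?_⟩
  · rw [eD, abs_mul]
    calc _ ≤ |φ₁ (ht x)| * ht x := mul_le_mul_of_nonneg_left (hDht i) (abs_nonneg _)
      _ ≤ B := hφ₁
      _ ≤ _ := by nlinarith [(Nat.cast_nonneg n : (0 : ℝ) ≤ n)]
  · rw [eL]
    have t1 : |φ₁ (ht x) * (n * ht x)| ≤ n * B := by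
      rw [abs_mul, abs_mul, Nat.abs_cast, abs_of_pos (ht_pos x)]
      nlinarith [(Nat.cast_nonneg n : (0 : ℝ) ≤ n)]
    have t2 : |deriv (deriv bump) (ht x / (2 * J)) / (2 * J) / (2 * J) * (ht x ^ 2 - 1)| ≤ B := by
      by_cases hc : 1 < ht x / (2 * J)
      · rw [(b3 hc).2]
        simpa using hB0
      · have hc' : ht x ≤ 2 * J := by
          rw [not_lt, div_le_iff₀ (by positivity), one_mul] at hc
          exact hc
        rw [abs_mul, abs_div, abs_div, abs_of_pos (show (0 : ℝ) < 2 * J by positivity),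
          abs_of_nonneg (show (0 : ℝ) ≤ ht x ^ 2 - 1 by nlinarith), div_div, div_mul_eq_mul_div,
          div_le_iff₀ (by positivity)]
        exact mul_le_mul b2 (by nlinarith) (by nlinarith) hB0
    exact (abs_add_le _ _).trans (by linarith)
  · have e : cut J =ᶠ[𝓝 x] fun _ => (1 : ℝ) := by
      filter_upwards [(isOpen_lt continuous_ht continuous_const).mem_nhds hlt] with z hz
      exact cut_eq_one hJ0 (le_of_lt hz)
    have e2 : φ =ᶠ[𝓝 (ht x)] fun _ => (1 : ℝ) := by
      filter_upwards [gt_mem_nhds hlt] with s hs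
      refine bump_eq_one ?_
      rw [div_le_iff₀ (by positivity)]
      linarith [show s < J from hs]
    have e3 : φ₁ =ᶠ[𝓝 (ht x)] fun _ => (0 : ℝ) := by
      have h4 := e2.deriv
      have h5 : deriv φ = φ₁ := funext fun s => (d0 s).deriv
      rw [h5] at h4
      simpa using h4
    have e4 : deriv (deriv bump) (ht x / (2 * J)) / (2 * J) / (2 * J) = 0 := by
      rw [← (d1 (ht x)).deriv, e3.deriv_eq, deriv_const]
    refine ⟨fun i => ?_, ?_⟩
    · rw [eD, e3.self_of_nhds, zero_mul]
    · rw [eL, e3.self_of_nhds, e4, zero_mul, zero_mul, add_zero]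

/-- The kernels of the approximations: the mollifier with a cutoff. -/
def mollKer (n : ℕ) (j : ℕ) : E n × E n → ℝ := cutRad ((j : ℝ) + 1) (mol n (scale j))

lemma smooth_mollKer (n j : ℕ) : ContDiff ℝ ∞ (mollKer n j) := smooth_cutRad _ (smooth_mol n _)

lemma hasCompactSupport_mollKer (n j : ℕ) : HasCompactSupport (mollKer n j) :=
  hasCompactSupport_cutRad (by positivity) (mol_support n (scale_pos j) (scale_le_one j))

/-- The approximations of `u` by smooth functions with compact support. -/
def moll (j : ℕ) (u : E n → ℂ) : E n → ℂ := kint (mollKer n j) u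

/-- The kernel of the commutator of the Laplacian and `moll j`. -/
def commKer (n : ℕ) (j : ℕ) (w : E n × E n) : ℝ :=
  lapFst (mollKer n j) w - lapSnd (mollKer n j) w

lemma smooth_commKer (n j : ℕ) : ContDiff ℝ ∞ (commKer n j) :=
  (smooth_lapFst (smooth_mollKer n j)).sub (smooth_lapSnd (smooth_mollKer n j))

lemma hasCompactSupport_commKer (n j : ℕ) : HasCompactSupport (commKer n j) :=
  (hasCompactSupport_lapFst (hasCompactSupport_mollKer n j)).sub
    (hasCompactSupport_lapSnd (hasCompactSupport_mollKer n j))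

/-- The inhomogeneity in the equation of the approximations. -/
def src (j : ℕ) (u F : E n → ℂ) (x : E n) : ℂ := kint (mollKer n j) F x + kint (commKer n j) u x

lemma tendsto_of_eventually_const {f : ℕ → ℝ} {x : E n} {c : ℝ}
    (h : ∀ j : ℕ, ht x < (j : ℝ) + 1 → f j = c) : Tendsto f atTop (𝓝 c) := by
  refine tendsto_const_nhds.congr' ?_
  obtain ⟨N, hN⟩ := exists_nat_gt (ht x)
  filter_upwards [eventually_ge_atTop N] with j hj
  refine (h j ?_).symm
  have : (N : ℝ) ≤ j := by exact_mod_cast hj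
  linarith

lemma moll_apply (j : ℕ) (u : E n → ℂ) (x : E n) :
    moll j u x = (cut ((j : ℝ) + 1) x : ℂ) * kint (rad (mol n (scale j))) u x := by
  simp only [moll, kint, mollKer, cutRad, mul_smul]
  rw [integral_smul, Complex.real_smul]

lemma l2Lim_moll {u : E n → ℂ} (hu : MemLp u 2 (hvol n)) :
    L2Lim (hvol n) (fun j => moll j u) u (eLpNorm u 2 (hvol n)) := by
  have := (l2Lim_kint_mol hu).seq_mul (b := fun j => cut ((j : ℝ) + 1)) (β := fun _ => 1) (C := 1)
    (fun j => (smooth_cut _).continuous.aestronglyMeasurable)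
    (fun j x => abs_cut_le _ x)
    (fun x => tendsto_of_eventually_const fun j hj => cut_eq_one (by positivity) hj.le)
  simpa [← moll_apply] using this

lemma D_moll_apply (j : ℕ) {u : E n → ℂ} (hu : LocallyIntegrable u (hvol n)) (i : Option (Fin n))
    (x : E n) : (hframe n).D i (moll j u) x
      = (((hframe n).D i (cut ((j : ℝ) + 1)) x : ℝ) : ℂ) * kint (rad (mol n (scale j))) u x
        + (cut ((j : ℝ) + 1) x : ℂ) * kint ((hframe2 n).D (.inl i) (rad (mol n (scale j)))) u
            x := by
  have hs := smooth_rad (n := n) (smooth_mol n (scale j))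
  have hs1 : ContDiff ℝ ∞ fun w : E n × E n => cut ((j : ℝ) + 1) w.1 :=
    (smooth_cut _).comp contDiff_fst
  rw [moll, D_kint (smooth_mollKer n j) (hasCompactSupport_mollKer n j) hu]
  have e : ∀ y, (hframe2 n).D (.inl i) (mollKer n j) (x, y)
      = (hframe n).D i (cut ((j : ℝ) + 1)) x * rad (mol n (scale j)) (x, y)
        + cut ((j : ℝ) + 1) x * (hframe2 n).D (.inl i) (rad (mol n (scale j))) (x, y) := by
    intro y
    have h1 : (hframe2 n).D (.inl i) (mollKer n j) (x, y) = _ :=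
      along_mul (hs1.differentiable (by simp) (x, y)) (hs.differentiable (by simp) (x, y))
    rw [h1]
    have h2 : along ((hframe2 n).Z (.inl i)) (fun w : E n × E n => cut ((j : ℝ) + 1) w.1) (x, y)
        = (hframe n).D i (cut ((j : ℝ) + 1)) x := (D_fst_apply hs1 i x y).symm
    have h3 : along ((hframe2 n).Z (.inl i)) (rad (mol n (scale j))) (x, y)
        = (hframe2 n).D (.inl i) (rad (mol n (scale j))) (x, y) := rfl
    rw [h2, h3]
    ring
  simp only [kint, e, add_smul, mul_smul]
  have i1 := (integrable_kint (continuous_rad_mol n _) (hasCompactSupport_rad_mol j x) hu)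
  have i2 := (integrable_kint ((hframe2 n).smooth_D (.inl i) hs).continuous
    (hasCompactSupport_D_rad_mol j i x) hu)
  simp only [← Complex.real_smul]
  refine (integral_add (i1.smul ((hframe n).D i (cut ((j : ℝ) + 1)) x))
    (i2.smul (cut ((j : ℝ) + 1) x))).trans ?_
  congr 1
  · exact integral_real_smul _ _
  · exact integral_real_smul _ _

/-- The radial kernel commutes with the Laplacian, so that only derivatives of the cutoff are
left. -/
lemma commKer_apply (j : ℕ) (x y : E n) : commKer n j (x, y)
    = ∑ i, 2 * ((hframe n).D i (cut ((j : ℝ) + 1)) x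
        * (hframe2 n).D (.inl i) (rad (mol n (scale j))) (x, y))
      + (hframe n).lap (cut ((j : ℝ) + 1)) x * rad (mol n (scale j)) (x, y) := by
  have hs := smooth_rad (n := n) (smooth_mol n (scale j))
  have h1 := lap_rad_symm (smooth_mol n (scale j)) x y
  rw [commKer, lapFst_apply (smooth_mollKer n j), lapSnd_apply (smooth_mollKer n j)]
  have e1 : (hframe n).lap (fun x => mollKer n j (x, y)) x = _ :=
    Frame.lap_mul (smooth_cut ((j : ℝ) + 1)) (hs.comp (contDiff_prodMk_left y)) x
  have e2 : (hframe n).lap (fun y => mollKer n j (x, y)) y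
      = cut ((j : ℝ) + 1) x * (hframe n).lap (fun y => rad (mol n (scale j)) (x, y)) y := by
    have h2 : (hframe n).lap (fun y => mollKer n j (x, y)) y = _ :=
      Frame.lap_mul (contDiff_const (c := cut ((j : ℝ) + 1) x)) (hs.comp (contDiff_prodMk_right x))
          y
    rw [h2]
    have h3 : ∀ i, (hframe n).D i (fun _ : E n => cut ((j : ℝ) + 1) x) = 0 := fun i => by
      funext z
      simp [Frame.D, along]
    have h4 : ∀ i, (hframe n).D i (0 : E n → ℝ) = 0 := fun i => by
      funext z
      simp [Frame.D, along]
    have h5 : (hframe n).lap (fun _ : E n => cut ((j : ℝ) + 1) x) y = 0 := by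
      simp only [Frame.lap, h3, h4]
      simp
    rw [h5]
    simp only [Frame.grad, h3]
    simp [Function.comp_def]
  rw [e1, e2]
  simp only [Function.comp_def]
  rw [h1, Frame.grad]
  simp only [← D_fst_apply hs, smul_eq_mul, ← Finset.mul_sum]
  ring

lemma l2Lim_D_moll (n : ℕ) : ∃ C : ℝ≥0, ∀ (u : E n → ℂ) (G : Option (Fin n) → E n → ℂ),
    IsWeakJet u G → ∀ i, L2Lim (hvol n) (fun j => (hframe n).D i (moll j u)) (G i)
      (C * (eLpNorm u 2 (hvol n) + ∑ i, eLpNorm (G i) 2 (hvol n))) := by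
  obtain ⟨B, hB0, hB⟩ := exists_cut_bound n
  refine ⟨B.toNNReal + 16, fun u G hu i => ?_⟩
  have hJ : ∀ j : ℕ, (1 : ℝ) ≤ (j : ℝ) + 1 := fun j => by linarith
      [(Nat.cast_nonneg j : (0 : ℝ) ≤ j)]
  have h1 := (l2Lim_kint_mol hu.memLp).seq_mul (b := fun j => (hframe n).D i (cut ((j : ℝ) + 1)))
    (β := fun _ => 0) (C := B)
    (fun j => ((hframe n).smooth_D i (smooth_cut _)).continuous.aestronglyMeasurable)
    (fun j x => (hB _ (hJ j) x).1 i)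
    (fun x => tendsto_of_eventually_const fun j hj => ((hB _ (hJ j) x).2.2 hj).1 i)
  have h2 := (l2Lim_D_mol hu i).seq_mul (b := fun j => cut ((j : ℝ) + 1)) (β := fun _ => 1) (C := 1)
    (fun j => (smooth_cut _).continuous.aestronglyMeasurable)
    (fun j x => abs_cut_le _ x)
    (fun x => tendsto_of_eventually_const fun j hj => cut_eq_one (by positivity) hj.le)
  have h3 := h1.add h2
  simp only [← D_moll_apply _ (locallyIntegrable_of_memLp hu.memLp)] at h3
  simp only [Complex.ofReal_zero, zero_mul, Complex.ofReal_one, one_mul, zero_add] at h3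
  refine h3.mono ?_
  rw [ENNReal.ofReal_one, one_mul, ENNReal.coe_add, add_mul, mul_add, mul_add]
  exact add_le_add le_self_add le_add_self

/-- The commutator terms vanish in the limit, since the derivatives of the cutoffs are bounded and
supported far out. -/
lemma l2Lim_src (n : ℕ) : ∃ C : ℝ≥0, ∀ (u : E n → ℂ) (G : Option (Fin n) → E n → ℂ)
    (F : E n → ℂ), IsWeakJet u G → MemLp F 2 (hvol n) → L2Lim (hvol n) (fun j => src j u F) F
      (C * (eLpNorm F 2 (hvol n) + (eLpNorm u 2 (hvol n) + ∑ i, eLpNorm (G i) 2 (hvol n)))) := by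
  obtain ⟨B, hB0, hB⟩ := exists_cut_bound n
  refine ⟨1 + B.toNNReal + (n + 1) * (32 * B.toNNReal), fun u G F hu hF => ?_⟩
  have hJ : ∀ j : ℕ, (1 : ℝ) ≤ (j : ℝ) + 1 := fun j => by linarith
      [(Nat.cast_nonneg j : (0 : ℝ) ≤ j)]
  have h1 := (l2Lim_kint_mol hu.memLp).seq_mul (b := fun j => (hframe n).lap (cut ((j : ℝ) + 1)))
    (β := fun _ => 0) (C := B)
    (fun j => ((hframe n).smooth_lap (smooth_cut _)).continuous.aestronglyMeasurable)
    (fun j x => (hB _ (hJ j) x).2.1)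
    (fun x => tendsto_of_eventually_const fun j hj => ((hB _ (hJ j) x).2.2 hj).2)
  have h2 : ∀ i, _ := fun i => (l2Lim_D_mol hu i).seq_mul
    (b := fun j x => 2 * (hframe n).D i (cut ((j : ℝ) + 1)) x)
    (β := fun _ => 0) (C := 2 * B)
    (fun j => (((hframe n).smooth_D i (smooth_cut _)).continuous.const_mul 2).aestronglyMeasurable)
    (fun j x => by
      rw [abs_mul, abs_two]
      exact mul_le_mul_of_nonneg_left ((hB _ (hJ j) x).1 i) zero_le_two)
    (fun x => tendsto_of_eventually_const fun j hj => by rw [((hB _ (hJ j) x).2.2 hj).1 i,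
        mul_zero])
  have h3 := (l2Lim_moll hF).add ((L2Lim.sum Finset.univ fun i _ => h2 i).add h1)
  have e : ∀ j x, src j u F x = moll j F x + (∑ i,
      ((2 * (hframe n).D i (cut ((j : ℝ) + 1)) x : ℝ) : ℂ)
      * kint ((hframe2 n).D (.inl i) (rad (mol n (scale j)))) u x
      + (((hframe n).lap (cut ((j : ℝ) + 1)) x : ℝ) : ℂ) * kint (rad (mol n (scale j))) u x) := by
    intro j x
    have hu' := locallyIntegrable_of_memLp hu.memLp
    have hs := smooth_rad (n := n) (smooth_mol n (scale j))
    rw [src, moll]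
    congr 1
    have i1 := (integrable_kint (continuous_rad_mol n _) (hasCompactSupport_rad_mol j x) hu')
    have i2 := fun i => (integrable_kint ((hframe2 n).smooth_D (.inl i) hs).continuous
      (hasCompactSupport_D_rad_mol j i x) hu')
    have e1 : ∀ y, commKer n j (x, y) • u y
        = ∑ i, (2 * (hframe n).D i (cut ((j : ℝ) + 1)) x)
            • ((hframe2 n).D (.inl i) (rad (mol n (scale j))) (x, y) • u y)
          + (hframe n).lap (cut ((j : ℝ) + 1)) x • (rad (mol n (scale j)) (x, y) • u y) := by
      intro y
      rw [commKer_apply, add_smul, Finset.sum_smul, mul_smul]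
      congr 1
      refine Finset.sum_congr rfl fun i _ => ?_
      rw [smul_smul]
      ring_nf
    simp only [kint, e1, ← Complex.real_smul]
    refine (integral_add (integrable_finsetSum _ fun i _ =>
      (i2 i).smul (2 * (hframe n).D i (cut ((j : ℝ) + 1)) x))
      (i1.smul ((hframe n).lap (cut ((j : ℝ) + 1)) x))).trans ?_
    congr 1
    · refine (integral_finsetSum _ fun i _ =>
        (i2 i).smul (2 * (hframe n).D i (cut ((j : ℝ) + 1)) x)).trans ?_
      exact Finset.sum_congr rfl fun i _ => integral_real_smul _ _
    · exact integral_real_smul _ _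
  simp only [← e] at h3
  simp only [Complex.ofReal_zero, zero_mul, Finset.sum_const_zero, add_zero] at h3
  refine h3.mono ?_
  set S := ∑ i, eLpNorm (G i) 2 (hvol n)
  set U := eLpNorm u 2 (hvol n)
  set f := eLpNorm F 2 (hvol n)
  have e2 : ENNReal.ofReal (2 * B) = 2 * (B.toNNReal : ℝ≥0∞) := by
    rw [ENNReal.ofReal_mul zero_le_two, ENNReal.ofReal_ofNat]
    rfl
  calc f + (∑ _i : Option (Fin n), ENNReal.ofReal (2 * B) * (16 * S) + ENNReal.ofReal B * U)
      = 1 * f + B.toNNReal * U + ((n : ℝ≥0∞) + 1) * (32 * B.toNNReal) * S := by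
        rw [Finset.sum_const, e2, Finset.card_univ, Fintype.card_option, Fintype.card_fin,
          nsmul_eq_mul, show ENNReal.ofReal B = (B.toNNReal : ℝ≥0∞) from rfl]
        push_cast
        ring
    _ ≤ 1 * (f + (U + S)) + B.toNNReal * (f + (U + S))
        + ((n : ℝ≥0∞) + 1) * (32 * B.toNNReal) * (f + (U + S)) := by
        gcongr
        · exact le_self_add
        · exact le_self_add.trans le_add_self
        · exact le_add_self.trans le_add_self
    _ = _ := by
        push_cast
        ring

end Approximants

/-! ### The regularized nonlinearity -/

section RegPow

/-- A bounded, smooth and increasing approximation of the power `s ^ σ` on `s ≥ 0`. The summand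
`1 / M` keeps the base away from `0`, where the power is not smooth. -/
def regPow (σ M s : ℝ) : ℝ := (s / (1 + s / M) + 1 / M) ^ σ

variable {σ M : ℝ}

lemma regBase_bounds (hM : 1 ≤ M) {s : ℝ} (hs : 0 ≤ s) :
    0 < s / (1 + s / M) + 1 / M ∧ s / (1 + s / M) + 1 / M ≤ s + 1 ∧
      s / (1 + s / M) + 1 / M ≤ M + 1 := by
  have hM0 : 0 < M := by linarith
  have h1 : 0 ≤ s / M := by positivity
  have h2 : 1 / M ≤ 1 := by rw [div_le_one hM0]; exact hM
  refine ⟨by positivity, add_le_add (div_le_self hs (by linarith)) h2, add_le_add ?_ h2⟩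
  rw [div_le_iff₀ (by positivity)]
  field_simp
  nlinarith

lemma regPow_nonneg (hM : 1 ≤ M) {s : ℝ} (hs : 0 ≤ s) : 0 ≤ regPow σ M s :=
  Real.rpow_nonneg (regBase_bounds hM hs).1.le _

lemma regPow_le (hσ : 0 < σ) (hM : 1 ≤ M) {s : ℝ} (hs : 0 ≤ s) : regPow σ M s ≤ (M + 1) ^ σ :=
  Real.rpow_le_rpow (regBase_bounds hM hs).1.le (regBase_bounds hM hs).2.2 hσ.le

lemma regPow_mono (hσ : 0 < σ) (hM : 1 ≤ M) {s t : ℝ} (hs : 0 ≤ s) (hst : s ≤ t) :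
    regPow σ M s ≤ regPow σ M t := by
  have hM0 : 0 < M := by linarith
  refine Real.rpow_le_rpow (regBase_bounds hM hs).1.le (add_le_add ?_ le_rfl) hσ.le
  have ht := hs.trans hst
  rw [div_le_div_iff₀ (by positivity) (by positivity)]
  field_simp
  nlinarith

lemma hasDerivAt_regPow (hM : 1 ≤ M) {s : ℝ} (hs : 0 ≤ s) :
    HasDerivAt (regPow σ M)
      (1 / (1 + s / M) ^ 2 * σ * (s / (1 + s / M) + 1 / M) ^ (σ - 1)) s := by
  have hM0 : 0 < M := by linarith
  have h1 : (1 + s / M) ≠ 0 := by positivity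
  have h2 : HasDerivAt (fun s => s / (1 + s / M) + 1 / M) (1 / (1 + s / M) ^ 2) s := by
    have := (((hasDerivAt_id s).div (((hasDerivAt_id s).div_const M).const_add 1) h1)).add_const
      (1 / M)
    refine this.congr_deriv ?_
    simp only [id]
    field_simp
    ring
  exact h2.rpow_const (.inl (regBase_bounds hM hs).1.ne')

/-- The regularized nonlinearity. -/
def regNl (σ M : ℝ) (z : ℂ) : ℂ := (regPow σ M (‖z‖ ^ 2) : ℂ) * z

lemma lipschitzWith_regNl (hσ : 0 < σ) (hM : 1 ≤ M) :
    LipschitzWith ((1 + 2 * σ) * (M + 1) ^ σ).toNNReal (regNl σ M) := by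
  have hM0 : 0 < M := by linarith
  set K := (M + 1) ^ σ
  have hK : 0 ≤ K := by positivity
  have key : ∀ s r : ℝ, 0 ≤ s → s ≤ r →
      (regPow σ M (r ^ 2) - regPow σ M (s ^ 2)) * s ≤ 2 * σ * K * (r - s) := by
    intro s r hs hsr
    rcases hsr.eq_or_lt with rfl | hlt
    · simp
    have hd : ∀ t, HasDerivAt (fun r => regPow σ M (r ^ 2))
        (1 / (1 + t ^ 2 / M) ^ 2 * σ * (t ^ 2 / (1 + t ^ 2 / M) + 1 / M) ^ (σ - 1) * (2 * t))
            t := by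
      intro t
      have := HasDerivAt.comp (h := fun x => x ^ 2) t (hasDerivAt_regPow (σ := σ) hM (sq_nonneg t))
        (hasDerivAt_pow 2 t)
      refine this.congr_deriv ?_
      simp
    obtain ⟨ξ, ⟨h1, h2⟩, h3⟩ := exists_hasDerivAt_eq_slope (fun r => regPow σ M (r ^ 2)) _ hlt
      (fun t _ => (hd t).continuousAt.continuousWithinAt) (fun t _ => hd t)
    have hr : 0 < r - s := by linarith
    have hξ : 0 ≤ ξ := by linarith
    rw [eq_div_iff hr.ne'] at h3
    rw [← h3]
    set b := ξ ^ 2 / (1 + ξ ^ 2 / M) + 1 / M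
    obtain ⟨b0, -, b2⟩ := regBase_bounds hM (sq_nonneg ξ)
    have e : b ^ (σ - 1) * b = b ^ σ := by
      have hb : b ≠ 0 := b0.ne'
      rw [Real.rpow_sub_one hb, div_mul_cancel₀ _ hb]
    have hb1 : 1 / (1 + ξ ^ 2 / M) ^ 2 * ξ ^ 2 ≤ b := by
      have h4 : 1 / (1 + ξ ^ 2 / M) ^ 2 * ξ ^ 2 ≤ ξ ^ 2 / (1 + ξ ^ 2 / M) := by
        rw [div_mul_eq_mul_div, one_mul]
        refine div_le_div_of_nonneg_left (sq_nonneg _) (by positivity) ?_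
        have : 0 ≤ ξ ^ 2 / M := by positivity
        nlinarith
      have : 0 ≤ 1 / M := by positivity
      linarith
    have hbK : b ^ σ ≤ K := Real.rpow_le_rpow b0.le b2 hσ.le
    have hbp : 0 ≤ b ^ (σ - 1) := Real.rpow_nonneg b0.le _
    have hq : 0 ≤ 1 / (1 + ξ ^ 2 / M) ^ 2 := by positivity
    have step : 1 / (1 + ξ ^ 2 / M) ^ 2 * σ * b ^ (σ - 1) * (2 * ξ) * s ≤ 2 * σ * K := by
      calc _ ≤ 1 / (1 + ξ ^ 2 / M) ^ 2 * σ * b ^ (σ - 1) * (2 * ξ) * ξ :=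
            mul_le_mul_of_nonneg_left h1.le (by positivity)
        _ = 2 * σ * (b ^ (σ - 1) * (1 / (1 + ξ ^ 2 / M) ^ 2 * ξ ^ 2)) := by ring
        _ ≤ 2 * σ * (b ^ (σ - 1) * b) := by gcongr
        _ ≤ 2 * σ * K := by rw [e]; gcongr
    calc _ = (1 / (1 + ξ ^ 2 / M) ^ 2 * σ * b ^ (σ - 1) * (2 * ξ) * s) * (r - s) := by ring
      _ ≤ _ := mul_le_mul_of_nonneg_right step hr.le
  have main : ∀ z w : ℂ, ‖w‖ ≤ ‖z‖ → ‖regNl σ M z - regNl σ M w‖ ≤ (1 + 2 * σ) * K * ‖z - w‖ := by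
    intro z w hzw
    have e : regNl σ M z - regNl σ M w = (regPow σ M (‖z‖ ^ 2) : ℂ) * (z - w)
        + ((regPow σ M (‖z‖ ^ 2) - regPow σ M (‖w‖ ^ 2) : ℝ) : ℂ) * w := by
      simp only [regNl]; push_cast; ring
    have hm := regPow_mono hσ hM (sq_nonneg ‖w‖) (pow_le_pow_left₀ (norm_nonneg _) hzw 2)
    rw [e]
    refine (norm_add_le _ _).trans ?_
    rw [norm_mul, norm_mul, Complex.norm_real, Complex.norm_real,
      Real.norm_of_nonneg (regPow_nonneg hM (sq_nonneg _)), Real.norm_of_nonneg (sub_nonneg.2 hm)]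
    have h1 := key ‖w‖ ‖z‖ (norm_nonneg _) hzw
    have h2 : ‖z‖ - ‖w‖ ≤ ‖z - w‖ := norm_sub_norm_le z w
    have h3 := regPow_le hσ hM (sq_nonneg ‖z‖)
    have h4 : regPow σ M (‖z‖ ^ 2) * ‖z - w‖ ≤ K * ‖z - w‖ :=
      mul_le_mul_of_nonneg_right h3 (norm_nonneg _)
    have h5 : 2 * σ * K * (‖z‖ - ‖w‖) ≤ 2 * σ * K * ‖z - w‖ :=
      mul_le_mul_of_nonneg_left h2 (by positivity)
    linarith
  refine LipschitzWith.of_dist_le_mul fun z w => ?_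
  rw [Real.coe_toNNReal _ (by positivity), dist_eq_norm, dist_eq_norm]
  rcases le_total ‖w‖ ‖z‖ with h | h
  · exact main z w h
  · rw [norm_sub_rev, norm_sub_rev z w]
    exact main w z h

lemma regNl_zero : regNl σ M 0 = 0 := by simp [regNl]

/-- The regularized nonlinearities converge, with a bound. -/
lemma tendsto_regNl (hσ : 0 < σ) (z : ℂ) :
    Tendsto (fun N : ℕ => regNl σ ((N : ℝ) + 1) z) atTop (𝓝 (((‖z‖ ^ (2 * σ) : ℝ) : ℂ) * z)) := by
  have h1 : Tendsto (fun N : ℕ => 1 / ((N : ℝ) + 1)) atTop (𝓝 0) :=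
    tendsto_one_div_add_atTop_nhds_zero_nat
  have h2 : Tendsto (fun N : ℕ => ‖z‖ ^ 2 / (1 + ‖z‖ ^ 2 / ((N : ℝ) + 1)) + 1 / ((N : ℝ) + 1)) atTop
      (𝓝 (‖z‖ ^ 2)) := by
    have h3 : Tendsto (fun N : ℕ => 1 + ‖z‖ ^ 2 / ((N : ℝ) + 1)) atTop (𝓝 1) := by
      have := (h1.const_mul (‖z‖ ^ 2)).const_add 1
      simpa [div_eq_mul_inv] using this
    have := ((tendsto_const_nhds (x := ‖z‖ ^ 2)).div h3 one_ne_zero).add h1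
    simpa using this
  have h3 := h2.rpow_const (p := σ) (.inr hσ.le)
  have h4 : (‖z‖ ^ 2) ^ σ = ‖z‖ ^ (2 * σ) := by
    rw [Real.rpow_mul (norm_nonneg _)]
    norm_num
  rw [h4] at h3
  exact ((Complex.continuous_ofReal.tendsto _).comp h3).mul_const z

lemma norm_regNl_le (hσ : 0 < σ) (hM : 1 ≤ M) (z : ℂ) :
    ‖regNl σ M z‖ ≤ 2 ^ σ * (‖z‖ ^ (2 * σ) * ‖z‖ + ‖z‖) := by
  have h4 : (‖z‖ ^ 2) ^ σ = ‖z‖ ^ (2 * σ) := by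
    rw [Real.rpow_mul (norm_nonneg _)]
    norm_num
  obtain ⟨b0, b1, -⟩ := regBase_bounds hM (sq_nonneg ‖z‖)
  have h1 : regPow σ M (‖z‖ ^ 2) ≤ 2 ^ σ * (‖z‖ ^ (2 * σ) + 1) := by
    calc _ ≤ (‖z‖ ^ 2 + 1) ^ σ := Real.rpow_le_rpow b0.le b1 hσ.le
      _ ≤ (2 * max (‖z‖ ^ 2) 1) ^ σ := by
          refine Real.rpow_le_rpow (by positivity) ?_ hσ.le
          linarith [le_max_left (‖z‖ ^ 2) 1, le_max_right (‖z‖ ^ 2) 1]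
      _ = 2 ^ σ * max (‖z‖ ^ 2) 1 ^ σ := Real.mul_rpow zero_le_two (by positivity)
      _ ≤ _ := by
          refine mul_le_mul_of_nonneg_left ?_ (by positivity)
          have h5 : 0 ≤ ‖z‖ ^ (2 * σ) := Real.rpow_nonneg (norm_nonneg _) _
          rcases max_choice (‖z‖ ^ 2) 1 with h | h
          · rw [h, h4]; linarith
          · rw [h, Real.one_rpow]; linarith
  rw [regNl, norm_mul, Complex.norm_real, Real.norm_of_nonneg (regPow_nonneg hM (sq_nonneg _))]
  calc _ ≤ 2 ^ σ * (‖z‖ ^ (2 * σ) + 1) * ‖z‖ := mul_le_mul_of_nonneg_right h1 (norm_nonneg _)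
    _ = _ := by ring

end RegPow

section Weighted

variable {W : Type*} [NormedAddCommGroup W] [NormedSpace ℝ W] [MeasurableSpace W] [BorelSpace W]
  {ι : Type*} [Fintype ι] [DecidableEq ι] (X : Frame W ι)

/-- Integration by parts where the fields outside `A` do not see `P`, and the fields in `A` turn
`P ∇h` into the gradient of `Θ`. -/
lemma Frame.integral_weighted {a P h Θ : W → ℝ} (A : Finset ι) (ha : ContDiff ℝ ∞ a)
    (hP : ContDiff ℝ ∞ P) (hh : ContDiff ℝ ∞ h) (ch : HasCompactSupport h) (hΘ : ContDiff ℝ 1 Θ)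
    (cΘ : HasCompactSupport Θ) (hA : ∀ α ∈ A, ∀ w, X.D α Θ w = P w * X.D α h w)
    (hA' : ∀ α ∉ A, ∀ w, X.D α P w = 0) :
    ∫ w, P w * (X.grad a h w + X.lap a w * h w) ∂X.vol
      = ∫ w, (∑ α ∈ A, (X.D α (X.D α a) w + X.div α w * X.D α a w)) * (P w * h w - Θ w) ∂X.vol := by
  set l : ι → W → ℝ := fun α w => X.D α (X.D α a) w + X.div α w * X.D α a w
  have hl : ∀ α, Continuous (l α) := fun α => (X.smooth_D _ (X.smooth_D _ ha)).continuous.add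
    ((X.smooth_div α).continuous.mul (X.smooth_D _ ha).continuous)
  have cont : ∀ α {f : W → ℝ}, ContDiff ℝ ∞ f → Continuous (X.D α f) := fun α f hf =>
    (X.smooth_D α hf).continuous
  have ibp : ∀ α {f : W → ℝ}, ContDiff ℝ 1 f → HasCompactSupport f →
      ∫ w, (X.D α f w * X.D α a w + l α w * f w) ∂X.vol = 0 := by
    intro α f hf cf
    have hDa := X.contDiff_one_D α ha
    have := X.integral_along α (fun w => f w * X.D α a w) (hf.mul hDa) cf.mul_right
    rw [← this]
    refine integral_congr_ae (.of_forall fun w => ?_)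
    have e : along (X.Z α) (fun w => f w * X.D α a w) w
        = f w * X.D α (X.D α a) w + X.D α a w * X.D α f w :=
      along_mul (hf.differentiable one_ne_zero w) (hDa.differentiable one_ne_zero w)
    simp only [e, l]
    ring
  have iP : ∀ α, Integrable (fun w => P w * (X.D α a w * X.D α h w + l α w * h w)) X.vol := by
    intro α
    refine X.integrable_of_compact (hP.continuous.mul (((cont α ha).mul (cont α hh)).add
      ((hl α).mul hh.continuous))) (HasCompactSupport.mul_left (HasCompactSupport.add ?_ ?_))
    · exact HasCompactSupport.mul_left (f := X.D α a) (X.hasCompactSupport_D α ch)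
    · exact HasCompactSupport.mul_left (f := l α) ch
  have iT : ∀ α, Integrable (fun w => l α w * (P w * h w - Θ w)) X.vol := by
    intro α
    refine X.integrable_of_compact ((hl α).mul ((hP.continuous.mul hh.continuous).sub
        hΘ.continuous))
      (HasCompactSupport.mul_left (HasCompactSupport.sub ?_ cΘ))
    exact HasCompactSupport.mul_left (f := P) ch
  have hin : ∀ α ∈ A, ∫ w, P w * (X.D α a w * X.D α h w + l α w * h w) ∂X.vol
      = ∫ w, l α w * (P w * h w - Θ w) ∂X.vol := by
    intro α hα
    have h1 := ibp α hΘ cΘ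
    rw [← add_zero (∫ w, l α w * (P w * h w - Θ w) ∂X.vol), ← h1, ← integral_add (iT α)]
    · refine integral_congr_ae (.of_forall fun w => ?_)
      simp only [hA α hα w]
      ring
    · refine X.integrable_of_compact (((X.continuous_D α hΘ).mul (cont α ha)).add
        ((hl α).mul hΘ.continuous)) (HasCompactSupport.add ?_ ?_)
      · exact HasCompactSupport.mul_right (f := X.D α Θ) (X.hasCompactSupport_D α cΘ)
      · exact HasCompactSupport.mul_left (f := l α) cΘ
  have hout : ∀ α ∉ A, ∫ w, P w * (X.D α a w * X.D α h w + l α w * h w) ∂X.vol = 0 := by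
    intro α hα
    rw [← ibp α (f := fun w => P w * h w) ((hP.mul hh).of_le (by simp)) ch.mul_left]
    refine integral_congr_ae (.of_forall fun w => ?_)
    have e : X.D α (fun w => P w * h w) w = P w * X.D α h w + h w * X.D α P w :=
      along_mul (hP.differentiable (by simp) w) (hh.differentiable (by simp) w)
    simp only [e, hA' α hα w]
    ring
  calc _ = ∫ w, ∑ α, P w * (X.D α a w * X.D α h w + l α w * h w) ∂X.vol := by
        refine integral_congr_ae (.of_forall fun w => ?_)
        simp only [Frame.grad, Frame.lap, smul_eq_mul, ← Finset.mul_sum, Finset.sum_add_distrib, l,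
          add_mul, Finset.sum_mul]
    _ = ∑ α, ∫ w, P w * (X.D α a w * X.D α h w + l α w * h w) ∂X.vol :=
        integral_finsetSum _ fun α _ => iP α
    _ = ∑ α ∈ A, ∫ w, l α w * (P w * h w - Θ w) ∂X.vol := by
        rw [← Finset.sum_subset (Finset.subset_univ A) fun α _ hα => hout α hα]
        exact Finset.sum_congr rfl hin
    _ = _ := by
        rw [← integral_finsetSum _ fun α _ => iT α]
        simp only [Finset.sum_mul, l]

end Weighted

/-! ### The forcing term of the virial identity and its sign -/

section Tens

variable {n : ℕ}

lemma smooth_tens {f g : E n → ℂ} (hf : ContDiff ℝ ∞ f) (hg : ContDiff ℝ ∞ g) :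
    ContDiff ℝ ∞ (tens f g) := (hf.comp contDiff_fst).mul (hg.comp contDiff_snd)

lemma hasCompactSupport_tens {f g : E n → ℂ} (hf : HasCompactSupport f)
    (hg : HasCompactSupport g) : HasCompactSupport (tens f g) := by
  refine HasCompactSupport.intro (hf.isCompact.prod hg.isCompact) fun w hw => ?_
  rw [Set.mem_prod, not_and_or] at hw
  rcases hw with h | h
  · simp [tens, image_eq_zero_of_notMem_tsupport h]
  · simp [tens, image_eq_zero_of_notMem_tsupport h]

lemma D_inl_tens {f g : E n → ℂ} (hf : ContDiff ℝ ∞ f) (hg : ContDiff ℝ ∞ g)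
    (i : Option (Fin n)) :
    (hframe2 n).D (.inl i) (tens f g) = tens ((hframe n).D i f) g := by
  funext w
  rw [hframe2, Frame.prod_D_inl _ _ _ ((smooth_tens hf hg).differentiable (by simp) w)]
  exact along_clm ((ContinuousLinearMap.mul ℝ ℂ).flip (g w.2)) (hf.differentiable (by simp) w.1)

lemma D_inr_tens {f g : E n → ℂ} (hf : ContDiff ℝ ∞ f) (hg : ContDiff ℝ ∞ g)
    (i : Option (Fin n)) :
    (hframe2 n).D (.inr i) (tens f g) = tens f ((hframe n).D i g) := by
  funext w
  rw [hframe2, Frame.prod_D_inr _ _ _ ((smooth_tens hf hg).differentiable (by simp) w)]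
  exact along_clm (ContinuousLinearMap.mul ℝ ℂ (f w.1)) (hg.differentiable (by simp) w.2)

/-- The weak derivatives of `u ⊗ u` along the product frame, given those of `u`. -/
def dtens (u : E n → ℂ) (G : Option (Fin n) → E n → ℂ) :
    Option (Fin n) ⊕ Option (Fin n) → E n × E n → ℂ :=
  Sum.elim (fun i => tens (G i) u) fun i => tens u (G i)

lemma D_tens {u : E n → ℂ} (hu : ContDiff ℝ ∞ u) (α : Option (Fin n) ⊕ Option (Fin n)) :
    (hframe2 n).D α (tens u u) = dtens u (fun i => (hframe n).D i u) α := by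
  cases α with
  | inl i => exact D_inl_tens hu hu i
  | inr i => exact D_inr_tens hu hu i

lemma D_normSq {v : E n × E n → ℂ} (hv : ContDiff ℝ ∞ v) (α : Option (Fin n) ⊕ Option (Fin n))
    (w : E n × E n) : (hframe2 n).D α (fun w => ‖v w‖ ^ 2) w
      = 2 * (starRingEnd ℂ (v w) * (hframe2 n).D α v w).re := by
  have h := ((hv.differentiable (by simp) w).hasFDerivAt).norm_sq
  rw [Frame.D, along, h.fderiv]
  simp [Frame.D, along, Complex.inner]
  ring

lemma D_inl_snd (f : E n → ℝ) (hf : ContDiff ℝ 1 f) (i : Option (Fin n)) (w : E n × E n) :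
    (hframe2 n).D (.inl i) (fun w => f w.2) w = 0 := by
  have hd : ContDiff ℝ 1 fun w : E n × E n => f w.2 := hf.comp contDiff_snd
  rw [hframe2, Frame.prod_D_inl _ _ _ (hd.differentiable one_ne_zero w)]
  simp [Frame.D, along]

lemma D_inr_fst (f : E n → ℝ) (hf : ContDiff ℝ 1 f) (i : Option (Fin n)) (w : E n × E n) :
    (hframe2 n).D (.inr i) (fun w => f w.1) w = 0 := by
  have hd : ContDiff ℝ 1 fun w : E n × E n => f w.1 := hf.comp contDiff_fst
  rw [hframe2, Frame.prod_D_inr _ _ _ (hd.differentiable one_ne_zero w)]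
  simp [Frame.D, along]

lemma wt_symm (δ : ℝ) (x y : E n) : wt δ (x, y) = wt δ (y, x) := by
  simp only [wt, coshd_comm]

lemma lapFst_wt {δ : ℝ} (hδ : 0 < δ) (w : E n × E n) :
    lapFst (wt δ) w = lapReg n δ (coshd w.1 w.2) := by
  rw [← lap_wt_left hδ, ← lapFst_apply (smooth_wt hδ)]

lemma lapSnd_wt {δ : ℝ} (hδ : 0 < δ) (w : E n × E n) :
    lapSnd (wt δ) w = lapReg n δ (coshd w.1 w.2) := by
  rw [coshd_comm, ← lap_wt_left hδ]
  simp only [fun x => wt_symm δ x w.1]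
  rw [← lapSnd_apply (smooth_wt hδ)]

end Tens

section Virial

variable {n : ℕ} {δ : ℝ}

/-- The expression `2 ⟨∇a, ∇v⟩ + (Δa) v` for `a = wt δ` and `v = u ⊗ u`. -/
def vir (δ : ℝ) (u : E n → ℂ) (G : Option (Fin n) → E n → ℂ) (w : E n × E n) : ℂ :=
  ∑ α, ((2 * (hframe2 n).D α (wt δ) w : ℝ) : ℂ) * dtens u G α w
    + (((hframe2 n).lap (wt δ) w : ℝ) : ℂ) * tens u u w

/-- The product measure on `ℍⁿ × ℍⁿ`. -/
abbrev hvol2 (n : ℕ) : Measure (E n × E n) := (hvol n).prod (hvol n)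

/-- The contribution of an inhomogeneity `F` of the equation to the virial identity. -/
def forcing (δ : ℝ) (u : E n → ℂ) (G : Option (Fin n) → E n → ℂ) (F : E n → ℂ) : ℝ :=
  2 * (∫ w, starRingEnd ℂ (tens F u w + tens u F w) * vir δ u G w ∂hvol2 n).re

lemma D_wt_le (hδ : 0 < δ) (α : Option (Fin n) ⊕ Option (Fin n)) (w : E n × E n) :
    |2 * (hframe2 n).D α (wt δ) w| ≤ 4 := by
  have h1 := grad_wt_le hδ w
  have h2 : (hframe2 n).D α (wt δ) w ^ 2 ≤ (hframe2 n).grad (wt δ) (wt δ) w := by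
    refine le_trans ?_ (Finset.single_le_sum
      (f := fun i => (hframe2 n).D i (wt δ) w • (hframe2 n).D i (wt δ) w)
      (fun i _ => mul_self_nonneg _) (Finset.mem_univ α))
    rw [sq, smul_eq_mul]
  rw [abs_mul, abs_two]
  have := abs_le_of_sq_le_sq (show (hframe2 n).D α (wt δ) w ^ 2 ≤ 2 ^ 2 by linarith) zero_le_two
  linarith

/-- A bound for the Laplacian of the weight. -/
def lapBound (n : ℕ) (δ : ℝ) : ℝ := 2 * (n * (1 + δ⁻¹) ^ 3 * (1 + δ))

lemma lap_wt_le (hn : 1 ≤ n) (hδ : 0 < δ) (w : E n × E n) :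
    |(hframe2 n).lap (wt δ) w| ≤ lapBound n δ := by
  have h1 := one_le_coshd w.1 w.2
  rw [lap_wt hδ, abs_of_nonneg (mul_nonneg zero_le_two (lapReg_nonneg hn hδ h1)), lapBound]
  exact mul_le_mul_of_nonneg_left (lapReg_le hn hδ h1) zero_le_two

lemma l2Lim_dtens {u : E n → ℂ} {G : Option (Fin n) → E n → ℂ} {uj : ℕ → E n → ℂ}
    {Gj : ℕ → Option (Fin n) → E n → ℂ} (hu : L2Tendsto (hvol n) uj u)
    (hG : ∀ i, L2Tendsto (hvol n) (fun j => Gj j i) (G i))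
    (α : Option (Fin n) ⊕ Option (Fin n)) :
    L2Tendsto (hvol2 n) (fun j => dtens (uj j) (Gj j) α) (dtens u G α) := by
  cases α with
  | inl i => exact (hG i).tens hu
  | inr i => exact hu.tens (hG i)

lemma l2Tendsto_vir (hn : 1 ≤ n) (hδ : 0 < δ) {u : E n → ℂ} {G : Option (Fin n) → E n → ℂ}
    {uj : ℕ → E n → ℂ} {Gj : ℕ → Option (Fin n) → E n → ℂ} (hu : L2Tendsto (hvol n) uj u)
    (hG : ∀ i, L2Tendsto (hvol n) (fun j => Gj j i) (G i)) :
    L2Tendsto (hvol2 n) (fun j => vir δ (uj j) (Gj j)) (vir δ u G) := by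
  refine L2Tendsto.add (L2Tendsto.sum _ fun α _ => ?_) ?_
  · exact (l2Lim_dtens hu hG α).bdd_mul
      (((hframe2 n).smooth_D α (smooth_wt hδ)).continuous.const_mul 2).aestronglyMeasurable
      (D_wt_le hδ α)
  · exact (hu.tens hu).bdd_mul ((hframe2 n).smooth_lap
        (smooth_wt hδ)).continuous.aestronglyMeasurable
      (lap_wt_le hn hδ)

lemma l2Tendsto_const {f : E n → ℂ} (hf : MemLp f 2 (hvol n)) :
    L2Tendsto (hvol n) (fun _ => f) f := ⟨fun _ => hf, hf, by simp⟩

lemma memLp_vir (hn : 1 ≤ n) (hδ : 0 < δ) {u : E n → ℂ} {G : Option (Fin n) → E n → ℂ}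
    (hu : MemLp u 2 (hvol n)) (hG : ∀ i, MemLp (G i) 2 (hvol n)) :
    MemLp (vir δ u G) 2 (hvol2 n) := by
  have h := l2Tendsto_vir (uj := fun _ => u) (Gj := fun _ => G) hn hδ (l2Tendsto_const hu)
    fun i => l2Tendsto_const (hG i)
  exact h.2.1

lemma memLp_of_continuous {f : E n → ℂ} (hf : Continuous f) (hc : HasCompactSupport f) :
    MemLp f 2 (hvol n) := hf.memLp_of_hasCompactSupport hc

lemma memLp_of_smooth {f : E n → ℂ} (hf : ContDiff ℝ ∞ f) (hc : HasCompactSupport f) :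
    MemLp f 2 (hvol n) := memLp_of_continuous hf.continuous hc

/-- `forcing` is continuous in `L²`. -/
lemma tendsto_forcing (hn : 1 ≤ n) (hδ : 0 < δ) {u F : E n → ℂ} {G : Option (Fin n) → E n → ℂ}
    {uj Fj : ℕ → E n → ℂ} {Gj : ℕ → Option (Fin n) → E n → ℂ} (hu : L2Tendsto (hvol n) uj u)
    (hG : ∀ i, L2Tendsto (hvol n) (fun j => Gj j i) (G i)) (hF : L2Tendsto (hvol n) Fj F) :
    Tendsto (fun j => forcing δ (uj j) (Gj j) (Fj j)) atTop (𝓝 (forcing δ u G F)) := by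
  have := ((hF.tens hu).add (hu.tens hF)).tendsto_pairing (l2Tendsto_vir hn hδ hu hG)
  exact (((Complex.continuous_re.tendsto _).comp this).const_mul 2)

/-- The bound of `forcing` by `L²` norms. -/
lemma abs_forcing_le (hn : 1 ≤ n) (hδ : 0 < δ) {u F : E n → ℂ} {G : Option (Fin n) → E n → ℂ}
    (hu : MemLp u 2 (hvol n)) (hG : ∀ i, MemLp (G i) 2 (hvol n)) (hF : MemLp F 2 (hvol n))
    {A B : ℝ} (hA : (eLpNorm u 2 (hvol n)).toReal ≤ A)
    (hB : ∀ i, (eLpNorm (G i) 2 (hvol n)).toReal ≤ B) :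
    |forcing δ u G F| ≤ 2 * ((2 * ((eLpNorm F 2 (hvol n)).toReal * A)) *
      ((∑ _α : Option (Fin n) ⊕ Option (Fin n), 4 * (B * A)) + lapBound n δ * (A * A))) := by
  have hA0 : 0 ≤ A := ENNReal.toReal_nonneg.trans hA
  have hB0 : 0 ≤ B := ENNReal.toReal_nonneg.trans (hB none)
  have hL : 0 ≤ lapBound n δ := (abs_nonneg _).trans (lap_wt_le hn hδ 0)
  have mF := (memLp_tens hF hu).add (memLp_tens hu hF)
  have mv := memLp_vir hn hδ hu hG
  have hu' : eLpNorm u 2 (hvol n) ≤ ENNReal.ofReal A := ENNReal.le_ofReal_iff_toReal_le hu.2.ne hA0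
      |>.2 hA
  have hG' : ∀ i, eLpNorm (G i) 2 (hvol n) ≤ ENNReal.ofReal B := fun i =>
    ENNReal.le_ofReal_iff_toReal_le (hG i).2.ne hB0 |>.2 (hB i)
  have b1 : (eLpNorm (tens F u + tens u F) 2 (hvol2 n)).toReal
      ≤ 2 * ((eLpNorm F 2 (hvol n)).toReal * A) := by
    have h1 : eLpNorm (tens F u + tens u F) 2 (hvol2 n)
        ≤ 2 * (eLpNorm F 2 (hvol n) * eLpNorm u 2 (hvol n)) := by
      refine (eLpNorm_add_le (memLp_tens hF hu).1 (memLp_tens hu hF).1 (by norm_num)).trans ?_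
      rw [eLpNorm_tens hF.1 hu.1, eLpNorm_tens hu.1 hF.1]
      exact le_of_eq (by ring)
    refine (ENNReal.toReal_mono (ENNReal.mul_ne_top (by norm_num)
      (ENNReal.mul_ne_top hF.2.ne hu.2.ne)) h1).trans ?_
    rw [ENNReal.toReal_mul, ENNReal.toReal_mul, ENNReal.toReal_ofNat]
    gcongr
  have bd : ∀ α, eLpNorm (dtens u G α) 2 (hvol2 n) ≤ ENNReal.ofReal (B * A) := by
    intro α
    rw [ENNReal.ofReal_mul hB0]
    cases α with
    | inl i => exact (eLpNorm_tens (hG i).1 hu.1).le.trans (mul_le_mul' (hG' i) hu')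
    | inr i =>
      rw [mul_comm]
      exact (eLpNorm_tens hu.1 (hG i).1).le.trans (mul_le_mul' hu' (hG' i))
  have md : ∀ α, MemLp (dtens u G α) 2 (hvol2 n) := fun α =>
    ⟨by cases α with
      | inl i => exact (memLp_tens (hG i) hu).1
      | inr i => exact (memLp_tens hu (hG i)).1, (bd α).trans_lt ENNReal.ofReal_lt_top⟩
  have b2 : (eLpNorm (vir δ u G) 2 (hvol2 n)).toReal
      ≤ (∑ _α : Option (Fin n) ⊕ Option (Fin n), 4 * (B * A)) + lapBound n δ * (A * A) := by
    refine ENNReal.toReal_le_of_le_ofReal (by positivity) ?_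
    have t : ∀ α, MemLp (fun w => ((2 * (hframe2 n).D α (wt δ) w : ℝ) : ℂ) * dtens u G α w) 2
        (hvol2 n) := fun α => memLp_bdd_mul
      (((hframe2 n).smooth_D α (smooth_wt hδ)).continuous.const_mul 2).aestronglyMeasurable
      (D_wt_le hδ α) (md α)
    have h1 : vir δ u G = (∑ α, fun w => ((2 * (hframe2 n).D α (wt δ) w : ℝ) : ℂ) * dtens u G α w)
        + fun w => (((hframe2 n).lap (wt δ) w : ℝ) : ℂ) * tens u u w := by
      funext w
      simp [vir]
    rw [h1, ENNReal.ofReal_add (by positivity) (by positivity),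
      ENNReal.ofReal_sum_of_nonneg fun _ _ => by positivity]
    refine (eLpNorm_add_le (Finset.aestronglyMeasurable_sum _ fun α _ => (t α).1) ?_
        (by norm_num)).trans
      (add_le_add ((eLpNorm_sum_le (fun α _ => (t α).1) (by norm_num)).trans
        (Finset.sum_le_sum fun α _ => ?_)) ?_)
    · exact (memLp_bdd_mul ((hframe2 n).smooth_lap (smooth_wt hδ)).continuous.aestronglyMeasurable
        (lap_wt_le hn hδ) (memLp_tens hu hu)).1
    · refine (eLpNorm_bdd_mul_le (D_wt_le hδ α) _).trans ?_
      rw [ENNReal.ofReal_mul zero_le_four]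
      exact mul_le_mul_right (bd α) _
    · refine (eLpNorm_bdd_mul_le (lap_wt_le hn hδ) _).trans ?_
      rw [ENNReal.ofReal_mul hL, eLpNorm_tens hu.1 hu.1, ENNReal.ofReal_mul hA0]
      exact mul_le_mul_right (mul_le_mul' hu' hu') _
  rw [forcing, abs_mul, abs_two]
  refine mul_le_mul_of_nonneg_left ?_ zero_le_two
  refine (Complex.abs_re_le_norm _).trans ((norm_pairing_le mF mv).trans ?_)
  exact mul_le_mul b1 b2 ENNReal.toReal_nonneg (by positivity)

section Smooth

variable {σ M : ℝ}

lemma continuous_regPow_max (hM : 1 ≤ M) : Continuous fun s => regPow σ M (max s 0) := by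
  refine continuous_iff_continuousAt.2 fun s => ?_
  exact ContinuousAt.comp (f := fun s : ℝ => max s 0)
    (hasDerivAt_regPow hM (le_max_right s 0)).continuousAt (by fun_prop)

/-- A primitive of the regularized power. -/
def primPow (σ M s : ℝ) : ℝ := ∫ t in (0 : ℝ)..s, regPow σ M (max t 0)

lemma hasDerivAt_primPow (hM : 1 ≤ M) (s : ℝ) :
    HasDerivAt (primPow σ M) (regPow σ M (max s 0)) s :=
  (continuous_regPow_max hM).integral_hasStrictDerivAt 0 s |>.hasDerivAt

lemma contDiff_primPow (hM : 1 ≤ M) : ContDiff ℝ 1 (primPow σ M) := by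
  rw [contDiff_one_iff_deriv]
  refine ⟨fun s => (hasDerivAt_primPow hM s).differentiableAt, ?_⟩
  rw [show deriv (primPow σ M) = fun s => regPow σ M (max s 0) from
    funext fun s => (hasDerivAt_primPow hM s).deriv]
  exact continuous_regPow_max hM

lemma primPow_le (hσ : 0 < σ) (hM : 1 ≤ M) {s : ℝ} (hs : 0 ≤ s) :
    primPow σ M s ≤ regPow σ M s * s := by
  have : primPow σ M s ≤ ∫ _t in (0 : ℝ)..s, regPow σ M s := by
    refine intervalIntegral.integral_mono_on hs
      ((continuous_regPow_max hM).intervalIntegrable _ _) (by simp) fun t ht => ?_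
    rw [max_eq_left ht.1]
    exact regPow_mono hσ hM ht.1 ht.2
  simpa [mul_comm] using this

/-- For smooth functions the regularized defocusing nonlinearity has a nonnegative contribution.
Integrating by parts in each variable separately turns it into an integral of the Laplacian of the
weight in that variable, which is nonnegative, against `(P ρ - Q) ⊗ ρ`, where `ρ = |u|²`, `P` is the
regularized power of `ρ` and `Q ≤ P ρ` its primitive. -/
lemma forcing_regNl_nonneg_of_smooth (hn : 1 ≤ n) (hδ : 0 < δ) (hσ : 0 < σ) (hM : 1 ≤ M)
    {u : E n → ℂ} (hu : ContDiff ℝ ∞ u) (cu : HasCompactSupport u) :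
    0 ≤ forcing δ u (fun i => (hframe n).D i u) fun x => regNl σ M (u x) := by
  set ρ : E n → ℝ := fun x => ‖u x‖ ^ 2
  have hρ : ContDiff ℝ ∞ ρ := hu.norm_sq ℝ
  have hρ0 : ∀ x, 0 ≤ ρ x := fun x => sq_nonneg _
  have cρ : HasCompactSupport ρ := cu.comp_left (g := fun z : ℂ => ‖z‖ ^ 2) (by simp)
  set P : E n → ℝ := fun x => regPow σ M (ρ x)
  have hM0 : 0 < M := by linarith
  have hP : ContDiff ℝ ∞ P := by
    refine ContDiff.rpow_const_of_ne ?_ fun x => (regBase_bounds hM (hρ0 x)).1.ne'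
    refine (hρ.div (contDiff_const.add (hρ.div_const M)) fun x => ?_).add contDiff_const
    have : 0 ≤ ρ x / M := div_nonneg (hρ0 x) hM0.le
    positivity
  set Q : E n → ℝ := fun x => primPow σ M (ρ x)
  have hQ : ContDiff ℝ 1 Q := (contDiff_primPow hM).comp (hρ.of_le (by simp))
  have cQ : HasCompactSupport Q := cρ.comp_left (g := primPow σ M) (by simp [primPow])
  set h : E n × E n → ℝ := fun w => ‖tens u u w‖ ^ 2
  have hhe : h = fun w => ρ w.1 * ρ w.2 := by
    funext w
    simp only [h, tens, norm_mul, mul_pow, ρ]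
  have hv := smooth_tens hu hu
  have hh : ContDiff ℝ ∞ h := hv.norm_sq ℝ
  have ch : HasCompactSupport h :=
    (hasCompactSupport_tens cu cu).comp_left (g := fun z : ℂ => ‖z‖ ^ 2) (by simp)
  have prodC : ∀ {f g : E n → ℝ}, HasCompactSupport f → HasCompactSupport g →
      HasCompactSupport fun w : E n × E n => f w.1 * g w.2 := by
    intro f g hf hg
    refine HasCompactSupport.intro (hf.isCompact.prod hg.isCompact) fun w hw => ?_
    rw [Set.mem_prod, not_and_or] at hw
    rcases hw with h | h
    · simp [image_eq_zero_of_notMem_tsupport h]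
    · simp [image_eq_zero_of_notMem_tsupport h]
  have hθ : ∀ x, 0 ≤ P x * ρ x - Q x := fun x => sub_nonneg.2 (primPow_le hσ hM (hρ0 x))
  have hmax : ∀ x, regPow σ M (max (ρ x) 0) = P x := fun x => by rw [max_eq_left (hρ0 x)]
  have hρ1 : ContDiff ℝ 1 ρ := hρ.of_le (by simp)
  -- derivatives of products of functions of one variable
  have dprod : ∀ {f g : E n → ℝ}, ContDiff ℝ 1 f → ContDiff ℝ 1 g → ∀ α w,
      (hframe2 n).D α (fun w => f w.1 * g w.2) w = f w.1 * (hframe2 n).D α (fun w => g w.2) w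
        + g w.2 * (hframe2 n).D α (fun w => f w.1) w := fun hf hg α w =>
    along_mul ((hf.comp contDiff_fst).differentiable one_ne_zero w)
      ((hg.comp contDiff_snd).differentiable one_ne_zero w)
  have dQ1 : ∀ α w, (hframe2 n).D α (fun w => Q w.1) w
      = P w.1 * (hframe2 n).D α (fun w => ρ w.1) w := fun α w => by
    rw [← hmax]
    exact along_comp (f := fun w : E n × E n => ρ w.1) (hasDerivAt_primPow hM (ρ w.1))
      ((hρ1.comp contDiff_fst).differentiable one_ne_zero w)
  have dQ2 : ∀ α w, (hframe2 n).D α (fun w => Q w.2) w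
      = P w.2 * (hframe2 n).D α (fun w => ρ w.2) w := fun α w => by
    rw [← hmax]
    exact along_comp (f := fun w : E n × E n => ρ w.2) (hasDerivAt_primPow hM (ρ w.2))
      ((hρ1.comp contDiff_snd).differentiable one_ne_zero w)
  have I1 := (hframe2 n).integral_weighted (a := wt δ) (P := fun w => P w.1) (h := h)
    (Θ := fun w => Q w.1 * ρ w.2) (Finset.univ.map ⟨Sum.inl, Sum.inl_injective⟩)
    (smooth_wt hδ) (hP.comp contDiff_fst) hh ch
    ((hQ.comp contDiff_fst).mul (hρ1.comp contDiff_snd)) (prodC cQ cρ) ?_ ?_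
  rotate_left
  · intro α hα w
    obtain ⟨i, -, rfl⟩ := Finset.mem_map.1 hα
    simp only [Function.Embedding.coeFn_mk]
    rw [hhe, dprod hQ hρ1, dprod hρ1 hρ1, D_inl_snd ρ hρ1, dQ1]
    ring
  · rintro (i | i) hα w
    · exact absurd (Finset.mem_map.2 ⟨i, Finset.mem_univ _, rfl⟩) hα
    · exact D_inr_fst P (hP.of_le (by simp)) i w
  have I2 := (hframe2 n).integral_weighted (a := wt δ) (P := fun w => P w.2) (h := h)
    (Θ := fun w => ρ w.1 * Q w.2) (Finset.univ.map ⟨Sum.inr, Sum.inr_injective⟩)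
    (smooth_wt hδ) (hP.comp contDiff_snd) hh ch
    ((hρ1.comp contDiff_fst).mul (hQ.comp contDiff_snd)) (prodC cρ cQ) ?_ ?_
  rotate_left
  · intro α hα w
    obtain ⟨i, -, rfl⟩ := Finset.mem_map.1 hα
    simp only [Function.Embedding.coeFn_mk]
    rw [hhe, dprod hρ1 hQ, dprod hρ1 hρ1, D_inr_fst ρ hρ1, dQ2]
    ring
  · rintro (i | i) hα w
    · exact D_inl_snd P (hP.of_le (by simp)) i w
    · exact absurd (Finset.mem_map.2 ⟨i, Finset.mem_univ _, rfl⟩) hα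
  have J1 : 0 ≤ ∫ w, P w.1 * ((hframe2 n).grad (wt δ) h w + (hframe2 n).lap (wt δ) w * h w)
      ∂hvol2 n := by
    refine le_of_le_of_eq (integral_nonneg fun w => ?_) I1.symm
    simp only [Finset.sum_map, Function.Embedding.coeFn_mk]
    refine mul_nonneg ?_ ?_
    · have e : lapFst (wt δ) w = _ := rfl
      exact (lapReg_nonneg hn hδ (one_le_coshd w.1 w.2)).trans_eq ((lapFst_wt hδ w).symm.trans e)
    · rw [hhe]
      have := mul_nonneg (hθ w.1) (hρ0 w.2)
      simp only
      linarith
  have J2 : 0 ≤ ∫ w, P w.2 * ((hframe2 n).grad (wt δ) h w + (hframe2 n).lap (wt δ) w * h w)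
      ∂hvol2 n := by
    refine le_of_le_of_eq (integral_nonneg fun w => ?_) I2.symm
    simp only [Finset.sum_map, Function.Embedding.coeFn_mk]
    refine mul_nonneg ?_ ?_
    · have e : lapSnd (wt δ) w = _ := rfl
      exact (lapReg_nonneg hn hδ (one_le_coshd w.1 w.2)).trans_eq ((lapSnd_wt hδ w).symm.trans e)
    · rw [hhe]
      have := mul_nonneg (hρ0 w.1) (hθ w.2)
      simp only
      linarith
  have cT : ∀ {R : E n × E n → ℝ}, Continuous R → Integrable (fun w => R w *
      ((hframe2 n).grad (wt δ) h w + (hframe2 n).lap (wt δ) w * h w)) (hvol2 n) := by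
    intro R hR
    refine (hframe2 n).integrable_of_compact (hR.mul
      (((hframe2 n).smooth_grad (smooth_wt hδ) hh).continuous.add
        (((hframe2 n).smooth_lap (smooth_wt hδ)).continuous.mul hh.continuous)))
      (HasCompactSupport.mul_left (HasCompactSupport.add ?_ ?_))
    · exact (hframe2 n).hasCompactSupport_grad ch
    · exact HasCompactSupport.mul_left (f := (hframe2 n).lap (wt δ)) ch
  have pw : ∀ w, (starRingEnd ℂ (tens (fun x => regNl σ M (u x)) u w
        + tens u (fun x => regNl σ M (u x)) w) * vir δ u (fun i => (hframe n).D i u) w).re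
      = P w.1 * ((hframe2 n).grad (wt δ) h w + (hframe2 n).lap (wt δ) w * h w)
        + P w.2 * ((hframe2 n).grad (wt δ) h w + (hframe2 n).lap (wt δ) w * h w) := by
    intro w
    have e1 : tens (fun x => regNl σ M (u x)) u w + tens u (fun x => regNl σ M (u x)) w
        = ((P w.1 + P w.2 : ℝ) : ℂ) * tens u u w := by
      simp only [tens, regNl, P, ρ]
      push_cast
      ring
    have e2 : (starRingEnd ℂ (tens u u w) * vir δ u (fun i => (hframe n).D i u) w).re
        = (hframe2 n).grad (wt δ) h w + (hframe2 n).lap (wt δ) w * h w := by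
      have e3 : starRingEnd ℂ (tens u u w) * vir δ u (fun i => (hframe n).D i u) w
          = ∑ α, ((2 * (hframe2 n).D α (wt δ) w : ℝ) : ℂ)
              * (starRingEnd ℂ (tens u u w) * dtens u (fun i => (hframe n).D i u) α w)
            + (((hframe2 n).lap (wt δ) w * h w : ℝ) : ℂ) := by
        have : starRingEnd ℂ (tens u u w) * tens u u w = ((h w : ℝ) : ℂ) := by
          simp only [h]
          rw [mul_comm, Complex.mul_conj, Complex.normSq_eq_norm_sq]
        rw [vir, mul_add, Finset.mul_sum]
        push_cast
        rw [← this]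
        congr 1
        · exact Finset.sum_congr rfl fun α _ => by ring
        · ring
      rw [e3, Complex.add_re, Complex.re_sum, Complex.ofReal_re, Frame.grad]
      congr 1
      refine Finset.sum_congr rfl fun α _ => ?_
      rw [Complex.re_ofReal_mul, smul_eq_mul, D_normSq hv, D_tens hu]
      ring
    rw [e1, map_mul, Complex.conj_ofReal, mul_assoc, Complex.re_ofReal_mul, e2]
    ring
  rw [forcing]
  refine mul_nonneg zero_le_two ?_
  have hint : Integrable (fun w => starRingEnd ℂ (tens (fun x => regNl σ M (u x)) u w
        + tens u (fun x => regNl σ M (u x)) w) * vir δ u (fun i => (hframe n).D i u) w)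
            (hvol2 n) := by
    have mu := memLp_of_smooth hu cu
    have mF : MemLp (fun x => regNl σ M (u x)) 2 (hvol n) :=
      memLp_of_continuous ((lipschitzWith_regNl hσ hM).continuous.comp hu.continuous)
        (cu.comp_left regNl_zero)
    exact integrable_pairing ((memLp_tens mF mu).add (memLp_tens mu mF))
        (memLp_vir hn hδ mu fun i =>
      memLp_of_smooth ((hframe n).smooth_D i hu) ((hframe n).hasCompactSupport_D i cu))
  rw [← RCLike.re_eq_complex_re, ← integral_re hint]
  simp only [RCLike.re_eq_complex_re, pw]
  refine (add_nonneg J1 J2).trans_eq (integral_add (cT (hP.continuous.comp continuous_fst))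
    (cT (hP.continuous.comp continuous_snd))).symm

end Smooth

lemma l2Tendsto_comp_lipschitz {K : ℝ≥0} {Φ : ℂ → ℂ} (hΦ : LipschitzWith K Φ) (h0 : Φ 0 = 0)
    {α : Type*} [MeasurableSpace α] {μ : Measure α} {f : ℕ → α → ℂ} {g : α → ℂ}
    (h : L2Tendsto μ f g) : L2Tendsto μ (fun j x => Φ (f j x)) fun x => Φ (g x) := by
  refine ⟨fun j => hΦ.comp_memLp h0 (h.1 j), hΦ.comp_memLp h0 h.2.1, ?_⟩
  have s1 := ENNReal.Tendsto.const_mul (a := (K : ℝ≥0∞)) h.2.2 (.inr ENNReal.coe_ne_top)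
  rw [mul_zero] at s1
  refine tendsto_of_tendsto_of_tendsto_of_le_of_le tendsto_const_nhds s1 (fun _ => zero_le) ?_
  intro j
  have := eLpNorm_le_nnreal_smul_eLpNorm_of_ae_le_mul (μ := μ) (c := K)
    (f := (fun x => Φ (f j x)) - fun x => Φ (g x)) (g := f j - g)
    (.of_forall fun x => by
      have := hΦ.nndist_le (f j x) (g x)
      simpa [nndist_eq_nnnorm] using this) 2
  exact this

/-- The defocusing nonlinearity has a nonnegative contribution to the virial identity. -/
lemma forcing_nonlin_nonneg (hn : 1 ≤ n) (hδ : 0 < δ) {σ : ℝ} (hσ : 0 < σ) {u : E n → ℂ}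
    {G : Option (Fin n) → E n → ℂ} (hu : IsWeakJet u G)
    (hF : MemLp (fun x => ((‖u x‖ ^ (2 * σ) : ℝ) : ℂ) * u x) 2 (hvol n)) :
    0 ≤ forcing δ u G fun x => ((‖u x‖ ^ (2 * σ) : ℝ) : ℂ) * u x := by
  obtain ⟨C, hC⟩ := l2Lim_D_moll n
  have hM : ∀ N : ℕ, (1 : ℝ) ≤ (N : ℝ) + 1 := fun N => by
    linarith [(Nat.cast_nonneg N : (0 : ℝ) ≤ N)]
  have hl := locallyIntegrable_of_memLp hu.memLp
  -- for each regularized nonlinearity, by approximation of `u`; then the regularization is removed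
  have reg : ∀ N : ℕ, 0 ≤ forcing δ u G fun x => regNl σ ((N : ℝ) + 1) (u x) := by
    intro N
    have h1 := (l2Lim_moll hu.memLp).1
    refine ge_of_tendsto' (tendsto_forcing hn hδ h1 (fun i => (hC u G hu i).1)
      (l2Tendsto_comp_lipschitz (lipschitzWith_regNl hσ (hM N)) regNl_zero h1)) fun j => ?_
    exact forcing_regNl_nonneg_of_smooth hn hδ hσ (hM N)
      (smooth_kint (smooth_mollKer n j) (hasCompactSupport_mollKer n j) hl)
      (hasCompactSupport_kint (hasCompactSupport_mollKer n j) _)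
  refine ge_of_tendsto' (tendsto_forcing hn hδ (l2Tendsto_const hu.memLp)
      (fun i => l2Tendsto_const (hu.memLp_deriv i))
    (Fj := fun N x => regNl σ ((N : ℝ) + 1) (u x)) ⟨fun N =>
      (lipschitzWith_regNl hσ (hM N)).comp_memLp regNl_zero hu.memLp, hF, ?_⟩) reg
  set F : E n → ℂ := fun x => ((‖u x‖ ^ (2 * σ) : ℝ) : ℂ) * u x
  have hFn : ∀ x, ‖F x‖ = ‖u x‖ ^ (2 * σ) * ‖u x‖ := fun x => by
    rw [norm_mul, Complex.norm_real, Real.norm_of_nonneg (Real.rpow_nonneg (norm_nonneg _) _)]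
  refine tendsto_eLpNorm_zero (g := fun x => (2 ^ σ + 1) * (‖F x‖ + ‖u x‖)) (fun N => ?_)
    ((hF.norm.add hu.memLp.norm).const_mul _) (fun N x => ?_) fun x => ?_
  · exact (((lipschitzWith_regNl hσ (hM N)).comp_memLp regNl_zero hu.memLp).sub hF).1
  · refine (norm_sub_le _ _).trans ?_
    have h1 := norm_regNl_le hσ (hM N) (u x)
    rw [← hFn] at h1
    rw [Real.norm_of_nonneg (by positivity)]
    have h2 := norm_nonneg (u x)
    linarith
  · have := (tendsto_regNl hσ (u x)).sub_const (F x)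
    simpa [F] using this
end Virial

/-! ### The virial inequality for smooth functions -/

section VirialSmooth

variable {n : ℕ} {δ : ℝ}

lemma D_re {v : E n × E n → ℂ} (hv : ContDiff ℝ ∞ v) (α : Option (Fin n) ⊕ Option (Fin n)) :
    (hframe2 n).D α (fun w => (v w).re) = fun w => ((hframe2 n).D α v w).re :=
  funext fun w => along_clm Complex.reCLM (hv.differentiable (by simp) w)

lemma D_im {v : E n × E n → ℂ} (hv : ContDiff ℝ ∞ v) (α : Option (Fin n) ⊕ Option (Fin n)) :
    (hframe2 n).D α (fun w => (v w).im) = fun w => ((hframe2 n).D α v w).im :=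
  funext fun w => along_clm Complex.imCLM (hv.differentiable (by simp) w)

lemma lap_re {v : E n × E n → ℂ} (hv : ContDiff ℝ ∞ v) (w : E n × E n) :
    (hframe2 n).lap (fun w => (v w).re) w = ((hframe2 n).lap v w).re := by
  simp only [Frame.lap, D_re hv, D_re ((hframe2 n).smooth_D _ hv), Complex.re_sum, Complex.add_re,
    Complex.real_smul, Complex.re_ofReal_mul, smul_eq_mul]

lemma lap_im {v : E n × E n → ℂ} (hv : ContDiff ℝ ∞ v) (w : E n × E n) :
    (hframe2 n).lap (fun w => (v w).im) w = ((hframe2 n).lap v w).im := by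
  simp only [Frame.lap, D_im hv, D_im ((hframe2 n).smooth_D _ hv), Complex.im_sum, Complex.add_im,
    Complex.real_smul, Complex.im_ofReal_mul, smul_eq_mul]

lemma lap_tens {f g : E n → ℂ} (hf : ContDiff ℝ ∞ f) (hg : ContDiff ℝ ∞ g) (w : E n × E n) :
    (hframe2 n).lap (tens f g) w = tens ((hframe n).lap f) g w + tens f ((hframe n).lap g) w := by
  rw [Frame.lap, Fintype.sum_sum_type]
  simp only [D_inl_tens hf hg, D_inr_tens hf hg, D_inl_tens ((hframe n).smooth_D _ hf) hg,
    D_inr_tens hf ((hframe n).smooth_D _ hg)]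
  simp only [tens, Frame.lap, Finset.sum_mul, Finset.mul_sum]
  congr 1
  · refine Finset.sum_congr rfl fun i _ => ?_
    change _ + (hframe n).div i w.1 • _ = _
    rw [add_mul, smul_mul_assoc]
  · refine Finset.sum_congr rfl fun i _ => ?_
    change _ + (hframe n).div i w.2 • _ = _
    rw [mul_add, mul_smul_comm]

/-- The density of the virial (Morawetz) functional. -/
def mom (δ : ℝ) (u : E n → ℂ) (G : Option (Fin n) → E n → ℂ) (w : E n × E n) : ℂ :=
  ∑ α, (((hframe2 n).D α (wt δ) w : ℝ) : ℂ) * (starRingEnd ℂ (tens u u w) * dtens u G α w)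

/-- The time derivative of `tens u u`, given that of `u`. -/
def tens' (u u' : E n → ℂ) (w : E n × E n) : ℂ := tens u' u w + tens u u' w

/-- The time derivative of `mom`, given that of `u`. -/
def mom' (δ : ℝ) (u u' : E n → ℂ) (w : E n × E n) : ℂ :=
  ∑ α, (((hframe2 n).D α (wt δ) w : ℝ) : ℂ) *
    (starRingEnd ℂ (tens' u u' w) * dtens u (fun i => (hframe n).D i u) α w
      + starRingEnd ℂ (tens u u w) * (hframe2 n).D α (tens' u u') w)

/-- The virial inequality: the Hessian of the weight is nonnegative. -/
lemma virial_ineq (hδ : 0 < δ) {u u' H : E n → ℂ} (hu : ContDiff ℝ ∞ u) (hu' : ContDiff ℝ ∞ u')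
    (hH : ContDiff ℝ ∞ H) (cu : HasCompactSupport u) (cu' : HasCompactSupport u')
    (cH : HasCompactSupport H)
    (heq : ∀ x, Complex.I * u' x + (hframe n).lap u x = H x) :
    4 * ∫ w, bilapKer n δ (coshd w.1 w.2) * ‖tens u u w‖ ^ 2 ∂hvol2 n
      + forcing δ u (fun i => (hframe n).D i u) H ≤ 2 * (∫ w, mom' δ u u' w ∂hvol2 n).im := by
  set v := tens u u
  set v' := tens' u u'
  set h : E n × E n → ℂ := fun w => tens H u w + tens u H w
  have sv : ContDiff ℝ ∞ v := smooth_tens hu hu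
  have sv' : ContDiff ℝ ∞ v' := (smooth_tens hu' hu).add (smooth_tens hu hu')
  have sh : ContDiff ℝ ∞ h := (smooth_tens hH hu).add (smooth_tens hu hH)
  have cv : HasCompactSupport v := hasCompactSupport_tens cu cu
  have cv' : HasCompactSupport v' := (hasCompactSupport_tens cu' cu).add
      (hasCompactSupport_tens cu cu')
  have ch : HasCompactSupport h := (hasCompactSupport_tens cH cu).add (hasCompactSupport_tens cu cH)
  have sre : ∀ {f : E n × E n → ℂ}, ContDiff ℝ ∞ f → ContDiff ℝ ∞ fun w => (f w).re := fun hf =>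
    Complex.reCLM.contDiff.comp hf
  have sim : ∀ {f : E n × E n → ℂ}, ContDiff ℝ ∞ f → ContDiff ℝ ∞ fun w => (f w).im := fun hf =>
    Complex.imCLM.contDiff.comp hf
  have cre : ∀ {f : E n × E n → ℂ}, HasCompactSupport f → HasCompactSupport fun w => (f w).re :=
    fun hf => hf.comp_left (g := Complex.re) rfl
  have cim : ∀ {f : E n × E n → ℂ}, HasCompactSupport f → HasCompactSupport fun w => (f w).im :=
    fun hf => hf.comp_left (g := Complex.im) rfl
  have eqv : ∀ w, Complex.I * v' w + (hframe2 n).lap v w = h w := by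
    intro w
    rw [lap_tens hu hu]
    simp only [v', tens', h, tens, ← heq]
    ring
  have hr : ∀ w, (v' w).re = -((hframe2 n).lap (fun w => (v w).im) w - (h w).im) := by
    intro w
    rw [lap_im sv, ← eqv]
    simp
  have hs : ∀ w, (v' w).im = (hframe2 n).lap (fun w => (v w).re) w - (h w).re := by
    intro w
    rw [lap_re sv, ← eqv]
    simp
  have key := (hframe2 n).virial (smooth_wt hδ) (sre sv) (sim sv) (sre sh) (sim sh) (cre cv)
      (cim cv)
    (cre ch) (cim ch) hr hs
  have cont : ∀ α {f : E n × E n → ℂ}, ContDiff ℝ ∞ f → Continuous ((hframe2 n).D α f) :=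
    fun α f hf => ((hframe2 n).smooth_D α hf).continuous
  have cwt : ∀ α, Continuous ((hframe2 n).D α (wt δ)) := fun α =>
    ((hframe2 n).smooth_D α (smooth_wt hδ)).continuous
  have e1 : 2 * (∫ w, mom' δ u u' w ∂hvol2 n).im
      = 2 * ∫ w, ((v' w).re * (hframe2 n).grad (wt δ) (fun w => (v w).im) w
        + (v w).re * (hframe2 n).grad (wt δ) (fun w => (v' w).im) w
        - (v' w).im * (hframe2 n).grad (wt δ) (fun w => (v w).re) w
        - (v w).im * (hframe2 n).grad (wt δ) (fun w => (v' w).re) w) ∂hvol2 n := by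
    have hint : Integrable (mom' δ u u') (hvol2 n) := by
      refine (hframe2 n).integrable_of_compact (continuous_finsetSum _ fun α _ => ?_) ?_
      · simp only [← D_tens hu]
        exact (Complex.continuous_ofReal.comp (cwt α)).mul (((Complex.continuous_conj.comp
          sv'.continuous).mul (cont α sv)).add ((Complex.continuous_conj.comp sv.continuous).mul
          (cont α sv')))
      · refine HasCompactSupport.intro (cv'.isCompact.union cv.isCompact) fun w hw => ?_
        rw [Set.mem_union, not_or] at hw
        have h1 : tens' u u' w = 0 := image_eq_zero_of_notMem_tsupport hw.1
        have h2 : tens u u w = 0 := image_eq_zero_of_notMem_tsupport hw.2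
        simp [mom', h1, h2]
    rw [← RCLike.im_eq_complex_im, ← integral_im hint]
    congr 1
    refine integral_congr_ae (.of_forall fun w => ?_)
    simp only [RCLike.im_eq_complex_im, mom', ← D_tens hu, Complex.im_sum, Complex.im_ofReal_mul,
      Frame.grad, D_re sv, D_im sv, D_re sv', D_im sv', Finset.mul_sum, ← Finset.sum_add_distrib,
      ← Finset.sum_sub_distrib, smul_eq_mul]
    refine Finset.sum_congr rfl fun α _ => ?_
    simp only [Complex.add_im, Complex.mul_im, Complex.conj_re, Complex.conj_im, v, v']
    ring
  have e2 : forcing δ u (fun i => (hframe n).D i u) H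
      = 2 * ∫ w, ((h w).re * (2 * (hframe2 n).grad (wt δ) (fun w => (v w).re) w
          + (hframe2 n).lap (wt δ) w * (v w).re)
        + (h w).im * (2 * (hframe2 n).grad (wt δ) (fun w => (v w).im) w
          + (hframe2 n).lap (wt δ) w * (v w).im)) ∂hvol2 n := by
    have ev : ∀ w, vir δ u (fun i => (hframe n).D i u) w
        = ∑ α, ((2 * (hframe2 n).D α (wt δ) w : ℝ) : ℂ) * (hframe2 n).D α v w
          + (((hframe2 n).lap (wt δ) w : ℝ) : ℂ) * v w := fun w => by
      simp only [vir, D_tens hu, v]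
    have hint : Integrable (fun w => starRingEnd ℂ (h w) * vir δ u (fun i => (hframe n).D i u) w)
        (hvol2 n) := by
      refine (hframe2 n).integrable_of_compact ((Complex.continuous_conj.comp sh.continuous).mul ?_)
          ?_
      · rw [funext ev]
        exact (continuous_finsetSum _ fun α _ => (Complex.continuous_ofReal.comp
          ((cwt α).const_mul 2)).mul (cont α sv)).add ((Complex.continuous_ofReal.comp
            ((hframe2 n).smooth_lap (smooth_wt hδ)).continuous).mul sv.continuous)
      · exact HasCompactSupport.mul_right (ch.comp_left (g := starRingEnd ℂ) (map_zero _))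
    rw [forcing, ← RCLike.re_eq_complex_re, ← integral_re hint]
    congr 1
    refine integral_congr_ae (.of_forall fun w => ?_)
    have r1 : (vir δ u (fun i => (hframe n).D i u) w).re
        = 2 * (hframe2 n).grad (wt δ) (fun w => (v w).re) w
          + (hframe2 n).lap (wt δ) w * (v w).re := by
      simp only [ev, Complex.add_re, Complex.re_sum, Complex.re_ofReal_mul, Frame.grad, D_re sv,
        smul_eq_mul, mul_assoc, ← Finset.mul_sum]
    have r2 : (vir δ u (fun i => (hframe n).D i u) w).im
        = 2 * (hframe2 n).grad (wt δ) (fun w => (v w).im) w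
          + (hframe2 n).lap (wt δ) w * (v w).im := by
      simp only [ev, Complex.add_im, Complex.im_sum, Complex.im_ofReal_mul, Frame.grad, D_im sv,
        smul_eq_mul, mul_assoc, ← Finset.mul_sum]
    simp only [RCLike.re_eq_complex_re, Complex.mul_re, Complex.conj_re, Complex.conj_im, r1, r2]
    ring
  have e3 : 4 * ∫ w, bilapKer n δ (coshd w.1 w.2) * ‖v w‖ ^ 2 ∂hvol2 n
      = -∫ w, (hframe2 n).lap ((hframe2 n).lap (wt δ)) w * ((v w).re ^ 2 + (v w).im ^ 2)
        ∂hvol2 n := by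
    rw [← integral_neg, ← integral_const_mul]
    refine integral_congr_ae (.of_forall fun w => ?_)
    simp only [lap_lap_wt hδ]
    rw [← Complex.normSq_eq_norm_sq, Complex.normSq_apply]
    ring
  have e4 : 0 ≤ ∫ w, ((hframe2 n).hess (wt δ) (fun w => (v w).re) w
      + (hframe2 n).hess (wt δ) (fun w => (v w).im) w) ∂hvol2 n :=
    integral_nonneg fun w => add_nonneg (hess_wt_nonneg hδ (sre sv) w)
        (hess_wt_nonneg hδ (sim sv) w)
  have key' : 2 * ∫ w, ((v' w).re * (hframe2 n).grad (wt δ) (fun w => (v w).im) w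
        + (v w).re * (hframe2 n).grad (wt δ) (fun w => (v' w).im) w
        - (v' w).im * (hframe2 n).grad (wt δ) (fun w => (v w).re) w
        - (v w).im * (hframe2 n).grad (wt δ) (fun w => (v' w).re) w) ∂hvol2 n = _ := key
  rw [e1, e2, e3, key']
  have e4' : 0 ≤ ∫ w, ((hframe2 n).hess (wt δ) (fun w => (v w).re) w
      + (hframe2 n).hess (wt δ) (fun w => (v w).im) w) ∂(hframe2 n).vol := e4
  have e5 : (hframe2 n).vol = hvol2 n := rfl
  rw [e5] at e4' ⊢
  linarith

end VirialSmooth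

/-! ### Absolutely continuous families of functions -/

section Prim

variable {a b : ℝ}

/-- `f` is absolutely continuous on `[a, b]` with integrable derivative `f'`. -/
structure IsPrim (a b : ℝ) (f f' : ℝ → ℂ) : Prop where
  ac : AbsolutelyContinuousOnInterval f a b
  int : IntervalIntegrable f' volume a b
  deriv : ∀ᵐ t, t ∈ Set.uIcc a b → HasDerivAt f (f' t) t

lemma absolutelyContinuousOnInterval_congr {f g : ℝ → ℂ} (h : ∀ t ∈ Set.uIcc a b, f t = g t)
    (hg : AbsolutelyContinuousOnInterval g a b) : AbsolutelyContinuousOnInterval f a b := by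
  rw [absolutelyContinuousOnInterval_iff] at hg ⊢
  intro ε hε
  obtain ⟨δ, hδ, H⟩ := hg ε hε
  refine ⟨δ, hδ, fun P hP hs => ?_⟩
  refine lt_of_eq_of_lt (Finset.sum_congr rfl fun i hi => ?_) (H P hP hs)
  rw [h _ (hP.1 i hi).1, h _ (hP.1 i hi).2]

lemma absolutelyContinuousOnInterval_const (c : ℂ) :
    AbsolutelyContinuousOnInterval (fun _ => c) a b :=
  contDiffOn_const.absolutelyContinuousOnInterval

lemma absolutelyContinuousOnInterval_integral {f : ℝ → ℂ} (h : IntervalIntegrable f volume a b) :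
    AbsolutelyContinuousOnInterval (fun t => ∫ s in a..t, f s) a b := by
  have hre : IntervalIntegrable (fun t => (f t).re) volume a b := ⟨h.1.re, h.2.re⟩
  have him : IntervalIntegrable (fun t => (f t).im) volume a b := ⟨h.1.im, h.2.im⟩
  have h1 := (hre.absolutelyContinuousOnInterval_intervalIntegral Set.left_mem_uIcc).fun_smul
    (absolutelyContinuousOnInterval_const (1 : ℂ))
  have h2 := (him.absolutelyContinuousOnInterval_intervalIntegral Set.left_mem_uIcc).fun_smul
    (absolutelyContinuousOnInterval_const Complex.I)
  refine absolutelyContinuousOnInterval_congr (fun t ht => ?_) (h1.fun_add h2)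
  have ht' : IntervalIntegrable f volume a t :=
    h.mono_set (Set.uIcc_subset_uIcc_left ht)
  have e1 : ∫ s in a..t, (f s).re = (∫ s in a..t, f s).re :=
    Complex.reCLM.intervalIntegral_comp_comm ht'
  have e2 : ∫ s in a..t, (f s).im = (∫ s in a..t, f s).im :=
    Complex.imCLM.intervalIntegral_comp_comm ht'
  rw [e1, e2]
  apply Complex.ext <;> simp

lemma ae_hasDerivAt_integral {f : ℝ → ℂ} (h : IntervalIntegrable f volume a b) :
    ∀ᵐ t, t ∈ Set.uIcc a b → HasDerivAt (fun t => ∫ s in a..t, f s) (f t) t := by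
  filter_upwards [h.ae_hasDerivAt_integral] with t ht hm
  exact ht hm a Set.left_mem_uIcc

namespace IsPrim

variable {f f' g g' : ℝ → ℂ}

/-- The fundamental theorem of calculus. -/
lemma sub_eq (h : IsPrim a b f f') : f b - f a = ∫ t in a..b, f' t := by
  obtain ⟨C, hC⟩ := (h.ac.fun_sub (absolutelyContinuousOnInterval_integral
      h.int)).const_of_ae_hasDerivAt_zero
    (by
      filter_upwards [h.deriv, ae_hasDerivAt_integral h.int] with t h1 h2 ht
      have h3 := (h1 ht).fun_sub (h2 ht)
      rwa [sub_self] at h3)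
  have h1 := hC a Set.left_mem_uIcc
  have h2 := hC b Set.right_mem_uIcc
  simp only [intervalIntegral.integral_same, sub_zero] at h1
  rw [h1, ← h2]
  ring

lemma of_eq_integral (hab : a ≤ b) (hi : IntervalIntegrable f' volume a b)
    (h : ∀ t ∈ Set.Icc a b, f t = f a + ∫ s in a..t, f' s) : IsPrim a b f f' := by
  have h1 := absolutelyContinuousOnInterval_integral hi
  rw [← Set.uIcc_of_le hab] at h
  refine ⟨absolutelyContinuousOnInterval_congr h
    ((absolutelyContinuousOnInterval_const _).fun_add h1), hi, ?_⟩
  have hn : ∀ᵐ t : ℝ, t ≠ a ∧ t ≠ b := by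
    have ha : ∀ᵐ t : ℝ, t ≠ a := compl_mem_ae_iff.2 (measure_singleton a)
    have hb : ∀ᵐ t : ℝ, t ≠ b := compl_mem_ae_iff.2 (measure_singleton b)
    exact ha.and hb
  filter_upwards [ae_hasDerivAt_integral hi, hn] with t ht hne hm
  refine ((ht hm).const_add (f a)).congr_of_eventuallyEq ?_
  rw [Set.uIcc_of_le hab] at hm h
  filter_upwards [Icc_mem_nhds (lt_of_le_of_ne hm.1 hne.1.symm) (lt_of_le_of_ne hm.2 hne.2)] with s
      hs
  exact h s hs

lemma add (h : IsPrim a b f f') (k : IsPrim a b g g') :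
    IsPrim a b (fun t => f t + g t) (fun t => f' t + g' t) := by
  refine ⟨h.ac.fun_add k.ac, h.int.add k.int, ?_⟩
  filter_upwards [h.deriv, k.deriv] with t h1 h2 ht
  exact (h1 ht).add (h2 ht)

lemma const (c : ℂ) : IsPrim a b (fun _ => c) fun _ => 0 :=
  ⟨absolutelyContinuousOnInterval_const c, by simp, .of_forall fun t _ => hasDerivAt_const t c⟩

lemma mul (h : IsPrim a b f f') (k : IsPrim a b g g') :
    IsPrim a b (fun t => f t * g t) (fun t => f' t * g t + f t * g' t) := by
  refine ⟨h.ac.fun_smul k.ac, (h.int.mul_continuousOn k.ac.continuousOn).add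
    (k.int.continuousOn_mul h.ac.continuousOn), ?_⟩
  filter_upwards [h.deriv, k.deriv] with t h1 h2 ht
  exact (h1 ht).mul (h2 ht)

lemma conj (h : IsPrim a b f f') :
    IsPrim a b (fun t => starRingEnd ℂ (f t)) (fun t => starRingEnd ℂ (f' t)) := by
  refine ⟨?_, ?_, ?_⟩
  · have := h.ac
    rw [absolutelyContinuousOnInterval_iff] at this ⊢
    have e : ∀ x y : ℂ, dist (starRingEnd ℂ x) (starRingEnd ℂ y) = dist x y := fun x y =>
      Complex.dist_conj_conj x y
    simpa only [e] using this
  · have := h.int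
    exact ⟨Complex.conjCLE.toContinuousLinearMap.integrable_comp this.1,
      Complex.conjCLE.toContinuousLinearMap.integrable_comp this.2⟩
  · filter_upwards [h.deriv] with t h1 ht
    exact (Complex.conjCLE.toContinuousLinearMap.hasFDerivAt.comp_hasDerivAt t (h1 ht))

end IsPrim

end Prim

section TimeReg

variable {X Y : Type*} [TopologicalSpace X] [TopologicalSpace Y] {a b : ℝ}

/-- A bounded family `g t` of continuous functions that is absolutely continuous in `t`, with
derivative `g' t` dominated uniformly on the space by an integrable function of `t`. -/
structure TimeReg (a b : ℝ) (g g' : ℝ → X → ℂ) : Prop where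
  cont : ∀ t, Continuous (g t)
  cont' : ∀ t, Continuous (g' t)
  meas' : ∀ x, StronglyMeasurable fun t => g' t x
  meas : ∀ x, StronglyMeasurable fun t => g t x
  prim : ∀ x, IsPrim a b (fun t => g t x) fun t => g' t x
  bound : ∃ C : ℝ, ∀ t x, ‖g t x‖ ≤ C
  bound' : ∃ c : ℝ → ℝ, IntervalIntegrable c volume a b ∧ ∀ t x, ‖g' t x‖ ≤ c t

namespace TimeReg

variable {g g' k k' : ℝ → X → ℂ}

lemma comp (h : TimeReg a b g g') {φ : Y → X} (hφ : Continuous φ) :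
    TimeReg a b (fun t y => g t (φ y)) (fun t y => g' t (φ y)) where
  cont t := (h.cont t).comp hφ
  cont' t := (h.cont' t).comp hφ
  meas _ := h.meas _
  meas' _ := h.meas' _
  prim _ := h.prim _
  bound := h.bound.imp fun _ hC t _ => hC t _
  bound' := h.bound'.imp fun _ hC => ⟨hC.1, fun t _ => hC.2 t _⟩

lemma add (h : TimeReg a b g g') (m : TimeReg a b k k') :
    TimeReg a b (fun t x => g t x + k t x) (fun t x => g' t x + k' t x) where
  cont t := (h.cont t).add (m.cont t)
  cont' t := (h.cont' t).add (m.cont' t)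
  meas x := (h.meas x).add (m.meas x)
  meas' x := (h.meas' x).add (m.meas' x)
  prim x := (h.prim x).add (m.prim x)
  bound := by
    obtain ⟨C, hC⟩ := h.bound
    obtain ⟨D, hD⟩ := m.bound
    exact ⟨C + D, fun t x => (norm_add_le _ _).trans (add_le_add (hC t x) (hD t x))⟩
  bound' := by
    obtain ⟨C, hC⟩ := h.bound'
    obtain ⟨D, hD⟩ := m.bound'
    exact ⟨fun t => C t + D t, hC.1.add hD.1, fun t x =>
      (norm_add_le _ _).trans (add_le_add (hC.2 t x) (hD.2 t x))⟩

lemma const {z : X → ℂ} (hz : Continuous z) (hb : ∃ C : ℝ, ∀ x, ‖z x‖ ≤ C) :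
    TimeReg a b (fun _ => z) (fun _ _ => 0) where
  cont t := hz
  cont' t := continuous_const
  meas x := stronglyMeasurable_const
  meas' x := stronglyMeasurable_const
  prim x := IsPrim.const _
  bound := hb.imp fun _ hC _ => hC
  bound' := ⟨fun _ => 0, by simp, fun t x => by simp⟩

lemma sum {ι : Type*} (s : Finset ι) {g g' : ι → ℝ → X → ℂ} (h : ∀ i ∈ s, TimeReg a b (g i) (g' i))
    :
    TimeReg a b (fun t x => ∑ i ∈ s, g i t x) (fun t x => ∑ i ∈ s, g' i t x) := by
  classical
  induction s using Finset.induction_on with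
  | empty => simpa using const (X := X) (z := fun _ => (0 : ℂ)) continuous_const ⟨0, by simp⟩
  | insert i s hi ih =>
    simp only [Finset.sum_insert hi]
    exact (h i (Finset.mem_insert_self i s)).add (ih fun k hk => h k (Finset.mem_insert_of_mem hk))

lemma conj (h : TimeReg a b g g') :
    TimeReg a b (fun t x => starRingEnd ℂ (g t x)) (fun t x => starRingEnd ℂ (g' t x)) where
  cont t := Complex.continuous_conj.comp (h.cont t)
  cont' t := Complex.continuous_conj.comp (h.cont' t)
  meas x := Complex.continuous_conj.comp_stronglyMeasurable (h.meas x)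
  meas' x := Complex.continuous_conj.comp_stronglyMeasurable (h.meas' x)
  prim x := (h.prim x).conj
  bound := by simpa using h.bound
  bound' := by simpa using h.bound'

lemma mul (h : TimeReg a b g g') (m : TimeReg a b k k') :
    TimeReg a b (fun t x => g t x * k t x) (fun t x => g' t x * k t x + g t x * k' t x) where
  cont t := (h.cont t).mul (m.cont t)
  cont' t := ((h.cont' t).mul (m.cont t)).add ((h.cont t).mul (m.cont' t))
  meas x := (h.meas x).mul (m.meas x)
  meas' x := ((h.meas' x).mul (m.meas x)).add ((h.meas x).mul (m.meas' x))
  prim x := (h.prim x).mul (m.prim x)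
  bound := by
    obtain ⟨C, hC⟩ := h.bound
    obtain ⟨D, hD⟩ := m.bound
    refine ⟨C * D, fun t x => ?_⟩
    rw [norm_mul]
    exact mul_le_mul (hC t x) (hD t x) (norm_nonneg _) ((norm_nonneg _).trans (hC t x))
  bound' := by
    obtain ⟨C, hC⟩ := h.bound
    obtain ⟨D, hD⟩ := m.bound
    obtain ⟨c, hc⟩ := h.bound'
    obtain ⟨d, hd⟩ := m.bound'
    refine ⟨fun t => c t * D + C * d t, (hc.1.mul_const D).add (hd.1.const_mul C), fun t x =>
      (norm_add_le _ _).trans ?_⟩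
    rw [norm_mul, norm_mul]
    exact add_le_add (mul_le_mul (hc.2 t x) (hD t x) (norm_nonneg _)
      ((norm_nonneg _).trans (hc.2 t x))) (mul_le_mul (hC t x) (hd.2 t x) (norm_nonneg _)
      ((norm_nonneg _).trans (hC t x)))

lemma congr (h : TimeReg a b g g') (e : ∀ t x, g t x = k t x) (e' : ∀ t x, g' t x = k' t x) :
    TimeReg a b k k' := by
  obtain rfl : g = k := funext fun t => funext fun x => e t x
  obtain rfl : g' = k' := funext fun t => funext fun x => e' t x
  exact h

/-- The integral over the space of a family of this kind is absolutely continuous in time. -/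
lemma integral_sub {X : Type*} [TopologicalSpace X] [TopologicalSpace.PseudoMetrizableSpace X]
    [T2Space X]
    [SecondCountableTopology X] [MeasurableSpace X] [OpensMeasurableSpace X]
    {μ : Measure X} [IsFiniteMeasureOnCompacts μ] [SFinite μ] {g g' : ℝ → X → ℂ}
    (hab : a ≤ b) (h : TimeReg a b g g') {K : Set X} (hK : IsCompact K)
    (hg : ∀ t, ∀ x ∉ K, g t x = 0) (hg' : ∀ t, ∀ x ∉ K, g' t x = 0) :
    IntervalIntegrable (fun t => ∫ x, g' t x ∂μ) volume a b ∧
      ∫ x, g b x ∂μ - ∫ x, g a x ∂μ = ∫ t in a..b, ∫ x, g' t x ∂μ := by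
  obtain ⟨c, hc, hbd⟩ := h.bound'
  have hm : StronglyMeasurable fun p : X × ℝ => g' p.2 p.1 :=
    stronglyMeasurable_uncurry_of_continuous_of_stronglyMeasurable (u := fun x t => g' t x) h.cont'
        h.meas'
  have hI : Integrable (fun p : X × ℝ => g' p.2 p.1) (μ.prod (volume.restrict (Set.Ioc a b))) := by
    have hd : Integrable (fun p : X × ℝ => K.indicator (fun _ => (1 : ℝ)) p.1 * c p.2)
        (μ.prod (volume.restrict (Set.Ioc a b))) := by
      refine Integrable.mul_prod ?_ ((intervalIntegrable_iff_integrableOn_Ioc_of_le hab).1 hc)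
      rw [integrable_indicator_iff hK.isClosed.measurableSet]
      exact integrableOn_const hK.measure_lt_top.ne
    refine hd.mono' hm.aestronglyMeasurable (.of_forall fun p => ?_)
    by_cases hp : p.1 ∈ K
    · simpa [hp] using hbd p.2 p.1
    · simp [hp, hg' p.2 p.1 hp]
  have gi : ∀ t, Integrable (g t) μ := fun t => (h.cont t).integrable_of_hasCompactSupport
    (HasCompactSupport.intro' hK hK.isClosed fun x hx => hg t x hx)
  have hsw := integral_integral_swap (f := fun x t => g' t x) hI
  refine ⟨?_, ?_⟩
  · rw [intervalIntegrable_iff_integrableOn_Ioc_of_le hab]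
    exact hI.integral_prod_right
  · rw [← MeasureTheory.integral_sub (gi b) (gi a), intervalIntegral.integral_of_le hab, ← hsw]
    refine integral_congr_ae (.of_forall fun x => ?_)
    simp only
    rw [(h.prim x).sub_eq, intervalIntegral.integral_of_le hab]

end TimeReg
end TimeReg

/-! ### The mollified equation -/

section Commute

variable {n : ℕ}

/-- The fields of the two factors of the product frame commute. -/
lemma D_inl_D_inr {κ : E n × E n → ℝ} (hκ : ContDiff ℝ ∞ κ) (i k : Option (Fin n)) :
    (hframe2 n).D (.inl i) ((hframe2 n).D (.inr k) κ)
      = (hframe2 n).D (.inr k) ((hframe2 n).D (.inl i) κ) := by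
  funext w
  have h1 : DifferentiableAt ℝ (fderiv ℝ κ) w :=
    (hκ.fderiv_right (m := ∞) (by simp)).differentiable (by simp) w
  have dl : HasFDerivAt ((hframe2 n).Z (.inl i))
      (((fderiv ℝ ((hframe n).Z i) w.1).comp (ContinuousLinearMap.fst ℝ _ _)).prod 0) w :=
    ((((hframe n).smooth_Z i).differentiable (by simp) w.1).hasFDerivAt.comp w
        hasFDerivAt_fst).prodMk
      (hasFDerivAt_const _ _)
  have dr : HasFDerivAt ((hframe2 n).Z (.inr k)) (ContinuousLinearMap.prod 0
      ((fderiv ℝ ((hframe n).Z k) w.2).comp (ContinuousLinearMap.snd ℝ _ _))) w :=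
    HasFDerivAt.prodMk (hasFDerivAt_const (0 : E n) _)
      ((((hframe n).smooth_Z k).differentiable (by simp) w.2).hasFDerivAt.comp w hasFDerivAt_snd)
  have el : (hframe2 n).Z (.inl i) w = ((hframe n).Z i w.1, 0) := rfl
  have er : (hframe2 n).Z (.inr k) w = (0, (hframe n).Z k w.2) := rfl
  have hsymm := (hκ.contDiffAt (x := w)).isSymmSndFDerivAt
    (by simpa using WithTop.coe_le_coe.2 (le_top : (2 : ℕ∞) ≤ ⊤))
  change fderiv ℝ (fun z => fderiv ℝ κ z ((hframe2 n).Z (.inr k) z)) w ((hframe2 n).Z (.inl i) w)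
    = fderiv ℝ (fun z => fderiv ℝ κ z ((hframe2 n).Z (.inl i) z)) w ((hframe2 n).Z (.inr k) w)
  rw [(h1.hasFDerivAt.clm_apply dr).fderiv, (h1.hasFDerivAt.clm_apply dl).fderiv]
  simp only [add_apply, ContinuousLinearMap.comp_apply,
    ContinuousLinearMap.flip_apply, el, er, ContinuousLinearMap.prod_apply,
    zero_apply, ContinuousLinearMap.coe_fst', ContinuousLinearMap.coe_snd',
    map_zero]
  have := hsymm ((hframe n).Z i w.1, 0) (0, (hframe n).Z k w.2)
  simpa using this

lemma lapSnd_D_inl {κ : E n × E n → ℝ} (hκ : ContDiff ℝ ∞ κ) (i : Option (Fin n)) :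
    lapSnd ((hframe2 n).D (.inl i) κ) = (hframe2 n).D (.inl i) (lapSnd κ) := by
  funext w
  set Y := hframe2 n
  have hs : ∀ k, ContDiff ℝ ∞ (Y.D (.inr k) κ) := fun k => Y.smooth_D _ hκ
  have hss : ∀ k, ContDiff ℝ ∞ (Y.D (.inr k) (Y.D (.inr k) κ)) := fun k => Y.smooth_D _ (hs k)
  have hdiv : ∀ k, ContDiff ℝ ∞ fun w : E n × E n => (hframe n).div k w.2 := fun k =>
    ((hframe n).smooth_div k).comp contDiff_snd
  have hd : ∀ {f : E n × E n → ℝ}, ContDiff ℝ ∞ f → DifferentiableAt ℝ f w := fun hf =>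
    hf.differentiable (by simp) w
  have e : Y.D (.inl i) (lapSnd κ) w = ∑ k, along (Y.Z (.inl i))
      (fun w => Y.D (.inr k) (Y.D (.inr k) κ) w + (hframe n).div k w.2 * Y.D (.inr k) κ w) w :=
    along_sum _ fun k _ => (hd (hss k)).add ((hd (hdiv k)).mul (hd (hs k)))
  rw [e, lapSnd]
  refine Finset.sum_congr rfl fun k _ => ?_
  rw [along_add (hd (hss k)) ((hd (hdiv k)).fun_mul (hd (hs k))), along_mul (hd (hdiv k))
      (hd (hs k))]
  have e1 : along (Y.Z (.inl i)) (Y.D (.inr k) (Y.D (.inr k) κ)) w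
      = Y.D (.inr k) (Y.D (.inr k) (Y.D (.inl i) κ)) w := by
    rw [← D_inl_D_inr hκ, ← D_inl_D_inr (hs k)]
    rfl
  have e2 : along (Y.Z (.inl i)) (fun w => (hframe n).div k w.2) w = 0 :=
    D_inl_snd _ (((hframe n).smooth_div k).of_le (by simp)) i w
  have e3 : along (Y.Z (.inl i)) (Y.D (.inr k) κ) w = Y.D (.inr k) (Y.D (.inl i) κ) w := by
    rw [← D_inl_D_inr hκ]
    rfl
  rw [e1, e2, e3, mul_zero, add_zero]

end Commute

section Solution

variable {n : ℕ} {a b : ℝ}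

/-- Evaluation of `kint κ` at a point is a functional on `L²`, bounded uniformly in the point. -/
lemma exists_kint_clm {κ : E n × E n → ℝ} (hκ : Continuous κ) (hc : HasCompactSupport κ) :
    ∃ C : ℝ, 0 ≤ C ∧ ∀ x, ∃ L : Lp ℂ 2 (hvol n) →L[ℝ] ℂ, ‖L‖ ≤ C ∧ ∀ f, L f = kint κ f x := by
  obtain ⟨C, hC, hb⟩ := exists_norm_kint_le hκ hc
  refine ⟨C, hC, fun x => ?_⟩
  have hx := Frame.hasCompactSupport_slice_right hc x
  let A : Lp ℂ 2 (hvol n) →ₗ[ℝ] ℂ :=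
    { toFun := fun f => kint κ f x
      map_add' := fun f g => by
        rw [kint_congr_ae (Lp.coeFn_add f g)]
        exact kint_add_right hκ hx (locallyIntegrable_of_memLp (Lp.memLp f))
          (locallyIntegrable_of_memLp (Lp.memLp g))
      map_smul' := fun c f => by
        rw [kint_congr_ae (Lp.coeFn_smul c f)]
        simp only [kint, RingHom.id_apply, Pi.smul_apply, smul_comm _ c]
        exact integral_real_smul c fun y => κ (x, y) • f y }
  refine ⟨A.mkContinuous C fun f => ?_, A.mkContinuous_norm_le hC _, fun f => rfl⟩
  have := hb f (Lp.memLp f) x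
  rwa [Lp.norm_def]

/-- `U` is a bounded continuous curve in `L²(ℍⁿ)` that solves `i ∂ₜ U + Δ U = F` on `[a, b]` in the
sense of distributions, where `F` is an integrable curve in `L²(ℍⁿ)`. -/
structure IsWeakSol (a b : ℝ) (U F : ℝ → Lp ℂ 2 (hvol n)) : Prop where
  cont : Continuous U
  bdd : ∃ C : ℝ, ∀ t, ‖U t‖ ≤ C
  meas : StronglyMeasurable F
  int : IntervalIntegrable F volume a b
  eqn : ∀ φ : E n → ℝ, ContDiff ℝ ∞ φ → HasCompactSupport φ → ∀ t ∈ Set.Icc a b,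
    Complex.I * ((∫ x, φ x • U t x ∂hvol n) - ∫ x, φ x • U a x ∂hvol n)
      + ∫ τ in a..t, ∫ x, (hframe n).lap φ x • U τ x ∂hvol n
      = ∫ τ in a..t, ∫ x, φ x • F τ x ∂hvol n

/-- The time derivative of `kint κ (U t)` for a solution `U`. -/
def dkint (κ : E n × E n → ℝ) (u F : E n → ℂ) (x : E n) : ℂ :=
  Complex.I * kint (lapSnd κ) u x - Complex.I * kint κ F x

variable {U F : ℝ → Lp ℂ 2 (hvol n)}

lemma IsWeakSol.timeReg (hab : a ≤ b) (h : IsWeakSol a b U F) {κ : E n × E n → ℝ}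
    (hκ : ContDiff ℝ ∞ κ) (hc : HasCompactSupport κ) :
    TimeReg a b (fun t => kint κ (U t)) (fun t => dkint κ (U t) (F t)) := by
  have sl := smooth_lapSnd hκ
  have cl := hasCompactSupport_lapSnd hc
  obtain ⟨C, hC, L⟩ := exists_kint_clm hκ.continuous hc
  obtain ⟨C', hC', L'⟩ := exists_kint_clm sl.continuous cl
  obtain ⟨M, hM⟩ := h.bdd
  have hU : ∀ t, LocallyIntegrable (U t) (hvol n) := fun t => locallyIntegrable_of_memLp
      (Lp.memLp _)
  have hF : ∀ t, LocallyIntegrable (F t) (hvol n) := fun t => locallyIntegrable_of_memLp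
      (Lp.memLp _)
  have cU : ∀ x, Continuous fun t => kint κ (U t) x := fun x => by
    obtain ⟨A, -, hA⟩ := L x
    simpa only [Function.comp_def, hA] using A.continuous.comp h.cont
  have cU' : ∀ x, Continuous fun t => kint (lapSnd κ) (U t) x := fun x => by
    obtain ⟨A, -, hA⟩ := L' x
    simpa only [Function.comp_def, hA] using A.continuous.comp h.cont
  have mF : ∀ x, StronglyMeasurable fun t => kint κ (F t) x := fun x => by
    obtain ⟨A, -, hA⟩ := L x
    simpa only [hA] using A.continuous.comp_stronglyMeasurable h.meas
  have iF : ∀ x, IntervalIntegrable (fun t => kint κ (F t) x) volume a b := fun x => by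
    obtain ⟨A, -, hA⟩ := L x
    have hi : IntervalIntegrable (fun t => A (F t)) volume a b :=
      ⟨A.integrable_comp h.int.1, A.integrable_comp h.int.2⟩
    simpa only [hA] using hi
  have iU : ∀ x a b, IntervalIntegrable (fun t => kint (lapSnd κ) (U t) x) volume a b :=
      fun x a b =>
    (cU' x).intervalIntegrable a b
  have nb : ∀ x (f : Lp ℂ 2 (hvol n)), ‖kint κ f x‖ ≤ C * ‖f‖ := fun x f => by
    obtain ⟨A, hA', hA⟩ := L x
    rw [← hA]
    exact A.le_of_opNorm_le hA' f
  have nb' : ∀ x (f : Lp ℂ 2 (hvol n)), ‖kint (lapSnd κ) f x‖ ≤ C' * ‖f‖ := fun x f => by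
    obtain ⟨A, hA', hA⟩ := L' x
    rw [← hA]
    exact A.le_of_opNorm_le hA' f
  refine ⟨fun t => (smooth_kint hκ hc (hU t)).continuous, fun t =>
    ((smooth_kint sl cl (hU t)).continuous.const_mul _).sub
      ((smooth_kint hκ hc (hF t)).continuous.const_mul _), fun x =>
    ((cU' x).stronglyMeasurable.const_mul _).sub ((mF x).const_mul _), fun x =>
    (cU x).stronglyMeasurable, fun x => ?_, ⟨C * M, fun t x => (nb x _).trans
      (mul_le_mul_of_nonneg_left (hM t) hC)⟩, fun t => C' * M + C * ‖F t‖, ?_, fun t x => ?_⟩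
  · refine IsPrim.of_eq_integral hab (((iU x a b).const_mul _).sub ((iF x).const_mul _)) fun t ht =>
        ?_
    have iF' : IntervalIntegrable (fun t => kint κ (F t) x) volume a t :=
      (iF x).mono_set (Set.uIcc_subset_uIcc_left (by rwa [Set.uIcc_of_le hab]))
    have he := h.eqn (fun y => κ (x, y)) (hκ.comp (contDiff_prodMk_right x))
      (Frame.hasCompactSupport_slice_right hc x) t ht
    simp only [← lapSnd_apply hκ] at he
    change Complex.I * (kint κ (U t) x - kint κ (U a) x) + ∫ τ in a..t, kint (lapSnd κ) (U τ) x
      = ∫ τ in a..t, kint κ (F τ) x at he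
    simp only [dkint]
    rw [intervalIntegral.integral_sub ((iU x a t).const_mul _) (iF'.const_mul _),
      intervalIntegral.integral_const_mul, intervalIntegral.integral_const_mul, ← he]
    linear_combination (kint κ (U t) x - kint κ (U a) x) * Complex.I_mul_I
  · exact (intervalIntegrable_const).add (h.int.norm.const_mul C)
  · refine (norm_sub_le _ _).trans ?_
    rw [norm_mul, norm_mul, Complex.norm_I, one_mul, one_mul]
    exact add_le_add ((nb' x _).trans (mul_le_mul_of_nonneg_left (hM t) hC')) (nb x _)

lemma smooth_dkint {κ : E n × E n → ℝ} (hκ : ContDiff ℝ ∞ κ) (hc : HasCompactSupport κ)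
    {u F : E n → ℂ} (hu : LocallyIntegrable u (hvol n)) (hF : LocallyIntegrable F (hvol n)) :
    ContDiff ℝ ∞ (dkint κ u F) :=
  (contDiff_const.mul (smooth_kint (smooth_lapSnd hκ) (hasCompactSupport_lapSnd hc) hu)).sub
    (contDiff_const.mul (smooth_kint hκ hc hF))

lemma hasCompactSupport_dkint {κ : E n × E n → ℝ} (hc : HasCompactSupport κ) (u F : E n → ℂ) :
    HasCompactSupport (dkint κ u F) :=
  (hasCompactSupport_kint (hasCompactSupport_lapSnd hc) u).mul_left.sub
    (hasCompactSupport_kint hc F).mul_left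

lemma D_dkint {κ : E n × E n → ℝ} (hκ : ContDiff ℝ ∞ κ) (hc : HasCompactSupport κ)
    {u F : E n → ℂ} (hu : LocallyIntegrable u (hvol n)) (hF : LocallyIntegrable F (hvol n))
    (i : Option (Fin n)) :
    (hframe n).D i (dkint κ u F) = dkint ((hframe2 n).D (.inl i) κ) u F := by
  funext x
  have s1 := smooth_kint (smooth_lapSnd hκ) (hasCompactSupport_lapSnd hc) hu
  have s2 := smooth_kint hκ hc hF
  rw [dkint, lapSnd_D_inl hκ, ← D_kint (smooth_lapSnd hκ) (hasCompactSupport_lapSnd hc) hu,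
    ← D_kint hκ hc hF]
  have d1 := s1.differentiable (by simp) x
  have d2 := s2.differentiable (by simp) x
  have e := along_sub (Z := (hframe n).Z i) (d1.const_mul Complex.I) (d2.const_mul Complex.I)
  refine e.trans ?_
  congr 1
  · exact along_clm (ContinuousLinearMap.mul ℝ ℂ Complex.I) d1
  · exact along_clm (ContinuousLinearMap.mul ℝ ℂ Complex.I) d2

/-- The equation of the approximations. -/
lemma eqn_moll (j : ℕ) {u F : E n → ℂ} (hu : LocallyIntegrable u (hvol n)) (x : E n) :
    Complex.I * dkint (mollKer n j) u F x + (hframe n).lap (moll j u) x = src j u F x := by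
  have hκ := smooth_mollKer n j
  have hc := hasCompactSupport_mollKer n j
  rw [moll, lap_kint hκ hc hu, src, dkint]
  have e : kint (commKer n j) u x = kint (lapFst (mollKer n j)) u x - kint (lapSnd (mollKer n j)) u
      x := by
    simp only [kint, commKer, sub_smul]
    exact integral_sub
      (integrable_kint (smooth_lapFst hκ).continuous
        (Frame.hasCompactSupport_slice_right (hasCompactSupport_lapFst hc) x) hu)
      (integrable_kint (smooth_lapSnd hκ).continuous
        (Frame.hasCompactSupport_slice_right (hasCompactSupport_lapSnd hc) x) hu)
  rw [e]
  linear_combination (kint (lapSnd (mollKer n j)) u x - kint (mollKer n j) F x) * Complex.I_mul_I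

end Solution

/-! ### The interaction Morawetz estimate with regularized weight -/

section Morawetz

variable {n : ℕ} {a b δ : ℝ} {U F : ℝ → Lp ℂ 2 (hvol n)}

lemma timeReg_tens {X : Type*} [TopologicalSpace X] {f f' g g' : ℝ → X → ℂ}
    (hf : TimeReg a b f f') (hg : TimeReg a b g g') :
    TimeReg a b (fun t => tens (f t) (g t))
      (fun t w => tens (f' t) (g t) w + tens (f t) (g' t) w) :=
  (hf.comp continuous_fst).mul (hg.comp continuous_snd)

/-- The time derivative of the approximation `moll j (U t)`. -/
def dmoll (j : ℕ) (u F : E n → ℂ) : E n → ℂ := dkint (mollKer n j) u F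

/-- The virial inequality for the approximations, and the integral of its right-hand side. -/
lemma IsWeakSol.virial (hab : a ≤ b) (h : IsWeakSol a b U F) (hδ : 0 < δ) (j : ℕ) :
    IntervalIntegrable (fun t => 2 * (∫ w, mom' δ (moll j (U t)) (dmoll j (U t) (F t)) w
      ∂hvol2 n).im) volume a b ∧
    ∫ t in a..b, 2 * (∫ w, mom' δ (moll j (U t)) (dmoll j (U t) (F t)) w ∂hvol2 n).im
      = (2 * ∫ w, mom δ (moll j (U b)) (fun i => (hframe n).D i (moll j (U b))) w ∂hvol2 n).im
        - (2 * ∫ w, mom δ (moll j (U a)) (fun i => (hframe n).D i (moll j (U a))) w ∂hvol2 n).im ∧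
    ∀ t, 4 * ∫ w, bilapKer n δ (coshd w.1 w.2) * ‖tens (moll j (U t)) (moll j (U t)) w‖ ^ 2 ∂hvol2 n
      + forcing δ (moll j (U t)) (fun i => (hframe n).D i (moll j (U t))) (src j (U t) (F t))
      ≤ 2 * (∫ w, mom' δ (moll j (U t)) (dmoll j (U t) (F t)) w ∂hvol2 n).im := by
  have hκ := smooth_mollKer n j
  have hc := hasCompactSupport_mollKer n j
  have hU : ∀ t, LocallyIntegrable (U t) (hvol n) := fun t => locallyIntegrable_of_memLp
      (Lp.memLp _)
  have hF : ∀ t, LocallyIntegrable (F t) (hvol n) := fun t => locallyIntegrable_of_memLp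
      (Lp.memLp _)
  have su : ∀ t, ContDiff ℝ ∞ (moll j (U t)) := fun t => smooth_kint hκ hc (hU t)
  have su' : ∀ t, ContDiff ℝ ∞ (dmoll j (U t) (F t)) := fun t => smooth_dkint hκ hc (hU t) (hF t)
  have cu : ∀ t, HasCompactSupport (moll j (U t)) := fun t => hasCompactSupport_kint hc _
  have cu' : ∀ t, HasCompactSupport (dmoll j (U t) (F t)) := fun t => hasCompactSupport_dkint hc _ _
  have t0 : TimeReg a b (fun t => moll j (U t)) (fun t => dmoll j (U t) (F t)) :=
      h.timeReg hab hκ hc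
  have tD : ∀ i, TimeReg a b (fun t => (hframe n).D i (moll j (U t)))
      (fun t => (hframe n).D i (dmoll j (U t) (F t))) := fun i =>
    (h.timeReg hab ((hframe2 n).smooth_D (.inl i) hκ) ((hframe2 n).hasCompactSupport_D _ hc)).congr
      (fun t x => by rw [moll, D_kint hκ hc (hU t)])
      (fun t x => by rw [dmoll, D_dkint hκ hc (hU t) (hF t)])
  have tv : TimeReg a b (fun t => tens (moll j (U t)) (moll j (U t)))
      (fun t => tens' (moll j (U t)) (dmoll j (U t) (F t))) := timeReg_tens t0 t0
  have tV : ∀ α, TimeReg a b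
      (fun t => dtens (moll j (U t)) (fun i => (hframe n).D i (moll j (U t))) α)
      (fun t => (hframe2 n).D α (tens' (moll j (U t)) (dmoll j (U t) (F t)))) := by
    intro α
    have hd : ∀ {f g : E n → ℂ}, ContDiff ℝ ∞ f → ContDiff ℝ ∞ g → ∀ w,
        DifferentiableAt ℝ (tens f g) w := fun hf hg w =>
      (smooth_tens hf hg).differentiable (by simp) w
    have e : ∀ t w, (hframe2 n).D α (tens' (moll j (U t)) (dmoll j (U t) (F t))) w
        = (hframe2 n).D α (tens (dmoll j (U t) (F t)) (moll j (U t))) w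
          + (hframe2 n).D α (tens (moll j (U t)) (dmoll j (U t) (F t))) w := fun t w =>
      along_add (hd (su' t) (su t) w) (hd (su t) (su' t) w)
    cases α with
    | inl i =>
      refine (timeReg_tens (tD i) t0).congr (fun t w => rfl) fun t w => ?_
      rw [e, D_inl_tens (su' t) (su t), D_inl_tens (su t) (su' t)]
    | inr i =>
      refine (timeReg_tens t0 (tD i)).congr (fun t w => rfl) fun t w => ?_
      rw [e, D_inr_tens (su' t) (su t), D_inr_tens (su t) (su' t)]
  have tm : TimeReg a b
      (fun t => mom δ (moll j (U t)) (fun i => (hframe n).D i (moll j (U t))))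
      (fun t => mom' δ (moll j (U t)) (dmoll j (U t) (F t))) := by
    have tz : ∀ α, TimeReg a b (fun _ w => (((hframe2 n).D α (wt δ) w : ℝ) : ℂ)) (fun _ _ => 0) :=
      fun α => TimeReg.const (Complex.continuous_ofReal.comp
        ((hframe2 n).smooth_D α (smooth_wt hδ)).continuous) ⟨2, fun w => by
          have := D_wt_le hδ α w
          rw [abs_mul, abs_two] at this
          rw [Complex.norm_real, Real.norm_eq_abs]
          linarith⟩
    refine (TimeReg.sum Finset.univ fun α _ => (tz α).mul (tv.conj.mul (tV α))).congr
      (fun t w => rfl) fun t w => ?_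
    simp only [mom', zero_mul, zero_add]
  obtain ⟨R, hR⟩ := exists_ball_of_compact hc
  obtain ⟨R', hR'⟩ := exists_ball_of_compact (hasCompactSupport_lapSnd hc)
  set K := Metric.closedBall (0 : E n) (max R R')
  have z0 : ∀ t, ∀ x ∉ K, moll j (U t) x = 0 := fun t x hx => by
    have : ∀ y, mollKer n j (x, y) = 0 := fun y => by
      by_contra hne
      exact hx (by simpa [K] using Or.inl (hR x y hne).1)
    simp [moll, kint, this]
  have z1 : ∀ t, ∀ x ∉ K, dmoll j (U t) (F t) x = 0 := fun t x hx => by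
    have h1 : ∀ y, mollKer n j (x, y) = 0 := fun y => by
      by_contra hne
      exact hx (by simpa [K] using Or.inl (hR x y hne).1)
    have h2 : ∀ y, lapSnd (mollKer n j) (x, y) = 0 := fun y => by
      by_contra hne
      exact hx (by simpa [K] using Or.inr (hR' x y hne).1)
    simp [dmoll, dkint, kint, h1, h2]
  have z2 : ∀ t, ∀ w ∉ K ×ˢ K, tens (moll j (U t)) (moll j (U t)) w = 0 := fun t w hw => by
    rw [Set.mem_prod, not_and_or] at hw
    rcases hw with hw | hw <;> simp [tens, z0 t _ hw]
  have z3 : ∀ t, ∀ w ∉ K ×ˢ K, tens' (moll j (U t)) (dmoll j (U t) (F t)) w = 0 := fun t w hw => by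
    rw [Set.mem_prod, not_and_or] at hw
    rcases hw with hw | hw <;> simp [tens', tens, z0 t _ hw, z1 t _ hw]
  obtain ⟨i1, i2⟩ := tm.integral_sub (μ := hvol2 n) (K := K ×ˢ K) hab
    ((isCompact_closedBall _ _).prod (isCompact_closedBall _ _))
    (fun t w hw => by simp [mom, z2 t w hw]) (fun t w hw => by simp [mom', z2 t w hw, z3 t w hw])
  have i3 : IntervalIntegrable (fun t => (∫ w, mom' δ (moll j (U t)) (dmoll j (U t) (F t)) w
      ∂hvol2 n).im) volume a b := ⟨i1.1.im, i1.2.im⟩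
  refine ⟨i3.const_mul 2, ?_, fun t => ?_⟩
  · rw [intervalIntegral.integral_const_mul]
    have e : ∫ t in a..b, (∫ w, mom' δ (moll j (U t)) (dmoll j (U t) (F t)) w ∂hvol2 n).im
        = (∫ t in a..b, ∫ w, mom' δ (moll j (U t)) (dmoll j (U t) (F t)) w ∂hvol2 n).im :=
      Complex.imCLM.intervalIntegral_comp_comm i1
    rw [e, ← i2]
    simp
    ring
  · exact virial_ineq hδ (su t) (su' t) ((smooth_kint hκ hc (hF t)).add
      (smooth_kint (smooth_commKer n j) (hasCompactSupport_commKer n j) (hU t))) (cu t) (cu' t)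
      ((hasCompactSupport_kint hc _).add (hasCompactSupport_kint (hasCompactSupport_commKer n j) _))
      (eqn_moll j (hU t))

/-- The virial functional is bounded uniformly in the regularization of the weight. -/
lemma abs_mom_le (hδ : 0 < δ) {u : E n → ℂ} {G : Option (Fin n) → E n → ℂ}
    (hu : MemLp u 2 (hvol n)) (hG : ∀ i, MemLp (G i) 2 (hvol n)) {A B : ℝ}
    (hA : (eLpNorm u 2 (hvol n)).toReal ≤ A) (hB : ∀ i, (eLpNorm (G i) 2 (hvol n)).toReal ≤ B) :
    |(2 * ∫ w, mom δ u G w ∂hvol2 n).im|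
      ≤ ∑ _α : Option (Fin n) ⊕ Option (Fin n), (A * A) * (4 * (B * A)) := by
  have hA0 : 0 ≤ A := ENNReal.toReal_nonneg.trans hA
  have hB0 : 0 ≤ B := ENNReal.toReal_nonneg.trans (hB none)
  have hv := memLp_tens hu hu
  have hV : ∀ α, MemLp (dtens u G α) 2 (hvol2 n) := fun α => by
    cases α with
    | inl i => exact memLp_tens (hG i) hu
    | inr i => exact memLp_tens hu (hG i)
  have hzm : ∀ α, AEStronglyMeasurable (fun w => 2 * (hframe2 n).D α (wt δ) w) (hvol2 n) := fun α =>
    (((hframe2 n).smooth_D α (smooth_wt hδ)).continuous.const_mul 2).aestronglyMeasurable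
  have hW : ∀ α, MemLp (fun w => ((2 * (hframe2 n).D α (wt δ) w : ℝ) : ℂ) * dtens u G α w) 2
      (hvol2 n) := fun α => memLp_bdd_mul (hzm α) (D_wt_le hδ α) (hV α)
  have e : 2 * ∫ w, mom δ u G w ∂hvol2 n = ∑ α, ∫ w, starRingEnd ℂ (tens u u w)
      * (((2 * (hframe2 n).D α (wt δ) w : ℝ) : ℂ) * dtens u G α w) ∂hvol2 n := by
    rw [← integral_finsetSum _ fun α _ => integrable_pairing hv (hW α), ← integral_const_mul]
    refine integral_congr_ae (.of_forall fun w => ?_)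
    simp only [mom, Finset.mul_sum]
    refine Finset.sum_congr rfl fun α _ => ?_
    push_cast
    ring
  rw [e]
  refine (Complex.abs_im_le_norm _).trans ((norm_sum_le _ _).trans (Finset.sum_le_sum fun α _ =>
      ?_))
  refine (norm_pairing_le hv (hW α)).trans ?_
  have b1 : (eLpNorm (tens u u) 2 (hvol2 n)).toReal ≤ A * A := by
    rw [eLpNorm_tens hu.1 hu.1, ENNReal.toReal_mul]
    exact mul_le_mul hA hA ENNReal.toReal_nonneg hA0
  have b2 : (eLpNorm (dtens u G α) 2 (hvol2 n)).toReal ≤ B * A := by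
    cases α with
    | inl i =>
      rw [dtens, Sum.elim_inl, eLpNorm_tens (hG i).1 hu.1, ENNReal.toReal_mul]
      exact mul_le_mul (hB i) hA ENNReal.toReal_nonneg hB0
    | inr i =>
      rw [dtens, Sum.elim_inr, eLpNorm_tens hu.1 (hG i).1, ENNReal.toReal_mul, mul_comm B]
      exact mul_le_mul hA (hB i) ENNReal.toReal_nonneg hA0
  have b3 := ENNReal.toReal_mono (ENNReal.mul_ne_top ENNReal.ofReal_ne_top (hV α).2.ne)
    (eLpNorm_bdd_mul_le (μ := hvol2 n) (D_wt_le hδ α) (dtens u G α))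
  rw [ENNReal.toReal_mul, ENNReal.toReal_ofReal (by norm_num)] at b3
  exact mul_le_mul b1 (b3.trans (by linarith)) ENNReal.toReal_nonneg (mul_nonneg hA0 hA0)

lemma continuous_bilapKer (hδ : 0 < δ) :
    Continuous fun w : E n × E n => bilapKer n δ (coshd w.1 w.2) := by
  have h := ((hframe2 n).smooth_lap ((hframe2 n).smooth_lap (smooth_wt (n := n) hδ))).continuous
  have e : (fun w : E n × E n => bilapKer n δ (coshd w.1 w.2))
      = fun w => -((hframe2 n).lap ((hframe2 n).lap (wt δ)) w) / 4 := by
    funext w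
    rw [lap_lap_wt hδ]
    ring
  rw [e]
  exact h.neg.div_const 4

lemma exists_bilapKer_bound (hn : 3 ≤ n) (hδ : 0 < δ) (hδ1 : δ ≤ 1) :
    ∃ K : ℝ, ∀ w : E n × E n, |bilapKer n δ (coshd w.1 w.2)| ≤ K :=
  ⟨_, fun w => by
    rw [abs_of_nonneg (bilapKer_nonneg hn hδ hδ1 (one_le_coshd w.1 w.2))]
    exact bilapKer_le hn hδ hδ1 (one_le_coshd w.1 w.2)⟩

/-- The integral against `bilapKer` as an `L²` pairing, which is continuous in `v`. -/
lemma integral_bilapKer_eq (v : E n × E n → ℂ) (hi : Integrable (fun w =>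
    starRingEnd ℂ (v w) * ((bilapKer n δ (coshd w.1 w.2) : ℂ) * v w)) (hvol2 n)) :
    Integrable (fun w => bilapKer n δ (coshd w.1 w.2) * ‖v w‖ ^ 2) (hvol2 n) ∧
    ∫ w, bilapKer n δ (coshd w.1 w.2) * ‖v w‖ ^ 2 ∂hvol2 n
      = (∫ w, starRingEnd ℂ (v w) * ((bilapKer n δ (coshd w.1 w.2) : ℂ) * v w) ∂hvol2 n).re := by
  have e : ∀ w, bilapKer n δ (coshd w.1 w.2) * ‖v w‖ ^ 2
      = (starRingEnd ℂ (v w) * ((bilapKer n δ (coshd w.1 w.2) : ℂ) * v w)).re := fun w => by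
    rw [mul_left_comm, Complex.re_ofReal_mul, mul_comm (starRingEnd ℂ (v w)), Complex.mul_conj,
      Complex.ofReal_re, Complex.normSq_eq_norm_sq]
  simp only [e]
  refine ⟨hi.re, ?_⟩
  rw [← RCLike.re_eq_complex_re, ← integral_re hi]

/-- The interaction Morawetz estimate: the bilaplacian of the regularized weight is integrable
against `|u|² ⊗ |u|²`, with a bound that does not depend on the regularization. -/
theorem morawetz_regularized (hn : 3 ≤ n) : ∃ C : ℝ≥0, ∀ (a b : ℝ) (U F : ℝ → Lp ℂ 2 (hvol n))
    (G : ℝ → Option (Fin n) → E n → ℂ) (σ : ℝ) (Λ : ℝ≥0), a ≤ b → 0 < σ → IsWeakSol a b U F →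
    (∀ t ∈ Set.Icc a b, IsWeakJet (U t) (G t)) →
    (∀ t ∈ Set.Icc a b, eLpNorm (U t) 2 (hvol n) ≤ Λ ∧ ∀ i, eLpNorm (G t i) 2 (hvol n) ≤ Λ) →
    (∀ᵐ t ∂volume.restrict (Set.Icc a b),
      F t =ᵐ[hvol n] fun x => ((‖U t x‖ ^ (2 * σ) : ℝ) : ℂ) * U t x) →
    ∀ δ : ℝ, 0 < δ → δ ≤ 1 →
      ∫⁻ t in Set.Icc a b, ∫⁻ w, ENNReal.ofReal (bilapKer n δ (coshd w.1 w.2))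
        * ‖tens (U t) (U t) w‖ₑ ^ 2 ∂hvol2 n ≤ C * Λ ^ 4 := by
  obtain ⟨C₁, hC₁⟩ := l2Lim_D_moll n
  obtain ⟨C₂, hC₂⟩ := l2Lim_src n
  have hn1 : 1 ≤ n := by omega
  -- the approximations have derivatives of norm at most `K Λ`
  set K : ℝ≥0 := C₁ * (1 + (n + 1)) with hK
  set C₀ : ℝ≥0 := 2 * ∑ _α : Option (Fin n) ⊕ Option (Fin n), 4 * K with hC₀
  refine ⟨C₀, fun a b U F G σ Λ hab hσ h hG hΛ hFU δ hδ hδ1 => ?_⟩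
  have sumΛ : ∀ t ∈ Set.Icc a b, eLpNorm (U t) 2 (hvol n) + ∑ i, eLpNorm (G t i) 2 (hvol n)
      ≤ ((1 + (n + 1)) * Λ : ℝ≥0) := by
    intro t ht
    have := Finset.sum_le_card_nsmul Finset.univ (fun i => eLpNorm (G t i) 2 (hvol n)) Λ
      fun i _ => (hΛ t ht).2 i
    refine (add_le_add (hΛ t ht).1 this).trans (le_of_eq ?_)
    simp
    ring
  have lu : ∀ t ∈ Set.Icc a b, L2Lim (hvol n) (fun j => moll j (U t)) (U t) Λ := fun t ht =>
    (l2Lim_moll (Lp.memLp _)).mono (hΛ t ht).1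
  have lD : ∀ t ∈ Set.Icc a b, ∀ i, L2Lim (hvol n) (fun j => (hframe n).D i (moll j (U t))) (G t i)
      (K * Λ : ℝ≥0) := fun t ht i => (hC₁ _ _ (hG t ht) i).mono (by
    refine (mul_le_mul' le_rfl (sumΛ t ht)).trans (le_of_eq ?_)
    rw [hK]
    push_cast
    ring)
  have toR : ∀ {f : ℕ → E n → ℂ} {g : E n → ℂ} {N : ℝ≥0} , L2Lim (hvol n) f g N → ∀ j,
      (eLpNorm (f j) 2 (hvol n)).toReal ≤ N := fun hf j => by
    have := ENNReal.toReal_mono ENNReal.coe_ne_top (hf.2 j)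
    simpa using this
  have lap0 : 0 ≤ lapBound n δ := (abs_nonneg _).trans (lap_wt_le hn1 hδ (0 : E n × E n))
  -- the domination of the forcing terms
  set P : ℝ := 2 * ((2 * Λ) * ((∑ _α : Option (Fin n) ⊕ Option (Fin n),
      (4 : ℝ) * (((K * Λ : ℝ≥0) : ℝ) * (Λ : ℝ)))
    + lapBound n δ * (Λ * Λ)))
  have hP : 0 ≤ P := by positivity
  set c : ℝ → ℝ := fun t => P * (C₂ * (‖F t‖ + (1 + (n + 1)) * Λ)) with hc
  have hc0 : ∀ t, 0 ≤ c t := fun t => by positivity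
  have cm : Measurable c := by
    have := h.meas.norm.measurable
    fun_prop
  have ci : IntervalIntegrable c volume a b :=
    ((h.int.norm.add intervalIntegrable_const).const_mul _).const_mul _
  set f : ℕ → ℝ → ℝ := fun j t => forcing δ (moll j (U t)) (fun i => (hframe n).D i (moll j (U t)))
    (src j (U t) (F t))
  set B : ℕ → ℝ → ℝ := fun j t => ∫ w, bilapKer n δ (coshd w.1 w.2)
    * ‖tens (moll j (U t)) (moll j (U t)) w‖ ^ 2 ∂hvol2 n
  set m : ℕ → ℝ → ℝ := fun j t => 2 * (∫ w, mom' δ (moll j (U t)) (dmoll j (U t) (F t)) w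
    ∂hvol2 n).im
  have vir : ∀ j, IntervalIntegrable (m j) volume a b ∧ ∫ t in a..b, m j t = _ ∧
      ∀ t, 4 * B j t + f j t ≤ m j t := fun j => h.virial hab hδ j
  have lF : ∀ t ∈ Set.Icc a b, L2Lim (hvol n) (fun j => src j (U t) (F t)) (F t)
      (C₂ * (‖F t‖₊ + (1 + (n + 1)) * Λ) : ℝ≥0) := fun t ht =>
    (hC₂ _ _ _ (hG t ht) (Lp.memLp _)).mono (by
      rw [ENNReal.coe_mul, ENNReal.coe_add]
      refine mul_le_mul' le_rfl (add_le_add (le_of_eq ?_) (sumΛ t ht))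
      rw [← Lp.enorm_def]
      rfl)
  have fb : ∀ t ∈ Set.Icc a b, ∀ j, |f j t| ≤ c t := by
    intro t ht j
    refine (abs_forcing_le hn1 hδ ((lu t ht).1.1 j) (fun i => (lD t ht i).1.1 j) ((lF t ht).1.1 j)
      (toR (lu t ht) j) (fun i => toR (lD t ht i) j)).trans ?_
    have h1 := toR (lF t ht) j
    push_cast at h1
    have e : ∀ s X : ℝ, 2 * ((2 * (s * Λ)) * X) = s * (2 * ((2 * Λ) * X)) := fun s X => by ring
    rw [e]
    refine (mul_le_mul_of_nonneg_right h1 hP).trans (le_of_eq ?_)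
    rw [hc]
    ring
  have ic : ∫⁻ t in Set.Icc a b, ENNReal.ofReal (c t) = ENNReal.ofReal (∫ t in a..b, c t) := by
    rw [intervalIntegral.integral_of_le hab, ← integral_Icc_eq_integral_Ioc,
      ofReal_integral_eq_lintegral_ofReal ((intervalIntegrable_iff_integrableOn_Icc_of_le hab).1 ci)
        (.of_forall hc0)]
  obtain ⟨KB, hKB⟩ := exists_bilapKer_bound hn hδ hδ1
  have mB := (continuous_bilapKer (n := n) hδ).aestronglyMeasurable (μ := hvol2 n)
  set B₀ : ℝ → ℝ := fun t => ∫ w, bilapKer n δ (coshd w.1 w.2) * ‖tens (U t) (U t) w‖ ^ 2 ∂hvol2 n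
  have B0i : ∀ t, Integrable (fun w => bilapKer n δ (coshd w.1 w.2) * ‖tens (U t) (U t) w‖ ^ 2)
      (hvol2 n) := fun t => by
    have ht := memLp_tens (Lp.memLp (U t)) (Lp.memLp (U t))
    exact (integral_bilapKer_eq _ (integrable_pairing ht (memLp_bdd_mul mB hKB ht))).1
  have b0 : ∀ w : E n × E n, 0 ≤ bilapKer n δ (coshd w.1 w.2) := fun w =>
    bilapKer_nonneg hn hδ hδ1 (one_le_coshd _ _)
  have B0n : ∀ t, 0 ≤ B₀ t := fun t => integral_nonneg fun w => mul_nonneg (b0 w) (sq_nonneg _)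
  have Bn : ∀ j t, 0 ≤ B j t := fun j t => integral_nonneg fun w => mul_nonneg (b0 w) (sq_nonneg _)
  have limB : ∀ t ∈ Set.Icc a b, Tendsto (fun j => B j t) atTop (𝓝 (B₀ t)) := by
    intro t ht
    have hv := (lu t ht).1.tens (lu t ht).1
    have hW := hv.bdd_mul mB hKB
    have hp := (Complex.continuous_re.tendsto _).comp (hv.tendsto_pairing hW)
    have e1 : B₀ t = _ := (integral_bilapKer_eq _ (integrable_pairing hv.2.1 hW.2.1)).2
    have e2 : (fun j => B j t) = _ := funext fun j =>
      (integral_bilapKer_eq _ (integrable_pairing (hv.1 j) (hW.1 j))).2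
    rw [e1, e2]
    exact hp
  have mint : ∀ j, ∫ t in a..b, m j t ≤ C₀ * Λ ^ 4 := by
    intro j
    rw [(vir j).2.1]
    have hb := abs_mom_le hδ ((lu b (Set.right_mem_Icc.2 hab)).1.1 j)
      (fun i => (lD b (Set.right_mem_Icc.2 hab) i).1.1 j) (toR (lu b (Set.right_mem_Icc.2 hab)) j)
      (fun i => toR (lD b (Set.right_mem_Icc.2 hab) i) j)
    have ha := abs_mom_le hδ ((lu a (Set.left_mem_Icc.2 hab)).1.1 j)
      (fun i => (lD a (Set.left_mem_Icc.2 hab) i).1.1 j) (toR (lu a (Set.left_mem_Icc.2 hab)) j)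
      (fun i => toR (lD a (Set.left_mem_Icc.2 hab) i) j)
    have e : (C₀ * Λ ^ 4 : ℝ) = 2 * ∑ _α : Option (Fin n) ⊕ Option (Fin n),
        ((Λ : ℝ) * Λ) * ((4 : ℝ) * (((K * Λ : ℝ≥0) : ℝ) * (Λ : ℝ))) := by
      rw [hC₀]
      simp only [Finset.sum_const]
      push_cast
      ring
    rw [e]
    linarith [(abs_le.1 hb).2, (abs_le.1 ha).1]
  -- Fatou's lemma in time; adding `c` makes the integrands nonnegative
  have fatou : ∫⁻ t in Set.Icc a b, ENNReal.ofReal (4 * B₀ t + c t)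
      ≤ ENNReal.ofReal (C₀ * Λ ^ 4 + ∫ t in a..b, c t) := by
    have hmi : ∀ j, IntegrableOn (fun t => m j t + c t) (Set.Icc a b) := fun j =>
      (intervalIntegrable_iff_integrableOn_Icc_of_le hab).1 ((vir j).1.add ci)
    calc ∫⁻ t in Set.Icc a b, ENNReal.ofReal (4 * B₀ t + c t)
        ≤ ∫⁻ t in Set.Icc a b, liminf (fun j => ENNReal.ofReal (m j t + c t)) atTop := by
          refine lintegral_mono_ae ?_
          filter_upwards [hFU, ae_restrict_mem measurableSet_Icc] with t hFt ht
          have l1 : Tendsto (fun j => f j t) atTop (𝓝 (forcing δ (U t) (G t) (F t))) :=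
            tendsto_forcing hn1 hδ (lu t ht).1 (fun i => (lD t ht i).1) (lF t ht).1
          have pos : 0 ≤ forcing δ (U t) (G t) (F t) := by
            have hp := forcing_nonlin_nonneg hn1 hδ hσ (hG t ht)
                ((memLp_congr_ae hFt).1 (Lp.memLp _))
            have e : forcing δ (U t) (G t) (F t) = forcing δ (U t) (G t)
                (fun x => ((‖U t x‖ ^ (2 * σ) : ℝ) : ℂ) * U t x) := by
              rw [forcing, forcing]
              congr 2
              refine integral_congr_ae ?_
              have h1 := Measure.quasiMeasurePreserving_fst (μ := hvol n) (ν := hvol n) |>.ae hFt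
              have h2 := Measure.quasiMeasurePreserving_snd (μ := hvol n) (ν := hvol n) |>.ae hFt
              filter_upwards [h1, h2] with w w1 w2
              simp only [tens, w1, w2]
            rw [e]
            exact hp
          have l2 := (((limB t ht).const_mul 4).add l1).add_const (c t)
          have l3 := (ENNReal.continuous_ofReal.tendsto _).comp l2
          calc ENNReal.ofReal (4 * B₀ t + c t)
              ≤ ENNReal.ofReal (4 * B₀ t + forcing δ (U t) (G t) (F t) + c t) :=
                ENNReal.ofReal_le_ofReal (by linarith)
            _ = liminf (fun j => ENNReal.ofReal (4 * B j t + f j t + c t)) atTop :=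
                l3.liminf_eq.symm
            _ ≤ _ := liminf_le_liminf (.of_forall fun j =>
                ENNReal.ofReal_le_ofReal (by linarith [(vir j).2.2 t]))
      _ ≤ liminf (fun j => ∫⁻ t in Set.Icc a b, ENNReal.ofReal (m j t + c t)) atTop :=
          lintegral_liminf_le' fun j => (hmi j).1.aemeasurable.ennreal_ofReal
      _ ≤ _ := by
          refine liminf_le_of_le (by isBoundedDefault) fun y hy => ?_
          obtain ⟨j, hj⟩ := hy.exists
          refine hj.trans ?_
          rw [← ofReal_integral_eq_lintegral_ofReal (hmi j), integral_Icc_eq_integral_Ioc,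
            ← intervalIntegral.integral_of_le hab, intervalIntegral.integral_add (vir j).1 ci]
          · exact ENNReal.ofReal_le_ofReal (by linarith [mint j])
          · filter_upwards [ae_restrict_mem measurableSet_Icc] with t ht
            have h1 := (vir j).2.2 t
            have h2 := (abs_le.1 (fb t ht j)).1
            have h3 := Bn j t
            simp only [Pi.zero_apply]
            linarith
  have ci0 : 0 ≤ ∫ t in a..b, c t := intervalIntegral.integral_nonneg hab fun t _ => hc0 t
  rw [ENNReal.ofReal_add (by positivity) ci0] at fatou
  simp only [fun t => ENNReal.ofReal_add (mul_nonneg zero_le_four (B0n t)) (hc0 t)] at fatou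
  rw [lintegral_add_right _ cm.ennreal_ofReal, ic,
    ENNReal.add_le_add_iff_right ENNReal.ofReal_ne_top] at fatou
  have eC : ENNReal.ofReal (C₀ * Λ ^ 4) = C₀ * Λ ^ 4 := by
    rw [show (C₀ * Λ ^ 4 : ℝ) = ((C₀ * Λ ^ 4 : ℝ≥0) : ℝ) by push_cast; rfl,
        ENNReal.ofReal_coe_nnreal]
    push_cast
    rfl
  rw [eC] at fatou
  refine le_trans (lintegral_mono fun t => ?_) fatou
  have e : ∫⁻ w, ENNReal.ofReal (bilapKer n δ (coshd w.1 w.2)) * ‖tens (U t) (U t) w‖ₑ ^ 2 ∂hvol2 n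
      = ENNReal.ofReal (B₀ t) := by
    rw [ofReal_integral_eq_lintegral_ofReal (B0i t) (.of_forall fun w =>
      mul_nonneg (b0 w) (sq_nonneg _))]
    refine lintegral_congr fun w => ?_
    rw [ENNReal.ofReal_mul (b0 w), ENNReal.ofReal_pow (norm_nonneg _), ofReal_norm]
  rw [e]
  exact ENNReal.ofReal_le_ofReal (by linarith [B0n t])

end Morawetz

/-! ### The Riemannian geometry of the hyperboloid in the chart -/

section Geometry

variable {n : ℕ}

lemma pderiv_graphMap (i : Fin n) (x : E n) :
    pderiv i graphMap x = (x i / ht x, EuclideanSpace.single i (1 : ℝ)) := by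
  have h : HasFDerivAt (graphMap : E n → ℝ × E n)
      (((ht x)⁻¹ • innerSL ℝ x).prod (ContinuousLinearMap.id ℝ (E n))) x :=
    (hasFDerivAt_ht x).prodMk (hasFDerivAt_id x)
  rw [pderiv, h.fderiv]
  simp [EuclideanSpace.inner_single_right, div_eq_inv_mul]

lemma metric_apply (x : E n) (i j : Fin n) :
    metric x i j = (if i = j then 1 else 0) - x i * x j / ht x ^ 2 := by
  have := ht_ne x
  simp only [metric, Matrix.of_apply, mink, pderiv_graphMap, EuclideanSpace.inner_single_left,
    PiLp.single_apply]
  simp only [map_one, one_mul]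
  congr 1
  field_simp

lemma det_metric (x : E n) : (metric x).det = (ht x ^ 2)⁻¹ := by
  have e : metric x = 1 + Matrix.replicateCol Unit (fun i => -(x i / ht x ^ 2))
      * Matrix.replicateRow Unit (fun j => x j) := by
    ext i j
    rw [metric_apply, Matrix.add_apply, Matrix.one_apply, Matrix.mul_apply]
    simp
    ring
  rw [e, Matrix.det_one_add_replicateCol_mul_replicateRow, dotProduct]
  have h1 : ∑ i, x i * -(x i / ht x ^ 2) = -(‖x‖ ^ 2 / ht x ^ 2) := by
    rw [norm_sq_eq_sum, Finset.sum_div, ← Finset.sum_neg_distrib]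
    exact Finset.sum_congr rfl fun i _ => by ring
  have := ht_ne x
  rw [h1]
  field_simp
  linarith [ht_sq x]

lemma volDensity_eq (x : E n) : volDensity x = (ht x)⁻¹ := by
  rw [volDensity, det_metric, Real.sqrt_inv, Real.sqrt_sq (ht_pos x).le]

lemma metric_inv_apply (x : E n) (i j : Fin n) :
    (metric x)⁻¹ i j = (if i = j then 1 else 0) + x i * x j := by
  have h : metric x * Matrix.of (fun i j => (if i = j then 1 else 0) + x i * x j) = 1 := by
    ext i j
    rw [Matrix.mul_apply, Matrix.one_apply]
    simp only [metric_apply, Matrix.of_apply, sub_mul, mul_add, Finset.sum_sub_distrib,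
      Finset.sum_add_distrib, ite_mul, mul_ite, one_mul, mul_one, zero_mul, mul_zero,
      Finset.sum_ite_eq, Finset.sum_ite_eq', Finset.mem_univ, if_true]
    have h1 : ∑ k, x i * x k / ht x ^ 2 * (x k * x j) = x i * x j * (‖x‖ ^ 2 / ht x ^ 2) := by
      rw [norm_sq_eq_sum, Finset.sum_div, Finset.mul_sum]
      exact Finset.sum_congr rfl fun k _ => by ring
    have := ht_ne x
    rw [h1]
    have h2 : x i * x j - (x i * x j / ht x ^ 2 + x i * x j * (‖x‖ ^ 2 / ht x ^ 2)) = 0 := by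
      field_simp
      rw [ht_sq]
      ring
    split_ifs with hij <;> linarith
  rw [Matrix.inv_eq_right_inv h, Matrix.of_apply]

/-- The inverse metric is `1 + x ⊗ x`: the norm of a covector is seen by the coordinate fields and
the Euler field. -/
lemma covecNormSq_eq (x : E n) (ξ : Fin n → ℂ) :
    covecNormSq (chart x) ξ = ∑ i, ‖ξ i‖ ^ 2 + ‖∑ i, x i • ξ i‖ ^ 2 := by
  have hx : ((chart x : ℝ × E n)).2 = x := rfl
  have e : (∑ i, ∑ j, ((metric x)⁻¹ i j : ℂ) * ξ i * star (ξ j))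
      = ∑ i, ξ i * star (ξ i) + (∑ i, x i • ξ i) * star (∑ i, x i • ξ i) := by
    simp only [metric_inv_apply, star_sum, Finset.sum_mul_sum, ← Finset.sum_add_distrib]
    rw [Finset.sum_add_distrib]
    have h1 : ∀ i j, (((if i = j then 1 else 0) + x i * x j : ℝ) : ℂ) * ξ i * star (ξ j)
        = (if i = j then ξ i * star (ξ j) else 0) + (x i • ξ i) * star (x j • ξ j) := by
      intro i j
      have : star (x j • ξ j) = (x j : ℂ) * star (ξ j) := by
        simp
      rw [this, Complex.real_smul]
      split_ifs <;> push_cast <;> ring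
    simp only [h1, Finset.sum_add_distrib, Finset.sum_ite_eq, Finset.mem_univ, if_true]
  rw [covecNormSq, hx, e, Complex.add_re, Complex.re_sum]
  have h2 : ∀ z : ℂ, (z * star z).re = ‖z‖ ^ 2 := fun z => by
    rw [← Complex.normSq_eq_norm_sq, ← Complex.ofReal_re (Complex.normSq z), ← Complex.mul_conj]
    rfl
  simp only [h2]

/-- The Laplace-Beltrami operator in the chart. -/
lemma laplacian_chart {φ : hyperboloid n → ℝ} (hφ : ContDiff ℝ ∞ fun x => φ (chart x)) (x : E n) :
    laplacian φ (chart x) = (hframe n).lap (fun x => φ (chart x)) x := by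
  set f : E n → ℝ := fun x => φ (chart x)
  set T := hframe n
  have sD : ∀ i, ContDiff ℝ ∞ (T.D i f) := fun i => T.smooth_D i hφ
  have e1 : ∀ (i : Fin n) (y : E n), ∑ j, (metric y)⁻¹ i j * pderiv j f y
      = T.D (some i) f y + y i * T.D none f y := by
    intro i y
    rw [D_none_eq_sum, Finset.mul_sum]
    simp only [metric_inv_apply, add_mul, Finset.sum_add_distrib, ite_mul, one_mul, zero_mul,
      Finset.sum_ite_eq, Finset.mem_univ, if_true]
    congr 1
    exact Finset.sum_congr rfl fun j _ => by rw [smul_eq_mul, mul_assoc]; rfl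
  have e2 : ∀ i : Fin n, pderiv i (fun y => volDensity y * ∑ j, (metric y)⁻¹ i j * pderiv j f y) x
      = (ht x)⁻¹ * (T.D (some i) (T.D (some i) f) x + (T.D none f x
        + x i * T.D (some i) (T.D none f) x))
        - x i / ht x ^ 3 * (T.D (some i) f x + x i * T.D none f x) := by
    intro i
    have e3 : (fun y => volDensity y * ∑ j, (metric y)⁻¹ i j * pderiv j f y)
        = fun y => (ht y)⁻¹ * (T.D (some i) f y + y i * T.D none f y) := by
      funext y
      rw [e1, volDensity_eq]
    have h1 : HasFDerivAt (fun x => (ht x)⁻¹) (-((ht x)^2)⁻¹ • ((ht x)⁻¹ • innerSL ℝ x)) x :=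
      (hasDerivAt_inv (ht_ne x)).comp_hasFDerivAt x (hasFDerivAt_ht x)
    have h2 := ((sD (some i)).differentiable (by simp) x).hasFDerivAt
    have h3 := ((sD none).differentiable (by simp) x).hasFDerivAt
    have h4 : HasFDerivAt (fun x : E n => x i) (EuclideanSpace.proj (𝕜 := ℝ) i) x :=
      (EuclideanSpace.proj (𝕜 := ℝ) i).hasFDerivAt
    have h5 := h1.mul (h2.add (h4.mul h3))
    rw [e3, pderiv]
    rw [show (fun y => (ht y)⁻¹ * (T.D (some i) f y + y i * T.D none f y))
      = (fun y => (ht y)⁻¹) * (T.D (some i) f + (fun y : E n => y i) * T.D none f) from rfl,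
          h5.fderiv]
    have d1 : fderiv ℝ (T.D (some i) f) x (EuclideanSpace.single i 1)
      = T.D (some i) (T.D (some i) f) x := rfl
    have d2 : fderiv ℝ (T.D none f) x (EuclideanSpace.single i 1)
      = T.D (some i) (T.D none f) x := rfl
    simp [d1, d2, EuclideanSpace.inner_single_right]
    have := ht_ne x
    field_simp
    ring
  have hne := ht_ne x
  have s1 := D_none_eq_sum f x
  have s2 := D_none_eq_sum (T.D none f) x
  simp only [smul_eq_mul] at s1 s2
  have e0 : laplacian φ (chart x) = (volDensity x)⁻¹ * ∑ i, pderiv i (fun y => volDensity y *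
      ∑ j, (metric y)⁻¹ i j * pderiv j f y) x := rfl
  rw [hframe_lap, e0, Finset.sum_congr rfl fun i _ => e2 i, volDensity_eq, inv_inv, smul_eq_mul, s2,
    Finset.mul_sum]
  have e4 : ∀ i : Fin n, ht x * ((ht x)⁻¹ * (T.D (some i) (T.D (some i) f) x + (T.D none f x
        + x i * T.D (some i) (T.D none f) x))
        - x i / ht x ^ 3 * (T.D (some i) f x + x i * T.D none f x))
      = T.D (some i) (T.D (some i) f) x + T.D none f x + x i * T.D (some i) (T.D none f) x
        - (ht x ^ 2)⁻¹ * (x i * T.D (some i) f x) - (ht x ^ 2)⁻¹ * T.D none f x * x i ^ 2 := by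
    intro i
    field_simp
    ring
  simp only [e4, Finset.sum_sub_distrib, Finset.sum_add_distrib, ← Finset.mul_sum, ← norm_sq_eq_sum]
  rw [← s1]
  simp only [Finset.sum_const, Finset.card_univ, Fintype.card_fin, nsmul_eq_mul]
  have hsq := ht_sq x
  have e5 : (ht x ^ 2)⁻¹ * T.D none f x * ‖x‖ ^ 2
      = T.D none f x - (ht x ^ 2)⁻¹ * T.D none f x := by
    rw [show ‖x‖ ^ 2 = ht x ^ 2 - 1 by linarith]
    field_simp
  rw [e5]
  ring

/-- The chart as a homeomorphism. -/
def chartHomeo (n : ℕ) : E n ≃ₜ hyperboloid n where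
  toFun := chart
  invFun p := (p : ℝ × E n).2
  left_inv _ := rfl
  right_inv := by
    rintro ⟨⟨s, x⟩, h1, h2⟩
    have h3 : s = √(1 + ‖x‖ ^ 2) := by
      rw [eq_comm, Real.sqrt_eq_iff_mul_self_eq (by positivity) h2.le]
      simp only [mink, real_inner_self_eq_norm_sq] at h1
      linarith
    exact Subtype.ext (Prod.ext h3.symm rfl)
  continuous_toFun := (continuous_ht.prodMk continuous_id).subtype_mk _
  continuous_invFun := continuous_snd.comp continuous_subtype_val

lemma vol_eq (n : ℕ) : vol n = (hvol n).map chart := by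
  simp only [vol, hvol, volDensity_eq]

lemma measurableEmbedding_chart : MeasurableEmbedding (chart : E n → hyperboloid n) :=
  (chartHomeo n).measurableEmbedding

lemma lintegral_vol (f : hyperboloid n → ℝ≥0∞) : ∫⁻ p, f p ∂vol n = ∫⁻ x, f (chart x) ∂hvol n := by
  rw [vol_eq, measurableEmbedding_chart.lintegral_map]

lemma integral_vol (f : hyperboloid n → ℂ) : ∫ p, f p ∂vol n = ∫ x, f (chart x) ∂hvol n := by
  rw [vol_eq, measurableEmbedding_chart.integral_map]

lemma aestronglyMeasurable_vol {f : hyperboloid n → ℂ} :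
    AEStronglyMeasurable f (vol n) ↔ AEStronglyMeasurable (fun x => f (chart x)) (hvol n) := by
  rw [vol_eq, measurableEmbedding_chart.aestronglyMeasurable_map_iff]
  rfl

lemma eLpNorm_vol (f : hyperboloid n → ℂ) :
    eLpNorm f 2 (vol n) = eLpNorm (fun x => f (chart x)) 2 (hvol n) := by
  rw [vol_eq, measurableEmbedding_chart.eLpNorm_map_measure]
  rfl

lemma neg_mink_chart (x y : E n) : -mink (chart x : ℝ × E n) (chart y) = coshd x y := by
  simp only [mink, chart, graphMap, coshd, ht]
  ring

lemma cosh_hdist (x y : E n) : Real.cosh (hdist (chart x) (chart y)) = coshd x y := by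
  rw [hdist, neg_mink_chart, Real.cosh_arcosh (one_le_coshd x y)]

lemma sinh_hdist (x y : E n) :
    Real.sinh (hdist (chart x) (chart y)) = √(coshd x y ^ 2 - 1) := by
  rw [hdist, neg_mink_chart, Real.sinh_arcosh (one_le_coshd x y)]

end Geometry

/-! ### Sobolev functions and solutions in the chart -/

section Sobolev

variable {n : ℕ} {f g : hyperboloid n → ℂ} {G H : hyperboloid n → Fin n → ℂ}

lemma IsWeakDiff.ae_unique (hG : IsWeakDiff f G) (hH : IsWeakDiff f H) (i : Fin n) :
    ∀ᵐ x, G (chart x) i = H (chart x) i := by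
  refine ae_eq_of_integral_contDiff_smul_eq (hG.2 i).1 (hH.2 i).1 fun φ hφ hc => ?_
  have h1 := (hG.2 i).2 φ hφ hc
  rw [(hH.2 i).2 φ hφ hc] at h1
  exact (neg_injective h1).symm

lemma IsWeakDiff.sub (hG : IsWeakDiff f G) (hH : IsWeakDiff g H) : IsWeakDiff (f - g) (G - H) := by
  refine ⟨hG.1.sub hH.1, fun i => ⟨(hG.2 i).1.sub (hH.2 i).1, fun φ hφ hc => ?_⟩⟩
  have cd : Continuous (pderiv i φ) :=
    (hφ.continuous_fderiv (by simp)).clm_apply continuous_const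
  have hd : HasCompactSupport (pderiv i φ) := hc.fderiv_apply ℝ _
  have i1 := hG.1.integrable_smul_left_of_hasCompactSupport cd hd
  have i2 := hH.1.integrable_smul_left_of_hasCompactSupport cd hd
  have i3 := (hG.2 i).1.integrable_smul_left_of_hasCompactSupport hφ.continuous hc
  have i4 := (hH.2 i).1.integrable_smul_left_of_hasCompactSupport hφ.continuous hc
  simp only [Pi.sub_apply, smul_sub]
  rw [integral_sub i1 i2, integral_sub i3 i4, (hG.2 i).2 φ hφ hc, (hH.2 i).2 φ hφ hc]
  ring

/-- The derivatives along the frame given by a differential: the coordinate derivatives and the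
Euler derivative. -/
def jet (G : hyperboloid n → Fin n → ℂ) : Option (Fin n) → E n → ℂ
  | none => fun x => ∑ i, x i • G (chart x) i
  | some i => fun x => G (chart x) i

lemma jet_sub (i : Option (Fin n)) (x : E n) : jet (G - H) i x = jet G i x - jet H i x := by
  cases i <;> simp [jet, smul_sub]

lemma jet_congr (h : ∀ i, ∀ᵐ x, G (chart x) i = H (chart x) i) :
    ∀ᵐ x ∂hvol n, ∀ i, jet G i x = jet H i x := by
  filter_upwards [hvol_absolutelyContinuous.ae_le (ae_all_iff.2 h)] with x hx i
  cases i <;> simp [jet, hx]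

/-- The norm of `H¹` is the `L²` norm of the jet. -/
lemma IsWeakDiff.H1norm_eq (hG : IsWeakDiff f G) : H1norm f
    = (∫⁻ x, (‖f (chart x)‖ₑ ^ 2 + ∑ i, ‖jet G i x‖ₑ ^ 2) ∂hvol n) ^ (1 / 2 : ℝ) := by
  have key : ∀ H : hyperboloid n → Fin n → ℂ,
      ∫⁻ p, (‖f p‖ₑ ^ 2 + ENNReal.ofReal (covecNormSq p (H p))) ∂vol n
        = ∫⁻ x, (‖f (chart x)‖ₑ ^ 2 + ∑ i, ‖jet H i x‖ₑ ^ 2) ∂hvol n := fun H => by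
    rw [lintegral_vol]
    refine lintegral_congr fun x => ?_
    congr 1
    rw [covecNormSq_eq, Fintype.sum_option, add_comm,
      ENNReal.ofReal_add (sq_nonneg _) (Finset.sum_nonneg fun i _ => sq_nonneg _),
      ENNReal.ofReal_sum_of_nonneg fun i _ => sq_nonneg _]
    simp only [ENNReal.ofReal_pow (norm_nonneg _), ofReal_norm]
    rfl
  refine le_antisymm ?_ (le_iInf₂ fun H hH => ?_)
  · rw [← key G]
    exact iInf₂_le G hG
  · rw [key H]
    refine ENNReal.rpow_le_rpow (le_of_eq ?_) (by norm_num)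
    refine lintegral_congr_ae ?_
    filter_upwards [jet_congr fun i => hG.ae_unique hH i] with x hx
    simp only [hx]

lemma eLpNorm_two_eq {α : Type*} [MeasurableSpace α] {μ : Measure α} (f : α → ℂ) :
    eLpNorm f 2 μ = (∫⁻ x, ‖f x‖ₑ ^ 2 ∂μ) ^ (1 / 2 : ℝ) := by
  rw [eLpNorm_eq_lintegral_rpow_enorm_toReal (by norm_num) (by norm_num)]
  simp

lemma IsWeakDiff.eLpNorm_jet_le (hG : IsWeakDiff f G) (i : Option (Fin n)) :
    eLpNorm (jet G i) 2 (hvol n) ≤ H1norm f := by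
  rw [hG.H1norm_eq, eLpNorm_two_eq]
  refine ENNReal.rpow_le_rpow (lintegral_mono fun x => ?_) (by norm_num)
  exact (Finset.single_le_sum (f := fun i => ‖jet G i x‖ₑ ^ 2) (fun _ _ => zero_le)
    (Finset.mem_univ i)).trans le_add_self

lemma eLpNorm_le_H1norm (f : hyperboloid n → ℂ) :
    eLpNorm (fun x => f (chart x)) 2 (hvol n) ≤ H1norm f := by
  refine le_iInf₂ fun G _ => ?_
  rw [eLpNorm_two_eq, lintegral_vol]
  exact ENNReal.rpow_le_rpow (lintegral_mono fun x => le_self_add) (by norm_num)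

lemma MemH1.memLp (hf : MemH1 f) : MemLp (fun x => f (chart x)) 2 (hvol n) :=
  ⟨aestronglyMeasurable_vol.1 hf.1, (eLpNorm_le_H1norm f).trans_lt hf.2⟩

lemma MemH1.exists_weakDiff (hf : MemH1 f) : ∃ G, IsWeakDiff f G := by
  by_contra! h
  refine hf.2.ne ?_
  simp [H1norm, h]

lemma MemH1.isWeakJet (hf : MemH1 f) (hG : IsWeakDiff f G) :
    IsWeakJet (fun x => f (chart x)) (jet G) := by
  have hm : ∀ i, AEStronglyMeasurable (fun x => G (chart x) i) (hvol n) := fun i =>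
    (hG.2 i).1.aestronglyMeasurable.mono_ac hvol_absolutelyContinuous
  refine ⟨hf.memLp, fun i => ⟨?_, (hG.eLpNorm_jet_le i).trans_lt hf.2⟩, .of_forall fun x => rfl,
    fun i ψ hψ hc => (hG.2 i).2 ψ hψ hc⟩
  cases i with
  | some i => exact hm i
  | none =>
    exact Finset.aestronglyMeasurable_fun_sum _ fun i _ =>
      (EuclideanSpace.proj (𝕜 := ℝ) i).continuous.aestronglyMeasurable.smul (hm i)

lemma IsWeakJet.congr {u v : E n → ℂ} {G : Option (Fin n) → E n → ℂ} (h : IsWeakJet u G)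
    (e : u =ᵐ[hvol n] v) : IsWeakJet v G := by
  refine ⟨(memLp_congr_ae e).1 h.memLp, h.memLp_deriv, h.euler, fun i ψ hψ hc => ?_⟩
  rw [← h.weak i ψ hψ hc]
  refine integral_congr_ae ?_
  filter_upwards [absolutelyContinuous_hvol.ae_le e] with x hx
  rw [hx]

end Sobolev

section Bridge

variable {n : ℕ} {a b : ℝ} {u : ℝ → hyperboloid n → ℂ}

/-- A continuous curve in `H¹` is bounded by its `L^∞` norm at every time. -/
lemma ContH1.le_LinftyH1norm (hab : a < b) (hu : ContH1 (Set.Icc a b) u) {t : ℝ}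
    (ht : t ∈ Set.Icc a b) {c : ℝ≥0∞}
    (hc : ∀ s ∈ Set.Icc a b, c ≤ H1norm (u s) + H1norm (u s - u t)) :
    c ≤ LinftyH1norm (Set.Icc a b) u := by
  refine ENNReal.le_of_forall_pos_le_add fun ε hε _ => ?_
  have h1 : ∀ᶠ s in 𝓝[Set.Icc a b] t, H1norm (u s - u t) < ε :=
    (hu.2 t ht).eventually_lt_const (by exact_mod_cast hε)
  rw [eventually_nhdsWithin_iff, Metric.eventually_nhds_iff] at h1
  obtain ⟨η, hη, h1⟩ := h1
  have h2 : ∀ᵐ s ∂volume.restrict (Set.Icc a b), H1norm (u s) ≤ LinftyH1norm (Set.Icc a b) u :=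
    ENNReal.ae_le_essSup _
  set J := Set.Ioo (max a (t - η)) (min b (t + η))
  have hJ : J ⊆ Set.Icc a b := fun s hs =>
    ⟨(le_max_left _ _).trans hs.1.le, hs.2.le.trans (min_le_left _ _)⟩
  have hJ0 : volume J ≠ 0 := by
    rw [Real.volume_Ioo]
    simp only [ne_eq, ENNReal.ofReal_eq_zero, not_le, sub_pos, lt_min_iff, max_lt_iff]
    exact ⟨⟨hab, by linarith [ht.2]⟩, by linarith [ht.1], by linarith⟩
  have h3 : ∀ᵐ s ∂volume.restrict J, H1norm (u s) ≤ LinftyH1norm (Set.Icc a b) u :=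
    ae_restrict_of_ae_restrict_of_subset hJ h2
  have : NeBot (ae (volume.restrict J)) := by
    rw [ae_neBot]
    exact fun h => hJ0 (Measure.restrict_eq_zero.1 h)
  obtain ⟨s, hs1, hs2⟩ := (h3.and (ae_restrict_mem measurableSet_Ioo)).exists
  refine (hc s (hJ hs2)).trans (add_le_add hs1 (h1 ?_ (hJ hs2)).le)
  rw [Real.dist_eq, abs_lt]
  constructor
  · linarith [hs2.1, le_max_right a (t - η)]
  · linarith [hs2.2, min_le_right b (t + η)]

lemma ContH1.eLpNorm_le (hab : a < b) (hu : ContH1 (Set.Icc a b) u) {t : ℝ}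
    (ht : t ∈ Set.Icc a b) :
    eLpNorm (fun x => u t (chart x)) 2 (hvol n) ≤ LinftyH1norm (Set.Icc a b) u := by
  refine hu.le_LinftyH1norm hab ht fun s hs => ?_
  have m1 := ((hu.1 s hs).memLp).1
  have m2 := ((hu.1 t ht).memLp).1
  have h1 : eLpNorm ((fun x => u s (chart x)) - fun x => u t (chart x)) 2 (hvol n)
      ≤ H1norm (u s - u t) := eLpNorm_le_H1norm (u s - u t)
  rw [← sub_sub_cancel (fun x => u s (chart x)) fun x => u t (chart x)]
  exact (eLpNorm_sub_le m1 (m1.sub m2) (by norm_num)).trans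
    (add_le_add (eLpNorm_le_H1norm _) h1)

lemma ContH1.eLpNorm_jet_le (hab : a < b) (hu : ContH1 (Set.Icc a b) u) {t : ℝ}
    (ht : t ∈ Set.Icc a b) {G : hyperboloid n → Fin n → ℂ} (hG : IsWeakDiff (u t) G)
    (i : Option (Fin n)) :
    eLpNorm (jet G i) 2 (hvol n) ≤ LinftyH1norm (Set.Icc a b) u := by
  refine hu.le_LinftyH1norm hab ht fun s hs => ?_
  obtain ⟨H, hH⟩ := (hu.1 s hs).exists_weakDiff
  have e : jet G i = jet H i - jet (H - G) i := by
    funext x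
    simp [jet_sub]
  have m1 := ((hu.1 s hs).isWeakJet hH).memLp_deriv i
  have m2 := ((hu.1 t ht).isWeakJet hG).memLp_deriv i
  have m3 : AEStronglyMeasurable (jet (H - G) i) (hvol n) := by
    rw [show jet (H - G) i = jet H i - jet G i from funext fun x => jet_sub i x]
    exact m1.1.sub m2.1
  rw [e]
  exact (eLpNorm_sub_le m1.1 m3 (by norm_num)).trans
    (add_le_add (hH.eLpNorm_jet_le i) ((hH.sub hG).eLpNorm_jet_le i))

/-- The nonlinearity of a curve in `L²`: where it is square integrable, it is the limit of
Lipschitz nonlinearities, so that it is measurable in time. -/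
lemma exists_nonlin_curve {σ : ℝ} (hσ : 0 < σ) {U : ℝ → Lp ℂ 2 (hvol n)} (hU : Continuous U)
    (hi : ∫⁻ t in Set.Icc a b, eLpNorm (fun x => ((‖U t x‖ ^ (2 * σ) : ℝ) : ℂ) * U t x) 2 (hvol n) <
        ⊤) :
    ∃ F : ℝ → Lp ℂ 2 (hvol n), StronglyMeasurable F ∧ IntegrableOn F (Set.Icc a b) ∧
      ∀ᵐ t ∂volume.restrict (Set.Icc a b),
        F t =ᵐ[hvol n] fun x => ((‖U t x‖ ^ (2 * σ) : ℝ) : ℂ) * U t x := by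
  set Nl : ℝ → E n → ℂ := fun t x => ((‖U t x‖ ^ (2 * σ) : ℝ) : ℂ) * U t x
  have hM : ∀ N : ℕ, (1 : ℝ) ≤ (N : ℝ) + 1 := fun N => by
    linarith [(Nat.cast_nonneg N : (0 : ℝ) ≤ N)]
  have hL := fun N : ℕ => lipschitzWith_regNl hσ (hM N)
  set FN : ℕ → ℝ → Lp ℂ 2 (hvol n) := fun N t => (hL N).compLp (regNl_zero) (U t)
  have FNc : ∀ N, Continuous (FN N) := fun N =>
    ((hL N).continuous_compLp (regNl_zero)).comp hU
  have FNe : ∀ N t, FN N t =ᵐ[hvol n] fun x => regNl σ ((N : ℝ) + 1) (U t x) := fun N t =>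
    (hL N).coeFn_compLp (regNl_zero) (U t)
  have meas : ∀ t, AEStronglyMeasurable (Nl t) (hvol n) := fun t => by
    have h1 := (Lp.memLp (U t)).1
    have h2 : AEStronglyMeasurable (fun x => (‖U t x‖ ^ (2 * σ) : ℝ)) (hvol n) :=
      (Real.continuous_rpow_const (by positivity)).comp_aestronglyMeasurable h1.norm
    exact (Complex.continuous_ofReal.comp_aestronglyMeasurable h2).mul h1
  have lim : ∀ t, MemLp (Nl t) 2 (hvol n) →
      L2Tendsto (hvol n) (fun N x => regNl σ ((N : ℝ) + 1) (U t x)) (Nl t) := by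
    intro t ht
    have hr : ∀ N : ℕ, MemLp (fun x => regNl σ ((N : ℝ) + 1) (U t x)) 2 (hvol n) := fun N =>
      (hL N).comp_memLp (regNl_zero) (Lp.memLp (U t))
    refine ⟨hr, ht, ?_⟩
    have hg : MemLp (fun x => (2 ^ σ + 1) * ‖Nl t x‖ + 2 ^ σ * ‖U t x‖ : E n → ℝ) 2 (hvol n) :=
      (ht.norm.const_mul _).add ((Lp.memLp (U t)).norm.const_mul _)
    refine tendsto_eLpNorm_zero (fun N => ((hr N).sub ht).1) hg (fun N x => ?_) fun x => ?_
    · have h1 := norm_regNl_le hσ (hM N) (U t x)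
      have h2 : ‖Nl t x‖ = ‖U t x‖ ^ (2 * σ) * ‖U t x‖ := by
        rw [norm_mul, Complex.norm_real, Real.norm_of_nonneg (by positivity)]
      have h3 : 0 ≤ (2 ^ σ + 1) * ‖Nl t x‖ + 2 ^ σ * ‖U t x‖ := by positivity
      rw [Real.norm_of_nonneg h3]
      refine (norm_sub_le _ _).trans ?_
      rw [← h2] at h1
      linarith
    · have := (tendsto_regNl hσ (U t x)).sub_const (Nl t x)
      rwa [show ((‖U t x‖ ^ (2 * σ) : ℝ) : ℂ) * U t x - Nl t x = 0 from sub_self _] at this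
  -- the norm of the nonlinearity is measurable in time
  have nm : ∀ t, eLpNorm (Nl t) 2 (hvol n) = liminf (fun N => ‖FN N t‖ₑ) atTop := by
    intro t
    have e : ∀ N, ‖FN N t‖ₑ = eLpNorm (fun x => regNl σ ((N : ℝ) + 1) (U t x)) 2 (hvol n) :=
        fun N => by
      rw [Lp.enorm_def, eLpNorm_congr_ae (FNe N t)]
    simp only [e]
    have hle := Lp.eLpNorm_lim_le_liminf_eLpNorm (p := 2) (μ := hvol n)
      (f := fun (N : ℕ) x => regNl σ ((N : ℝ) + 1) (U t x))
      (fun N => ((hL N).comp_memLp (regNl_zero) (Lp.memLp (U t))).1) (Nl t)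
      (.of_forall fun x => tendsto_regNl hσ (U t x))
    by_cases ht : eLpNorm (Nl t) 2 (hvol n) < ⊤
    · exact ((lim t ⟨meas t, ht⟩).tendsto_eLpNorm.liminf_eq).symm
    · rw [not_lt, top_le_iff] at ht
      rw [ht, top_le_iff] at hle
      rw [ht, hle]
  have mm : Measurable fun t => eLpNorm (Nl t) 2 (hvol n) := by
    simp only [nm]
    exact Measurable.liminf fun N => (FNc N).enorm.measurable
  have fin : ∀ᵐ t ∂volume.restrict (Set.Icc a b), MemLp (Nl t) 2 (hvol n) := by
    filter_upwards [ae_lt_top mm hi.ne] with t ht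
    exact ⟨meas t, ht⟩
  classical
  set F₀ : ℝ → Lp ℂ 2 (hvol n) := fun t => if h : MemLp (Nl t) 2 (hvol n) then h.toLp (Nl t) else 0
  have hF₀ : ∀ t, MemLp (Nl t) 2 (hvol n) → F₀ t =ᵐ[hvol n] Nl t := fun t ht => by
    simp only [F₀, dif_pos ht]
    exact ht.coeFn_toLp
  have hm₀ : AEStronglyMeasurable F₀ (volume.restrict (Set.Icc a b)) := by
    refine aestronglyMeasurable_of_tendsto_ae atTop (f := FN)
        (fun N => (FNc N).aestronglyMeasurable) ?_
    filter_upwards [fin] with t ht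
    have h1 := (lim t ht)
    have h2 := (Lp.tendsto_Lp_iff_tendsto_eLpNorm'' (fun (N : ℕ) x => regNl σ ((N : ℝ) + 1) (U t x))
        h1.1
      (Nl t) h1.2.1).2 h1.2.2
    have e : F₀ t = ht.toLp (Nl t) := by simp only [F₀, dif_pos ht]
    rw [e]
    refine h2.congr fun N => ?_
    exact Lp.ext ((MemLp.coeFn_toLp _).trans (FNe N t).symm)
  refine ⟨hm₀.mk F₀, hm₀.stronglyMeasurable_mk, ⟨hm₀.stronglyMeasurable_mk.aestronglyMeasurable,
      ?_⟩, ?_⟩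
  · rw [hasFiniteIntegral_iff_enorm]
    refine lt_of_le_of_lt (lintegral_mono_ae ?_) hi
    filter_upwards [fin, hm₀.ae_eq_mk] with t ht he
    rw [← he, Lp.enorm_def, eLpNorm_congr_ae (hF₀ t ht)]
  · filter_upwards [fin, hm₀.ae_eq_mk] with t ht he
    rw [← he]
    exact hF₀ t ht

/-- A solution in the sense of the hyperboloid gives a weak solution in the chart. -/
lemma IsSolution.exists_isWeakSol {σ : ℝ} (hσ : 0 < σ) (hab : a ≤ b) (h : IsSolution σ a b u) :
    ∃ U F : ℝ → Lp ℂ 2 (hvol n), IsWeakSol a b U F ∧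
      (∀ t ∈ Set.Icc a b, U t =ᵐ[hvol n] fun x => u t (chart x)) ∧
      ∀ᵐ t ∂volume.restrict (Set.Icc a b),
        F t =ᵐ[hvol n] fun x => ((‖U t x‖ ^ (2 * σ) : ℝ) : ℂ) * U t x := by
  set U₀ : Set.Icc a b → Lp ℂ 2 (hvol n) := fun t => (h.cont.1 t t.2).memLp.toLp _
  have U₀c : Continuous U₀ := by
    rw [continuous_iff_continuousAt]
    intro t
    have h1 : Tendsto (fun s : Set.Icc a b => H1norm (u s - u t)) (𝓝 t) (𝓝 0) := by
      have := h.cont.2 t t.2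
      rw [nhdsWithin_eq_map_subtype_coe t.2] at this
      exact this
    rw [ContinuousAt, Lp.tendsto_Lp_iff_tendsto_eLpNorm']
    refine tendsto_of_tendsto_of_tendsto_of_le_of_le tendsto_const_nhds h1 (fun _ => zero_le)
      fun s => ?_
    refine le_trans (le_of_eq (eLpNorm_congr_ae ?_)) (eLpNorm_le_H1norm (u s - u t))
    filter_upwards [(h.cont.1 s s.2).memLp.coeFn_toLp, (h.cont.1 t t.2).memLp.coeFn_toLp] with x h1
        h2
    simp only [Pi.sub_apply, U₀, h1, h2]
  set U : ℝ → Lp ℂ 2 (hvol n) := Set.IccExtend hab U₀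
  have Uc : Continuous U := U₀c.Icc_extend'
  have Ue : ∀ t ∈ Set.Icc a b, U t =ᵐ[hvol n] fun x => u t (chart x) := fun t ht => by
    rw [show U t = U₀ ⟨t, ht⟩ from Set.IccExtend_of_mem hab U₀ ht]
    exact (h.cont.1 t ht).memLp.coeFn_toLp
  have Ne : ∀ t ∈ Set.Icc a b, (fun x => ((‖U t x‖ ^ (2 * σ) : ℝ) : ℂ) * U t x)
      =ᵐ[hvol n] fun x => nonlin σ (u t) (chart x) := fun t ht => by
    filter_upwards [Ue t ht] with x hx
    rw [hx, nonlin]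
  have hi : ∫⁻ t in Set.Icc a b, eLpNorm (fun x => ((‖U t x‖ ^ (2 * σ) : ℝ) : ℂ) * U t x) 2 (hvol n)
      < ⊤ := by
    refine lt_of_le_of_lt (le_of_eq ?_) h.nonlin_integrable
    refine setLIntegral_congr_fun measurableSet_Icc fun t ht => ?_
    rw [eLpNorm_congr_ae (Ne t ht), eLpNorm_vol]
  obtain ⟨F, hF1, hF2, hF3⟩ := exists_nonlin_curve hσ Uc hi
  refine ⟨U, F, ⟨Uc, ?_, hF1, (intervalIntegrable_iff_integrableOn_Icc_of_le hab).2 hF2, ?_⟩, Ue,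
      hF3⟩
  · obtain ⟨C, hC⟩ := (isCompact_range U₀c).isBounded.exists_norm_le
    exact ⟨C, fun t => hC _ ⟨_, rfl⟩⟩
  · intro φ hφ hc t ht
    have ha : a ∈ Set.Icc a b := Set.left_mem_Icc.2 hab
    have he := h.eqn (fun p => φ (p : ℝ × E n).2) ⟨hφ, hc⟩ a ha t ht
    have e1 : ∀ s ∈ Set.Icc a b, ∀ ψ : E n → ℝ, ∀ Ψ : hyperboloid n → ℝ, (∀ x, Ψ (chart x) = ψ x) →
        ∫ p, Ψ p • u s p ∂vol n = ∫ x, ψ x • U s x ∂hvol n := by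
      intro s hs ψ Ψ hΨ
      rw [integral_vol]
      refine integral_congr_ae ?_
      filter_upwards [Ue s hs] with x hx
      rw [hx, hΨ]
    have sub : Set.uIoc a t ⊆ Set.Icc a b := fun s hs => by
      rw [Set.uIoc_of_le ht.1] at hs
      exact ⟨hs.1.le, hs.2.trans ht.2⟩
    rw [e1 t ht φ _ fun x => rfl, e1 a ha φ _ fun x => rfl] at he
    have e2 : ∫ τ in a..t, ∫ p, laplacian (fun p : hyperboloid n => φ (p : ℝ × E n).2) p • u τ p
        ∂vol n
        = ∫ τ in a..t, ∫ x, (hframe n).lap φ x • U τ x ∂hvol n :=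
      intervalIntegral.integral_congr_ae (.of_forall fun s hs =>
        e1 s (sub hs) _ _ fun x => laplacian_chart hφ x)
    have e3 : ∫ τ in a..t, ∫ p, φ (p : ℝ × E n).2 • nonlin σ (u τ) p ∂vol n
        = ∫ τ in a..t, ∫ x, φ x • F τ x ∂hvol n := by
      refine intervalIntegral.integral_congr_ae ?_
      rw [ae_restrict_iff' measurableSet_Icc] at hF3
      filter_upwards [hF3] with s hs hm
      rw [integral_vol]
      refine integral_congr_ae ?_
      filter_upwards [hs (sub hm), Ne s (sub hm)] with x h1 h2
      rw [h1, h2]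
      rfl
    rw [e2, e3] at he
    exact he

end Bridge

/-! ### Removing the regularization of the weight -/

section Limit

variable {n : ℕ} {v : E n → ℂ}

/-- The density `|v|² ⊗ |v|²` integrated against (a quarter of minus) the bilaplacian of the
regularized weight. -/
def energy (n : ℕ) (δ : ℝ) (v : E n → ℂ) : ℝ≥0∞ :=
  ∫⁻ w, ENNReal.ofReal (bilapKer n δ (coshd w.1 w.2)) * ‖tens v v w‖ₑ ^ 2 ∂hvol2 n

lemma energy_congr {δ : ℝ} {v' : E n → ℂ} (h : v =ᵐ[hvol n] v') : energy n δ v = energy n δ v' := by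
  refine lintegral_congr_ae ?_
  have h1 := (Measure.quasiMeasurePreserving_fst (μ := hvol n) (ν := hvol n)).ae_eq_comp h
  have h2 := (Measure.quasiMeasurePreserving_snd (μ := hvol n) (ν := hvol n)).ae_eq_comp h
  filter_upwards [h1, h2] with w h1 h2
  simp only [Function.comp_apply] at h1 h2
  rw [tens, tens, h1, h2]

lemma energy_eq_ofReal (hn : 3 ≤ n) {δ : ℝ} (hδ : 0 < δ) (hδ1 : δ ≤ 1) (hv : MemLp v 2 (hvol n)) :
    energy n δ v = ENNReal.ofReal
      (∫ w, bilapKer n δ (coshd w.1 w.2) * ‖tens v v w‖ ^ 2 ∂hvol2 n) := by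
  obtain ⟨K, hK⟩ := exists_bilapKer_bound hn hδ hδ1
  have hV := memLp_tens hv hv
  have b0 : ∀ w : E n × E n, 0 ≤ bilapKer n δ (coshd w.1 w.2) := fun w =>
    bilapKer_nonneg hn hδ hδ1 (one_le_coshd _ _)
  rw [ofReal_integral_eq_lintegral_ofReal
    (integral_bilapKer_eq _ (integrable_pairing hV (memLp_bdd_mul
      (continuous_bilapKer hδ).aestronglyMeasurable hK hV))).1
    (.of_forall fun w => mul_nonneg (b0 w) (sq_nonneg _))]
  refine lintegral_congr fun w => ?_
  rw [ENNReal.ofReal_mul (b0 w), ENNReal.ofReal_pow (norm_nonneg _), ofReal_norm]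

lemma continuous_energy (hn : 3 ≤ n) {δ : ℝ} (hδ : 0 < δ) (hδ1 : δ ≤ 1)
    {U : ℝ → Lp ℂ 2 (hvol n)} (hU : Continuous U) : Continuous fun t => energy n δ (U t) := by
  obtain ⟨K, hK⟩ := exists_bilapKer_bound hn hδ hδ1
  have mB := (continuous_bilapKer (n := n) hδ).aestronglyMeasurable (μ := hvol2 n)
  simp only [energy_eq_ofReal hn hδ hδ1 (Lp.memLp (U _))]
  refine ENNReal.continuous_ofReal.comp (continuous_iff_seqContinuous.2 fun τ t hτ => ?_)
  have hl : L2Tendsto (hvol n) (fun j => U (τ j)) (U t) :=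
    ⟨fun j => Lp.memLp _, Lp.memLp _, (Lp.tendsto_Lp_iff_tendsto_eLpNorm' _ _).1
      ((hU.tendsto t).comp hτ)⟩
  have hv := hl.tens hl
  have hW := hv.bdd_mul mB hK
  have hp := (Complex.continuous_re.tendsto _).comp (hv.tendsto_pairing hW)
  have e : ∀ s, MemLp (tens (U s) (U s)) 2 (hvol2 n) := fun s =>
    memLp_tens (Lp.memLp _) (Lp.memLp _)
  have e1 : ∀ s, ∫ w, bilapKer n δ (coshd w.1 w.2) * ‖tens (U s) (U s) w‖ ^ 2 ∂hvol2 n = _ :=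
    fun s => (integral_bilapKer_eq _ (integrable_pairing (e s) (memLp_bdd_mul mB hK (e s)))).2
  simp only [Function.comp_def, e1]
  exact hp

/-- Any functional of the solution that is controlled by the limit of the regularized energies
obeys the global bound. -/
lemma exists_lintegral_le (hn : 3 ≤ n) : ∃ C : ℝ≥0, ∀ σ : ℝ, 0 < σ → ∀ a b : ℝ, a ≤ b →
    ∀ u : ℝ → hyperboloid n → ℂ, IsSolution σ a b u → ∀ (X : ℝ → ℝ≥0∞) (A : ℝ≥0),
      (∀ t ∈ Set.Icc a b,
        X t ≤ A * liminf (fun k => energy n (scale k) fun x => u t (chart x)) atTop) →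
      ∫⁻ t in Set.Icc a b, X t ≤ (A * (C + 1) : ℝ≥0) * LinftyH1norm (Set.Icc a b) u ^ 4 := by
  classical
  obtain ⟨C, hC⟩ := morawetz_regularized hn
  refine ⟨C, fun σ hσ a b hab u hu X A hX => ?_⟩
  rcases hab.eq_or_lt with rfl | hlt
  · simp
  rcases eq_or_ne A 0 with rfl | hA
  · refine le_trans (le_of_eq ?_) zero_le
    rw [setLIntegral_congr_fun measurableSet_Icc (g := 0) fun t ht => by simpa using hX t ht]
    simp
  rcases eq_or_ne (LinftyH1norm (Set.Icc a b) u) ⊤ with hΛ | hΛ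
  · rw [hΛ, ENNReal.top_pow (by norm_num), ENNReal.mul_top]
    · exact le_top
    · simpa using hA
  obtain ⟨Λ, hΛ⟩ : ∃ Λ : ℝ≥0, (Λ : ℝ≥0∞) = LinftyH1norm (Set.Icc a b) u :=
    ⟨_, ENNReal.coe_toNNReal hΛ⟩
  rw [← hΛ]
  obtain ⟨U, F, hU, hUu, hF⟩ := hu.exists_isWeakSol hσ hab
  set G : ℝ → Option (Fin n) → E n → ℂ := fun t =>
    if h : t ∈ Set.Icc a b then jet (hu.cont.1 t h).exists_weakDiff.choose else 0
  have hG : ∀ t (h : t ∈ Set.Icc a b), G t = jet (hu.cont.1 t h).exists_weakDiff.choose :=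
    fun t h => dif_pos h
  have key := fun k => hC a b U F G σ Λ hab hσ hU
    (fun t ht => by
      rw [hG t ht]
      exact ((hu.cont.1 t ht).isWeakJet (hu.cont.1 t ht).exists_weakDiff.choose_spec).congr
        (hUu t ht).symm)
    (fun t ht => by
      rw [hG t ht, eLpNorm_congr_ae (hUu t ht), hΛ]
      exact ⟨hu.cont.eLpNorm_le hlt ht, fun i =>
        hu.cont.eLpNorm_jet_le hlt ht (hu.cont.1 t ht).exists_weakDiff.choose_spec i⟩)
    hF (scale k) (scale_pos k) (scale_le_one k)
  calc ∫⁻ t in Set.Icc a b, X t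
      ≤ ∫⁻ t in Set.Icc a b, A * liminf (fun k => energy n (scale k) (U t)) atTop := by
        refine setLIntegral_mono' measurableSet_Icc fun t ht => (hX t ht).trans (le_of_eq ?_)
        simp only [energy_congr (hUu t ht)]
    _ = A * ∫⁻ t in Set.Icc a b, liminf (fun k => energy n (scale k) (U t)) atTop :=
        lintegral_const_mul' _ _ ENNReal.coe_ne_top
    _ ≤ A * liminf (fun k => ∫⁻ t in Set.Icc a b, energy n (scale k) (U t)) atTop := by
        gcongr
        exact lintegral_liminf_le fun k =>
          (continuous_energy hn (scale_pos k) (scale_le_one k) hU.cont).measurable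
    _ ≤ A * (C * Λ ^ 4) := by
        gcongr
        exact (liminf_le_liminf (.of_forall key)).trans_eq (liminf_const _)
    _ ≤ (A * (C + 1) : ℝ≥0) * Λ ^ 4 := by
        rw [← mul_assoc]
        gcongr
        push_cast
        gcongr
        exact le_self_add

lemma bilapKer_ge (hn : 3 < n) {δ s : ℝ} (hδ : 0 < δ) (hδ1 : δ ≤ 1) (hs : 1 ≤ s) :
    (1 - δ) * (s * invRoot δ s ^ 3) ≤ bilapKer n δ s := by
  have hn' : (4 : ℝ) ≤ n := by exact_mod_cast hn
  have hr := invRoot_pos hδ hs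
  have h0 : (0 : ℝ) ≤ 1 - δ := by linarith
  have h1 : (1 - δ) * 1 ≤ (1 - δ) * (((n : ℝ) - 1) * (n - 3)) :=
    mul_le_mul_of_nonneg_left (by nlinarith) h0
  have h2 : 0 ≤ δ * (2 * (n : ℝ) - 6) := mul_nonneg hδ.le (by linarith)
  have h3 : 0 ≤ (1 - δ) * (6 * (n : ℝ) - 18) := mul_nonneg h0 (by linarith)
  have h4 : 0 ≤ invRoot δ s ^ 5 * (δ * ((1 - δ) * (6 * n - 18) + 6 * δ)) := by positivity
  have h5 : 0 ≤ invRoot δ s ^ 7 * (15 * δ ^ 2 * (1 - δ)) := by positivity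
  have h6 : invRoot δ s ^ 3 * (1 - δ)
      ≤ invRoot δ s ^ 3 * (((n : ℝ) - 1) * (n - 3) * (1 - δ) + δ * (2 * n - 6)) :=
    mul_le_mul_of_nonneg_left (by linarith) (by positivity)
  rw [bilapKer]
  have h7 := mul_le_mul_of_nonneg_left (show invRoot δ s ^ 3 * (1 - δ) ≤ _ from
    h6.trans (le_add_of_nonneg_right (add_nonneg h4 h5))) (show 0 ≤ s by linarith)
  rw [← add_assoc] at h7
  linarith

/-- In dimension at least four the bilaplacian of the distance dominates `cosh d / sinh³ d`. -/
lemma lintegral_cosh_div_sinh_le (hn : 3 < n) (hv : AEStronglyMeasurable v (hvol n)) :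
    ∫⁻ w, ENNReal.ofReal (coshd w.1 w.2 / √(coshd w.1 w.2 ^ 2 - 1) ^ 3) * ‖tens v v w‖ₑ ^ 2 ∂hvol2 n
      ≤ liminf (fun k => energy n (scale k) v) atTop := by
  have mk : ∀ k, AEMeasurable (fun w : E n × E n =>
      ENNReal.ofReal (bilapKer n (scale k) (coshd w.1 w.2)) * ‖tens v v w‖ₑ ^ 2) (hvol2 n) :=
          fun k =>
    ((continuous_bilapKer (scale_pos k)).measurable.ennreal_ofReal.aemeasurable).mul
      ((hv.comp_fst.mul hv.comp_snd).enorm.pow_const 2)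
  refine (lintegral_mono fun w => ?_).trans (lintegral_liminf_le' mk)
  set s := coshd w.1 w.2
  rcases (one_le_coshd w.1 w.2).eq_or_lt with hs | hs
  · -- on the diagonal the kernel is the junk value `1 / 0 = 0`
    rw [show s = 1 from hs.symm]
    simp
  have hp : 0 < s ^ 2 - 1 := by nlinarith
  have lr : Tendsto (fun k => invRoot (scale k) s) atTop (𝓝 (√(s ^ 2 - 1))⁻¹) := by
    have h1 : Tendsto (fun k => s ^ 2 - 1 + scale k) atTop (𝓝 (s ^ 2 - 1)) := by
      simpa using tendsto_scale.const_add (s ^ 2 - 1)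
    exact ((Real.continuous_sqrt.tendsto _).comp h1).inv₀ (Real.sqrt_pos.2 hp).ne'
  have l2 : Tendsto (fun k => (1 - scale k) * (s * invRoot (scale k) s ^ 3)) atTop
      (𝓝 (s / √(s ^ 2 - 1) ^ 3)) := by
    have h1 := (tendsto_scale.const_sub 1).mul ((lr.pow 3).const_mul s)
    rwa [sub_zero, one_mul, inv_pow, ← div_eq_mul_inv] at h1
  have l3 := ENNReal.Tendsto.mul_const (b := ‖tens v v w‖ₑ ^ 2) (ENNReal.tendsto_ofReal l2)
    (.inr (by finiteness))
  rw [← l3.liminf_eq]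
  refine liminf_le_liminf (.of_forall fun k => ?_)
  simp only
  gcongr
  exact bilapKer_ge hn (scale_pos k) (scale_le_one k) hs.le

/-- The mollifier at scale `ε` lives on a ball of volume at least of order `ε^{3/2}`. -/
lemma exists_le_molMass : ∃ c : ℝ, 0 < c ∧ ∀ ε, 0 < ε → ε ≤ 1 → c * √ε ^ 3 ≤ molMass 3 ε := by
  set c := (volume (Metric.ball (0 : E 3) 1)).toReal
  have hc : 0 < c := ENNReal.toReal_pos (Metric.measure_ball_pos _ _ one_pos).ne'
    measure_ball_lt_top.ne
  refine ⟨c / 2, by positivity, fun ε hε hε1 => ?_⟩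
  have hs0 := Real.sqrt_pos.2 hε
  have hsq := Real.sq_sqrt hε.le
  have hv : (volume (Metric.ball (0 : E 3) (√ε))).toReal = √ε ^ 3 * c := by
    rw [Measure.addHaar_ball _ _ hs0.le, ENNReal.toReal_mul,
      ENNReal.toReal_ofReal (by positivity), finrank_euclideanSpace_fin]
  have hsm : ContDiff ℝ ∞ fun s : ℝ => bump ((s - 1) / ε) := smooth_bump.comp (by fun_prop)
  set g : E 3 → ℝ := fun y => rad (fun s : ℝ => bump ((s - 1) / ε)) (0, y)
  have gc : Continuous g := (smooth_rad hsm).continuous.comp (by fun_prop)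
  have gs : HasCompactSupport g := hasCompactSupport_rad (fun s h => bump_eq_zero (by
    rw [le_div_iff₀ hε]
    linarith)) 0
  have hi : Integrable (fun y : E 3 => (ht y)⁻¹ • g y) :=
    ((continuous_ht.inv₀ ht_ne).smul gc).integrable_of_hasCompactSupport gs.smul_left
  have e : c / 2 * √ε ^ 3
      = ∫ y, (Metric.ball (0 : E 3) (√ε)).indicator (fun _ => (1 / 2 : ℝ)) y := by
    rw [integral_indicator measurableSet_ball, setIntegral_const, measureReal_def, hv, smul_eq_mul]
    ring
  rw [e, molMass, integral_hvol]
  refine integral_mono ((integrable_indicator_iff measurableSet_ball).2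
    (integrableOn_const measure_ball_lt_top.ne)) hi fun y => ?_
  by_cases hy : y ∈ Metric.ball (0 : E 3) (√ε)
  · -- here `cosh d(0, y) - 1 ≤ ε / 2`, where the bump equals `1`
    have h1 : ‖y‖ ^ 2 ≤ ε := by
      rw [← hsq]
      exact pow_le_pow_left₀ (norm_nonneg _) (mem_ball_zero_iff.1 hy).le 2
    have h2 : ht y ≤ 1 + ε / 2 := by
      rw [ht]
      exact Real.sqrt_le_iff.2 ⟨by linarith, by nlinarith⟩
    have h3 : coshd 0 y = ht y := by simp [coshd, ht]
    simp only [Set.indicator_of_mem hy]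
    change 1 / 2 ≤ (ht y)⁻¹ • bump ((coshd 0 y - 1) / ε)
    rw [h3, bump_eq_one, smul_eq_mul, mul_one, one_div]
    · exact inv_anti₀ (ht_pos y) (by linarith)
    · rw [div_le_iff₀ hε]
      linarith
  · simp only [Set.indicator_of_notMem hy]
    exact smul_nonneg (inv_nonneg.2 (ht_pos y).le) (bump_nonneg _)

/-- In dimension three the bilaplacian of the regularized distance dominates an approximate
identity: it concentrates on the diagonal. -/
lemma exists_mol_le : ∃ A : ℝ≥0, ∀ ε, 0 < ε → ε ≤ 1 / 2 → ∀ s, 1 ≤ s →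
    mol 3 ε s ≤ A * bilapKer 3 ε s := by
  obtain ⟨c, hc, h⟩ := exists_le_molMass
  refine ⟨⟨256 / (15 * c), by positivity⟩, fun ε hε hε1 s hs => ?_⟩
  have hb := bilapKer_nonneg le_rfl hε (by linarith) hs
  rcases le_or_gt (1 + ε) s with h1 | h1
  · rw [mol_eq_zero 3 hε h1]
    exact mul_nonneg (NNReal.coe_nonneg _) hb
  have hs0 := Real.sqrt_pos.2 hε
  have hsq := Real.sq_sqrt hε.le
  set q := √ε
  -- on the support of the mollifier `s ≤ 1 + ε`, so that `s² - 1 + ε ≤ 4 ε`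
  have hr : (2 * q)⁻¹ ≤ invRoot ε s := by
    refine inv_anti₀ (Real.sqrt_pos.2 (by nlinarith)) (Real.sqrt_le_iff.2 ⟨by positivity, ?_⟩)
    nlinarith
  have hr7 : (2 * q)⁻¹ ^ 7 ≤ invRoot ε s ^ 7 := pow_le_pow_left₀ (by positivity) hr 7
  have hb' : 15 / 256 * (q ^ 3)⁻¹ ≤ bilapKer 3 ε s := by
    have e : (15 / 256 : ℝ) * (q ^ 3)⁻¹ = (2 * q)⁻¹ ^ 7 * (15 * (q ^ 2) ^ 2 * (1 / 2)) := by
      field_simp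
      norm_num
    rw [e, hsq]
    have hr0 := invRoot_pos hε hs
    have h2 : (2 * q)⁻¹ ^ 7 * (15 * ε ^ 2 * (1 / 2)) ≤
        invRoot ε s ^ 7 * (15 * ε ^ 2 * (1 - ε)) := by
      have : (0 : ℝ) ≤ 15 * ε ^ 2 := by positivity
      exact mul_le_mul hr7 (mul_le_mul_of_nonneg_left (by linarith) this) (by positivity)
        (by positivity)
    have h3 : 0 ≤ invRoot ε s ^ 5 * (6 * ε ^ 2) := by positivity
    have h4 : bilapKer 3 ε s
        = s * (invRoot ε s ^ 5 * (6 * ε ^ 2) + invRoot ε s ^ 7 * (15 * ε ^ 2 * (1 - ε))) := by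
      rw [bilapKer]
      push_cast
      ring
    rw [h4]
    have h5 : (0 : ℝ) ≤ invRoot ε s ^ 7 * (15 * ε ^ 2 * (1 - ε)) := le_trans (by positivity) h2
    nlinarith
  calc mol 3 ε s ≤ (c * q ^ 3)⁻¹ * 1 :=
        mul_le_mul (inv_anti₀ (by positivity) (h ε hε (by linarith))) (bump_le_one _)
          (bump_nonneg _) (by positivity)
    _ = 256 / (15 * c) * (15 / 256 * (q ^ 3)⁻¹) := by
        field_simp
    _ ≤ 256 / (15 * c) * bilapKer 3 ε s := mul_le_mul_of_nonneg_left hb' (by positivity)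

/-- Testing a square integrable `ρ` with `|ρ| ≤ |v|²` against its own mollification. The truncation
is needed because `|v|²` itself need not be square integrable. -/
lemma lintegral_sq_le_liminf {ρ : E n → ℂ} (hρ : MemLp ρ 2 (hvol n))
    (hv : AEStronglyMeasurable v (hvol n)) (h : ∀ x, ‖ρ x‖ₑ ≤ ‖v x‖ₑ ^ 2) :
    ∫⁻ x, ‖ρ x‖ₑ ^ 2 ∂hvol n ≤ liminf (fun k => ∫⁻ w, ENNReal.ofReal (rad (mol n (scale k)) w)
      * ‖tens v v w‖ₑ ^ 2 ∂hvol2 n) atTop := by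
  have hl := (l2Tendsto_const hρ).tendsto_pairing (l2Lim_kint_mol hρ).1
  have hl2 := (continuous_enorm.tendsto _).comp hl
  have e : ‖∫ x, starRingEnd ℂ (ρ x) * ρ x ∂hvol n‖ₑ = ∫⁻ x, ‖ρ x‖ₑ ^ 2 ∂hvol n := by
    have e1 : ∀ x, starRingEnd ℂ (ρ x) * ρ x = ((‖ρ x‖ ^ 2 : ℝ) : ℂ) := fun x => by
      rw [mul_comm, Complex.mul_conj, Complex.normSq_eq_norm_sq]
    simp only [e1]
    rw [integral_complex_ofReal, ← ofReal_norm, Complex.norm_real,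
      Real.norm_of_nonneg (integral_nonneg fun x => sq_nonneg _),
      ofReal_integral_eq_lintegral_ofReal hρ.norm.integrable_sq (.of_forall fun x => sq_nonneg _)]
    refine lintegral_congr fun x => ?_
    rw [ENNReal.ofReal_pow (norm_nonneg _), ofReal_norm]
  rw [← e, ← hl2.liminf_eq]
  refine liminf_le_liminf (.of_forall fun k => ?_)
  have hm : AEMeasurable (fun w : E n × E n => ENNReal.ofReal (rad (mol n (scale k)) w)
      * ‖tens v v w‖ₑ ^ 2) (hvol2 n) :=
    ((continuous_rad_mol n _).measurable.ennreal_ofReal.aemeasurable).mul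
      ((hv.comp_fst.mul hv.comp_snd).enorm.pow_const 2)
  rw [lintegral_prod _ hm]
  refine (enorm_integral_le_lintegral_enorm _).trans (lintegral_mono fun x => ?_)
  rw [enorm_mul, RCLike.enorm_conj]
  calc ‖ρ x‖ₑ * ‖kint (rad (mol n (scale k))) ρ x‖ₑ
      ≤ ‖v x‖ₑ ^ 2 * ∫⁻ y, ENNReal.ofReal (rad (mol n (scale k)) (x, y)) * ‖v y‖ₑ ^ 2 ∂hvol n := by
        refine mul_le_mul' (h x) ((enorm_integral_le_lintegral_enorm _).trans
          (lintegral_mono fun y => ?_))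
        rw [enorm_smul, Real.enorm_of_nonneg (show 0 ≤ rad (mol n (scale k)) (x, y) from
          mol_nonneg (scale_pos k) (scale_le_one k) _)]
        exact mul_le_mul' le_rfl (h y)
    _ = _ := by
        rw [← lintegral_const_mul' _ _ (by finiteness)]
        refine lintegral_congr fun y => ?_
        rw [tens, enorm_mul, mul_pow]
        ring

/-- In dimension three the limit of the regularized energies controls the `L⁴` norm: a quarter of
minus the bilaplacian of the distance is bounded below by a multiple of the delta function on the
diagonal. -/
lemma exists_lintegral_pow_four_le : ∃ A : ℝ≥0, ∀ v : E 3 → ℂ, MemLp v 2 (hvol 3) →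
    ∫⁻ x, ‖v x‖ₑ ^ 4 ∂hvol 3 ≤ A * liminf (fun k => energy 3 (scale k) v) atTop := by
  obtain ⟨A, hA⟩ := exists_mol_le
  refine ⟨A, fun v hv => ?_⟩
  set ρ : ℕ → E 3 → ℂ := fun N x => ((min (‖v x‖ ^ 2) (N ^ 2) : ℝ) : ℂ)
  have n0 : ∀ N x, ‖ρ N x‖ = min (‖v x‖ ^ 2) (N ^ 2) := fun N x => by
    rw [Complex.norm_real, Real.norm_of_nonneg (by positivity)]
  have hρ : ∀ N, MemLp (ρ N) 2 (hvol 3) := fun N => by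
    refine MemLp.of_le_mul (c := (N : ℝ)) hv (Complex.continuous_ofReal.comp_aestronglyMeasurable
      ((hv.1.norm.pow 2).inf aestronglyMeasurable_const)) (.of_forall fun x => ?_)
    rw [n0]
    rcases le_total ‖v x‖ N with h | h
    · refine (min_le_left _ _).trans ?_
      nlinarith [norm_nonneg (v x)]
    · refine (min_le_right _ _).trans ?_
      nlinarith [(Nat.cast_nonneg N : (0 : ℝ) ≤ N)]
  have h1 : ∀ N x, ‖ρ N x‖ₑ ≤ ‖v x‖ₑ ^ 2 := fun N x => by
    rw [← ofReal_norm, ← ofReal_norm, ← ENNReal.ofReal_pow (norm_nonneg _), n0]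
    exact ENNReal.ofReal_le_ofReal (min_le_left _ _)
  have h2 : liminf (fun k => ∫⁻ w, ENNReal.ofReal (rad (mol 3 (scale k)) w)
      * ‖tens v v w‖ₑ ^ 2 ∂hvol2 3) atTop ≤ A * liminf (fun k => energy 3 (scale k) v) atTop := by
    rw [← ENNReal.liminf_const_mul_of_ne_top ENNReal.coe_ne_top]
    refine liminf_le_liminf ?_
    filter_upwards [eventually_ge_atTop 1] with k hk
    have hk2 : scale k ≤ 1 / 2 := by
      have : (1 : ℝ) ≤ k := by exact_mod_cast hk
      exact one_div_le_one_div_of_le (by norm_num) (by linarith)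
    rw [energy, ← lintegral_const_mul' _ _ ENNReal.coe_ne_top]
    refine lintegral_mono fun w => ?_
    rw [← mul_assoc, ← ENNReal.ofReal_coe_nnreal, ← ENNReal.ofReal_mul (NNReal.coe_nonneg _)]
    gcongr
    exact hA _ (scale_pos k) hk2 _ (one_le_coshd _ _)
  -- removing the truncation
  have h3 : ∫⁻ x, ‖v x‖ₑ ^ 4 ∂hvol 3 ≤ liminf (fun N => ∫⁻ x, ‖ρ N x‖ₑ ^ 2 ∂hvol 3) atTop := by
    refine (lintegral_mono fun x => ?_).trans
      (lintegral_liminf_le' fun N => (hρ N).1.enorm.pow_const 2)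
    refine le_liminf_of_le (by isBoundedDefault) ?_
    obtain ⟨N₀, hN₀⟩ := exists_nat_ge ‖v x‖
    filter_upwards [eventually_ge_atTop N₀] with N hN
    have hN' : ‖v x‖ ≤ N := hN₀.trans (by exact_mod_cast hN)
    rw [← ofReal_norm (ρ N x), n0, min_eq_left (pow_le_pow_left₀ (norm_nonneg _) hN' 2),
      ENNReal.ofReal_pow (norm_nonneg _), ofReal_norm, ← pow_mul]
  refine (h3.trans (liminf_le_liminf (.of_forall fun N =>
    (lintegral_sq_le_liminf (hρ N) hv.1 (h1 N)).trans h2))).trans_eq (liminf_const _)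

/-- The double integral over the hyperboloid in the chart. -/
lemma lintegral_lintegral_vol {v : hyperboloid n → ℂ}
    (hv : AEStronglyMeasurable (fun x => v (chart x)) (hvol n)) :
    ∫⁻ p, ∫⁻ q, ENNReal.ofReal (Real.cosh (hdist p q) / Real.sinh (hdist p q) ^ 3)
        * ‖v q‖ₑ ^ 2 * ‖v p‖ₑ ^ 2 ∂vol n ∂vol n
      = ∫⁻ w, ENNReal.ofReal (coshd w.1 w.2 / √(coshd w.1 w.2 ^ 2 - 1) ^ 3)
        * ‖tens (fun x => v (chart x)) (fun x => v (chart x)) w‖ₑ ^ 2 ∂hvol2 n := by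
  rw [lintegral_prod, lintegral_vol]
  · refine lintegral_congr fun x => ?_
    rw [lintegral_vol]
    refine lintegral_congr fun y => ?_
    rw [cosh_hdist, sinh_hdist, tens, enorm_mul, mul_pow]
    ring
  · have hc : Continuous fun w : E n × E n => coshd w.1 w.2 := smooth_coshd.continuous
    exact ((hc.measurable.div (((hc.pow 2).sub continuous_const).sqrt.pow 3).measurable
      ).ennreal_ofReal.aemeasurable).mul ((hv.comp_fst.mul hv.comp_snd).enorm.pow_const 2)

end Limit

end HypNLS

end

theorem corollary6p2 :
    (∃ C : ℝ≥0, ∀ σ : ℝ, 0 < σ → ∀ a b : ℝ, a ≤ b →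
      ∀ u : ℝ → HypNLS.hyperboloid 3 → ℂ, HypNLS.IsSolution σ a b u →
        ∫⁻ t in Set.Icc a b, ∫⁻ p, ‖u t p‖ₑ ^ 4 ∂(HypNLS.vol 3)
          ≤ C * HypNLS.LinftyH1norm (Set.Icc a b) u ^ 4) ∧
    (∀ n : ℕ, 3 < n →
      ∃ C : ℝ≥0, ∀ σ : ℝ, 0 < σ → ∀ a b : ℝ, a ≤ b →
        ∀ u : ℝ → HypNLS.hyperboloid n → ℂ, HypNLS.IsSolution σ a b u →
          ∫⁻ t in Set.Icc a b, ∫⁻ p, ∫⁻ q,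
              ENNReal.ofReal (Real.cosh (HypNLS.hdist p q) / Real.sinh (HypNLS.hdist p q) ^ 3)
                * ‖u t q‖ₑ ^ 2 * ‖u t p‖ₑ ^ 2 ∂(HypNLS.vol n) ∂(HypNLS.vol n)
            ≤ C * HypNLS.LinftyH1norm (Set.Icc a b) u ^ 4) := by
  refine ⟨?_, fun n hn => ?_⟩
  · obtain ⟨C, hC⟩ := HypNLS.exists_lintegral_le (le_refl 3)
    obtain ⟨A, hA⟩ := HypNLS.exists_lintegral_pow_four_le
    refine ⟨A * (C + 1), fun σ hσ a b hab u hu => hC σ hσ a b hab u hu _ A fun t ht => ?_⟩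
    rw [HypNLS.lintegral_vol]
    exact hA _ (hu.cont.1 t ht).memLp
  · obtain ⟨C, hC⟩ := HypNLS.exists_lintegral_le hn.le
    refine ⟨1 * (C + 1), fun σ hσ a b hab u hu => hC σ hσ a b hab u hu _ 1 fun t ht => ?_⟩
    have hm := (hu.cont.1 t ht).memLp.1
    rw [HypNLS.lintegral_lintegral_vol hm, ENNReal.coe_one, one_mul]
    exact HypNLS.lintegral_cosh_div_sinh_le hn hm
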